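/- **Setting.** Let $G=(V,A)$ be a loopless directed flow network with $|V|=n$, $|A|=m$, source $s\neq t$ sink, no isolated vertices (it is enough that $n\le 2m$) and integer capacities $c\ge 0$ ($c=0$ off $A$). Let $f$ be an integral preflow ($0\le f\le c$, excess $e(u)=\sum_v f(v,u)-\sum_v f(u,v)\ge 0$ for $u\ne s,t$), let $\Delta\ge 1$ be an integer and $d:V\to\mathbb Z_{\ge 0}$ a labelling. Write $r(u,v)=c(u,v)-f(u,v)+f(v,u)$ for the residual capacity, $A_f=\{(u,v): r(u,v)>0\}$, $\gamma(u,v)=r(u,v)+r(v,u)$. Let $A_1$ be the set of arcs $(u,v)\in A_f$ with $\Delta/4<\gamma(u,v)\le\Delta/2$, or with $\Delta/4\le\gamma(u,v)\le 2\Delta$ and $r(u,v)\le\Delta$; let $V_A=\{u:\Delta/2<e(u)\le\Delta\}$, and let $V_C$ consist of $V_A$ and all vertices incident to $A_1$. **create-all-pseudoarcs$(G_{in},\rho)$** works with the current capacities $r$, a rooted forest with parent pointers $\pi$, and a queue $Q$. Let $path(u)$ be the tree path from $u$ to $root(u)$. A vertex $u\in V_C$ is *feasible* if $root(u)\in V_C\setminus\{u\}$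 or if some not yet discarded arc $(root(u),w)$ of $G_{in}$ has $r>\rho$. While there is a feasible vertex, take a feasible $u$ with $d(u)$ minimum and repeat, as long as $v=root(u)\notin V_C\setminus\{u\}$ and $u$ is feasible: choose a non-discarded arc $(v,w)$ of $G_{in}$ with $r(v,w)>\rho$; if $root(w)\neq v$, link $v$ to $w$ (set $\pi_v=w$) and append this link to $Q$; otherwise discard the arc. If this ends with $v=root(u)\in V_C\setminus\{u\}$, let $\delta$ be the minimum of $r$ on $path(u)$, create the pseudoarc $(u,v)$ with path $path(u)$ and capacity $\delta$ (append it to $Q$), decrease $r$ by $\delta$ on $path(u)$, and then, as long as $path(u)$ contains an arc with $r=0$, cut such an arc from the forest and append the cut to $Q$. In a $\Delta$-scaling phase one starts with the empty forest and queue, calls create-all-pseudoarcs with $\rho=\Delta$ on the graph of arcs with $r>\Delta$ between vertices of $V\setminus V_A$ (this makes the $\Delta$-abundant pseudoarcs), and then, with forest, queue and remaining capacities kept, with $\rho=0$ on the graph of the arcs of $A_f$ between vertices of $V\setminus V_A$, all arcs being again non-discarded (this makes the $\Delta$-small pseudoarcs). A *compact preflow* assigns a flow to each arc of $A_1$, between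 $0$ and its remaining capacity, and to each pseudoarc, between $0$ and its capacity, so that the excesses that result when these flows are added to $f$ are nonnegative outside $s,t$. **restore-all-flows** takes $Q$ and a compact preflow and computes the corresponding residual preflow: a preflow $g$ of $G$ with $g(u,v)-g(v,u)=f(u,v)-f(v,u)+h(u,v)-h(v,u)$, where $h(a)$ is the compact flow on $a$ (zero if $a\notin A_1$) plus the sum of the flows on all pseudoarcs whose path contains $a$. **Theorem.** On a unit-cost random access machine (integer registers and memory; addition, subtraction, comparison, indirect addressing) there are programs for both tasks, and an absolute constant $C$, such that for all data as above: 1. the two calls of create-all-pseudoarcs in the phase are carried out, from the residual network given as a list of arcs (the arcs of $A$ and their reversals, in any order), in at most $C\,m\log n$ steps in total, with the queue $Q$, including all the pseudoarcs, as output; 2. every execution of the two calls, however the choices are made, puts at most $C\,m$ entries into $Q$, and for every such execution and every compact preflow, restore-all-flows transforms the compact preflow into a residual preflow in at most $C\,m\log n$ steps. -/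

import Mathlib

/-! ## The machine model

A unit-cost random access machine with integer registers, an integer-addressed memory, and a
structured programming language. The only arithmetic is addition, subtraction and comparison.
A program is a fixed finite object, so each of its expressions and tests has a fixed size;
every executed assignment, store and test is charged one step. -/

/-- A machine state: registers and memory. -/
structure RState where
  reg : ℕ → ℤ
  mem : ℤ → ℤ

/-- Integer expressions; `load e` is the content of the memory cell with address `e`. -/
inductive Expr where
  | lit (k : ℤ)
  | reg (x : ℕ)
  | load (e : Expr)
  | add (e₁ e₂ : Expr)
  | sub (e₁ e₂ : Expr)

/-- The value of an expression. -/
def Expr.eval (S : RState) : Expr → ℤ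
  | .lit k => k
  | .reg x => S.reg x
  | .load e => S.mem (e.eval S)
  | .add e₁ e₂ => e₁.eval S + e₂.eval S
  | .sub e₁ e₂ => e₁.eval S - e₂.eval S

/-- Tests. -/
inductive Test where
  | lt (e₁ e₂ : Expr)
  | eq (e₁ e₂ : Expr)
  | neg (b : Test)
  | and (b₁ b₂ : Test)

/-- Truth of a test. -/
def Test.Holds (S : RState) : Test → Prop
  | .lt e₁ e₂ => e₁.eval S < e₂.eval S
  | .eq e₁ e₂ => e₁.eval S = e₂.eval S
  | .neg b => ¬ b.Holds S
  | .and b₁ b₂ => b₁.Holds S ∧ b₂.Holds S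

/-- Programs. -/
inductive Cmd where
  | skip
  | assign (x : ℕ) (e : Expr)
  | store (a e : Expr)
  | seq (p q : Cmd)
  | ite (b : Test) (p q : Cmd)
  | loop (b : Test) (p : Cmd)

/-- `Exec p S T S'`: program `p`, started in state `S`, halts after `T` steps in state `S'`. -/
inductive Exec : Cmd → RState → ℕ → RState → Prop where
  | skip (S : RState) : Exec .skip S 1 S
  | assign (x : ℕ) (e : Expr) (S : RState) :
      Exec (.assign x e) S 1 { S with reg := Function.update S.reg x (e.eval S) }
  | store (a e : Expr) (S : RState) :
      Exec (.store a e) S 1 { S with mem := Function.update S.mem (a.eval S) (e.eval S) }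
  | seq {p q : Cmd} {S S₁ S₂ : RState} {T₁ T₂ : ℕ} :
      Exec p S T₁ S₁ → Exec q S₁ T₂ S₂ → Exec (.seq p q) S (T₁ + T₂) S₂
  | ite_true {b : Test} {p q : Cmd} {S S' : RState} {T : ℕ} :
      b.Holds S → Exec p S T S' → Exec (.ite b p q) S (T + 1) S'
  | ite_false {b : Test} {p q : Cmd} {S S' : RState} {T : ℕ} :
      ¬ b.Holds S → Exec q S T S' → Exec (.ite b p q) S (T + 1) S'
  | loop_true {b : Test} {p : Cmd} {S S₁ S₂ : RState} {T₁ T₂ : ℕ} :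
      b.Holds S → Exec p S T₁ S₁ → Exec (.loop b p) S₁ T₂ S₂ →
      Exec (.loop b p) S (T₁ + T₂ + 1) S₂
  | loop_false {b : Test} {p : Cmd} {S : RState} :
      ¬ b.Holds S → Exec (.loop b p) S 1 S

/-- The start state: the input occupies the memory cells `0, 1, 2, …`; all else is zero. -/
def RState.start (input : List ℤ) : RState where
  reg := fun _ => 0
  mem := fun a => if 0 ≤ a then input.getD a.toNat 0 else 0

/-- The output occupies consecutive memory cells from the address in register `0` on. -/
def RState.Outputs (S : RState) (output : List ℤ) : Prop :=
  ∀ (i : ℕ) (h : i < output.length), S.mem (S.reg 0 + (i : ℤ)) = output[i]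

/-! ## Flow networks, preflows, arc classes -/

/-- A flow network with vertex set `Fin n` and arc set `A`. -/
structure FlowNetwork (n : ℕ) where
  A : Finset (Fin n × Fin n)
  c : Fin n → Fin n → ℤ
  s : Fin n
  t : Fin n
  s_ne_t : s ≠ t
  loopless : ∀ u, (u, u) ∉ A
  c_nonneg : ∀ u v, 0 ≤ c u v
  c_eq_zero : ∀ u v, (u, v) ∉ A → c u v = 0

namespace FlowNetwork

variable {n : ℕ}

/-- The excess of `u` under `f`. -/
def excess (f : Fin n → Fin n → ℤ) (u : Fin n) : ℤ :=
  ∑ v, f v u - ∑ v, f u v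

/-- Preflows: the capacity constraint, and nonnegative excess outside source and sink. -/
def IsPreflow (N : FlowNetwork n) (f : Fin n → Fin n → ℤ) : Prop :=
  (∀ u v, 0 ≤ f u v ∧ f u v ≤ N.c u v) ∧ ∀ u, u ≠ N.s → u ≠ N.t → 0 ≤ excess f u

/-- The residual capacity of `(u, v)`. -/
def res (N : FlowNetwork n) (f : Fin n → Fin n → ℤ) (u v : Fin n) : ℤ :=
  N.c u v - f u v + f v u

/-- The arcs of the residual network. -/
def resArcs (N : FlowNetwork n) (f : Fin n → Fin n → ℤ) : Set (Fin n × Fin n) :=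
  {a | 0 < N.res f a.1 a.2}

/-- The compaction capacity. -/
def compCap (N : FlowNetwork n) (f : Fin n → Fin n → ℤ) (u v : Fin n) : ℤ :=
  N.res f u v + N.res f v u

/-- `Δ/4 < γ(u,v) ≤ Δ/2`. -/
def Favorable (N : FlowNetwork n) (f : Fin n → Fin n → ℤ) (Δ : ℕ) (u v : Fin n) : Prop :=
  (Δ : ℤ) < 4 * N.compCap f u v ∧ 2 * N.compCap f u v ≤ Δ

/-- `Δ/4 ≤ γ(u,v) ≤ 2Δ` and `r(u,v) ≤ Δ`. -/
def Large (N : FlowNetwork n) (f : Fin n → Fin n → ℤ) (Δ : ℕ) (u v : Fin n) : Prop :=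
  (Δ : ℤ) ≤ 4 * N.compCap f u v ∧ N.compCap f u v ≤ 2 * Δ ∧ N.res f u v ≤ Δ

/-- `A₁`: the original arcs of the compact network. -/
def origArcs (N : FlowNetwork n) (f : Fin n → Fin n → ℤ) (Δ : ℕ) : Set (Fin n × Fin n) :=
  {a | a ∈ N.resArcs f ∧ (N.Favorable f Δ a.1 a.2 ∨ N.Large f Δ a.1 a.2)}

/-- `V_A`: the active vertices, `Δ/2 < e(u) ≤ Δ`. -/
def active (f : Fin n → Fin n → ℤ) (Δ : ℕ) : Set (Fin n) :=
  {u | (Δ : ℤ) < 2 * excess f u ∧ excess f u ≤ Δ}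

/-- `V_C`: the active vertices, and the vertices incident to an arc of `A₁`. -/
def compVerts (N : FlowNetwork n) (f : Fin n → Fin n → ℤ) (Δ : ℕ) : Set (Fin n) :=
  {u | u ∈ active f Δ ∨ ∃ a ∈ N.origArcs f Δ, a.1 = u ∨ a.2 = u}

/-- The arcs of the residual network without the active vertices. -/
def inArcs (N : FlowNetwork n) (f : Fin n → Fin n → ℤ) (Δ : ℕ) : Set (Fin n × Fin n) :=
  {a | a ∈ N.resArcs f ∧ a.1 ∉ active f Δ ∧ a.2 ∉ active f Δ}

/-- The arcs of the abundance graph: residual capacity above `Δ`, no active vertices. -/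
def abArcs (N : FlowNetwork n) (f : Fin n → Fin n → ℤ) (Δ : ℕ) : Set (Fin n × Fin n) :=
  {a | (Δ : ℤ) < N.res f a.1 a.2 ∧ a.1 ∉ active f Δ ∧ a.2 ∉ active f Δ}

/-- `E` lists, in any order, the ordered pairs that can carry residual capacity:
the arcs of `A` and their reversals. -/
def Enumerates (N : FlowNetwork n) (E : List (Fin n × Fin n)) : Prop :=
  E.Nodup ∧ ∀ a, a ∈ E ↔ a ∈ N.A ∨ a.swap ∈ N.A

end FlowNetwork

/-! ## Rooted forests and the queue of operations -/

/-- An entry of the queue `Q`. The entry `transfer u v δ` is the pseudoarc `(u, v)` of capacity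
`δ`; its path is the tree path of `u` in the forest at that moment. -/
inductive Op (n : ℕ) where
  | link (v w : Fin n)
  | cut (w : Fin n)
  | transfer (u v : Fin n) (δ : ℤ)

/-- A forest, given by its parent pointers. -/
abbrev Forest (n : ℕ) := Fin n → Option (Fin n)

namespace Forest

variable {n : ℕ}

/-- `v` lies on `path(u)`, the path from `u` to the root of its tree. -/
def OnPath (π : Forest n) (u v : Fin n) : Prop :=
  Relation.ReflTransGen (fun a b => π a = some b) u v

/-- `v = root(u)`. -/
def IsRootOf (π : Forest n) (u v : Fin n) : Prop :=
  π.OnPath u v ∧ π v = none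

/-- `(a, b)` is an arc of `path(u)`. -/
def ArcOnPath (π : Forest n) (u a b : Fin n) : Prop :=
  π.OnPath u a ∧ π a = some b

end Forest

/-! ## The procedure create-all-pseudoarcs -/

/-- The variables of the procedure: current residual capacities `r` (for a tree arc `(u, π u)`
this is `val(u)`), the forest `π`, the arcs `live` of the input graph that may still be chosen,
and the queue `Q`, which also holds the pseudoarcs. -/
structure PState (n : ℕ) where
  r : Fin n → Fin n → ℤ
  π : Forest n
  live : Set (Fin n × Fin n)
  Q : List (Op n)

namespace PState

variable {n : ℕ}

/-- `link(v, w)`, recorded in `Q`. -/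
def link (σ : PState n) (v w : Fin n) : PState n :=
  { σ with π := Function.update σ.π v (some w), Q := σ.Q ++ [.link v w] }

/-- `cut(w)`, recorded in `Q`. -/
def cut (σ : PState n) (w : Fin n) : PState n :=
  { σ with π := Function.update σ.π w none, Q := σ.Q ++ [.cut w] }

open Classical in
/-- Create the pseudoarc `(u, v)` of capacity `δ`, recorded in `Q`, and decrease the capacities
along `path(u)` by `δ`. -/
noncomputable def transfer (σ : PState n) (u v : Fin n) (δ : ℤ) : PState n :=
  { σ with
    r := fun a b => if σ.π.ArcOnPath u a b then σ.r a b - δ else σ.r a b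
    Q := σ.Q ++ [.transfer u v δ] }

/-- `find-min(u)` may return `w`, with `val(w) = δ`. -/
def FindMin (σ : PState n) (u w : Fin n) (δ : ℤ) : Prop :=
  (∃ b, σ.π.ArcOnPath u w b ∧ σ.r w b = δ) ∧
    ∀ a b, σ.π.ArcOnPath u a b → δ ≤ σ.r a b

/-- The vertex `u ∈ V_C` is feasible: the search for a path from `u` has either already
reached a vertex of `V_C \ {u}` or can be continued, because an arc of residual capacity above
`ρ` can be chosen at `root(u)`. -/
def Feasible (VC : Set (Fin n)) (ρ : ℤ) (σ : PState n) (u : Fin n) : Prop :=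
  u ∈ VC ∧ ∃ v, σ.π.IsRootOf u v ∧
    ((v ∈ VC ∧ v ≠ u) ∨ ∃ w, (v, w) ∈ σ.live ∧ ρ < σ.r v w)

/-- One round of the loop of feasible-path: at `v = root(u)`, where `v` is not in `V_C \ {u}`,
an arc `(v, w)` with `r(v, w) > ρ` is chosen. If `w` is in another tree, `link(v, w)` is
carried out; if `w` is in the tree of `v`, where `link` is not applicable, the arc is discarded. -/
inductive SearchStep (VC : Set (Fin n)) (ρ : ℤ) (u : Fin n) : PState n → PState n → Prop where
  | link {σ : PState n} {v w : Fin n} :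
      σ.π.IsRootOf u v → ¬ (v ∈ VC ∧ v ≠ u) → (v, w) ∈ σ.live → ρ < σ.r v w →
      ¬ σ.π.IsRootOf w v → SearchStep VC ρ u σ (σ.link v w)
  | discard {σ : PState n} {v w : Fin n} :
      σ.π.IsRootOf u v → ¬ (v ∈ VC ∧ v ≠ u) → (v, w) ∈ σ.live → ρ < σ.r v w →
      σ.π.IsRootOf w v → SearchStep VC ρ u σ { σ with live := σ.live \ {(v, w)} }

/-- feasible-path, when it returns a path: this is `path(u)`, with end `v` in `V_C \ {u}`. -/
def FeasiblePath (VC : Set (Fin n)) (ρ : ℤ) (u v : Fin n) (σ σ' : PState n) : Prop :=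
  Relation.ReflTransGen (SearchStep VC ρ u) σ σ' ∧ σ'.π.IsRootOf u v ∧ v ∈ VC ∧ v ≠ u

/-- feasible-path, when it ends without a path: no arc can be chosen any more. -/
def NoPath (VC : Set (Fin n)) (ρ : ℤ) (u : Fin n) (σ σ' : PState n) : Prop :=
  Relation.ReflTransGen (SearchStep VC ρ u) σ σ' ∧ ¬ Feasible VC ρ σ' u

/-- cut-all-saturated. -/
inductive CutAll (u : Fin n) : PState n → PState n → Prop where
  | done {σ : PState n} : (¬ ∃ w, σ.FindMin u w 0) → CutAll u σ σ
  | step {σ σ' : PState n} {w : Fin n} :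
      σ.FindMin u w 0 → CutAll u (σ.cut w) σ' → CutAll u σ σ'

/-- The loop of create-all-pseudoarcs, with distance labels `d`: while there is a feasible
vertex, take a feasible vertex of smallest label, run feasible-path, and, when this returns a
path, run transfer-capacity and cut-all-saturated. -/
inductive CreateLoop (VC : Set (Fin n)) (d : Fin n → ℕ) (ρ : ℤ) :
    PState n → PState n → Prop where
  | done {σ : PState n} : (∀ u, ¬ Feasible VC ρ σ u) → CreateLoop VC d ρ σ σ
  | build {σ σ₁ σ₂ σ' : PState n} {u v w : Fin n} {δ : ℤ} :
      Feasible VC ρ σ u → (∀ u', Feasible VC ρ σ u' → d u ≤ d u') →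
      FeasiblePath VC ρ u v σ σ₁ → σ₁.FindMin u w δ →
      CutAll u (σ₁.transfer u v δ) σ₂ → CreateLoop VC d ρ σ₂ σ' →
      CreateLoop VC d ρ σ σ'
  | fail {σ σ₁ σ' : PState n} {u : Fin n} :
      Feasible VC ρ σ u → (∀ u', Feasible VC ρ σ u' → d u ≤ d u') →
      NoPath VC ρ u σ σ₁ → CreateLoop VC d ρ σ₁ σ' → CreateLoop VC d ρ σ σ'

/-- create-all-pseudoarcs on the graph with arc set `G` and with threshold `ρ`. -/
def CreateAll (VC : Set (Fin n)) (d : Fin n → ℕ) (G : Set (Fin n × Fin n)) (ρ : ℤ)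
    (σ σ' : PState n) : Prop :=
  CreateLoop VC d ρ { σ with live := G } σ'

end PState

namespace FlowNetwork

variable {n : ℕ}

/-- The state at the start of a phase: empty forest and empty queue. -/
def startState (N : FlowNetwork n) (f : Fin n → Fin n → ℤ) : PState n where
  r := N.res f
  π := fun _ => none
  live := ∅
  Q := []

/-- An execution of the two calls of a `Δ`-scaling phase: first create-all-pseudoarcs on the
abundance graph with `ρ = Δ` (from the start to `σ₁`), which yields the abundant pseudoarcs,
then create-all-pseudoarcs on the residual network without active vertices with `ρ = 0`
(from `σ₁` to `σ₂`), which yields the small pseudoarcs. -/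
def PhaseExecution (N : FlowNetwork n) (f : Fin n → Fin n → ℤ) (Δ : ℕ) (d : Fin n → ℕ)
    (σ₁ σ₂ : PState n) : Prop :=
  PState.CreateAll (N.compVerts f Δ) d (N.abArcs f Δ) Δ (N.startState f) σ₁ ∧
    PState.CreateAll (N.compVerts f Δ) d (N.inArcs f Δ) 0 σ₁ σ₂

end FlowNetwork

/-! ## Compact preflows and their transformation -/

section Compact

variable {n : ℕ}

open Classical in
/-- The total flow that arrives on the arc `(a, b)` when the operations of the queue are
executed from the forest `π` on and the `k`-th entry, if it is a pseudoarc, sends `x k` units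
along its path. -/
noncomputable def pathFlow : Forest n → List (Op n) → (ℕ → ℤ) → Fin n → Fin n → ℤ
  | _, [], _, _, _ => 0
  | π, .link v w :: Q, x, a, b =>
      pathFlow (Function.update π v (some w)) Q (fun k => x (k + 1)) a b
  | π, .cut w :: Q, x, a, b =>
      pathFlow (Function.update π w none) Q (fun k => x (k + 1)) a b
  | π, .transfer u _ _ :: Q, x, a, b =>
      (if π.ArcOnPath u a b then x 0 else 0) + pathFlow π Q (fun k => x (k + 1)) a b

/-- The net amount that the flow `x` on the pseudoarcs of the queue brings to `v`. -/
def pseudoNet : List (Op n) → (ℕ → ℤ) → Fin n → ℤ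
  | [], _, _ => 0
  | .link _ _ :: Q, x, v => pseudoNet Q (fun k => x (k + 1)) v
  | .cut _ :: Q, x, v => pseudoNet Q (fun k => x (k + 1)) v
  | .transfer a b _ :: Q, x, v =>
      ((if b = v then x 0 else 0) - (if a = v then x 0 else 0)) +
        pseudoNet Q (fun k => x (k + 1)) v

/-- A compact preflow at the end of the phase, as the change to the preflow `f`: `y` is the
flow sent on the original arcs, bounded by the capacities left to them in `σ`; `x k` is the flow
sent on the pseudoarc in entry `k` of the queue of `σ`, bounded by its capacity; the resulting
excesses are nonnegative outside source and sink. -/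
structure IsCompactPreflow (N : FlowNetwork n) (f : Fin n → Fin n → ℤ) (Δ : ℕ) (σ : PState n)
    (y : Fin n → Fin n → ℤ) (x : ℕ → ℤ) : Prop where
  orig_bounds : ∀ u v, 0 ≤ y u v ∧ y u v ≤ σ.r u v
  orig_support : ∀ u v, y u v ≠ 0 → (u, v) ∈ N.origArcs f Δ
  pseudo_bounds : ∀ k u v δ, σ.Q[k]? = some (.transfer u v δ) → 0 ≤ x k ∧ x k ≤ δ
  excess_nonneg : ∀ v, v ≠ N.s → v ≠ N.t →
    0 ≤ FlowNetwork.excess f v + FlowNetwork.excess y v + pseudoNet σ.Q x v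

/-- `g` is the residual preflow that corresponds to the compact preflow `(y, x)`: it is a preflow
of the network, and its net flow on each pair of vertices is that of `f`, changed by the flow on
the original arcs and by the flows sent along the paths of the pseudoarcs. -/
def IsRestored (N : FlowNetwork n) (f : Fin n → Fin n → ℤ) (σ : PState n)
    (y : Fin n → Fin n → ℤ) (x : ℕ → ℤ) (g : Fin n → Fin n → ℤ) : Prop :=
  N.IsPreflow g ∧ ∀ u v, g u v - g v u = f u v - f v u
    + (y u v + pathFlow (fun _ => none) σ.Q x u v)
    - (y v u + pathFlow (fun _ => none) σ.Q x v u)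

end Compact

/-! ## Inputs and outputs as lists of integers -/

section Encoding

variable {n : ℕ}

/-- The number of a vertex. -/
def vtx (v : Fin n) : ℤ := ((v : ℕ) : ℤ)

open Classical in
/-- `1` or `0`, according to the truth of the proposition. -/
noncomputable def bit (P : Prop) : ℤ := if P then 1 else 0

/-- A queue entry; the arc of a `link` is given by its position in the arc list `E`. -/
def encOp (E : List (Fin n × Fin n)) : Op n → List ℤ
  | .link v w => [0, (E.idxOf (v, w) : ℤ), 0, 0]
  | .cut w => [1, vtx w, 0, 0]
  | .transfer u v δ => [2, vtx u, vtx v, δ]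

/-- A queue with the flow on its pseudoarcs. -/
def encFlows (E : List (Fin n × Fin n)) : List (Op n) → (ℕ → ℤ) → List ℤ
  | [], _ => []
  | .transfer u v δ :: Q, x =>
      encOp E (.transfer u v δ) ++ [x 0] ++ encFlows E Q (fun k => x (k + 1))
  | φ :: Q, x => encOp E φ ++ [0] ++ encFlows E Q (fun k => x (k + 1))

/-- The input for creating the pseudoarcs: `n`, the number of listed arcs, `Δ`; for each vertex
its label and its membership in `V_A` and `V_C`; for each listed arc its ends and its residual
capacity. -/
noncomputable def createInput (N : FlowNetwork n) (f : Fin n → Fin n → ℤ) (Δ : ℕ)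
    (d : Fin n → ℕ) (E : List (Fin n × Fin n)) : List ℤ :=
  [(n : ℤ), (E.length : ℤ), (Δ : ℤ)]
    ++ (List.finRange n).flatMap (fun v =>
        [(d v : ℤ), bit (v ∈ FlowNetwork.active f Δ), bit (v ∈ N.compVerts f Δ)])
    ++ E.flatMap (fun a => [vtx a.1, vtx a.2, N.res f a.1 a.2])

/-- The output of creating the pseudoarcs: the number of queue entries of the first call, the
number of all queue entries, and the queue. -/
def createOutput (E : List (Fin n × Fin n)) (σ₁ σ₂ : PState n) : List ℤ :=
  [(σ₁.Q.length : ℤ), (σ₂.Q.length : ℤ)] ++ σ₂.Q.flatMap (encOp E)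

/-- The input for restoring the flows: `n`, the number of listed arcs, the length of the queue;
for each listed arc its ends, the position of the reversed arc, the old flow and the flow sent on
it as an original arc; the queue with the flow on its pseudoarcs. -/
def restoreInput (f : Fin n → Fin n → ℤ) (E : List (Fin n × Fin n)) (Q : List (Op n))
    (y : Fin n → Fin n → ℤ) (x : ℕ → ℤ) : List ℤ :=
  [(n : ℤ), (E.length : ℤ), (Q.length : ℤ)]
    ++ E.flatMap (fun a =>
        [vtx a.1, vtx a.2, (E.idxOf a.swap : ℤ), f a.1 a.2, y a.1 a.2])
    ++ encFlows E Q x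

/-- The output of restoring the flows: the flow on each listed arc. -/
def restoreOutput (E : List (Fin n × Fin n)) (g : Fin n → Fin n → ℤ) : List ℤ :=
  E.map (fun a => g a.1 a.2)

end Encoding

/-! Both tasks are bookkeeping on a rooted forest. The theorem therefore rests on two facts: only
$O(m)$ forest operations are needed, and each takes amortized time $O(\log n)$.

Time per operation. The forest is kept as link-cut trees over splay trees, with the potential
$\sum_v \log_2 s(v)$, where `s` counts the nodes below `v` over solid and dashed edges alike.
Exchanging a solid for a dashed edge leaves `s` unchanged, hence costs no potential. A double
rotation at `x` obeys the bound `3 * (lg' x - lg x) - 2` (`Conf.zigzig`, `Conf.zigzag`). On the way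
to the root the dashed edges are used up two at a time by such a double rotation, whose `-2` pays
for the round (`accessBody_spec`). This gives `accessCmd_spec` and from it value changes, links,
cuts, path minima and path additions within `opTime n`.

Number of operations. Weigh a state by three for each arc of positive capacity outside the forest
and two for each vertex with a parent. A link lowers the weight by at least one. A cut removes a
saturated arc, which does not return to the first count, so it lowers the weight by at least two. A
pseudoarc saturates the smallest arc of its path and so forces a cut, which pays for both queue
entries. The initial weight is at most $6m$, which bounds the queue of every execution
(`PState.length_queue_le`). An arc that is examined without a link is passed for the rest of the
call, which happens at most $2m$ times per call.

Choice of the vertex. A search in which no arc can be chosen any more stays dead for the rest of the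
call (`PState.Dead`). It is therefore enough to sort the vertices by label once and to treat each of
them until its search is dead (`DeadBelow.min_label`). The forest with its path minima also serves
as the priority queue for the sorting (`sortCmd_spec`).

Restoring. The queue is replayed on a forest whose values are the flows that have reached a tree arc
since its link. A cut, and at the end every vertex, moves this value to the arc (`FlowRep`). The
positive part of the resulting net flow is a preflow: the capacity bound holds because the
pseudoarcs and the remaining capacities share the residual capacity, the excess condition because a
path carries flow from one end to the other (`PState.Ok.isRestored`, `Forest.sum_arcOnPath`).

Programs are verified with `Wp`, which couples the final state with the running time; `Wp.loop`
turns a potential into termination and a time bound at once. -/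

set_option linter.unusedSectionVars false

/-! ## Running programs -/

/-- Composition of a list of programs. -/
def Cmd.seqs : List Cmd → Cmd
  | [] => .skip
  | [p] => p
  | p :: q :: l => .seq p (Cmd.seqs (q :: l))

open Classical in
/-- The final state of a program without loops. -/
noncomputable def Cmd.run : Cmd → RState → RState
  | .skip, S => S
  | .assign x e, S => { S with reg := Function.update S.reg x (e.eval S) }
  | .store a e, S => { S with mem := Function.update S.mem (a.eval S) (e.eval S) }
  | .seq p q, S => q.run (p.run S)
  | .ite b p q, S => if b.Holds S then p.run S else q.run S
  | .loop _ _, S => S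

/-- A bound on the number of steps of a program without loops. -/
def Cmd.cost : Cmd → ℕ
  | .skip => 1
  | .assign _ _ => 1
  | .store _ _ => 1
  | .seq p q => p.cost + q.cost
  | .ite _ p q => max p.cost q.cost + 1
  | .loop _ _ => 0

def Cmd.loopFree : Cmd → Bool
  | .seq p q => p.loopFree && q.loopFree
  | .ite _ p q => p.loopFree && q.loopFree
  | .loop _ _ => false
  | _ => true

theorem Cmd.exec_run (p : Cmd) (h : p.loopFree = true) (S : RState) :
    ∃ T, Exec p S T (p.run S) ∧ T ≤ p.cost := by
  induction p generalizing S with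
  | skip => exact ⟨1, .skip S, le_rfl⟩
  | assign x e => exact ⟨1, .assign x e S, le_rfl⟩
  | store a e => exact ⟨1, .store a e S, le_rfl⟩
  | seq p q ihp ihq =>
    simp only [loopFree, Bool.and_eq_true] at h
    obtain ⟨T₁, h₁, l₁⟩ := ihp h.1 S
    obtain ⟨T₂, h₂, l₂⟩ := ihq h.2 (p.run S)
    exact ⟨T₁ + T₂, .seq h₁ h₂, by simp only [cost]; omega⟩
  | ite b p q ihp ihq =>
    simp only [loopFree, Bool.and_eq_true] at h
    by_cases hb : b.Holds S
    · obtain ⟨T, h₁, l₁⟩ := ihp h.1 S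
      refine ⟨T + 1, ?_, by simp only [cost]; omega⟩
      simpa only [run, if_pos hb] using Exec.ite_true hb h₁
    · obtain ⟨T, h₁, l₁⟩ := ihq h.2 S
      refine ⟨T + 1, ?_, by simp only [cost]; omega⟩
      simpa only [run, if_neg hb] using Exec.ite_false hb h₁
  | loop b p => simp [loopFree] at h

/-- The program halts, and running time and final state satisfy `Q`. -/
def Wp (p : Cmd) (S : RState) (Q : ℝ → RState → Prop) : Prop :=
  ∃ (T : ℕ) (S' : RState), Exec p S T S' ∧ Q T S'

theorem Wp.mono {p : Cmd} {S : RState} {Q Q' : ℝ → RState → Prop} (h : Wp p S Q)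
    (hQ : ∀ T S', Q T S' → Q' T S') : Wp p S Q' := by
  obtain ⟨T, S', h₁, h₂⟩ := h
  exact ⟨T, S', h₁, hQ _ _ h₂⟩

/-- For code without loops the cost is a number read off the program text, which `decide` evaluates;
only the final state then needs an argument. -/
theorem Wp.of_run {p : Cmd} {S : RState} {Q : ℝ → RState → Prop} (h : p.loopFree = true)
    (hQ : ∀ T : ℝ, T ≤ p.cost → Q T (p.run S)) : Wp p S Q := by
  obtain ⟨T, h₁, h₂⟩ := p.exec_run h S
  exact ⟨T, _, h₁, hQ _ (by exact_mod_cast h₂)⟩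

theorem Wp.seq {p q : Cmd} {S : RState} {Q : ℝ → RState → Prop}
    (h : Wp p S (fun T₁ S₁ => Wp q S₁ (fun T₂ S₂ => Q (T₁ + T₂) S₂))) : Wp (.seq p q) S Q := by
  obtain ⟨T₁, S₁, h₁, T₂, S₂, h₂, h₃⟩ := h
  exact ⟨T₁ + T₂, S₂, .seq h₁ h₂, by exact_mod_cast h₃⟩

theorem Wp.seqs_cons {p q : Cmd} {l : List Cmd} {S : RState} {Q : ℝ → RState → Prop}
    (h : Wp p S (fun T₁ S₁ => Wp (Cmd.seqs (q :: l)) S₁ (fun T₂ S₂ => Q (T₁ + T₂) S₂))) :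
    Wp (Cmd.seqs (p :: q :: l)) S Q := Wp.seq h

theorem Wp.assign {x : ℕ} {e : Expr} {S : RState} {Q : ℝ → RState → Prop}
    (h : Q 1 { S with reg := Function.update S.reg x (e.eval S) }) : Wp (.assign x e) S Q :=
  ⟨1, _, .assign x e S, by exact_mod_cast h⟩

theorem Wp.ite {b : Test} {p q : Cmd} {S : RState} {Q : ℝ → RState → Prop}
    (h₁ : b.Holds S → Wp p S (fun T S' => Q (T + 1) S'))
    (h₂ : ¬ b.Holds S → Wp q S (fun T S' => Q (T + 1) S')) : Wp (.ite b p q) S Q := by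
  by_cases hb : b.Holds S
  · obtain ⟨T, S', h, hQ⟩ := h₁ hb
    exact ⟨T + 1, S', .ite_true hb h, by exact_mod_cast hQ⟩
  · obtain ⟨T, S', h, hQ⟩ := h₂ hb
    exact ⟨T + 1, S', .ite_false hb h, by exact_mod_cast hQ⟩

/-- A loop whose body lowers a nonnegative potential by at least the time it takes. -/
theorem Wp.loop {α : Type*} {b : Test} {p : Cmd} (I : α → RState → Prop) (pot : α → ℝ)
    (hpot : ∀ a S, I a S → 0 ≤ pot a)
    (body : ∀ a S, I a S → b.Holds S →
      Wp p S (fun T S' => ∃ a', I a' S' ∧ T + 1 ≤ pot a - pot a'))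
    {a : α} {S : RState} (h : I a S) :
    Wp (.loop b p) S (fun T S' => ∃ a', I a' S' ∧ ¬ b.Holds S' ∧ T ≤ pot a - pot a' + 1) := by
  obtain ⟨k, hk⟩ := exists_nat_gt (pot a)
  induction k generalizing a S with
  | zero => exact absurd (hpot a S h) (by simpa using hk)
  | succ k ih =>
    by_cases hb : b.Holds S
    · obtain ⟨T, S₁, hT, a₁, ha₁, hle⟩ := body a S h hb
      obtain ⟨T₂, S₂, hT₂, a₂, ha₂, hb₂, hle₂⟩ := ih ha₁ (by
        push_cast at hk
        have : (0 : ℝ) ≤ T := Nat.cast_nonneg T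
        linarith)
      refine ⟨T + T₂ + 1, S₂, .loop_true hb hT hT₂, a₂, ha₂, hb₂, ?_⟩
      push_cast
      linarith
    · exact ⟨1, S, .loop_false hb, a, h, hb, by simp⟩

/-! ## Memory fields

Field `j < 16` of item `i` is kept in the memory cell `-16 i - j - 1`. -/

/-- Negative addresses keep the fields apart from the input and the output, which occupy nonnegative
cells. Sixteen is a power of two, so that addresses are computed with four doublings. -/
def fadr (j i : ℤ) : ℤ := -16 * i - j - 1

def RState.fld (S : RState) (j i : ℤ) : ℤ := S.mem (fadr j i)

theorem fadr_inj {j j' i i' : ℤ} (h₁ : 0 ≤ j) (h₂ : j < 16) (h₁' : 0 ≤ j') (h₂' : j' < 16) :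
    fadr j i = fadr j' i' ↔ j = j' ∧ i = i' := by
  unfold fadr; omega

theorem fadr_neg {j i : ℤ} (h₁ : 0 ≤ j) (hi : 0 ≤ i) : fadr j i < 0 := by
  unfold fadr; omega

/-- Sixteen times an expression. -/
def Expr.mul16 (e : Expr) : Expr :=
  let e₂ := Expr.add e e
  let e₄ := Expr.add e₂ e₂
  let e₈ := Expr.add e₄ e₄
  Expr.add e₈ e₈

/-- The address of field `j` of item `e`. -/
def Expr.fa (j e : Expr) : Expr := .sub (.sub (.lit (-1)) j) e.mul16

theorem Expr.eval_fa (S : RState) (j e : Expr) :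
    (Expr.fa j e).eval S = fadr (j.eval S) (e.eval S) := by
  simp only [Expr.fa, Expr.mul16, Expr.eval, fadr]; ring

/-- The content of field `j` of item `e`. -/
def Expr.fl (j e : Expr) : Expr := .load (.fa j e)

theorem Expr.eval_fl (S : RState) (j e : Expr) :
    (Expr.fl j e).eval S = S.fld (j.eval S) (e.eval S) := by
  simp only [Expr.fl, Expr.eval, Expr.eval_fa, RState.fld]

/-- Assign a value to field `j` of item `e`. -/
def Cmd.setf (j e v : Expr) : Cmd := .store (.fa j e) v

/-- The state after setting a field. -/
def RState.setF (S : RState) (j i v : ℤ) : RState :=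
  { S with mem := Function.update S.mem (fadr j i) v }

/-- The state after setting a register. -/
def RState.setR (S : RState) (x : ℕ) (v : ℤ) : RState :=
  { S with reg := Function.update S.reg x v }

theorem RState.reg_setF (S : RState) (j i v : ℤ) : (S.setF j i v).reg = S.reg := rfl

theorem RState.mem_setR (S : RState) (x : ℕ) (v : ℤ) : (S.setR x v).mem = S.mem := rfl

theorem RState.fld_setR (S : RState) (x : ℕ) (v j i : ℤ) : (S.setR x v).fld j i = S.fld j i := rfl

theorem RState.reg_setR (S : RState) (x y : ℕ) (v : ℤ) :
    (S.setR x v).reg y = if y = x then v else S.reg y := by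
  simp [RState.setR, Function.update_apply]

theorem RState.fld_setF (S : RState) {j i v j' i' : ℤ} (h₁ : 0 ≤ j) (h₂ : j < 16)
    (h₁' : 0 ≤ j') (h₂' : j' < 16) :
    (S.setF j i v).fld j' i' = if j' = j ∧ i' = i then v else S.fld j' i' := by
  simp only [RState.setF, RState.fld, Function.update_apply, fadr_inj h₁' h₂' h₁ h₂]

theorem RState.mem_setF (S : RState) {j i v a : ℤ} (h₁ : 0 ≤ j) (hi : 0 ≤ i) (ha : 0 ≤ a) :
    (S.setF j i v).mem a = S.mem a := by
  have := fadr_neg h₁ hi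
  simp only [RState.setF, Function.update_apply]
  rw [if_neg (by omega)]

theorem Cmd.run_assign (x : ℕ) (e : Expr) (S : RState) :
    (Cmd.assign x e).run S = S.setR x (e.eval S) := rfl

theorem Cmd.run_setf (j e v : Expr) (S : RState) :
    (Cmd.setf j e v).run S = S.setF (j.eval S) (e.eval S) (v.eval S) := by
  simp only [Cmd.setf, Cmd.run, Expr.eval_fa, RState.setF]

theorem Cmd.run_seq (p q : Cmd) (S : RState) : (Cmd.seq p q).run S = q.run (p.run S) := rfl

open Classical in
theorem Cmd.run_ite (b : Test) (p q : Cmd) (S : RState) :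
    (Cmd.ite b p q).run S = if b.Holds S then p.run S else q.run S := rfl

theorem Cmd.run_skip (S : RState) : Cmd.skip.run S = S := rfl

/-! ## Link-cut trees

The nodes of each tree are partitioned into vertical paths; each path is kept, ordered by depth, in
a binary tree. `par` is the parent in the binary tree, or, at its root, the parent of the top of the
path. The data of a node are relative to the sum `off` of the tags above it. -/

/-- The fields of a link-cut forest, with the ghost fields `s` (number of nodes below, over solid and
dashed edges), `lst` (the inorder list of the binary subtree) and `off`. -/
structure Conf (V : Type*) where
  ch : Bool → V → Option V
  par : V → Option V
  tag : V → ℤ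
  sv : V → ℤ
  sm : V → ℤ
  am : V → V
  hd : V → V
  s : V → ℝ
  lst : V → List V
  off : V → ℤ

/-- A restructuring changes only two or three summands in the sums that give the sizes and the
potential; this lemma and the next isolate the change. -/
theorem Finset.sum_eq_add_of_eq_off_pair {V : Type*} [Fintype V] [DecidableEq V] {F F' : V → ℝ}
    {x y : V} (hxy : x ≠ y) (h : ∀ c, c ≠ x → c ≠ y → F' c = F c) :
    ∑ c, F' c = ∑ c, F c + (F' x - F x) + (F' y - F y) := by
  have : ∑ c, (F' c - F c) = ∑ c ∈ {x, y}, (F' c - F c) := by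
    symm
    apply Finset.sum_subset (Finset.subset_univ _)
    intro c _ hc
    simp only [Finset.mem_insert, Finset.mem_singleton, not_or] at hc
    rw [h c hc.1 hc.2, sub_self]
  rw [Finset.sum_sub_distrib, Finset.sum_pair hxy] at this
  linarith

theorem Finset.sum_eq_add_of_eq_off_triple {V : Type*} [Fintype V] [DecidableEq V] {F F' : V → ℝ}
    {x y b : V} (hxy : x ≠ y) (hxb : x ≠ b) (hyb : y ≠ b)
    (h : ∀ c, c ≠ x → c ≠ y → c ≠ b → F' c = F c) :
    ∑ c, F' c = ∑ c, F c + (F' x - F x) + (F' y - F y) + (F' b - F b) := by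
  have : ∑ c, (F' c - F c) = ∑ c ∈ {x, y, b}, (F' c - F c) := by
    symm
    apply Finset.sum_subset (Finset.subset_univ _)
    intro c _ hc
    simp only [Finset.mem_insert, Finset.mem_singleton, not_or] at hc
    rw [h c hc.1 hc.2.1 hc.2.2, sub_self]
  rw [Finset.sum_sub_distrib, Finset.sum_insert (by simp [hxy, hxb]), Finset.sum_pair hyb] at this
  linarith

namespace Conf

variable {V : Type*}

/-- `v` is the root of a binary tree. -/
def Root (C : Conf V) (v : V) : Prop := ∀ d y, C.ch d y ≠ some v

def lstO (C : Conf V) (o : Option V) : List V := o.elim [] C.lst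

def sO (C : Conf V) (o : Option V) : ℝ := o.elim 0 C.s

/-- The aggregated data of `v` are correct: the top, the minimum and its place. -/
def AggOK (val : V → ℤ) (C : Conf V) (v : V) : Prop :=
  (C.lst v).head? = some (C.hd v) ∧ C.am v ∈ C.lst v ∧ val (C.am v) = C.sm v + C.off v ∧
    ∀ w ∈ C.lst v, C.sm v + C.off v ≤ val w

variable [Fintype V] [DecidableEq V]

/-- The link-cut forest represents the forest `π` with values `val`; the aggregated data may be
wrong in `A`. -/
structure InvX (π : V → Option V) (val : V → ℤ) (C : Conf V) (A : Set V) : Prop where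
  par_ch : ∀ d v c, C.ch d v = some c → C.par c = some v
  ch_ne : ∀ v c, C.ch false v = some c → C.ch true v ≠ some c
  s_pos : ∀ v, 1 ≤ C.s v
  size : ∀ v, C.s v = 1 + ∑ c, if C.par c = some v then C.s c else 0
  lst_eq : ∀ v, C.lst v = C.lstO (C.ch false v) ++ v :: C.lstO (C.ch true v)
  chain : ∀ v, C.Root v → (C.lst v).IsChain (fun a b => π b = some a)
  head : ∀ v a, C.Root v → (C.lst v).head? = some a → π a = C.par v
  off_ch : ∀ d v c, C.ch d v = some c → C.off c = C.tag c + C.off v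
  off_root : ∀ v, C.Root v → C.off v = C.tag v
  val_eq : ∀ v, val v = C.sv v + C.off v
  agg : ∀ v, v ∉ A → AggOK val C v

abbrev Inv (π : V → Option V) (val : V → ℤ) (C : Conf V) : Prop := InvX π val C ∅

variable {π : V → Option V} {val : V → ℤ} {C : Conf V} {A : Set V}

namespace InvX

/-- Sizes increase strictly along `par`. This is the source of all acyclicity arguments: equations
between nodes that would close a cycle are refuted by comparing sizes. -/
theorem s_lt_of_par (h : InvX π val C A) {c v : V} (hc : C.par c = some v) :
    C.s c + 1 ≤ C.s v := by
  have h1 : (if C.par c = some v then C.s c else 0)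
      ≤ ∑ c, if C.par c = some v then C.s c else 0 :=
    Finset.single_le_sum (f := fun c => if C.par c = some v then C.s c else 0)
      (fun i _ => by
        have := h.s_pos i
        split_ifs <;> linarith) (Finset.mem_univ c)
  rw [if_pos hc] at h1
  have := h.size v
  linarith

theorem s_add_lt_of_par (h : InvX π val C A) {c c' v : V} (hc : C.par c = some v)
    (hc' : C.par c' = some v) (hne : c ≠ c') : C.s c + C.s c' + 1 ≤ C.s v := by
  have h1 : ∑ i ∈ {c, c'}, (if C.par i = some v then C.s i else 0)
      ≤ ∑ c, if C.par c = some v then C.s c else 0 :=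
    Finset.sum_le_sum_of_subset_of_nonneg (Finset.subset_univ _) (fun i _ _ => by
        have := h.s_pos i
        split_ifs <;> linarith)
  rw [Finset.sum_pair hne, if_pos hc, if_pos hc'] at h1
  have := h.size v
  linarith

theorem ch_ne' (h : InvX π val C A) {d : Bool} {v c : V} (hc : C.ch d v = some c) :
    C.ch (!d) v ≠ some c := by
  cases d
  · exact h.ch_ne v c hc
  · exact fun h' => h.ch_ne v c h' hc

theorem s_sibling (h : InvX π val C A) {d : Bool} {v c : V} (hc : C.ch d v = some c) :
    C.s c + C.sO (C.ch (!d) v) + 1 ≤ C.s v := by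
  cases hb : C.ch (!d) v with
  | none => simpa [sO] using h.s_lt_of_par (h.par_ch _ _ _ hc)
  | some b =>
    have := h.s_add_lt_of_par (h.par_ch _ _ _ hc) (h.par_ch _ _ _ hb)
      (fun e => h.ch_ne' hc (e ▸ hb))
    simpa [sO] using this

theorem sO_nonneg (h : InvX π val C A) (o : Option V) : 0 ≤ C.sO o := by
  cases o with
  | none => simp [sO]
  | some b => have := h.s_pos b; simp only [sO, Option.elim]; linarith

/-- Summed over all nodes, the size equations cancel except for the nodes without `par`, whose sizes
therefore add up to the number of nodes. A node of largest size is one of them. -/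
theorem s_le_card (h : InvX π val C A) (v : V) : C.s v ≤ Fintype.card V := by
  have hne : (Finset.univ : Finset V).Nonempty := ⟨v, Finset.mem_univ v⟩
  obtain ⟨w, -, hw⟩ := Finset.exists_max_image Finset.univ C.s hne
  have hroot : C.par w = none := by
    by_contra hp
    obtain ⟨p, hp⟩ := Option.ne_none_iff_exists'.1 hp
    have := h.s_lt_of_par hp
    have := hw p (Finset.mem_univ p)
    linarith
  have h1 : ∑ v, C.s v = Fintype.card V + ∑ c, if C.par c = none then 0 else C.s c := by
    have : ∑ v, C.s v = ∑ v, (1 + ∑ c, if C.par c = some v then C.s c else 0) :=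
      Finset.sum_congr rfl (fun v _ => h.size v)
    rw [this, Finset.sum_add_distrib, Finset.sum_comm]
    congr 1
    · simp
    · apply Finset.sum_congr rfl
      intro c _
      cases hp : C.par c with
      | none => simp
      | some p => simp
  have h2 : ∑ c, (C.s c - if C.par c = none then 0 else C.s c) = Fintype.card V := by
    rw [Finset.sum_sub_distrib]; linarith
  have h3 := Finset.single_le_sum (f := fun c => C.s c - if C.par c = none then 0 else C.s c)
      (fun i _ => by
        have := h.s_pos i
        split_ifs <;> linarith) (Finset.mem_univ w)
  simp only [hroot, if_true, sub_zero] at h3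
  have := hw v (Finset.mem_univ v)
  linarith

theorem mem_lst_self (h : InvX π val C A) (v : V) : v ∈ C.lst v := by
  rw [h.lst_eq v]; simp

theorem mem_lst_of_ch (h : InvX π val C A) {d : Bool} {v c w : V} (hc : C.ch d v = some c)
    (hw : w ∈ C.lst c) : w ∈ C.lst v := by
  rw [h.lst_eq v]
  cases d <;> simp [hc, lstO, hw]

theorem length_lst_of_ch (h : InvX π val C A) {d : Bool} {v c : V} (hc : C.ch d v = some c) :
    (C.lst c).length < (C.lst v).length := by
  rw [h.lst_eq v]
  cases d <;> (simp [hc, lstO]; try omega)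

/-- Every node of the binary subtree of `r` other than `r` has its parent there. -/
theorem exists_parent (h : InvX π val C A) {r x : V} (hx : x ∈ C.lst r) (hne : x ≠ r) :
    ∃ d y, C.ch d y = some x ∧ y ∈ C.lst r := by
  induction hk : (C.lst r).length using Nat.strong_induction_on generalizing r with
  | _ k ih =>
    have hx' := hx
    rw [h.lst_eq r] at hx'
    have key : ∀ d c, C.ch d r = some c → x ∈ C.lst c →
        ∃ d y, C.ch d y = some x ∧ y ∈ C.lst r := by
      intro d c hc hxc
      by_cases hxc' : x = c
      · exact ⟨d, r, hxc' ▸ hc, h.mem_lst_self r⟩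
      · obtain ⟨d', y, h1, h2⟩ := ih _ (hk ▸ h.length_lst_of_ch hc) hxc hxc' rfl
        exact ⟨d', y, h1, h.mem_lst_of_ch hc h2⟩
    rcases List.mem_append.1 hx' with h1 | h1
    · cases hc : C.ch false r with
      | none => simp [hc, lstO] at h1
      | some c => exact key false c hc (by simpa [hc, lstO] using h1)
    · rcases List.mem_cons.1 h1 with h1 | h1
      · exact absurd h1 hne
      · cases hc : C.ch true r with
        | none => simp [hc, lstO] at h1
        | some c => exact key true c hc (by simpa [hc, lstO] using h1)

theorem eq_of_root_of_mem (h : InvX π val C A) {r x : V} (hx : x ∈ C.lst r) (hr : C.Root x) :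
    x = r := by
  by_contra hne
  obtain ⟨d, y, h1, -⟩ := h.exists_parent hx hne
  exact hr d y h1

theorem ch_mem_lst (h : InvX π val C A) {r y c : V} {d : Bool} (hy : y ∈ C.lst r)
    (hc : C.ch d y = some c) : c ∈ C.lst r := by
  induction hk : (C.lst r).length using Nat.strong_induction_on generalizing r with
  | _ k ih =>
    by_cases hyr : y = r
    · subst hyr; exact h.mem_lst_of_ch hc (h.mem_lst_self c)
    · have hy' := hy
      rw [h.lst_eq r] at hy'
      rcases List.mem_append.1 hy' with h1 | h1
      · cases hc' : C.ch false r with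
        | none => simp [hc', lstO] at h1
        | some c' =>
          exact h.mem_lst_of_ch hc' (ih _ (hk ▸ h.length_lst_of_ch hc')
            (by simpa [hc', lstO] using h1) rfl)
      · rcases List.mem_cons.1 h1 with h1 | h1
        · exact absurd h1 hyr
        · cases hc' : C.ch true r with
          | none => simp [hc', lstO] at h1
          | some c' =>
            exact h.mem_lst_of_ch hc' (ih _ (hk ▸ h.length_lst_of_ch hc')
              (by simpa [hc', lstO] using h1) rfl)

/-- Each node lies in the binary tree of some root. -/
theorem exists_root (h : InvX π val C A) (x : V) : ∃ r, C.Root r ∧ x ∈ C.lst r := by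
  by_contra hcon
  push Not at hcon
  -- If no root were reached, climbing from `x` could go on for ever, and the sizes would exceed the
  -- bound of `s_le_card`.
  have key : ∀ k : ℕ, ∃ y, x ∈ C.lst y ∧ (k : ℝ) ≤ C.s y := by
    intro k
    induction k with
    | zero => exact ⟨x, h.mem_lst_self x, by have := h.s_pos x; push_cast; linarith⟩
    | succ k ih =>
      obtain ⟨y, h1, h2⟩ := ih
      have : ¬ C.Root y := fun hr => hcon y hr h1
      simp only [Root, not_forall, not_not] at this
      obtain ⟨d, z, hz⟩ := this
      refine ⟨z, h.mem_lst_of_ch hz h1, ?_⟩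
      have := h.s_lt_of_par (h.par_ch _ _ _ hz)
      push_cast; linarith
  obtain ⟨y, -, h2⟩ := key (Fintype.card V + 1)
  have := h.s_le_card y
  push_cast at h2
  linarith

end InvX

/-! ### Recomputing the aggregated data of a node -/

/-- A pair is a minimum relative to the offset of the node under repair, together with a node where
it is attained. Adding the tag of the child makes its minimum comparable. -/
def better (C : Conf V) (o : Option V) (p : ℤ × V) : ℤ × V :=
  o.elim p (fun c => if C.sm c + C.tag c < p.1 then (C.sm c + C.tag c, C.am c) else p)

def pull (C : Conf V) (v : V) : Conf V :=
  let p := C.better (C.ch true v) (C.better (C.ch false v) (C.sv v, v))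
  { C with
    sm := Function.update C.sm v p.1
    am := Function.update C.am v p.2
    hd := Function.update C.hd v ((C.ch false v).elim v C.hd) }

/-- The data of a node depend on its own value and on the data of its children only, so `v` can be
repaired as soon as its children are correct. -/
theorem InvX.pull (h : InvX π val C A) (v : V)
    (hA : ∀ d c, C.ch d v = some c → c ∉ A) : InvX π val (C.pull v) (A \ {v}) where
  par_ch := h.par_ch
  ch_ne := h.ch_ne
  s_pos := h.s_pos
  size := h.size
  lst_eq := h.lst_eq
  chain := h.chain
  head := h.head
  off_ch := h.off_ch
  off_root := h.off_root
  val_eq := h.val_eq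
  agg := by
    intro w hw
    by_cases hwv : w = v
    swap
    · have := h.agg w (fun hA => hw ⟨hA, hwv⟩)
      simpa [AggOK, Conf.pull, hwv] using this
    subst hwv
    have hl := h.lst_eq w
    -- One comparison, stated for an arbitrary list `l` of nodes already scanned, so that it applies
    -- to the left and then to the right child.
    have key : ∀ (l : List V) (d : Bool) (p : ℤ × V),
        (p.2 ∈ l ∧ val p.2 = p.1 + C.off w ∧ ∀ u ∈ l, p.1 + C.off w ≤ val u) →
        let q := C.better (C.ch d w) p
        q.2 ∈ l ++ C.lstO (C.ch d w) ∧ val q.2 = q.1 + C.off w ∧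
          ∀ u ∈ l ++ C.lstO (C.ch d w), q.1 + C.off w ≤ val u := by
      intro l d p hp
      cases hc : C.ch d w with
      | none => simpa [better, lstO] using hp
      | some c =>
        obtain ⟨-, h1, h2, h3⟩ := h.agg c (hA d c hc)
        have h4 := h.off_ch d w c hc
        simp only [better, lstO, Option.elim]
        split_ifs with hlt
        · refine ⟨by simp [h1], by simp only; linarith, ?_⟩
          intro u hu
          simp only
          rcases List.mem_append.1 hu with hu | hu
          · have := hp.2.2 u hu; linarith
          · have := h3 u hu; linarith
        · refine ⟨by simp [hp.1], hp.2.1, ?_⟩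
          intro u hu
          rcases List.mem_append.1 hu with hu | hu
          · exact hp.2.2 u hu
          · have := h3 u hu; linarith
    have k1 := key [w] false (C.sv w, w) ⟨by simp, h.val_eq w, by simp [h.val_eq w]⟩
    have k2 := key _ true _ k1
    refine ⟨?_, ?_, ?_, ?_⟩
    · simp only [Conf.pull, Function.update_self]
      rw [hl]
      cases hc : C.ch false w with
      | none => simp [lstO]
      | some c => simp [lstO, (h.agg c (hA _ c hc)).1]
    · simp only [Conf.pull, Function.update_self]
      have := k2.1
      rw [hl]
      simp only [List.mem_append, List.mem_cons, List.not_mem_nil, or_false] at this ⊢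
      tauto
    · simpa only [Conf.pull, Function.update_self] using k2.2.1
    · intro u hu
      simp only [Conf.pull, Function.update_self] at hu ⊢
      apply k2.2.2 u
      rw [hl] at hu
      simp only [List.mem_append, List.mem_cons, List.not_mem_nil, or_false] at hu ⊢
      tauto

/-! ### Rotations -/

/-- Rotate `x`, the child of `y` on side `d`, up, without recomputing aggregated data. -/
def rotCore (C : Conf V) (d : Bool) (x y : V) : Conf V where
  ch := fun e v => if v = x ∧ e = !d then some y else if v = y ∧ e = d then C.ch (!d) x
    else if C.ch e v = some y then some x else C.ch e v
  par := fun v => if v = x then C.par y else if v = y then some x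
    else if C.ch (!d) x = some v then some y else C.par v
  tag := fun v => if v = x then C.tag x + C.tag y else if v = y then - C.tag x
    else if C.ch (!d) x = some v then C.tag v + C.tag x else C.tag v
  sv := C.sv
  sm := C.sm
  am := C.am
  hd := C.hd
  s := fun v => if v = x then C.s y else if v = y then C.s y - C.s x + C.sO (C.ch (!d) x) else C.s v
  lst := fun v => if v = x then C.lst y else if v = y then
    (if d then C.lstO (C.ch false y) ++ y :: C.lstO (C.ch (!d) x)
      else C.lstO (C.ch (!d) x) ++ y :: C.lstO (C.ch true y)) else C.lst v
  off := C.off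

def rot (C : Conf V) (d : Bool) (x y : V) : Conf V := ((C.rotCore d x y).pull y).pull x

end Conf

namespace Conf

variable {V : Type*} [Fintype V] [DecidableEq V]
variable {π : V → Option V} {val : V → ℤ} {C : Conf V} {A : Set V}

theorem InvX.ne_of_ch (h : InvX π val C A) {d : Bool} {x y : V} (hx : C.ch d y = some x) :
    x ≠ y := by
  rintro rfl
  have := h.s_lt_of_par (h.par_ch _ _ _ hx)
  linarith

theorem InvX.ch_unique (h : InvX π val C A) {d d' : Bool} {x y y' : V} (hx : C.ch d y = some x)
    (hx' : C.ch d' y' = some x) : d' = d ∧ y' = y := by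
  have h1 := h.par_ch _ _ _ hx
  have h2 := h.par_ch _ _ _ hx'
  rw [h1] at h2
  have hy : y = y' := by simpa using h2
  subst hy
  refine ⟨?_, rfl⟩
  by_contra hd
  have : d' = !d := by cases d <;> cases d' <;> simp_all
  exact h.ch_ne' hx (this ▸ hx')

theorem root_rotCore (h : InvX π val C A) {d : Bool} {x y v : V} (hx : C.ch d y = some x) :
    (C.rotCore d x y).Root v ↔ (v = x ∧ C.Root y) ∨ (v ≠ x ∧ v ≠ y ∧ C.Root v) := by
  have hxy := h.ne_of_ch hx
  constructor
  · intro hr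
    have hvy : v ≠ y := by
      rintro rfl
      exact hr (!d) x (by simp [rotCore])
    by_cases hvx : v = x
    · left
      refine ⟨hvx, fun e w hw => hr e w ?_⟩
      subst hvx
      have h1 : ¬ (w = v ∧ e = !d) := by
        rintro ⟨rfl, rfl⟩
        have := h.s_lt_of_par (h.par_ch _ _ _ hx)
        have := h.s_lt_of_par (h.par_ch _ _ _ hw)
        linarith
      have h2 : ¬ (w = y ∧ e = d) := by
        rintro ⟨rfl, rfl⟩
        exact h.ne_of_ch hw rfl
      simp [rotCore, h1, h2, hw]
    · right
      refine ⟨hvx, hvy, fun e w hw => ?_⟩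
      by_cases h1 : w = x ∧ e = !d
      · refine hr d y ?_
        obtain ⟨rfl, rfl⟩ := h1
        simp [rotCore, hxy.symm, hw]
      · have h2 : ¬ (w = y ∧ e = d) := by
          rintro ⟨rfl, rfl⟩
          rw [hw] at hx
          exact hvx (by simpa using hx)
        refine hr e w ?_
        simp [rotCore, h1, h2, hw, hvy]
  · rintro (⟨rfl, hr⟩ | ⟨h1, h2, hr⟩)
    · intro e w hw
      simp only [rotCore] at hw
      split_ifs at hw with c1 c2 c3
      · exact hxy (by simpa using hw.symm)
      · exact h.ne_of_ch hw rfl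
      · exact hr e w c3
      · have := h.ch_unique hx hw
        exact c2 ⟨this.2, this.1⟩
    · intro e w hw
      simp only [rotCore] at hw
      split_ifs at hw with c1 c2 c3
      · exact h2 (by simpa using hw.symm)
      · exact hr _ _ hw
      · exact h1 (by simpa using hw.symm)
      · exact hr _ _ hw

/-- The inorder list below the pair is unchanged, `x` inherits the size of `y`, and the three tags
are altered so that the sum of the tags above each node, `off`, stays the same. Hence only the
aggregated data of `x` and `y` can become wrong. -/
theorem InvX.rotCore (h : InvX π val C A) {d : Bool} {x y : V} (hx : C.ch d y = some x)
     : InvX π val (C.rotCore d x y) (A ∪ {x, y}) := by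
  have hxy := h.ne_of_ch hx
  have hpx := h.par_ch _ _ _ hx
  have hb : ∀ b, C.ch (!d) x = some b → b ≠ x ∧ b ≠ y ∧ C.par b = some x := by
    intro b hb
    refine ⟨h.ne_of_ch hb, ?_, h.par_ch _ _ _ hb⟩
    rintro rfl
    have := h.s_lt_of_par (h.par_ch _ _ _ hx)
    have := h.s_lt_of_par (h.par_ch _ _ _ hb)
    linarith
  have hchy : ∀ e w, C.ch e w = some y → w ≠ x ∧ w ≠ y := by
    intro e w hw
    refine ⟨?_, ?_⟩
    · rintro rfl
      have := h.s_lt_of_par (h.par_ch _ _ _ hx)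
      have := h.s_lt_of_par (h.par_ch _ _ _ hw)
      linarith
    · rintro rfl; exact h.ne_of_ch hw rfl
  have hpy : C.par y ≠ some x := by
    intro hp
    have := h.s_lt_of_par hpx
    have := h.s_lt_of_par hp
    linarith
  have hpy' : C.par y ≠ some y := by
    intro hp
    have := h.s_lt_of_par hp
    linarith
  have hsx := h.s_sibling hx
  have hsb : C.s x ≥ 1 + C.sO (C.ch (!d) x) := by
    cases hbb : C.ch (!d) x with
    | none => have := h.s_pos x; simpa [sO] using this
    | some b => have := h.s_lt_of_par (hb b hbb).2.2; simp [sO]; linarith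
  have hnn := h.sO_nonneg (C.ch (!d) y)
  have hnn' := h.sO_nonneg (C.ch (!d) x)
  refine ⟨?_, ?_, ?_, ?_, ?_, ?_, ?_, ?_, ?_, h.val_eq, ?_⟩
  · intro e v c hc
    simp only [Conf.rotCore] at hc ⊢
    split_ifs at hc with c1 c2 c3
    · cases hc
      rw [if_neg hxy.symm, if_pos rfl, c1.1]
    · rw [if_neg (hb c hc).1, if_neg (hb c hc).2.1, if_pos hc, c2.1]
    · cases hc
      rw [if_pos rfl, h.par_ch _ _ _ c3]
    · have hcx : c ≠ x := by
        rintro rfl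
        have := h.ch_unique hx hc
        exact c2 ⟨this.2, this.1⟩
      have hcy : c ≠ y := by rintro rfl; exact c3 hc
      have hcb : C.ch (!d) x ≠ some c := by
        intro h'
        have := h.ch_unique h' hc
        exact c1 ⟨this.2, this.1⟩
      rw [if_neg hcx, if_neg hcy, if_neg hcb, h.par_ch _ _ _ hc]
  · intro v c h1 h2
    -- The four possible origins of a child pointer after the rotation. Two pointers from one node
    -- to the same child would need compatible origins, which the old tree excludes.
    have hu : ∀ e, (C.rotCore d x y).ch e v = some c →
        (v = x ∧ c = y ∧ e = !d) ∨ (v = y ∧ e = d ∧ C.ch (!d) x = some c) ∨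
        (c = x ∧ C.ch e v = some y) ∨ (c ≠ x ∧ c ≠ y ∧ C.ch (!d) x ≠ some c ∧ C.ch e v = some c) := by
      intro e he
      simp only [Conf.rotCore] at he
      split_ifs at he with c1 c2 c3
      · cases he; exact Or.inl ⟨c1.1, rfl, c1.2⟩
      · exact Or.inr (Or.inl ⟨c2.1, c2.2, he⟩)
      · cases he; exact Or.inr (Or.inr (Or.inl ⟨rfl, c3⟩))
      · refine Or.inr (Or.inr (Or.inr ⟨?_, ?_, ?_, he⟩))
        · rintro rfl
          have := h.ch_unique hx he
          exact c2 ⟨this.2, this.1⟩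
        · rintro rfl; exact c3 he
        · intro h'
          have := h.ch_unique h' he
          exact c1 ⟨this.2, this.1⟩
    have k1 := hu _ h1
    have k2 := hu _ h2
    rcases k1 with k1 | k1 | k1 | k1 <;> rcases k2 with k2 | k2 | k2 | k2
    all_goals try (exfalso; grind)
    · exact h.ch_ne _ _ k1.2 k2.2
    · exact h.ch_ne _ _ k1.2.2.2 k2.2.2.2
  · intro v
    have := h.s_pos v
    have := h.s_pos y
    simp only [Conf.rotCore]
    split_ifs <;> linarith
  · intro v
    have hsz := h.size v
    -- The node `x` exchanges the middle subtree for `y`, and `y` exchanges `x` for the middle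
    -- subtree. The parent of `y` sees no change, because `x` takes over the size of `y`.
    have hsum : ∑ c, (if (C.rotCore d x y).par c = some v then (C.rotCore d x y).s c else 0)
        = ∑ c, (if C.par c = some v then C.s c else 0)
          + (if x = v then (C.s y - C.s x) else 0)
          + (if y = v then (C.sO (C.ch (!d) x) - C.s x) else 0) := by
      cases hbb : C.ch (!d) x with
      | none =>
        rw [Finset.sum_eq_add_of_eq_off_pair (F := fun c => if C.par c = some v then C.s c else 0) hxy]
        · simp only [Conf.rotCore, if_true, hbb, if_neg hxy.symm, hpx, sO, Option.elim,
            Option.some.injEq]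
          split_ifs <;> ring
        · intro c h1 h2
          simp [Conf.rotCore, h1, h2, hbb]
      | some b =>
        obtain ⟨b1, b2, b3⟩ := hb b hbb
        rw [Finset.sum_eq_add_of_eq_off_triple
          (F := fun c => if C.par c = some v then C.s c else 0) hxy b1.symm b2.symm]
        · simp only [Conf.rotCore, if_true, hbb, if_neg hxy.symm, if_neg b1, if_neg b2, hpx, b3, sO,
            Option.elim, Option.some.injEq]
          split_ifs <;> ring
        · intro c h1 h2 h3
          simp [Conf.rotCore, h1, h2, hbb, h3.symm]
    rw [hsum]
    simp only [Conf.rotCore]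
    by_cases h1 : v = x
    · subst h1
      simp [hxy.symm]; linarith
    · by_cases h2 : v = y
      · subst h2
        simp [hxy, hxy.symm]; linarith
      · simp [h1, h2, Ne.symm h1, Ne.symm h2]; linarith
  · have hlx := h.lst_eq x
    have hly := h.lst_eq y
    have hO : ∀ o, o ≠ some x → o ≠ some y → (C.rotCore d x y).lstO o = C.lstO o := by
      intro o h1 h2
      cases o with
      | none => rfl
      | some w => simp [lstO, Conf.rotCore, show w ≠ x by simpa using h1, show w ≠ y by simpa using h2]
    have hOx : (C.rotCore d x y).lstO (some x) = C.lst y := by simp [lstO, Conf.rotCore]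
    intro v
    by_cases h1 : v = x
    · subst h1
      have e1 : (C.rotCore d v y).ch (!d) v = some y := by simp [Conf.rotCore]
      have e2 : (C.rotCore d v y).ch d v = C.ch d v := by
        have : ¬ C.ch d v = some y := fun h' => (hchy _ _ h').1 rfl
        simp [Conf.rotCore, hxy, this]
      have n1 : C.ch d v ≠ some v := fun h' => h.ne_of_ch h' rfl
      have n2 : C.ch d v ≠ some y := fun h' => (hchy _ _ h').1 rfl
      have e3 : (C.rotCore d v y).lst v = C.lst y := by simp [Conf.rotCore]
      rw [e3]
      cases d
      · simp only [Bool.not_false] at e1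
        rw [e1, e2, hO _ n1 n2, hly, hx]
        rw [show C.lstO (some v) = C.lst v from rfl, hlx]
        simp [Conf.rotCore, hxy.symm, lstO]
      · simp only [Bool.not_true] at e1
        rw [e1, e2, hO _ n1 n2, hly, hx]
        rw [show C.lstO (some v) = C.lst v from rfl, hlx]
        simp [Conf.rotCore, hxy.symm, lstO]
    · by_cases h2 : v = y
      · subst h2
        have e1 : (C.rotCore d x v).ch d v = C.ch (!d) x := by simp [Conf.rotCore, h1]
        have e2 : (C.rotCore d x v).ch (!d) v = C.ch (!d) v := by
          have : ¬ C.ch (!d) v = some v := fun h' => h.ne_of_ch h' rfl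
          simp [Conf.rotCore, h1, this]
        have n1 : C.ch (!d) x ≠ some x := fun h' => h.ne_of_ch h' rfl
        have n2 : C.ch (!d) x ≠ some v := fun h' => (hb _ h').2.1 rfl
        have n3 : C.ch (!d) v ≠ some x := h.ch_ne' hx
        have n4 : C.ch (!d) v ≠ some v := fun h' => h.ne_of_ch h' rfl
        cases d
        · rw [e1]
          simp only [Bool.not_false] at *
          rw [e2, hO _ n1 n2, hO _ n3 n4]
          simp [Conf.rotCore, h1]
        · rw [e1]
          simp only [Bool.not_true] at *
          rw [e2, hO _ n1 n2, hO _ n3 n4]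
          simp [Conf.rotCore, h1]
      · have e3 : (C.rotCore d x y).lst v = C.lst v := by simp [Conf.rotCore, h1, h2]
        have hch : ∀ e, (C.rotCore d x y).lstO ((C.rotCore d x y).ch e v) = C.lstO (C.ch e v) := by
          intro e
          by_cases hy : C.ch e v = some y
          · have : (C.rotCore d x y).ch e v = some x := by simp [Conf.rotCore, h1, h2, hy]
            rw [this, hOx, hy]; rfl
          · have : (C.rotCore d x y).ch e v = C.ch e v := by simp [Conf.rotCore, h1, h2, hy]
            rw [this, hO _ _ hy]
            intro h'
            exact h2 (h.ch_unique hx h').2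
        rw [e3, hch, hch, h.lst_eq v]
  · intro v hv
    rcases (root_rotCore h hx).1 hv with ⟨rfl, hr⟩ | ⟨h1, h2, hr⟩
    · simpa [Conf.rotCore] using h.chain y hr
    · simpa [Conf.rotCore, h1, h2] using h.chain v hr
  · intro v a hv ha
    rcases (root_rotCore h hx).1 hv with ⟨rfl, hr⟩ | ⟨h1, h2, hr⟩
    · have := h.head y a hr
      simp only [Conf.rotCore, if_true] at ha ⊢
      exact this ha
    · have h3 : C.ch (!d) x ≠ some v := hr _ _
      have := h.head v a hr
      simp only [Conf.rotCore, if_neg h1, if_neg h2, if_neg h3] at ha ⊢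
      exact this ha
  · intro e v c hc
    have hox := h.off_ch _ _ _ hx
    simp only [Conf.rotCore] at hc ⊢
    split_ifs at hc with c1 c2 c3
    · cases hc
      rw [if_neg hxy.symm, if_pos rfl, c1.1]
      linarith
    · rw [if_neg (hb c hc).1, if_neg (hb c hc).2.1, if_pos hc, c2.1]
      have := h.off_ch _ _ _ hc
      linarith
    · cases hc
      rw [if_pos rfl]
      have := h.off_ch _ _ _ c3
      linarith
    · have hcx : c ≠ x := by
        rintro rfl
        have := h.ch_unique hx hc
        exact c2 ⟨this.2, this.1⟩
      have hcy : c ≠ y := by rintro rfl; exact c3 hc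
      have hcb : C.ch (!d) x ≠ some c := by
        intro h'
        have := h.ch_unique h' hc
        exact c1 ⟨this.2, this.1⟩
      rw [if_neg hcx, if_neg hcy, if_neg hcb, h.off_ch _ _ _ hc]
  · intro v hv
    rcases (root_rotCore h hx).1 hv with ⟨rfl, hr⟩ | ⟨h1, h2, hr⟩
    · have := h.off_root y hr
      have := h.off_ch _ _ _ hx
      simp only [Conf.rotCore, if_true]
      linarith
    · have h3 : C.ch (!d) x ≠ some v := hr _ _
      simpa only [Conf.rotCore, if_neg h1, if_neg h2, if_neg h3] using h.off_root v hr
  · intro v hv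
    simp only [Set.mem_union, Set.mem_insert_iff, Set.mem_singleton_iff, not_or] at hv
    have := h.agg v hv.1
    simpa [AggOK, Conf.rotCore, hv.2.1, hv.2.2] using this

end Conf

/-! ### Potential analysis of rotations -/

/-- The inequality of the arithmetic and geometric means; it produces the `-2` of the double
rotations. -/
theorem logb_add_logb_le {a b c : ℝ} (ha : 0 < a) (hb : 0 < b) (h : a + b ≤ c) :
    Real.logb 2 a + Real.logb 2 b ≤ 2 * Real.logb 2 c - 2 := by
  have hc : 0 < c := by linarith
  rw [← Real.logb_mul ha.ne' hb.ne']
  have h1 : a * b ≤ (c / 2) ^ 2 := by nlinarith [sq_nonneg (a - b)]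
  have h2 : Real.logb 2 (a * b) ≤ Real.logb 2 ((c / 2) ^ 2) :=
    Real.logb_le_logb_of_le (by norm_num) (by positivity) h1
  have h3 : Real.logb 2 ((c / 2) ^ 2) = 2 * Real.logb 2 c - 2 := by
    rw [Real.logb_pow, Real.logb_div hc.ne' (by norm_num), Real.logb_self_eq_one (by norm_num)]
    push_cast; ring
  linarith

theorem List.IsChain.map_const {α β : Type*} {R : α → α → Prop} {f : α → β}
    (hf : ∀ a b, R a b → f a = f b) {l : List α} (h : l.IsChain R) :
    ∀ a ∈ l, ∀ b ∈ l, f a = f b := by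
  induction l with
  | nil => simp
  | cons x l ih =>
    cases l with
    | nil => simp
    | cons y l =>
      have h' := List.isChain_cons_cons.1 h
      have ih' := ih h'.2
      have hx := hf _ _ h'.1
      intro a ha b hb
      have key : ∀ c ∈ x :: y :: l, f c = f y := by
        intro c hc
        rcases List.mem_cons.1 hc with rfl | hc
        · exact hx
        · exact ih' c hc y (by simp)
      rw [key a ha, key b hb]

namespace Conf

variable {V : Type*} [Fintype V] [DecidableEq V]
variable {π : V → Option V} {val : V → ℤ} {C C' C'' : Conf V} {A : Set V}

/-- The potential of a link-cut forest. -/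
noncomputable def pot (C : Conf V) : ℝ := ∑ v, Real.logb 2 (C.s v)

noncomputable abbrev lg (C : Conf V) (v : V) : ℝ := Real.logb 2 (C.s v)

theorem InvX.lg_nonneg (h : InvX π val C A) (v : V) : 0 ≤ C.lg v :=
  Real.logb_nonneg (by norm_num) (h.s_pos v)

theorem InvX.pot_nonneg (h : InvX π val C A) : 0 ≤ C.pot :=
  Finset.sum_nonneg (fun v _ => h.lg_nonneg v)

theorem InvX.lg_le (h : InvX π val C A) (v : V) : C.lg v ≤ Real.logb 2 (Fintype.card V) :=
  Real.logb_le_logb_of_le (by norm_num) (by have := h.s_pos v; linarith) (h.s_le_card v)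

theorem InvX.lg_le_of_par (h : InvX π val C A) {c v : V} (hc : C.par c = some v) :
    C.lg c ≤ C.lg v :=
  Real.logb_le_logb_of_le (by norm_num) (by have := h.s_pos c; linarith)
    (by have := h.s_lt_of_par hc; linarith)

theorem lg_mono {x y : V} (h : InvX π val C A) (hs : C.s x ≤ C'.s y) : C.lg x ≤ C'.lg y :=
  Real.logb_le_logb_of_le (by norm_num) (by have := h.s_pos x; linarith) hs

theorem InvX.mono (h : InvX π val C A) {B : Set V} (hAB : A ⊆ B) : InvX π val C B :=
  ⟨h.par_ch, h.ch_ne, h.s_pos, h.size, h.lst_eq, h.chain, h.head, h.off_ch, h.off_root, h.val_eq,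
    fun v hv => h.agg v (fun hA => hv (hAB hA))⟩

/-- A function constant along forest edges is constant on each path, and a dashed edge leads from a
path to the forest parent of its top. Such a function `cl` therefore separates trees of the forest
also in the link-cut structure. -/
theorem InvX.cl_par {β : Type*} {cl : V → β} (h : InvX π val C A)
    (hcl : ∀ a b, π a = some b → cl a = cl b) {c p : V} (hp : C.par c = some p) : cl c = cl p := by
  obtain ⟨r, hr, hc⟩ := h.exists_root c
  have hconst := List.IsChain.map_const (f := cl) (fun a b hab => (hcl b a hab).symm) (h.chain r hr)
  by_cases hcr : c = r
  · subst hcr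
    cases hl : (C.lst c).head? with
    | none =>
      rw [List.head?_eq_none_iff] at hl
      simp [hl] at hc
    | some a =>
      have h1 := h.head c a hr hl
      rw [hp] at h1
      rw [hconst c hc a (List.mem_of_mem_head? hl), hcl a p h1]
  · obtain ⟨d, y, hy, hyr⟩ := h.exists_parent hc hcr
    have := h.par_ch _ _ _ hy
    rw [hp] at this
    obtain rfl : p = y := by simpa using this
    exact hconst c hc p hyr

/-- The changes to a link-cut forest that a restructuring at `x` may make. -/
structure Evo {β : Type*} (cl : V → β) (x : V) (C C' : Conf V) : Prop where
  keep : ∀ c, C.Root c → (C.s c < C.s x ∨ cl c ≠ cl x) →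
    C'.Root c ∧ C'.par c = C.par c ∧ C'.s c = C.s c ∧ ∀ e, C'.ch e c = C.ch e c
  mono : C.s x ≤ C'.s x
  path : ∀ r, C.Root r → ∃ r', C'.Root r' ∧ C'.lst r' = C.lst r

theorem Evo.refl {β : Type*} (cl : V → β) (x : V) (C : Conf V) : Evo cl x C C :=
  ⟨fun _ h _ => ⟨h, rfl, rfl, fun _ => rfl⟩, le_rfl, fun r hr => ⟨r, hr, rfl⟩⟩

theorem Evo.trans {β : Type*} {cl : V → β} {x : V} (h₁ : Evo cl x C C') (h₂ : Evo cl x C' C'') :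
    Evo cl x C C'' := by
  refine ⟨fun c hc hcond => ?_, h₁.mono.trans h₂.mono, fun r hr => ?_⟩
  · obtain ⟨a1, a2, a3, a4⟩ := h₁.keep c hc hcond
    obtain ⟨b1, b2, b3, b4⟩ := h₂.keep c a1 (hcond.imp_left (fun h => by
      rw [a3]; exact h.trans_le h₁.mono))
    exact ⟨b1, b2.trans a2, b3.trans a3, fun e => (b4 e).trans (a4 e)⟩
  · obtain ⟨r', h1, h2⟩ := h₁.path r hr
    obtain ⟨r'', h3, h4⟩ := h₂.path r' h1
    exact ⟨r'', h3, h4.trans h2⟩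

theorem InvX.rot (h : Inv π val C) {d : Bool} {x y : V} (hx : C.ch d y = some x) :
    Inv π val (C.rot d x y) := by
  have hxy := h.ne_of_ch hx
  have h1 := InvX.rotCore h hx
  -- After the rotation `y` is a child of `x`, so `y` has to be repaired before `x`.
  have h2 := h1.pull y (by
    intro e c hc
    simp only [Set.mem_union, Set.mem_empty_iff_false, false_or, Set.mem_insert_iff,
      Set.mem_singleton_iff, not_or]
    refine ⟨?_, h1.ne_of_ch hc⟩
    rintro rfl
    have a1 := h1.s_lt_of_par (h1.par_ch _ _ _ hc)
    have a2 := h1.s_lt_of_par (h1.par_ch (!d) c y (by simp [Conf.rotCore]))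
    linarith)
  have h3 := h2.pull x (by
    intro e c hc
    have := h1.ne_of_ch hc
    simp only [Set.mem_union, Set.mem_empty_iff_false, false_or, Set.mem_insert_iff,
      Set.mem_singleton_iff, Set.mem_sdiff, not_and, not_not]
    tauto)
  refine h3.mono ?_
  intro v hv
  simp only [Set.mem_union, Set.mem_empty_iff_false, false_or, Set.mem_insert_iff,
      Set.mem_singleton_iff, Set.mem_sdiff] at hv
  tauto

theorem s_rot_self (C : Conf V) (d : Bool) (x y : V) : (C.rot d x y).s x = C.s y := by
  change (C.rotCore d x y).s x = C.s y
  simp [rotCore]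

theorem s_rot_other (C : Conf V) (d : Bool) {x y v : V} (h1 : v ≠ x) (h2 : v ≠ y) :
    (C.rot d x y).s v = C.s v := by
  change (C.rotCore d x y).s v = C.s v
  simp [rotCore, h1, h2]

theorem s_rot_snd (C : Conf V) (d : Bool) {x y : V} (h1 : x ≠ y) :
    (C.rot d x y).s y = C.s y - C.s x + C.sO (C.ch (!d) x) := by
  change (C.rotCore d x y).s y = _
  simp [rotCore, h1.symm]

theorem ch_rot (C : Conf V) (d : Bool) (x y : V) (e : Bool) (v : V) :
    (C.rot d x y).ch e v = if v = x ∧ e = !d then some y else if v = y ∧ e = d then C.ch (!d) x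
    else if C.ch e v = some y then some x else C.ch e v := rfl

theorem par_rot (C : Conf V) (d : Bool) (x y v : V) :
    (C.rot d x y).par v = if v = x then C.par y else if v = y then some x
    else if C.ch (!d) x = some v then some y else C.par v := rfl

theorem root_rot (h : InvX π val C A) {d : Bool} {x y v : V} (hx : C.ch d y = some x) :
    (C.rot d x y).Root v ↔ (v = x ∧ C.Root y) ∨ (v ≠ x ∧ v ≠ y ∧ C.Root v) :=
  root_rotCore h hx

/-- Since `x` takes over the size of `y`, the old term of `y` cancels; what remains is the old term
of `x` and the new term of `y`. -/
theorem pot_rot (h : Inv π val C) {d : Bool} {x y : V} (hx : C.ch d y = some x) :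
    (C.rot d x y).pot = C.pot - C.lg x + (C.rot d x y).lg y := by
  have hxy := h.ne_of_ch hx
  unfold pot
  rw [Finset.sum_eq_add_of_eq_off_pair (F := fun v => Real.logb 2 (C.s v)) hxy]
  · simp only [lg, s_rot_self]; ring
  · intro c h1 h2
    rw [s_rot_other C d h1 h2]

/-- A rotation touches pointers at `x`, `y`, the middle subtree and the parent of `y`. A root that
is smaller than `u` or in another class is none of these. So a splay on one path leaves intact a
smaller path hanging from it and all other trees. -/
theorem evo_rot {β : Type*} {cl : V → β} (hcl : ∀ a b, π a = some b → cl a = cl b)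
    (h : Inv π val C) {d : Bool} {x y u : V} (hx : C.ch d y = some x)
    (hu : u = x ∨ u ≠ y ∧ C.s u ≤ C.s x ∧ cl u = cl x) :
    Evo cl u C (C.rot d x y) := by
  have hxy := h.ne_of_ch hx
  have hpx := h.par_ch _ _ _ hx
  have hsx := h.s_lt_of_par hpx
  have hcx := h.cl_par hcl hpx
  have hus : C.s u ≤ C.s x := by
    rcases hu with rfl | hu
    · exact le_rfl
    · exact hu.2.1
  have hucl : cl u = cl x := by
    rcases hu with rfl | hu
    · rfl
    · exact hu.2.2
  refine ⟨?_, ?_, ?_⟩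
  · intro c hc hcond
    have hc1 : c ≠ x := by rintro rfl; exact hc _ _ hx
    have hc2 : c ≠ y := by
      rintro rfl
      rcases hcond with h' | h'
      · linarith
      · exact h' (by rw [hucl, hcx])
    have hc3 : ∀ e, C.ch e c ≠ some y := by
      intro e he
      have hp := h.par_ch _ _ _ he
      have := h.s_lt_of_par hp
      have := h.cl_par hcl hp
      rcases hcond with h' | h'
      · linarith
      · exact h' (by rw [hucl, hcx, this])
    refine ⟨(root_rot h hx).2 (Or.inr ⟨hc1, hc2, hc⟩), ?_, s_rot_other C d hc1 hc2, ?_⟩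
    · rw [par_rot, if_neg hc1, if_neg hc2, if_neg (hc _ _)]
    · intro e
      rw [ch_rot, if_neg (by tauto), if_neg (by tauto), if_neg (hc3 e)]
  · by_cases hux : u = x
    · rw [hux, s_rot_self]; linarith
    · have huy : u ≠ y := by tauto
      rw [s_rot_other C d hux huy]
  · intro r hr
    by_cases hry : r = y
    · refine ⟨x, (root_rot h hx).2 (Or.inl ⟨rfl, hry ▸ hr⟩), ?_⟩
      change (C.rotCore d x y).lst x = _
      simp [rotCore, hry]
    · have hrx : r ≠ x := by rintro rfl; exact hr _ _ hx
      refine ⟨r, (root_rot h hx).2 (Or.inr ⟨hrx, hry, hr⟩), ?_⟩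
      change (C.rotCore d x y).lst r = _
      simp [rotCore, hry, hrx]

theorem s_rot_snd_le (h : Inv π val C) {d : Bool} {x y : V} (hx : C.ch d y = some x) :
    (C.rot d x y).s y ≤ C.s y := by
  rw [s_rot_snd C d (h.ne_of_ch hx)]
  cases hb : C.ch (!d) x with
  | none => have := h.s_pos x; simp [sO]; linarith
  | some b => have := h.s_lt_of_par (h.par_ch _ _ _ hb); simp [sO]; linarith

/-- A single rotation. -/
theorem zig {β : Type*} {cl : V → β} (hcl : ∀ a b, π a = some b → cl a = cl b)
    (h : Inv π val C) {d : Bool} {x y : V} (hx : C.ch d y = some x) :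
    Inv π val (C.rot d x y) ∧ Evo cl x C (C.rot d x y) ∧
      (C.rot d x y).pot ≤ C.pot + ((C.rot d x y).lg x - C.lg x) := by
  have h' := InvX.rot h hx
  refine ⟨h', evo_rot hcl h hx (Or.inl rfl), ?_⟩
  rw [pot_rot h hx]
  have : (C.rot d x y).lg y ≤ (C.rot d x y).lg x :=
    lg_mono h' (by rw [s_rot_self]; exact s_rot_snd_le h hx)
  linarith

/-- The double rotation at `x`, when `x` and its parent `y` are children on the same side. -/
theorem zigzig {β : Type*} {cl : V → β} (hcl : ∀ a b, π a = some b → cl a = cl b)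
    (h : Inv π val C) {d : Bool} {x y z : V} (hx : C.ch d y = some x) (hy : C.ch d z = some y) :
    (C.rot d y z).ch d y = some x ∧ Inv π val ((C.rot d y z).rot d x y) ∧
      Evo cl x C ((C.rot d y z).rot d x y) ∧ ((C.rot d y z).rot d x y).s x = C.s z ∧
      ((C.rot d y z).rot d x y).pot
        ≤ C.pot + 3 * (((C.rot d y z).rot d x y).lg x - C.lg x) - 2 := by
  have hxy := h.ne_of_ch hx
  have hyz := h.ne_of_ch hy
  have hsx := h.s_lt_of_par (h.par_ch _ _ _ hx)
  have hsy := h.s_lt_of_par (h.par_ch _ _ _ hy)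
  have hxz : x ≠ z := by rintro rfl; linarith
  have hx1 : (C.rot d y z).ch d y = some x := by
    rw [ch_rot, if_neg (by simp), if_neg (by tauto), if_neg, hx]
    rw [hx]; simpa using hxz
  have h1 := InvX.rot h hy
  have h2 := InvX.rot h1 hx1
  have hs2 : ((C.rot d y z).rot d x y).s x = C.s z := by rw [s_rot_self, s_rot_self]
  refine ⟨hx1, h2, ?_, hs2, ?_⟩
  · have e1 : Evo cl x C (C.rot d y z) := evo_rot hcl h hy
      (Or.inr ⟨hxz, by linarith, h.cl_par hcl (h.par_ch _ _ _ hx)⟩)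
    exact e1.trans (evo_rot hcl h1 hx1 (Or.inl rfl))
  · rw [pot_rot h1 hx1, pot_rot h hy]
    have e1 : ((C.rot d y z).rot d x y).lg y ≤ ((C.rot d y z).rot d x y).lg x :=
      lg_mono h2 (by rw [s_rot_self]; exact s_rot_snd_le h1 hx1)
    have e2 : (C.rot d y z).lg x = C.lg x := by simp only [lg]; rw [s_rot_other C d hxy hxz]
    have e3 : C.lg x ≤ C.lg y := h.lg_le_of_par (h.par_ch _ _ _ hx)
    -- The old subtree of `x` and the new subtree of `z` are disjoint parts of the old subtree of
    -- `z`; this yields the `-2`.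
    have e4 : C.lg x + (C.rot d y z).lg z ≤ 2 * ((C.rot d y z).rot d x y).lg x - 2 := by
      apply logb_add_logb_le
      · have := h.s_pos x; linarith
      · have := h1.s_pos z; linarith
      · rw [hs2, s_rot_snd C d hyz]
        have := h.s_sibling hx
        linarith
    linarith

/-- The double rotation at `x`, when `x` and its parent `y` are children on opposite sides. -/
theorem zigzag {β : Type*} {cl : V → β} (hcl : ∀ a b, π a = some b → cl a = cl b)
    (h : Inv π val C) {d : Bool} {x y z : V} (hx : C.ch d y = some x) (hy : C.ch (!d) z = some y) :
    (C.rot d x y).ch (!d) z = some x ∧ Inv π val ((C.rot d x y).rot (!d) x z) ∧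
      Evo cl x C ((C.rot d x y).rot (!d) x z) ∧ ((C.rot d x y).rot (!d) x z).s x = C.s z ∧
      ((C.rot d x y).rot (!d) x z).pot
        ≤ C.pot + 3 * (((C.rot d x y).rot (!d) x z).lg x - C.lg x) - 2 := by
  have hxy := h.ne_of_ch hx
  have hyz := h.ne_of_ch hy
  have hsx := h.s_lt_of_par (h.par_ch _ _ _ hx)
  have hsy := h.s_lt_of_par (h.par_ch _ _ _ hy)
  have hxz : x ≠ z := by rintro rfl; linarith
  have hx1 : (C.rot d x y).ch (!d) z = some x := by
    rw [ch_rot, if_neg (by tauto), if_neg (by tauto), if_pos hy]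
  have h1 := InvX.rot h hx
  have h2 := InvX.rot h1 hx1
  have hs1z : (C.rot d x y).s z = C.s z := s_rot_other C d hxz.symm hyz.symm
  have hs2 : ((C.rot d x y).rot (!d) x z).s x = C.s z := by rw [s_rot_self, hs1z]
  refine ⟨hx1, h2, ?_, hs2, ?_⟩
  · exact (evo_rot hcl h hx (Or.inl rfl)).trans (evo_rot hcl h1 hx1 (Or.inl rfl))
  · rw [pot_rot h1 hx1, pot_rot h hx]
    have e1 : C.lg x ≤ (C.rot d x y).lg x :=
      lg_mono h (by rw [s_rot_self]; linarith)
    -- At the end `y` and `z` are the two children of `x`, with disjoint subtrees.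
    have e2 : (C.rot d x y).lg y + ((C.rot d x y).rot (!d) x z).lg z
        ≤ 2 * ((C.rot d x y).rot (!d) x z).lg x - 2 := by
      apply logb_add_logb_le
      · have := h1.s_pos y; linarith
      · have := h2.s_pos z; linarith
      · rw [hs2, s_rot_snd _ _ hxz, s_rot_snd _ _ hxy, hs1z, s_rot_self]
        have hb2 : (C.rot d x y).ch d x = C.ch d x := by
          rw [ch_rot, if_neg (by simp), if_neg (by tauto), if_neg]
          intro h'
          have := h.s_lt_of_par (h.par_ch _ _ _ h')
          linarith
        have hb3 : (C.rot d x y).sO (C.ch d x) = C.sO (C.ch d x) := by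
          cases hc : C.ch d x with
          | none => rfl
          | some c =>
            have := h.s_lt_of_par (h.par_ch _ _ _ hc)
            simp only [sO, Option.elim]
            rw [s_rot_other C d (h.ne_of_ch hc)]
            rintro rfl; linarith
        have hb4 : C.sO (C.ch d x) + C.sO (C.ch (!d) x) ≤ C.s x := by
          cases hc : C.ch d x with
          | none =>
            cases hc' : C.ch (!d) x with
            | none => have := h.s_pos x; simp [sO]; linarith
            | some c => have := h.s_lt_of_par (h.par_ch _ _ _ hc'); simp [sO]; linarith
          | some c => have := h.s_sibling hc; simp [sO] at this ⊢; linarith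
        rw [Bool.not_not, hb2, hb3]
        linarith
    have e3 : C.lg x ≤ ((C.rot d x y).rot (!d) x z).lg x := lg_mono h (by rw [hs2]; linarith)
    linarith

/-! ### Replacing the lower part of a path -/

/-- A dashed child differs from a solid one only by the missing child pointer, so `par` and `s`
stay, and with them the potential. The tags change because a binary root carries its full offset,
while a solid child carries it relative to its parent. -/
def setRCore (C : Conf V) (w : V) (o : Option V) : Conf V :=
  { C with
    ch := fun e v => if v = w ∧ e = true then o else C.ch e v
    tag := fun v => if o = some v then C.tag v - C.tag w
      else if C.ch true w = some v then C.tag v + C.tag w else C.tag v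
    lst := fun v => if v = w then C.lstO (C.ch false w) ++ w :: C.lstO o else C.lst v }

/-- Replace the lower part of the path with binary tree root `w`. -/
def setR (C : Conf V) (w : V) (o : Option V) : Conf V := (C.setRCore w o).pull w

theorem root_setR (h : InvX π val C A) {w v : V} {o : Option V} (hw : C.Root w)
    (ho : ∀ v, o = some v → C.Root v ∧ C.par v = some w) :
    (C.setR w o).Root v ↔ (C.Root v ∧ o ≠ some v) ∨ C.ch true w = some v := by
  have hdef : ∀ e u, (C.setR w o).ch e u = if u = w ∧ e = true then o else C.ch e u :=
    fun _ _ => rfl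
  constructor
  · intro hr
    by_cases hv : C.ch true w = some v
    · exact Or.inr hv
    · left
      refine ⟨fun e u hu => hr e u ?_, fun h' => hr true w ?_⟩
      · rw [hdef, if_neg, hu]
        rintro ⟨rfl, rfl⟩
        exact hv hu
      · rw [hdef, if_pos ⟨rfl, rfl⟩, h']
  · rintro (⟨h1, h2⟩ | h1) e u hu
    · rw [hdef] at hu
      split_ifs at hu
      · exact h2 hu
      · exact h1 _ _ hu
    · rw [hdef] at hu
      split_ifs at hu with hc
      · exact (ho v hu).1 _ _ h1
      · have := h.ch_unique h1 hu
        exact hc ⟨this.2, this.1⟩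

/-- The path up to `w` continues with the path of `o`, because the forest parent of the top of `o`
is `w`. Likewise the forest parent of the top of the detached part is `w`, so its dashed edge is
correct. -/
theorem InvX.setR (h : Inv π val C) {w : V} {o : Option V} (hw : C.Root w)
    (ho : ∀ v, o = some v → C.Root v ∧ C.par v = some w) : Inv π val (C.setR w o) := by
  have hne : ∀ v, o = some v → v ≠ w := by
    rintro v hv rfl
    have := h.s_lt_of_par (ho v hv).2
    linarith
  have hroot : ∀ v, (C.setRCore w o).Root v ↔ (C.Root v ∧ o ≠ some v) ∨ C.ch true w = some v :=
    fun v => root_setR h hw ho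
  have hlst := h.lst_eq w
  have hchain := h.chain w hw
  have key : InvX π val (C.setRCore w o) {w} := by
    refine ⟨?_, ?_, h.s_pos, h.size, ?_, ?_, ?_, ?_, ?_, h.val_eq, ?_⟩
    · intro d v c hc
      simp only [setRCore] at hc ⊢
      split_ifs at hc with h1
      · rw [(ho c hc).2, h1.1]
      · exact h.par_ch _ _ _ hc
    · intro v c h1 h2
      simp only [setRCore] at h1 h2
      rw [if_neg (by simp)] at h1
      split_ifs at h2 with h3
      · exact (ho c h2).1 _ _ h1
      · exact h.ch_ne _ _ h1 h2
    · intro v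
      have hO : ∀ o', o' ≠ some w → (C.setRCore w o).lstO o' = C.lstO o' := by
        intro o' h1
        cases o' with
        | none => rfl
        | some u => simp [lstO, setRCore, show u ≠ w by simpa using h1]
      by_cases hv : v = w
      · subst hv
        have e1 : (C.setRCore v o).ch false v = C.ch false v := by simp [setRCore]
        have e2 : (C.setRCore v o).ch true v = o := by simp [setRCore]
        rw [e1, e2, hO _ (hw _ _), hO _ (fun h' => hne v h' rfl)]
        simp [setRCore]
      · have e1 : ∀ e, (C.setRCore w o).ch e v = C.ch e v := by simp [setRCore, hv]
        rw [e1, e1, hO _ (hw _ _), hO _ (hw _ _), ← h.lst_eq v]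
        simp [setRCore, hv]
    · intro v hv
      by_cases hvw : v = w
      · subst hvw
        simp only [setRCore, if_true]
        have h1 : (C.lstO (C.ch false v) ++ [v]).IsChain (fun a b => π b = some a) := by
          rw [hlst] at hchain
          refine List.IsChain.left_of_append (l₂ := C.lstO (C.ch true v)) ?_
          simpa using hchain
        cases o with
        | none => simpa [lstO] using h1
        | some u =>
          have h2 := h.chain u (ho u rfl).1
          have h3 : (C.lstO (C.ch false v) ++ [v] ++ C.lst u).IsChain (fun a b => π b = some a) := by
            refine List.IsChain.append h1 h2 ?_
            intro a ha b hb
            simp only [List.getLast?_append, List.getLast?_singleton, Option.some_or,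
              Option.mem_def, Option.some.injEq] at ha
            subst ha
            rw [h.head u b (ho u rfl).1 hb, (ho u rfl).2]
          simpa [lstO] using h3
      · simp only [setRCore, if_neg hvw]
        rcases (hroot v).1 hv with h1 | h1
        · exact h.chain v h1.1
        · rw [hlst, h1] at hchain
          exact (List.IsChain.right_of_append hchain).tail
    · intro v a hv ha
      by_cases hvw : v = w
      · subst hvw
        simp only [setRCore, if_true] at ha
        have : (C.lst v).head? = some a := by
          rw [hlst]
          cases hl : C.lstO (C.ch false v) <;> simpa [hl] using ha
        exact h.head v a hw this
      · simp only [setRCore, if_neg hvw] at ha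
        rcases (hroot v).1 hv with h1 | h1
        · exact h.head v a h1.1 ha
        · change π a = C.par v
          rw [h.par_ch _ _ _ h1]
          rw [hlst, h1] at hchain
          have h2 := List.IsChain.right_of_append hchain
          simp only [lstO, Option.elim] at h2
          cases hl : C.lst v with
          | nil => simp [hl] at ha
          | cons a' l =>
            rw [hl] at ha h2
            simp only [List.head?_cons, Option.some.injEq] at ha
            subst ha
            exact (List.isChain_cons_cons.1 h2).1
    · intro d v c hc
      simp only [setRCore] at hc ⊢
      split_ifs at hc with h1
      · rw [if_pos hc, h.off_root c (ho c hc).1, h1.1, h.off_root w hw]; ring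
      · rw [if_neg, if_neg, h.off_ch _ _ _ hc]
        · intro h'
          have := h.ch_unique h' hc
          exact h1 ⟨this.2, this.1⟩
        · intro h'
          exact (ho c h').1 _ _ hc
    · intro v hv
      simp only [setRCore]
      rcases (hroot v).1 hv with h1 | h1
      · rw [if_neg h1.2, if_neg (h1.1 _ _), h.off_root v h1.1]
      · rw [if_neg (fun h' => (ho v h').1 _ _ h1), if_pos h1, h.off_ch _ _ _ h1, h.off_root w hw]
    · intro v hv
      have := h.agg v (by simp)
      simpa [AggOK, setRCore, show v ≠ w by simpa using hv] using this
  have h2 := key.pull w (fun d c hc => by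
    have := key.ne_of_ch hc
    simpa using this)
  exact h2.mono (by simp)

end Conf

/-! ## Link-cut forests in memory -/

attribute [simp] Expr.eval Test.Holds Expr.eval_fl Cmd.run_assign Cmd.run_setf Cmd.run_seq
  Cmd.run_ite Cmd.run_skip RState.reg_setF RState.mem_setR RState.fld_setR RState.reg_setR
  RState.fld_setF Cmd.seqs

section
variable {n : ℕ}

/-- The number of a node; `0` is the null pointer. -/
def vid (v : Fin n) : ℤ := (v : ℕ) + 1

def enc (o : Option (Fin n)) : ℤ := o.elim 0 vid

@[simp] theorem vid_inj {v w : Fin n} : vid v = vid w ↔ v = w := by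
  simp only [vid, Fin.ext_iff]; omega

theorem vid_pos (v : Fin n) : 0 < vid v := by simp only [vid]; omega

@[simp] theorem vid_ne_zero (v : Fin n) : vid v ≠ 0 := (vid_pos v).ne'

@[simp] theorem zero_ne_vid (v : Fin n) : 0 ≠ vid v := (vid_pos v).ne

@[simp] theorem enc_none : enc (none : Option (Fin n)) = 0 := rfl

@[simp] theorem enc_some (v : Fin n) : enc (some v) = vid v := rfl

@[simp] theorem enc_eq_zero {o : Option (Fin n)} : enc o = 0 ↔ o = none := by
  cases o <;> simp

@[simp] theorem enc_eq_vid {o : Option (Fin n)} {v : Fin n} : enc o = vid v ↔ o = some v := by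
  cases o <;> simp

theorem enc_nonneg (o : Option (Fin n)) : 0 ≤ enc o := by
  cases o with
  | none => simp
  | some v => exact (vid_pos v).le

/-- The memory holds the link-cut forest `C`. -/
structure MemRep (S : RState) (C : Conf (Fin n)) : Prop where
  ch0 : ∀ v, S.fld 0 (vid v) = enc (C.ch false v)
  ch1 : ∀ v, S.fld 1 (vid v) = enc (C.ch true v)
  par : ∀ v, S.fld 2 (vid v) = enc (C.par v)
  tag : ∀ v, S.fld 3 (vid v) = C.tag v
  sv : ∀ v, S.fld 4 (vid v) = C.sv v
  sm : ∀ v, S.fld 5 (vid v) = C.sm v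
  am : ∀ v, S.fld 6 (vid v) = vid (C.am v)
  hd : ∀ v, S.fld 7 (vid v) = vid (C.hd v)
  null0 : S.fld 0 0 = 0
  null1 : S.fld 1 0 = 0

/-- Only registers from `k` on and the fields of the link-cut forest have changed. -/
structure Frame (k : ℕ) (S S' : RState) : Prop where
  reg : ∀ x, x < k → S'.reg x = S.reg x
  mem : ∀ a, 0 ≤ a → S'.mem a = S.mem a
  fld : ∀ j i, 8 ≤ j → j < 16 → S'.fld j i = S.fld j i

theorem Frame.refl (k : ℕ) (S : RState) : Frame k S S :=
  ⟨fun _ _ => rfl, fun _ _ => rfl, fun _ _ _ _ => rfl⟩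

theorem Frame.trans {k : ℕ} {S S' S'' : RState} (h₁ : Frame k S S') (h₂ : Frame k S' S'') :
    Frame k S S'' :=
  ⟨fun x hx => (h₂.reg x hx).trans (h₁.reg x hx), fun a ha => (h₂.mem a ha).trans (h₁.mem a ha),
    fun j i h h' => (h₂.fld j i h h').trans (h₁.fld j i h h')⟩

theorem Frame.mono {k k' : ℕ} {S S' : RState} (h : Frame k S S') (hk : k' ≤ k) : Frame k' S S' :=
  ⟨fun x hx => h.reg x (hx.trans_le hk), h.mem, h.fld⟩

theorem Frame.setR {k x : ℕ} (S : RState) (v : ℤ) (hx : k ≤ x) : Frame k S (S.setR x v) :=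
  ⟨fun y hy => by rw [RState.reg_setR, if_neg (by omega)], fun _ _ => rfl, fun _ _ _ _ => rfl⟩

theorem Frame.setF {k : ℕ} (S : RState) {j i : ℤ} (v : ℤ) (hj : 0 ≤ j) (hj' : j < 8)
    (hi : 0 ≤ i) : Frame k S (S.setF j i v) :=
  ⟨fun _ _ => rfl, fun a ha => S.mem_setF hj hi ha, fun j' i' h1 h2 => by
    rw [RState.fld_setF _ hj (by omega) (by omega) h2, if_neg (by omega)]⟩

theorem MemRep.setR {S : RState} {C : Conf (Fin n)} (h : MemRep S C) (x : ℕ) (v : ℤ) :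
    MemRep (S.setR x v) C :=
  ⟨h.ch0, h.ch1, h.par, h.tag, h.sv, h.sm, h.am, h.hd, h.null0, h.null1⟩

theorem MemRep.ext_fld {S S' : RState} {C : Conf (Fin n)} (h : MemRep S C)
    (hf : ∀ j i, 0 ≤ j → j < 8 → 0 ≤ i → S'.fld j i = S.fld j i) : MemRep S' C := by
  have hv := fun v : Fin n => (vid_pos v).le
  constructor <;> intros <;> (rw [hf _ _ (by norm_num) (by norm_num) (by first | exact hv _ | norm_num)])
  · exact h.ch0 _
  · exact h.ch1 _
  · exact h.par _
  · exact h.tag _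
  · exact h.sv _
  · exact h.sm _
  · exact h.am _
  · exact h.hd _
  · exact h.null0
  · exact h.null1

open Expr in
/-- Recompute the aggregated data of the node in register `60`. -/
def pullCmd : Cmd := .seqs [
  .assign 61 (fl (lit 4) (reg 60)),
  .assign 62 (reg 60),
  .assign 63 (reg 60),
  .assign 64 (fl (lit 0) (reg 60)),
  .ite (.eq (reg 64) (lit 0)) .skip (.seq (.assign 63 (fl (lit 7) (reg 64)))
    (.ite (.lt (add (fl (lit 5) (reg 64)) (fl (lit 3) (reg 64))) (reg 61))
      (.seq (.assign 62 (fl (lit 6) (reg 64)))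
        (.assign 61 (add (fl (lit 5) (reg 64)) (fl (lit 3) (reg 64))))) .skip)),
  .assign 64 (fl (lit 1) (reg 60)),
  .ite (.eq (reg 64) (lit 0)) .skip
    (.ite (.lt (add (fl (lit 5) (reg 64)) (fl (lit 3) (reg 64))) (reg 61))
      (.seq (.assign 62 (fl (lit 6) (reg 64)))
        (.assign 61 (add (fl (lit 5) (reg 64)) (fl (lit 3) (reg 64))))) .skip),
  .setf (lit 5) (reg 60) (reg 61),
  .setf (lit 6) (reg 60) (reg 62),
  .setf (lit 7) (reg 60) (reg 63)]

theorem pullCmd_spec {S : RState} {C : Conf (Fin n)} {v : Fin n} (h : MemRep S C)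
    (hv : S.reg 60 = vid v) :
    MemRep (pullCmd.run S) (C.pull v) ∧ Frame 60 S (pullCmd.run S) := by
  -- The program computes in registers and writes only at the end; `S₁` is the state before the
  -- three writes, so it still represents `C`.
  have key : ∃ (S₁ : RState) (m : ℤ) (a t : Fin n), MemRep S₁ C ∧ Frame 60 S S₁ ∧
      (m, a) = C.better (C.ch true v) (C.better (C.ch false v) (C.sv v, v)) ∧
      t = (C.ch false v).elim v C.hd ∧
      pullCmd.run S = ((S₁.setF 5 (vid v) m).setF 6 (vid v) (vid a)).setF 7 (vid v) (vid t) := by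
    have hR : ∀ (S : RState) x y, MemRep S C → MemRep (S.setR x y) C := fun S x y h => h.setR x y
    have hF : ∀ (S' : RState) x y, 60 ≤ x → Frame 60 S S' → Frame 60 S (S'.setR x y) :=
      fun S' x y hx h => h.trans (Frame.setR _ _ hx)
    cases h0 : C.ch false v with
    | none =>
      cases h1 : C.ch true v with
      | none =>
        refine ⟨_, C.sv v, v, v, ?_, ?_, by simp [Conf.better], by simp, by
          simp [pullCmd, hv, h.ch0, h.ch1, h.sv, h0, h1]; rfl⟩
        · repeat' apply hR
          exact h
        · repeat' refine hF _ _ _ (by norm_num) ?_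
          exact Frame.refl _ _
      | some r =>
        by_cases hlt : C.sm r + C.tag r < C.sv v
        · refine ⟨_, C.sm r + C.tag r, C.am r, v, ?_, ?_, by simp [Conf.better, hlt], by simp, by
            simp [pullCmd, hv, h.ch0, h.ch1, h.sv, h0, h1, h.sm, h.tag, h.am, hlt]; rfl⟩
          · repeat' apply hR
            exact h
          · repeat' refine hF _ _ _ (by norm_num) ?_
            exact Frame.refl _ _
        · refine ⟨_, C.sv v, v, v, ?_, ?_, by simp [Conf.better, hlt], by simp, by
            simp [pullCmd, hv, h.ch0, h.ch1, h.sv, h0, h1, h.sm, h.tag, hlt]; rfl⟩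
          · repeat' apply hR
            exact h
          · repeat' refine hF _ _ _ (by norm_num) ?_
            exact Frame.refl _ _
    | some l =>
      obtain ⟨m, a, S₁, hS₁, hF₁, h60, h61, h62, h63, hma, hrun⟩ : ∃ (m : ℤ) (a : Fin n) (S₁ : RState),
          MemRep S₁ C ∧ Frame 60 S S₁ ∧ S₁.reg 60 = vid v ∧ S₁.reg 61 = m ∧ S₁.reg 62 = vid a ∧
          S₁.reg 63 = vid (C.hd l) ∧
          (m, a) = C.better (some l) (C.sv v, v) ∧ pullCmd.run S = Cmd.run (.seqs [
            .assign 64 (.fl (.lit 1) (.reg 60)),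
            .ite (.eq (.reg 64) (.lit 0)) .skip
              (.ite (.lt (.add (.fl (.lit 5) (.reg 64)) (.fl (.lit 3) (.reg 64))) (.reg 61))
                (.seq (.assign 62 (.fl (.lit 6) (.reg 64)))
                  (.assign 61 (.add (.fl (.lit 5) (.reg 64)) (.fl (.lit 3) (.reg 64))))) .skip),
            .setf (.lit 5) (.reg 60) (.reg 61),
            .setf (.lit 6) (.reg 60) (.reg 62),
            .setf (.lit 7) (.reg 60) (.reg 63)]) S₁ := by
        by_cases hlt : C.sm l + C.tag l < C.sv v
        · refine ⟨C.sm l + C.tag l, C.am l, ?_⟩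
          let S₁ := ((((((S.setR 61 (C.sv v)).setR 62 (vid v)).setR 63 (vid v)).setR 64 (vid l)).setR
            63 (vid (C.hd l))).setR 62 (vid (C.am l))).setR 61 (C.sm l + C.tag l)
          refine ⟨S₁, ?_, ?_, by simp [S₁, hv], by simp [S₁], by simp [S₁], by simp [S₁],
            by simp [Conf.better, hlt], ?_⟩
          · repeat' apply hR
            exact h
          · repeat' refine hF _ _ _ (by norm_num) ?_
            exact Frame.refl _ _
          · simp [S₁, pullCmd, hv, h.ch0, h.sv, h0, h.sm, h.tag, h.am, h.hd, hlt]
        · refine ⟨C.sv v, v, ?_⟩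
          let S₁ := (((((S.setR 61 (C.sv v)).setR 62 (vid v)).setR 63 (vid v)).setR 64 (vid l)).setR
            63 (vid (C.hd l)))
          refine ⟨S₁, ?_, ?_, by simp [S₁, hv], by simp [S₁], by simp [S₁], by simp [S₁],
            by simp [Conf.better, hlt], ?_⟩
          · repeat' apply hR
            exact h
          · repeat' refine hF _ _ _ (by norm_num) ?_
            exact Frame.refl _ _
          · simp [S₁, pullCmd, hv, h.ch0, h.sv, h0, h.sm, h.tag, h.hd, hlt]
      rw [hrun, ← hma]
      have hF' : ∀ (S' : RState) x y, 60 ≤ x → Frame 60 S S' → Frame 60 S (S'.setR x y) :=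
        fun S' x y hx h => h.trans (Frame.setR _ _ hx)
      cases h1 : C.ch true v with
      | none =>
        refine ⟨_, m, a, C.hd l, ?_, ?_, by simp [Conf.better], by simp, by
          simp [h60, h61, h62, h63, hS₁.ch1, h1]; rfl⟩
        · repeat' apply hR
          exact hS₁
        · repeat' refine hF _ _ _ (by norm_num) ?_
          exact hF₁
      | some r =>
        by_cases hlt : C.sm r + C.tag r < m
        · refine ⟨_, C.sm r + C.tag r, C.am r, C.hd l, ?_, ?_, by simp [Conf.better, hlt], by simp, by
            simp [h60, h61, h63, hS₁.ch1, h1, hS₁.sm, hS₁.tag, hS₁.am, hlt]; rfl⟩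
          · repeat' apply hR
            exact hS₁
          · repeat' refine hF _ _ _ (by norm_num) ?_
            exact hF₁
        · refine ⟨_, m, a, C.hd l, ?_, ?_, by simp [Conf.better, hlt], by simp, by
            simp [h60, h61, h62, h63, hS₁.ch1, h1, hS₁.sm, hS₁.tag, hlt]; rfl⟩
          · repeat' apply hR
            exact hS₁
          · repeat' refine hF _ _ _ (by norm_num) ?_
            exact hF₁
  obtain ⟨S₁, m, a, t, h1, h2, h3, h4, h5⟩ := key
  rw [h5]
  refine ⟨?_, ?_⟩
  · have hp : C.pull v = { C with
        sm := Function.update C.sm v m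
        am := Function.update C.am v a
        hd := Function.update C.hd v t } := by
      simp only [Conf.pull, ← h3, h4]
    rw [hp]
    constructor <;> intros
    all_goals simp [h1.ch0, h1.ch1, h1.par, h1.tag, h1.sv, h1.sm, h1.am, h1.hd, h1.null0, h1.null1,
      Function.update_apply]
    all_goals split_ifs <;> rfl
  · have := (vid_pos v).le
    exact ((h2.trans (Frame.setF _ _ (by norm_num) (by norm_num) this)).trans
      (Frame.setF _ _ (by norm_num) (by norm_num) this)).trans
      (Frame.setF _ _ (by norm_num) (by norm_num) this)
end

/-! ### Programs for rotations and for exchanging the lower part of a path -/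

section
variable {n : ℕ} {π : Fin n → Option (Fin n)} {val : Fin n → ℤ} {A : Set (Fin n)}

open Expr in
-- Register `52` holds the side of the rotated node. If the middle subtree is missing, the writes to
-- it go to fields `2` and `3` of the null item, about which nothing is assumed; its child fields
-- stay zero.
def rotCoreCmd : Cmd := .seqs [
  .assign 51 (fl (lit 2) (reg 50)),
  .ite (.eq (fl (lit 0) (reg 51)) (reg 50)) (.assign 52 (lit 0)) (.assign 52 (lit 1)),
  .assign 53 (fl (lit 2) (reg 51)),
  .assign 54 (fl (sub (lit 1) (reg 52)) (reg 50)),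
  .assign 55 (fl (lit 3) (reg 50)),
  .setf (lit 3) (reg 50) (add (reg 55) (fl (lit 3) (reg 51))),
  .setf (lit 3) (reg 51) (sub (lit 0) (reg 55)),
  .setf (lit 3) (reg 54) (add (fl (lit 3) (reg 54)) (reg 55)),
  .setf (reg 52) (reg 51) (reg 54),
  .setf (sub (lit 1) (reg 52)) (reg 50) (reg 51),
  .setf (lit 2) (reg 54) (reg 51),
  .setf (lit 2) (reg 51) (reg 50),
  .setf (lit 2) (reg 50) (reg 53),
  .ite (.eq (fl (lit 0) (reg 53)) (reg 51)) (.setf (lit 0) (reg 53) (reg 50))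
    (.ite (.eq (fl (lit 1) (reg 53)) (reg 51)) (.setf (lit 1) (reg 53) (reg 50)) .skip)]

/-- Rotate the node in register `50` up. -/
def rotCmd : Cmd :=
  .seqs [rotCoreCmd, .assign 60 (.reg 51), pullCmd, .assign 60 (.reg 50), pullCmd]

/-- The state after the pointer changes of a rotation, but for the pointer from above. -/
noncomputable def rotState (S : RState) (C : Conf (Fin n)) (d : Bool) (x y : Fin n) : RState :=
  let S₁ := ((((S.setR 51 (vid y)).setR 52 (cond d 1 0)).setR 53 (enc (C.par y))).setR 54
    (enc (C.ch (!d) x))).setR 55 (C.tag x)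
  let S₂ := (S₁.setF 3 (vid x) (C.tag x + C.tag y)).setF 3 (vid y) (- C.tag x)
  let S₃ := S₂.setF 3 (enc (C.ch (!d) x)) (S₂.fld 3 (enc (C.ch (!d) x)) + C.tag x)
  let S₄ := (S₃.setF (cond d 1 0) (vid y) (enc (C.ch (!d) x))).setF (cond d 0 1) (vid x) (vid y)
  ((S₄.setF 2 (enc (C.ch (!d) x)) (vid y)).setF 2 (vid y) (vid x)).setF 2 (vid x) (enc (C.par y))

theorem rotCoreCmd_spec {S : RState} {C : Conf (Fin n)} {d : Bool} {x y : Fin n} (h : MemRep S C)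
    (hI : Conf.InvX π val C A) (hx : C.ch d y = some x) (h50 : S.reg 50 = vid x) :
    MemRep (rotCoreCmd.run S) (C.rotCore d x y) ∧ Frame 50 S (rotCoreCmd.run S) ∧
      (rotCoreCmd.run S).reg 50 = vid x ∧ (rotCoreCmd.run S).reg 51 = vid y := by
  have hxy := hI.ne_of_ch hx
  have hpx := hI.par_ch _ _ _ hx
  have hsx := hI.s_lt_of_par hpx
  have hb : ∀ b, C.ch (!d) x = some b → b ≠ x ∧ b ≠ y := by
    intro b hb
    have := hI.s_lt_of_par (hI.par_ch _ _ _ hb)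
    refine ⟨hI.ne_of_ch hb, ?_⟩
    rintro rfl; linarith
  have hz : ∀ z, C.par y = some z → z ≠ x ∧ z ≠ y := by
    intro z hz
    have := hI.s_lt_of_par hz
    exact ⟨by rintro rfl; linarith, by rintro rfl; linarith⟩
  let S₅ := rotState S C d x y
  have hFb : ∀ (S : RState) v, Frame 50 S (S.setF 3 (enc (C.ch (!d) x)) v) ∧
      Frame 50 S (S.setF 2 (enc (C.ch (!d) x)) v) := fun S v =>
    ⟨Frame.setF _ _ (by norm_num) (by norm_num) (enc_nonneg _),
      Frame.setF _ _ (by norm_num) (by norm_num) (enc_nonneg _)⟩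
  have hF₅ : Frame 50 S S₅ := by
    have hR : ∀ (S' : RState) x y, 50 ≤ x → Frame 50 S S' → Frame 50 S (S'.setR x y) :=
      fun S' x y hx h => h.trans (Frame.setR _ _ hx)
    have hF : ∀ (S' : RState) j i v, 0 ≤ j ∧ j < 8 → 0 ≤ i → Frame 50 S S' →
        Frame 50 S (S'.setF j i v) :=
      fun S' j i v hj hi h => h.trans (Frame.setF _ _ hj.1 hj.2 hi)
    have hxp := (vid_pos x).le
    have hyp := (vid_pos y).le
    have hbp := enc_nonneg (C.ch (!d) x)
    simp only [S₅, rotState]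
    repeat' refine hF _ _ _ _ (by cases d <;> norm_num) (by assumption) ?_
    repeat' refine hR _ _ _ (by norm_num) ?_
    exact Frame.refl _ _
  have hr50 : S₅.reg 50 = vid x := by simp [S₅, rotState, h50]
  have hr51 : S₅.reg 51 = vid y := by simp [S₅, rotState]
  have hr53 : S₅.reg 53 = enc (C.par y) := by simp [S₅, rotState]
  have hrun : rotCoreCmd.run S = Cmd.run (.ite (.eq (.fl (.lit 0) (.reg 53)) (.reg 51))
      (.setf (.lit 0) (.reg 53) (.reg 50))
      (.ite (.eq (.fl (.lit 1) (.reg 53)) (.reg 51)) (.setf (.lit 1) (.reg 53) (.reg 50)) .skip))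
      S₅ := by
    rw [rotCoreCmd]
    simp only [Cmd.seqs]
    simp only [Cmd.run_seq]
    congr 1
    cases d with
    | false =>
      simp [S₅, rotState, h50, h.par, hpx, h.ch0, hx, h.ch1, h.tag]
    | true =>
      have h0 : C.ch false y ≠ some x := fun h' => hI.ch_ne _ _ h' hx
      simp [S₅, rotState, h50, h.par, hpx, h.ch0, h.tag, h0]
  have fO : ∀ j i, 4 ≤ j → j < 8 → S₅.fld j i = S.fld j i := by
    intro j i h1 h2
    have a1 : (0 : ℤ) ≤ j := by omega
    have a2 : j < 16 := by omega
    have a3 : j ≠ 3 := by omega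
    have a4 : j ≠ 2 := by omega
    have a5 : j ≠ 1 := by omega
    have a6 : j ≠ 0 := by omega
    cases d <;> simp [S₅, rotState, a1, a2, a3, a4, a5, a6]
  have f3 : ∀ v, S₅.fld 3 (vid v) = (C.rotCore d x y).tag v := by
    intro v
    simp only [Conf.rotCore]
    cases hbb : C.ch (!d) x with
    | none =>
      cases d <;> simp only [Bool.not_false, Bool.not_true] at hbb <;>
        simp [S₅, rotState, h.tag, hbb] <;> grind
    | some b =>
      have := hb b hbb
      cases d <;> simp only [Bool.not_false, Bool.not_true] at hbb <;>
        simp [S₅, rotState, h.tag, hbb] <;> grind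
  have f2 : ∀ v, S₅.fld 2 (vid v) = enc ((C.rotCore d x y).par v) := by
    intro v
    simp only [Conf.rotCore]
    cases hbb : C.ch (!d) x with
    | none =>
      cases d <;> simp only [Bool.not_false, Bool.not_true] at hbb <;>
        simp [S₅, rotState, h.par, hbb] <;> grind [enc_some, enc_none]
    | some b =>
      have := hb b hbb
      cases d <;> simp only [Bool.not_false, Bool.not_true] at hbb <;>
        simp [S₅, rotState, h.par, hbb] <;> grind [enc_some, enc_none]
  have f0 : ∀ v, S₅.fld 0 (vid v) = enc (if v = x ∧ false = !d then some y else
      if v = y ∧ false = d then C.ch (!d) x else C.ch false v) := by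
    intro v
    cases d <;> (simp [S₅, rotState, h.ch0]; grind [enc_some, enc_none])
  have f1 : ∀ v, S₅.fld 1 (vid v) = enc (if v = x ∧ true = !d then some y else
      if v = y ∧ true = d then C.ch (!d) x else C.ch true v) := by
    intro v
    cases d <;> (simp [S₅, rotState, h.ch1]; grind [enc_some, enc_none])
  have n0 : S₅.fld 0 0 = 0 := by
    cases d <;> simp [S₅, rotState, h.null0]
  have n1 : S₅.fld 1 0 = 0 := by
    cases d <;> simp [S₅, rotState, h.null1]
  have fin : ∀ (S₆ : RState), (∀ j i, 2 ≤ j → j < 8 → S₆.fld j i = S₅.fld j i) →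
      (∀ v, S₆.fld 0 (vid v) = enc ((C.rotCore d x y).ch false v)) →
      (∀ v, S₆.fld 1 (vid v) = enc ((C.rotCore d x y).ch true v)) →
      S₆.fld 0 0 = 0 → S₆.fld 1 0 = 0 → MemRep S₆ (C.rotCore d x y) := by
    intro S₆ g1 g2 g3 g4 g5
    refine ⟨g2, g3, ?_, ?_, ?_, ?_, ?_, ?_, g4, g5⟩ <;> intro v <;>
      rw [g1 _ _ (by norm_num) (by norm_num)]
    · exact f2 v
    · exact f3 v
    all_goals rw [fO _ _ (by norm_num) (by norm_num)]
    · exact h.sv v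
    · exact h.sm v
    · exact h.am v
    · exact h.hd v
  rw [hrun]
  -- The last write redirects the child pointer to `y`, if there is one: `y` may have no parent, be
  -- a left or a right child, or hang on a dashed edge.
  cases hp : C.par y with
  | none =>
    have hny : ∀ e v, C.ch e v ≠ some y := by
      intro e v h'
      have := hI.par_ch _ _ _ h'
      simp [hp] at this
    have e1 : Cmd.run (.ite (.eq (.fl (.lit 0) (.reg 53)) (.reg 51))
      (.setf (.lit 0) (.reg 53) (.reg 50))
      (.ite (.eq (.fl (.lit 1) (.reg 53)) (.reg 51)) (.setf (.lit 1) (.reg 53) (.reg 50)) .skip))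
      S₅ = S₅ := by
      simp [hr53, hp, hr51, n0, n1]
    rw [e1]
    refine ⟨fin S₅ (fun _ _ _ _ => rfl) ?_ ?_ n0 n1, hF₅, hr50, hr51⟩
    · intro v; rw [f0]; simp [Conf.rotCore, hny]
    · intro v; rw [f1]; simp [Conf.rotCore, hny]
  | some z =>
    obtain ⟨hzx, hzy⟩ := hz z hp
    have hzv : ∀ e v, C.ch e v = some y → v = z := by
      intro e v h'
      have := hI.par_ch _ _ _ h'
      rw [hp] at this
      simpa using this.symm
    have g0 : S₅.fld 0 (vid z) = enc (C.ch false z) := by rw [f0]; simp [hzx, hzy]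
    have g1 : S₅.fld 1 (vid z) = enc (C.ch true z) := by rw [f1]; simp [hzx, hzy]
    by_cases hc0 : C.ch false z = some y
    · have hc1 : ∀ v, C.ch true v ≠ some y := by
        intro v h'
        have := hzv _ _ h'
        subst this
        exact hI.ch_ne _ _ hc0 h'
      have e1 : Cmd.run (.ite (.eq (.fl (.lit 0) (.reg 53)) (.reg 51))
        (.setf (.lit 0) (.reg 53) (.reg 50))
        (.ite (.eq (.fl (.lit 1) (.reg 53)) (.reg 51)) (.setf (.lit 1) (.reg 53) (.reg 50)) .skip))
        S₅ = S₅.setF 0 (vid z) (vid x) := by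
        simp [hr53, hp, hr51, g0, hc0, hr50]
      rw [e1]
      refine ⟨fin _ ?_ ?_ ?_ ?_ ?_, hF₅.trans (Frame.setF _ _ (by norm_num) (by norm_num)
        (vid_pos z).le), by simpa using hr50, by simpa using hr51⟩
      · intro j i h1 h2
        rw [RState.fld_setF _ (by omega) (by omega) (by omega) (by omega), if_neg (by omega)]
      · intro v
        by_cases hvz : v = z
        · subst hvz; simp [Conf.rotCore, hzx, hzy, hc0]
        · have : C.ch false v ≠ some y := fun h' => hvz (hzv _ _ h')
          simp [f0, hvz, Conf.rotCore, this]
      · intro v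
        simp [f1, Conf.rotCore, hc1]
      · simp [n0]
      · simp [n1]
    · have hc0' : ∀ v, C.ch false v ≠ some y := by
        intro v h'
        exact hc0 (hzv _ _ h' ▸ h')
      by_cases hc1 : C.ch true z = some y
      · have e1 : Cmd.run (.ite (.eq (.fl (.lit 0) (.reg 53)) (.reg 51))
          (.setf (.lit 0) (.reg 53) (.reg 50))
          (.ite (.eq (.fl (.lit 1) (.reg 53)) (.reg 51)) (.setf (.lit 1) (.reg 53) (.reg 50)) .skip))
          S₅ = S₅.setF 1 (vid z) (vid x) := by
          simp [hr53, hp, hr51, g0, hc0, hr50, g1, hc1]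
        rw [e1]
        refine ⟨fin _ ?_ ?_ ?_ ?_ ?_, hF₅.trans (Frame.setF _ _ (by norm_num) (by norm_num)
          (vid_pos z).le), by simpa using hr50, by simpa using hr51⟩
        · intro j i h1 h2
          rw [RState.fld_setF _ (by omega) (by omega) (by omega) (by omega), if_neg (by omega)]
        · intro v
          simp [f0, Conf.rotCore, hc0']
        · intro v
          by_cases hvz : v = z
          · subst hvz; simp [Conf.rotCore, hzx, hzy, hc1]
          · have : C.ch true v ≠ some y := fun h' => hvz (hzv _ _ h')
            simp [f1, hvz, Conf.rotCore, this]
        · simp [n0]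
        · simp [n1]
      · have hc1' : ∀ v, C.ch true v ≠ some y := by
          intro v h'
          exact hc1 (hzv _ _ h' ▸ h')
        have e1 : Cmd.run (.ite (.eq (.fl (.lit 0) (.reg 53)) (.reg 51))
          (.setf (.lit 0) (.reg 53) (.reg 50))
          (.ite (.eq (.fl (.lit 1) (.reg 53)) (.reg 51)) (.setf (.lit 1) (.reg 53) (.reg 50)) .skip))
          S₅ = S₅ := by
          simp [hr53, hp, hr51, g0, hc0, g1, hc1]
        rw [e1]
        refine ⟨fin S₅ (fun _ _ _ _ => rfl) ?_ ?_ n0 n1, hF₅, hr50, hr51⟩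
        · intro v; rw [f0]; simp [Conf.rotCore, hc0']
        · intro v; rw [f1]; simp [Conf.rotCore, hc1']

theorem rotCmd_spec {S : RState} {C : Conf (Fin n)} {d : Bool} {x y : Fin n} (h : MemRep S C)
    (hI : Conf.InvX π val C A) (hx : C.ch d y = some x) (h50 : S.reg 50 = vid x) :
    MemRep (rotCmd.run S) (C.rot d x y) ∧ Frame 50 S (rotCmd.run S) := by
  obtain ⟨h1, h2, h3, h4⟩ := rotCoreCmd_spec h hI hx h50
  have k1 := pullCmd_spec (v := y) (h1.setR 60 (vid y)) (by simp)
  have hr : (pullCmd.run ((rotCoreCmd.run S).setR 60 (vid y))).reg 50 = vid x := by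
    rw [k1.2.reg 50 (by norm_num)]; simpa using h3
  have k2 := pullCmd_spec (v := x) (k1.1.setR 60 (vid x)) (by simp)
  have e : rotCmd.run S
      = pullCmd.run ((pullCmd.run ((rotCoreCmd.run S).setR 60 (vid y))).setR 60 (vid x)) := by
    simp [rotCmd, h4, hr]
  rw [e]
  refine ⟨k2.1, h2.trans ?_⟩
  exact (((Frame.setR _ _ (by norm_num)).trans (k1.2.mono (by norm_num))).trans
    (Frame.setR _ _ (by norm_num))).trans (k2.2.mono (by norm_num))

open Expr in
/-- Replace the lower part of the path with binary root in register `46` by the binary tree with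
root in register `47`. -/
def setRCmd : Cmd := .seqs [
  .assign 48 (fl (lit 1) (reg 46)),
  .setf (lit 3) (reg 48) (add (fl (lit 3) (reg 48)) (fl (lit 3) (reg 46))),
  .setf (lit 3) (reg 47) (sub (fl (lit 3) (reg 47)) (fl (lit 3) (reg 46))),
  .setf (lit 1) (reg 46) (reg 47),
  .assign 60 (reg 46),
  pullCmd]

theorem setRCmd_spec {S : RState} {C : Conf (Fin n)} {w : Fin n} {o : Option (Fin n)}
    (h : MemRep S C) (hI : Conf.InvX π val C A) (ho : ∀ v, o = some v → C.Root v ∧ v ≠ w)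
    (h46 : S.reg 46 = vid w) (h47 : S.reg 47 = enc o) :
    MemRep (setRCmd.run S) (C.setR w o) ∧ Frame 46 S (setRCmd.run S) := by
  have hc : ∀ c, C.ch true w = some c → c ≠ w ∧ o ≠ some c := by
    intro c hc
    exact ⟨hI.ne_of_ch hc, fun h' => (ho c h').1 _ _ hc⟩
  let S₁ := S.setR 48 (enc (C.ch true w))
  let S₂ := S₁.setF 3 (enc (C.ch true w)) (S₁.fld 3 (enc (C.ch true w)) + C.tag w)
  let S₃ := S₂.setF 3 (enc o) (S₂.fld 3 (enc o) - C.tag w)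
  let S₄ := (S₃.setF 1 (vid w) (enc o)).setR 60 (vid w)
  have t2 : S₂.fld 3 (vid w) = C.tag w := by
    cases hcc : C.ch true w with
    | none => simp [S₂, S₁, hcc, h.tag]
    | some c => simp [S₂, S₁, hcc, h.tag, (hc c hcc).1.symm]
  have e : setRCmd.run S = pullCmd.run S₄ := by
    have t2' : ∀ c, C.ch true w = some c → w ≠ c := fun c h' => (hc c h').1.symm
    cases hcc : C.ch true w with
    | none =>
      simp [S₄, S₃, S₂, S₁, setRCmd, h46, h.ch1, h47, h.tag, hcc]
    | some c =>
      simp [S₄, S₃, S₂, S₁, setRCmd, h46, h.ch1, h47, h.tag, hcc, t2' c hcc]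
  have hrep : MemRep S₄ (C.setRCore w o) := by
    constructor
    · intro v; simp [S₄, S₃, S₂, S₁, h.ch0, Conf.setRCore]
    · intro v
      simp [S₄, S₃, S₂, S₁, h.ch1, Conf.setRCore]; split_ifs <;> rfl
    · intro v; simp [S₄, S₃, S₂, S₁, h.par, Conf.setRCore]
    · intro v
      simp only [Conf.setRCore]
      cases hcc : C.ch true w with
      | none =>
        cases o with
        | none => simp [S₄, S₃, S₂, S₁, h.tag, hcc]
        | some u =>
          simp [S₄, S₃, S₂, S₁, h.tag, hcc]; grind
      | some c =>
        have h1 := hc c hcc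
        cases o with
        | none =>
          simp [S₄, S₃, S₂, S₁, h.tag, hcc]; grind
        | some u =>
          have h2 := ho u rfl
          simp [S₄, S₃, S₂, S₁, h.tag, hcc]; grind
    · intro v; simp [S₄, S₃, S₂, S₁, h.sv, Conf.setRCore]
    · intro v; simp [S₄, S₃, S₂, S₁, h.sm, Conf.setRCore]
    · intro v; simp [S₄, S₃, S₂, S₁, h.am, Conf.setRCore]
    · intro v; simp [S₄, S₃, S₂, S₁, h.hd, Conf.setRCore]
    · simp [S₄, S₃, S₂, S₁, h.null0]
    · simp [S₄, S₃, S₂, S₁, h.null1]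
  have k := pullCmd_spec (v := w) hrep (by simp [S₄])
  rw [e]
  refine ⟨k.1, ?_⟩
  have f1 : Frame 46 S S₂ := (Frame.setR S _ (by norm_num)).trans
    (Frame.setF _ _ (by norm_num) (by norm_num) (enc_nonneg _))
  have f2 : Frame 46 S S₃ := f1.trans (Frame.setF _ _ (by norm_num) (by norm_num) (enc_nonneg _))
  have f3 : Frame 46 S (S₃.setF 1 (vid w) (enc o)) :=
    f2.trans (Frame.setF _ _ (by norm_num) (by norm_num) (vid_pos w).le)
  exact (f3.trans (Frame.setR _ _ (by norm_num))).trans (k.2.mono (by norm_num))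
end

/-! ### The splay program and its amortized time -/

section
variable {n : ℕ} {π : Fin n → Option (Fin n)} {val : Fin n → ℤ} {C : Conf (Fin n)} {S : RState}

open Expr in
/-- The node in register `x` is not the root of a binary tree. -/
def solidTest (x : ℕ) : Test :=
  .neg (.and (.neg (.eq (fl (lit 0) (fl (lit 2) (reg x))) (reg x)))
    (.neg (.eq (fl (lit 1) (fl (lit 2) (reg x))) (reg x))))

/-- The null item has null children, so the test gives the right answer also when `v` has no parent.
-/
theorem solidTest_iff {A : Set (Fin n)} (h : MemRep S C) (hI : Conf.InvX π val C A) {x : ℕ}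
    {v : Fin n} (hx : S.reg x = vid v) : (solidTest x).Holds S ↔ ¬ C.Root v := by
  cases hp : C.par v with
  | none =>
    have hr : C.Root v := fun d y h' => by
      have := hI.par_ch _ _ _ h'
      simp [hp] at this
    simp [solidTest, hx, h.par, hp, h.null0, h.null1, hr]
  | some y =>
    simp only [solidTest, Test.Holds, Expr.eval_fl, Expr.eval, hx, h.par, hp, enc_some, h.ch0, h.ch1,
      enc_eq_vid, Conf.Root, not_forall, not_not, not_and]
    constructor
    · intro h'
      by_cases h0 : C.ch false y = some v
      · exact ⟨_, _, h0⟩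
      · exact ⟨_, _, h' h0⟩
    · rintro ⟨d, w, hw⟩ h0
      have := hI.par_ch _ _ _ hw
      rw [hp] at this
      obtain rfl : y = w := by simpa using this
      cases d
      · exact absurd hw h0
      · exact hw

open Expr in
def splayBody : Cmd := .seqs [
  .assign 41 (fl (lit 2) (reg 40)),
  .assign 42 (fl (lit 2) (reg 41)),
  .ite (solidTest 41) (.seqs [
    .ite (.eq (fl (lit 0) (reg 41)) (reg 40)) (.assign 43 (lit 0)) (.assign 43 (lit 1)),
    .ite (.eq (fl (lit 0) (reg 42)) (reg 41)) (.assign 44 (lit 0)) (.assign 44 (lit 1)),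
    .ite (.eq (reg 43) (reg 44))
      (.seqs [.assign 50 (reg 41), rotCmd, .assign 50 (reg 40), rotCmd])
      (.seqs [.assign 50 (reg 40), rotCmd, .assign 50 (reg 40), rotCmd])])
    (.seq (.assign 50 (reg 40)) rotCmd)]

/-- Move the node in register `40` to the root of its binary tree. -/
def splayCmd : Cmd := .loop (solidTest 40) splayBody

theorem rotCmd_assign_spec {A : Set (Fin n)} {d : Bool} {x y : Fin n} {k : ℕ} (h : MemRep S C)
    (hI : Conf.InvX π val C A) (hx : C.ch d y = some x) (hk : S.reg k = vid x) :
    MemRep (rotCmd.run (S.setR 50 (S.reg k))) (C.rot d x y) ∧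
      Frame 50 S (rotCmd.run (S.setR 50 (S.reg k))) := by
  have := rotCmd_spec (h.setR 50 (S.reg k)) hI hx (by simp [hk])
  exact ⟨this.1, (Frame.setR _ _ (by norm_num)).trans this.2⟩

/-- A single rotation, which lacks the `-2`, is made only below the binary root and ends the splay.
Its constant cost therefore arises once per splay. -/
theorem splayBody_spec {β : Type*} {cl : Fin n → β} (hcl : ∀ a b, π a = some b → cl a = cl b)
    {x : Fin n} (h : MemRep S C) (hI : Conf.Inv π val C) (h40 : S.reg 40 = vid x)
    (hnr : ¬ C.Root x) :
    ∃ C', MemRep (splayBody.run S) C' ∧ Conf.Inv π val C' ∧ Frame 41 S (splayBody.run S) ∧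
      Conf.Evo cl x C C' ∧ ((C'.Root x ∧ C'.pot ≤ C.pot + (C'.lg x - C.lg x)) ∨
        C'.pot ≤ C.pot + 3 * (C'.lg x - C.lg x) - 2) := by
  simp only [Conf.Root, not_forall, not_not] at hnr
  obtain ⟨d, y, hy⟩ := hnr
  have hpx := hI.par_ch _ _ _ hy
  let S₁ := (S.setR 41 (vid y)).setR 42 (enc (C.par y))
  have hS₁ : MemRep S₁ C := (h.setR _ _).setR _ _
  have hF₁ : Frame 41 S S₁ := (Frame.setR _ _ (by norm_num)).trans (Frame.setR _ _ (by norm_num))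
  have hr40 : S₁.reg 40 = vid x := by simp [S₁, h40]
  have hr41 : S₁.reg 41 = vid y := by simp [S₁]
  have hr42 : S₁.reg 42 = enc (C.par y) := by simp [S₁]
  have hsol := solidTest_iff hS₁ hI hr41
  by_cases hroot : C.Root y
  · have hrun : splayBody.run S = rotCmd.run (S₁.setR 50 (S₁.reg 40)) := by
      have : ¬ (solidTest 41).Holds S₁ := by rw [hsol]; simpa using hroot
      simp only [splayBody, Cmd.seqs, Cmd.run_seq, Cmd.run_assign, Expr.eval_fl, Expr.eval, h40, h.par,
        hpx, enc_some, RState.reg_setR, if_true, RState.fld_setR]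
      rw [show (S.setR 41 (vid y)).setR 42 (enc (C.par y)) = S₁ from rfl, Cmd.run_ite, if_neg this]
      simp
    rw [hrun]
    obtain ⟨h1, h2⟩ := rotCmd_assign_spec hS₁ hI hy hr40
    obtain ⟨h3, h4, h5⟩ := Conf.zig hcl hI hy
    exact ⟨_, h1, h3, hF₁.trans (h2.mono (by norm_num)), h4,
      Or.inl ⟨(Conf.root_rot hI hy).2 (Or.inl ⟨rfl, hroot⟩), h5⟩⟩
  · have hroot' := hroot
    simp only [Conf.Root, not_forall, not_not] at hroot'
    obtain ⟨e, z, hz⟩ := hroot'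
    have hpy := hI.par_ch _ _ _ hz
    let S₂ := (S₁.setR 43 (cond d 1 0)).setR 44 (cond e 1 0)
    have hS₂ : MemRep S₂ C := (hS₁.setR _ _).setR _ _
    have hF₂ : Frame 41 S S₂ := hF₁.trans
      ((Frame.setR _ _ (by norm_num)).trans (Frame.setR _ _ (by norm_num)))
    have h2r40 : S₂.reg 40 = vid x := by simp [S₂, hr40]
    have h2r41 : S₂.reg 41 = vid y := by simp [S₂, hr41]
    have hside : ∀ {d' : Bool} {x' y' : Fin n}, C.ch d' y' = some x' →
        (C.ch false y' = some x' ↔ d' = false) := by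
      intro d' x' y' h'
      cases d'
      · simpa using h'
      · simp only [Bool.true_eq_false, iff_false]
        exact fun h'' => hI.ch_ne _ _ h'' h'
    have hrun : splayBody.run S = Cmd.run (.ite (.eq (.reg 43) (.reg 44))
      (.seqs [.assign 50 (.reg 41), rotCmd, .assign 50 (.reg 40), rotCmd])
      (.seqs [.assign 50 (.reg 40), rotCmd, .assign 50 (.reg 40), rotCmd])) S₂ := by
      have : (solidTest 41).Holds S₁ := by rw [hsol]; exact hroot
      simp only [splayBody, Cmd.seqs, Cmd.run_seq, Cmd.run_assign, Expr.eval_fl, Expr.eval, h40, h.par,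
        hpx, enc_some, RState.reg_setR, if_true, RState.fld_setR]
      rw [show (S.setR 41 (vid y)).setR 42 (enc (C.par y)) = S₁ from rfl, Cmd.run_ite _ _ _ S₁,
        if_pos this]
      simp only [Cmd.run_seq]
      congr 1
      have e1 := hside hy
      have e2 := hside hz
      cases d <;> cases e <;>
        simp [hr41, hr40, hr42, hpy, hS₁.ch0, e1, e2, S₂]
    rw [hrun]
    by_cases hde : e = d
    · subst hde
      have hrun2 : Cmd.run (.ite (.eq (.reg 43) (.reg 44))
        (.seqs [.assign 50 (.reg 41), rotCmd, .assign 50 (.reg 40), rotCmd])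
        (.seqs [.assign 50 (.reg 40), rotCmd, .assign 50 (.reg 40), rotCmd])) S₂
        = rotCmd.run ((rotCmd.run (S₂.setR 50 (S₂.reg 41))).setR 50
            ((rotCmd.run (S₂.setR 50 (S₂.reg 41))).reg 40)) := by
        simp [S₂]
      rw [hrun2]
      obtain ⟨g1, g2, g3, g4, g5⟩ := Conf.zigzig hcl hI hy hz
      obtain ⟨h1, h2⟩ := rotCmd_assign_spec hS₂ hI hz h2r41
      obtain ⟨h3, h4⟩ := rotCmd_assign_spec (k := 40) h1 (Conf.InvX.rot hI hz) g1
        (by rw [h2.reg 40 (by norm_num), h2r40])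
      exact ⟨_, h3, g2, (hF₂.trans (h2.mono (by norm_num))).trans (h4.mono (by norm_num)), g3,
        Or.inr g5⟩
    · have hde' : e = !d := by cases d <;> cases e <;> simp_all
      subst hde'
      have hrun2 : Cmd.run (.ite (.eq (.reg 43) (.reg 44))
        (.seqs [.assign 50 (.reg 41), rotCmd, .assign 50 (.reg 40), rotCmd])
        (.seqs [.assign 50 (.reg 40), rotCmd, .assign 50 (.reg 40), rotCmd])) S₂
        = rotCmd.run ((rotCmd.run (S₂.setR 50 (S₂.reg 40))).setR 50
            ((rotCmd.run (S₂.setR 50 (S₂.reg 40))).reg 40)) := by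
        cases d <;> simp [S₂]
      rw [hrun2]
      obtain ⟨g1, g2, g3, g4, g5⟩ := Conf.zigzag hcl hI hy hz
      obtain ⟨h1, h2⟩ := rotCmd_assign_spec hS₂ hI hy h2r40
      obtain ⟨h3, h4⟩ := rotCmd_assign_spec (k := 40) h1 (Conf.InvX.rot hI hy) g1
        (by rw [h2.reg 40 (by norm_num), h2r40])
      exact ⟨_, h3, g2, (hF₂.trans (h2.mono (by norm_num))).trans (h4.mono (by norm_num)), g3,
        Or.inr g5⟩

theorem splayBody_cost : splayBody.cost ≤ 199 := by decide

theorem splayBody_loopFree : splayBody.loopFree = true := by decide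

open Classical in
theorem splayCmd_spec {β : Type*} {cl : Fin n → β} (hcl : ∀ a b, π a = some b → cl a = cl b)
    {x : Fin n} (h : MemRep S C) (hI : Conf.Inv π val C) (h40 : S.reg 40 = vid x) :
    Wp splayCmd S (fun T S' => ∃ C', MemRep S' C' ∧ Conf.Inv π val C' ∧ Frame 41 S S' ∧
      Conf.Evo cl x C C' ∧ C'.Root x ∧ C'.pot ≤ C.pot + 3 * (C'.lg x - C.lg x) ∧
      T ≤ 200 * (3 * (C'.lg x - C.lg x) - (C'.pot - C.pot) + 1) + 1) := by
  have := Wp.loop (b := solidTest 40) (p := splayBody)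
    (fun (C₁ : Conf (Fin n)) S₁ => MemRep S₁ C₁ ∧ Conf.Inv π val C₁ ∧ Frame 41 S S₁ ∧
      Conf.Evo cl x C C₁ ∧ C₁.pot ≤ C.pot + 3 * (C₁.lg x - C.lg x))
    -- The rank that `x` can still gain, the potential of the forest, and one unit for a final
    -- single rotation. The factor `200` exceeds the cost of the body by the one step of the test.
    (fun C₁ => 200 * (3 * (Real.logb 2 (Fintype.card (Fin n)) - C₁.lg x) + C₁.pot +
      if C₁.Root x then 0 else 1))
    (by
      rintro C₁ S₁ ⟨-, h2, -⟩
      have a1 := h2.lg_le x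
      have a2 := h2.pot_nonneg
      split_ifs <;> linarith)
    (by
      rintro C₁ S₁ ⟨h1, h2, h3, h4, h5⟩ hb
      have hr40 : S₁.reg 40 = vid x := by rw [h3.reg 40 (by norm_num), h40]
      rw [solidTest_iff h1 h2 hr40] at hb
      obtain ⟨C', k1, k2, k3, k4, k5⟩ := splayBody_spec hcl h1 h2 hr40 hb
      have hmono : C₁.lg x ≤ C'.lg x := Conf.lg_mono h2 k4.mono
      refine Wp.of_run splayBody_loopFree (fun T hT => ⟨C', ⟨k1, k2, h3.trans k3, h4.trans k4, ?_⟩, ?_⟩)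
      · rcases k5 with ⟨-, k5⟩ | k5 <;> linarith
      · have hc : (splayBody.cost : ℝ) ≤ 199 := by exact_mod_cast splayBody_cost
        rw [if_neg hb]
        rcases k5 with ⟨k6, k5⟩ | k5
        · rw [if_pos k6]; linarith
        · split_ifs <;> linarith)
    (a := C) (S := S) ⟨h, hI, Frame.refl _ _, Conf.Evo.refl _ _ _, by simp⟩
  refine Wp.mono this ?_
  rintro T S' ⟨C', ⟨h1, h2, h3, h4, h5⟩, hb, hT⟩
  have hr40 : S'.reg 40 = vid x := by rw [h3.reg 40 (by norm_num), h40]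
  rw [solidTest_iff h1 h2 hr40, not_not] at hb
  refine ⟨C', h1, h2, h3, h4, hb, h5, ?_⟩
  rw [if_pos hb] at hT
  split_ifs at hT <;> linarith
end

/-! ### The access program and its amortized time -/

section
variable {n : ℕ} {π : Fin n → Option (Fin n)} {val : Fin n → ℤ} {C : Conf (Fin n)} {S : RState}

/-- Roots of binary trees outside the class of `v` are kept. -/
def Conf.KeepOut {β : Type*} (cl : Fin n → β) (v : Fin n) (C C' : Conf (Fin n)) : Prop :=
  ∀ c, C.Root c → cl c ≠ cl v → C'.Root c ∧ C'.par c = C.par c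

theorem Conf.KeepOut.trans {β : Type*} {cl : Fin n → β} {v : Fin n} {C C' C'' : Conf (Fin n)}
    (h₁ : Conf.KeepOut cl v C C') (h₂ : Conf.KeepOut cl v C' C'') : Conf.KeepOut cl v C C'' := by
  intro c hc hcl
  obtain ⟨a1, a2⟩ := h₁ c hc hcl
  obtain ⟨b1, b2⟩ := h₂ c a1 hcl
  exact ⟨b1, b2.trans a2⟩

theorem Conf.Evo.keepOut {β : Type*} {cl : Fin n → β} {v w : Fin n} {C C' : Conf (Fin n)}
    (h : Conf.Evo cl w C C') (hw : cl w = cl v) : Conf.KeepOut cl v C C' := by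
  intro c hc hcl
  obtain ⟨a1, a2, -⟩ := h.keep c hc (Or.inr (by rw [hw]; exact hcl))
  exact ⟨a1, a2⟩

theorem Conf.keepOut_setR {β : Type*} {cl : Fin n → β} {v w : Fin n} {o : Option (Fin n)}
    {A : Set (Fin n)} (h : Conf.InvX π val C A) (hw : C.Root w)
    (ho : ∀ v, o = some v → C.Root v ∧ C.par v = some w)
    (hocl : ∀ u, o = some u → cl u = cl v) : Conf.KeepOut cl v C (C.setR w o) := by
  intro c hc hcl
  exact ⟨(Conf.root_setR h hw ho).2 (Or.inl ⟨hc, fun h' => hcl (hocl c h')⟩), rfl⟩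

/-- The path of `v` hangs on the topmost path, which has been splayed at `w`: `v` becomes the right
child of `w` and is rotated up. -/
def spliceLast : Cmd := .seqs [.assign 46 (.reg 31), .assign 47 (.reg 30), setRCmd,
  .assign 50 (.reg 30), rotCmd]

/-- Two dashed edges are made solid together, so that `v`, `w` and the next path parent `z` form a
chain of right children. The double rotation at `v` then releases two units of potential. -/
def spliceTwo : Cmd := .seqs [.assign 46 (.reg 31), .assign 47 (.reg 30), setRCmd,
  .assign 46 (.reg 32), .assign 47 (.reg 31), setRCmd, .assign 50 (.reg 31), rotCmd,
  .assign 50 (.reg 30), rotCmd]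

def accessBody : Cmd := .seqs [.assign 31 (.fl (.lit 2) (.reg 30)), .assign 40 (.reg 31), splayCmd,
  .assign 32 (.fl (.lit 2) (.reg 31)),
  .ite (.eq (.reg 32) (.lit 0)) spliceLast (.seqs [.assign 40 (.reg 32), splayCmd, spliceTwo])]

/-- Make the path from the node in register `30` to the root of its tree a solid path. -/
def accessCmd : Cmd := .seqs [.assign 40 (.reg 30), splayCmd, .assign 46 (.reg 30),
  .assign 47 (.lit 0), setRCmd, .loop (.neg (.eq (.fl (.lit 2) (.reg 30)) (.lit 0))) accessBody]

theorem setRCmd_assign_spec {A : Set (Fin n)} {w : Fin n} {o : Option (Fin n)} {e e' : ℤ}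
    (h : MemRep S C) (hI : Conf.InvX π val C A) (ho : ∀ v, o = some v → C.Root v ∧ v ≠ w)
    (h46 : e = vid w) (h47 : e' = enc o) :
    MemRep (setRCmd.run ((S.setR 46 e).setR 47 e')) (C.setR w o) ∧
      Frame 46 S (setRCmd.run ((S.setR 46 e).setR 47 e')) := by
  have := setRCmd_spec (S := (S.setR 46 e).setR 47 e') (w := w) (o := o) ((h.setR _ _).setR _ _) hI ho
    (by simp [h46]) (by simp [h47])
  exact ⟨this.1, ((Frame.setR _ _ (by norm_num)).trans (Frame.setR _ _ (by norm_num))).trans this.2⟩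

theorem spliceLast_spec {β : Type*} {cl : Fin n → β} (hcl : ∀ a b, π a = some b → cl a = cl b)
    {v w : Fin n} (h : MemRep S C) (hI : Conf.Inv π val C) (h30 : S.reg 30 = vid v)
    (h31 : S.reg 31 = vid w) (hv : C.Root v) (hw : C.Root w) (hp : C.par v = some w)
    (hpw : C.par w = none) (hc : C.ch true v = none) :
    ∃ C', MemRep (spliceLast.run S) C' ∧ Conf.Inv π val C' ∧ Frame 40 S (spliceLast.run S) ∧
      C'.Root v ∧ C'.ch true v = none ∧ C'.par v = none ∧ Conf.KeepOut cl v C C' ∧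
      C'.s v = C.s w ∧ C'.pot ≤ C.pot + (C'.lg v - C.lg v) := by
  have hvw : v ≠ w := by
    rintro rfl; simp [hpw] at hp
  have hov : ∀ u, some v = some u → C.Root u ∧ C.par u = some w := by
    rintro u hu; cases hu; exact ⟨hv, hp⟩
  obtain ⟨a1, a2⟩ := setRCmd_assign_spec (w := w) (o := some v) (e := S.reg 31) (e' := S.reg 30) h hI
    (by rintro u hu; cases hu; exact ⟨hv, hvw⟩) h31 h30
  have hI1 := Conf.InvX.setR hI hw hov
  have hch : (C.setR w (some v)).ch true w = some v := by
    change (if w = w ∧ true = true then some v else _) = some v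
    simp
  set S₁ := setRCmd.run ((S.setR 46 (S.reg 31)).setR 47 (S.reg 30)) with hS₁
  have hr30 : S₁.reg 30 = vid v := by rw [a2.reg 30 (by norm_num), h30]
  obtain ⟨b1, b2⟩ := rotCmd_assign_spec a1 hI1 hch hr30
  obtain ⟨z1, z2, z3⟩ := Conf.zig hcl hI1 hch
  have hrun : spliceLast.run S = rotCmd.run (S₁.setR 50 (S₁.reg 30)) := by
    simp [spliceLast, hS₁]
  rw [hrun]
  refine ⟨_, b1, z1, (a2.mono (by norm_num)).trans (b2.mono (by norm_num)), ?_, ?_, ?_, ?_, ?_, z3⟩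
  · exact (Conf.root_rot hI1 hch).2 (Or.inl ⟨rfl, (Conf.root_setR hI hw hov).2
      (Or.inl ⟨hw, by simpa using hvw⟩)⟩)
  · have e : (C.setR w (some v)).ch true v = none := by
      change (if v = w ∧ true = true then some v else C.ch true v) = none
      rw [if_neg (by simp [hvw]), hc]
    rw [Conf.ch_rot, if_neg (by simp), if_neg (by simp [hvw]), if_neg (by simp [e]), e]
  · rw [Conf.par_rot, if_pos rfl]; exact hpw
  · refine (Conf.keepOut_setR hI hw hov ?_).trans (z2.keepOut rfl)
    rintro u hu; cases hu; rfl
  · rw [Conf.s_rot_self]; rfl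

/-- Turning the two dashed edges into solid ones changes no size, so `Conf.zigzig` can be applied
and its bound refers to the potential of the original forest. -/
theorem spliceTwo_spec {β : Type*} {cl : Fin n → β} (hcl : ∀ a b, π a = some b → cl a = cl b)
    {v w z : Fin n} (h : MemRep S C) (hI : Conf.Inv π val C) (h30 : S.reg 30 = vid v)
    (h31 : S.reg 31 = vid w) (h32 : S.reg 32 = vid z) (hv : C.Root v) (hw : C.Root w) (hz : C.Root z)
    (hp : C.par v = some w) (hpw : C.par w = some z) (hc : C.ch true v = none) :
    ∃ C', MemRep (spliceTwo.run S) C' ∧ Conf.Inv π val C' ∧ Frame 40 S (spliceTwo.run S) ∧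
      C'.Root v ∧ C'.ch true v = none ∧ Conf.KeepOut cl v C C' ∧
      C'.s v = C.s z ∧ C'.pot ≤ C.pot + 3 * (C'.lg v - C.lg v) - 2 := by
  have s1 := hI.s_lt_of_par hp
  have s2 := hI.s_lt_of_par hpw
  have hvw : v ≠ w := by rintro rfl; linarith
  have hwz : w ≠ z := by rintro rfl; linarith
  have hvz : v ≠ z := by rintro rfl; linarith
  have hov : ∀ u, some v = some u → C.Root u ∧ C.par u = some w := by
    rintro u hu; cases hu; exact ⟨hv, hp⟩
  obtain ⟨a1, a2⟩ := setRCmd_assign_spec (w := w) (o := some v) (e := S.reg 31) (e' := S.reg 30) h hI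
    (by rintro u hu; cases hu; exact ⟨hv, hvw⟩) h31 h30
  have hI1 := Conf.InvX.setR hI hw hov
  set C₁ := C.setR w (some v) with hC₁
  have hw1 : C₁.Root w := (Conf.root_setR hI hw hov).2 (Or.inl ⟨hw, by simpa using hvw⟩)
  have hz1 : C₁.Root z := (Conf.root_setR hI hw hov).2 (Or.inl ⟨hz, by simpa using hvz⟩)
  have hpw1 : C₁.par w = some z := hpw
  set S₁ := setRCmd.run ((S.setR 46 (S.reg 31)).setR 47 (S.reg 30)) with hS₁
  have how : ∀ u, some w = some u → C₁.Root u ∧ C₁.par u = some z := by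
    rintro u hu; cases hu; exact ⟨hw1, hpw1⟩
  have r1 : ∀ x, x < 46 → S₁.reg x = S.reg x := a2.reg
  obtain ⟨b1, b2⟩ := setRCmd_assign_spec (w := z) (o := some w) (e := S₁.reg 32) (e' := S₁.reg 31) a1
    hI1 (by rintro u hu; cases hu; exact ⟨hw1, hwz⟩) (by rw [r1 _ (by norm_num), h32])
    (by rw [r1 _ (by norm_num), h31]; rfl)
  have hI2 := Conf.InvX.setR hI1 hz1 how
  set C₂ := C₁.setR z (some w) with hC₂
  set S₂ := setRCmd.run ((S₁.setR 46 (S₁.reg 32)).setR 47 (S₁.reg 31)) with hS₂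
  have hz2 : C₂.Root z := (Conf.root_setR hI1 hz1 how).2 (Or.inl ⟨hz1, by simpa using hwz⟩)
  have hch2 : C₂.ch true z = some w := by
    change (if z = z ∧ true = true then some w else _) = some w
    simp
  have hch1 : C₂.ch true w = some v := by
    change (if w = z ∧ true = true then some w else (if w = w ∧ true = true then some v else _))
      = some v
    simp [hwz]
  have hchv : C₂.ch true v = none := by
    change (if v = z ∧ true = true then some w else
      (if v = w ∧ true = true then some v else C.ch true v)) = none
    simp [hvz, hvw, hc]
  have r2 : ∀ x, x < 46 → S₂.reg x = S.reg x := fun x hx => (b2.reg x hx).trans (r1 x hx)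
  obtain ⟨g1, g2, g3, g4, g5⟩ := Conf.zigzig hcl hI2 hch1 hch2
  obtain ⟨c1, c2⟩ := rotCmd_assign_spec (k := 31) b1 hI2 hch2 (by rw [r2 _ (by norm_num), h31])
  have hI3 := Conf.InvX.rot hI2 hch2
  set S₃ := rotCmd.run (S₂.setR 50 (S₂.reg 31)) with hS₃
  have r3 : ∀ x, x < 46 → S₃.reg x = S.reg x :=
    fun x hx => (c2.reg x (by omega)).trans (r2 x hx)
  obtain ⟨d1, d2⟩ := rotCmd_assign_spec (k := 30) c1 hI3 g1 (by rw [r3 _ (by norm_num), h30])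
  have hrun : spliceTwo.run S = rotCmd.run (S₃.setR 50 (S₃.reg 30)) := by
    simp [spliceTwo, hS₁, hS₂, hS₃]
  rw [hrun]
  refine ⟨_, d1, g2, (((a2.mono (by norm_num)).trans (b2.mono (by norm_num))).trans
    (c2.mono (by norm_num))).trans (d2.mono (by norm_num)), ?_, ?_, ?_, g4, g5⟩
  · exact (Conf.root_rot hI3 g1).2 (Or.inl ⟨rfl, (Conf.root_rot hI2 hch2).2 (Or.inl ⟨rfl, hz2⟩)⟩)
  · have e : (C₂.rot true w z).ch true v = none := by
      rw [Conf.ch_rot, if_neg (by simp), if_neg (by simp [hvz]), if_neg (by simp [hchv]), hchv]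
    rw [Conf.ch_rot, if_neg (by simp), if_neg (by simp [hvw]), if_neg (by simp [e]), e]
  · refine ((Conf.keepOut_setR hI hw hov ?_).trans (Conf.keepOut_setR hI1 hz1 how ?_)).trans
      (g3.keepOut rfl)
    · rintro u hu; cases hu; rfl
    · rintro u hu; cases hu; exact (hI.cl_par hcl hp).symm

theorem spliceLast_cost : spliceLast.loopFree = true ∧ spliceLast.cost ≤ 200 := by decide

theorem spliceTwo_cost : spliceTwo.loopFree = true ∧ spliceTwo.cost ≤ 400 := by decide

theorem setRCmd_cost : setRCmd.loopFree = true ∧ setRCmd.cost ≤ 100 := by decide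

/-- The amortized time of an iteration of `accessCmd` per unit of potential. -/
abbrev accessUnit : ℝ := 1000

open Classical in
-- The ranks gained by the splays of `w` and `z` and by the double rotation at `v` all lie between
-- the old rank of `v` and its new rank. The two splays together gain at most this difference, the
-- rotation gains it once more, each with factor three. The `-2`, multiplied by `accessUnit`, covers
-- the constant costs. It is missing only when the round ends with a single rotation, and then `v`
-- has no path parent left.
theorem accessBody_spec {β : Type*} {cl : Fin n → β} (hcl : ∀ a b, π a = some b → cl a = cl b)
    {v w : Fin n} (h : MemRep S C) (hI : Conf.Inv π val C) (h30 : S.reg 30 = vid v) (hv : C.Root v)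
    (hc : C.ch true v = none) (hp : C.par v = some w) :
    Wp accessBody S (fun T S' => ∃ C', MemRep S' C' ∧ Conf.Inv π val C' ∧ Frame 31 S S' ∧
      C'.Root v ∧ C'.ch true v = none ∧ Conf.KeepOut cl v C C' ∧
      C.lg v ≤ C'.lg v ∧ C'.pot ≤ C.pot + 6 * (C'.lg v - C.lg v) ∧
      T + 1 ≤ accessUnit * (6 * (C'.lg v - C.lg v) - (C'.pot - C.pot)
        + (if C'.par v = none then 1 else 0))) := by
  have hclw := hI.cl_par hcl hp
  have s1 := hI.s_lt_of_par hp
  let S₁ := (S.setR 31 (vid w)).setR 40 (vid w)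
  have hS₁ : MemRep S₁ C := (h.setR _ _).setR _ _
  have hF₁ : Frame 31 S S₁ := (Frame.setR _ _ (by norm_num)).trans (Frame.setR _ _ (by norm_num))
  have r1 : S₁.reg 31 = vid w := by simp [S₁]
  have hw1 : (Cmd.assign 40 (.reg 31)).run ((Cmd.assign 31 (.fl (.lit 2) (.reg 30))).run S) = S₁ := by
    simp [S₁, h30, h.par, hp]
  refine Wp.seqs_cons (Wp.assign (Wp.seqs_cons (Wp.assign (Wp.seqs_cons ?_))))
  change Wp splayCmd ((Cmd.assign 40 (.reg 31)).run ((Cmd.assign 31 (.fl (.lit 2) (.reg 30))).run S)) _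
  rw [hw1]
  refine Wp.mono (splayCmd_spec hcl hS₁ hI (x := w) (by simp [S₁])) ?_
  rintro T₁ S₂ ⟨C₁, k1, k2, k3, k4, k5, k6, k7⟩
  -- The splay of `w` does not disturb the path of `v`, since `v` is smaller than `w`.
  obtain ⟨v1, v2, v3, v4⟩ := k4.keep v hv (Or.inl (by linarith))
  have hvw : v ≠ w := by rintro rfl; linarith
  have r2 : S₂.reg 31 = vid w := by rw [k3.reg 31 (by norm_num), r1]
  have hw2 : S₂.reg 30 = vid v := by rw [k3.reg 30 (by norm_num)]; simp [S₁, h30]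
  have l1 : C.lg v ≤ C.lg w := hI.lg_le_of_par hp
  have l2 : C.lg w ≤ C₁.lg w := Conf.lg_mono hI k4.mono
  have l3 : C₁.lg v = C.lg v := by simp only [Conf.lg, v3]
  let S₃ := S₂.setR 32 (enc (C₁.par w))
  have hS₃ : MemRep S₃ C₁ := k1.setR _ _
  have hF₃ : Frame 31 S S₃ := (hF₁.trans (k3.mono (by norm_num))).trans (Frame.setR _ _ (by norm_num))
  refine Wp.seqs_cons (Wp.assign ?_)
  change Wp _ ((Cmd.assign 32 (.fl (.lit 2) (.reg 31))).run S₂) _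
  rw [show (Cmd.assign 32 (.fl (.lit 2) (.reg 31))).run S₂ = S₃ by simp [S₃, r2, k1.par]]
  have r330 : S₃.reg 30 = vid v := by simp [S₃, hw2]
  have r331 : S₃.reg 31 = vid w := by simp [S₃, r2]
  have r332 : S₃.reg 32 = enc (C₁.par w) := by simp [S₃]
  refine Wp.ite (fun hb => ?_) (fun hb => ?_)
  · have hpw : C₁.par w = none := by simpa [r332] using hb
    obtain ⟨C₂, b1, b2, b3, b4, b5, b6, b7, b8, b9⟩ := spliceLast_spec hcl hS₃ k2 r330 r331 v1 k5
      (v2.trans hp) hpw ((v4 true).trans hc)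
    refine Wp.of_run spliceLast_cost.1 (fun T hT => ⟨C₂, b1, b2, hF₃.trans (b3.mono (by norm_num)),
      b4, b5, (k4.keepOut hclw.symm).trans b7, ?_⟩)
    have hcost : (spliceLast.cost : ℝ) ≤ 200 := by exact_mod_cast spliceLast_cost.2
    have l4 : C₂.lg v = C₁.lg w := by simp only [Conf.lg, b8]
    refine ⟨by linarith, by linarith, ?_⟩
    rw [if_pos b6]
    unfold accessUnit
    linarith
  · cases hpw : C₁.par w with
    | none => simp [r332, hpw] at hb
    | some z =>
      have s2 := k2.s_lt_of_par hpw
      have s3 := k2.s_lt_of_par (v2.trans hp)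
      have hclz := k2.cl_par hcl hpw
      let S₄ := S₃.setR 40 (vid z)
      have hS₄ : MemRep S₄ C₁ := hS₃.setR _ _
      have hF₄ : Frame 31 S S₄ := hF₃.trans (Frame.setR _ _ (by norm_num))
      refine Wp.seqs_cons (Wp.assign ?_)
      change Wp _ ((Cmd.assign 40 (.reg 32)).run S₃) _
      rw [show (Cmd.assign 40 (.reg 32)).run S₃ = S₄ by simp [S₄, r332, hpw]]
      refine Wp.seqs_cons (Wp.mono (splayCmd_spec hcl hS₄ k2 (x := z) (by simp [S₄])) ?_)
      rintro T₂ S₅ ⟨C₂, m1, m2, m3, m4, m5, m6, m7⟩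
      obtain ⟨w1, w2, w3, w4⟩ := m4.keep w k5 (Or.inl (by linarith))
      obtain ⟨u1, u2, u3, u4⟩ := m4.keep v v1 (Or.inl (by linarith))
      have q30 : S₅.reg 30 = vid v := by
        rw [m3.reg 30 (by norm_num)]; simp [S₄, r330]
      have q31 : S₅.reg 31 = vid w := by
        rw [m3.reg 31 (by norm_num)]; simp [S₄, r331]
      have q32 : S₅.reg 32 = vid z := by
        rw [m3.reg 32 (by norm_num)]; simp [S₄, r332, hpw]
      obtain ⟨C₃, b1, b2, b3, b4, b5, b7, b8, b9⟩ := spliceTwo_spec hcl m1 m2 q30 q31 q32 u1 w1 m5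
        ((u2.trans v2).trans hp) (w2.trans hpw) ((u4 true).trans ((v4 true).trans hc))
      refine Wp.of_run spliceTwo_cost.1 (fun T hT => ⟨C₃, b1, b2,
        (hF₄.trans (m3.mono (by norm_num))).trans (b3.mono (by norm_num)),
        b4, b5, ((k4.keepOut hclw.symm).trans (m4.keepOut (hclz.symm.trans hclw.symm))).trans b7, ?_⟩)
      have hcost : (spliceTwo.cost : ℝ) ≤ 400 := by exact_mod_cast spliceTwo_cost.2
      replace hT : T ≤ spliceTwo.cost := hT
      have l4 : C₃.lg v = C₂.lg z := by simp only [Conf.lg, b8]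
      have l5 : C₁.lg w ≤ C₁.lg z := k2.lg_le_of_par hpw
      have l6 : C₁.lg z ≤ C₂.lg z := Conf.lg_mono k2 m4.mono
      have l7 : C₂.lg v = C₁.lg v := by simp only [Conf.lg, u3]
      refine ⟨by linarith, by linarith, ?_⟩
      unfold accessUnit
      split_ifs <;> linarith

/-- Amortized time of `accessCmd`. -/
noncomputable def accessTime (n : ℕ) : ℝ := 1000 * (9 * Real.logb 2 n + 3)

open Classical in
-- The first splay gains rank with factor `3` and the rounds with factor `6`, which gives the `9` of
-- `accessTime`. Detaching the path below `v` changes no size.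
theorem accessCmd_spec {β : Type*} {cl : Fin n → β} (hcl : ∀ a b, π a = some b → cl a = cl b)
    {v : Fin n} (h : MemRep S C) (hI : Conf.Inv π val C) (h30 : S.reg 30 = vid v) :
    Wp accessCmd S (fun T S' => ∃ C', MemRep S' C' ∧ Conf.Inv π val C' ∧ Frame 31 S S' ∧
      C'.Root v ∧ C'.ch true v = none ∧ C'.par v = none ∧ Conf.KeepOut cl v C C' ∧
      T ≤ accessTime n - 1000 * (C'.pot - C.pot)) := by
  let S₁ := S.setR 40 (vid v)
  have hS₁ : MemRep S₁ C := h.setR _ _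
  have hF₁ : Frame 31 S S₁ := Frame.setR _ _ (by norm_num)
  refine Wp.seqs_cons (Wp.assign ?_)
  change Wp _ ((Cmd.assign 40 (.reg 30)).run S) _
  rw [show (Cmd.assign 40 (.reg 30)).run S = S₁ by simp [S₁, h30]]
  refine Wp.seqs_cons (Wp.mono (splayCmd_spec hcl hS₁ hI (x := v) (by simp [S₁])) ?_)
  rintro T₁ S₂ ⟨C₁, k1, k2, k3, k4, k5, k6, k7⟩
  have r30 : S₂.reg 30 = vid v := by rw [k3.reg 30 (by norm_num)]; simp [S₁, h30]
  have hno : ∀ u, (none : Option (Fin n)) = some u → C₁.Root u ∧ C₁.par u = some v := by simp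
  obtain ⟨a1, a2⟩ := setRCmd_assign_spec (w := v) (o := none) (e := S₂.reg 30) (e' := 0) k1 k2
    (by simp) r30 (by simp)
  have hI2 := Conf.InvX.setR k2 k5 hno
  set S₃ := setRCmd.run ((S₂.setR 46 (S₂.reg 30)).setR 47 0) with hS₃
  set C₂ := C₁.setR v none with hC₂
  refine Wp.seqs_cons (Wp.assign (Wp.seqs_cons (Wp.assign (Wp.seqs_cons
    (Wp.of_run setRCmd_cost.1 (fun T₂ hT₂ => ?_))))))
  change Wp _ S₃ _
  have r330 : S₃.reg 30 = vid v := by rw [a2.reg 30 (by norm_num), r30]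
  have hF₃ : Frame 31 S S₃ := (hF₁.trans (k3.mono (by norm_num))).trans (a2.mono (by norm_num))
  have hroot2 : C₂.Root v := (Conf.root_setR k2 k5 hno).2 (Or.inl ⟨k5, by simp⟩)
  have hch2 : C₂.ch true v = none := by
    change (if v = v ∧ true = true then none else _) = none
    simp
  have hcost : (setRCmd.cost : ℝ) ≤ 100 := by exact_mod_cast setRCmd_cost.2
  have hpot2 : C₂.pot = C₁.pot := rfl
  have hlg2 : C₂.lg v = C₁.lg v := rfl
  have hkeep2 : Conf.KeepOut cl v C C₂ :=
    (k4.keepOut rfl).trans (Conf.keepOut_setR k2 k5 hno (by simp))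
  have := Wp.loop (b := .neg (.eq (.fl (.lit 2) (.reg 30)) (.lit 0))) (p := accessBody)
    (fun (C' : Conf (Fin n)) S' => MemRep S' C' ∧ Conf.Inv π val C' ∧ Frame 31 S S' ∧
      C'.Root v ∧ C'.ch true v = none ∧ Conf.KeepOut cl v C C')
    -- The last summand is kept for the one round that may end with a single rotation.
    (fun C' => accessUnit * (6 * (Real.logb 2 (Fintype.card (Fin n)) - C'.lg v) + C'.pot +
      if C'.par v = none then 0 else 1))
    (by
      rintro C' S' ⟨-, h2, -⟩
      have a1 := h2.lg_le v
      have a2 := h2.pot_nonneg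
      unfold accessUnit
      split_ifs <;> linarith)
    (by
      rintro C' S' ⟨h1, h2, h3, h4, h5, h6⟩ hb
      have hr30 : S'.reg 30 = vid v := by rw [h3.reg 30 (by norm_num), h30]
      have hb' : C'.par v ≠ none := by
        simpa [hr30, h1.par] using hb
      obtain ⟨w, hw⟩ := Option.ne_none_iff_exists'.1 hb'
      refine Wp.mono (accessBody_spec hcl h1 h2 hr30 h4 h5 hw) ?_
      rintro T S'' ⟨C'', m1, m2, m3, m4, m5, m6, m7, m8, m9⟩
      refine ⟨C'', ⟨m1, m2, h3.trans m3, m4, m5, h6.trans m6⟩, ?_⟩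
      rw [if_neg hb']
      unfold accessUnit at m9 ⊢
      split_ifs at m9 ⊢ <;> linarith)
    (a := C₂) (S := S₃) ⟨a1, hI2, hF₃, hroot2, hch2, hkeep2⟩
  refine Wp.mono this ?_
  rintro T S' ⟨C', ⟨h1, h2, h3, h4, h5, h6⟩, hb, hT⟩
  have hr30 : S'.reg 30 = vid v := by rw [h3.reg 30 (by norm_num), h30]
  have hpar : C'.par v = none := by
    simpa [hr30, h1.par] using hb
  refine ⟨C', h1, h2, h3, h4, h5, hpar, h6, ?_⟩
  rw [if_pos hpar] at hT
  have q1 := hI.lg_nonneg v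
  have q2 := h2.lg_le v
  have q3 : C₁.lg v ≤ Real.logb 2 (Fintype.card (Fin n)) := k2.lg_le v
  have q4 : C.lg v ≤ C₁.lg v := Conf.lg_mono hI k4.mono
  rw [Fintype.card_fin] at hT q2 q3
  have hif : (if C₂.par v = none then (0 : ℝ) else 1) ≤ 1 := by split_ifs <;> norm_num
  unfold accessUnit at hT
  unfold accessTime
  rw [hpot2, hlg2] at hT
  linarith
end

/-! ## Paths in forests -/

namespace Forest

variable {n : ℕ} {π : Forest n}

/-- `l` is the path from `u` to the root of its tree, listed from the root on. -/
def IsPath (π : Forest n) (l : List (Fin n)) (u : Fin n) : Prop :=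
  l.IsChain (fun a b => π b = some a) ∧ l.getLast? = some u ∧ ∀ a, l.head? = some a → π a = none

theorem OnPath.cases_head {u w : Fin n} (h : π.OnPath u w) :
    u = w ∨ ∃ b, π u = some b ∧ π.OnPath b w := by
  rcases Relation.ReflTransGen.cases_head h with h | ⟨b, h1, h2⟩
  · exact Or.inl h
  · exact Or.inr ⟨b, h1, h2⟩

theorem onPath_iff_of_eq_some {u b w : Fin n} (h : π u = some b) :
    π.OnPath u w ↔ u = w ∨ π.OnPath b w := by
  constructor
  · intro h'
    rcases h'.cases_head with h1 | ⟨b', h1, h2⟩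
    · exact Or.inl h1
    · rw [h] at h1
      cases h1
      exact Or.inr h2
  · rintro (rfl | h')
    · exact Relation.ReflTransGen.refl
    · exact Relation.ReflTransGen.head h h'

theorem onPath_iff_of_eq_none {u w : Fin n} (h : π u = none) : π.OnPath u w ↔ u = w := by
  constructor
  · intro h'
    rcases h'.cases_head with h1 | ⟨b', h1, h2⟩
    · exact h1
    · simp [h] at h1
  · rintro rfl
    exact Relation.ReflTransGen.refl

theorem isRootOf_iff_of_eq_some {u b v : Fin n} (h : π u = some b) :
    π.IsRootOf u v ↔ π.IsRootOf b v := by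
  unfold IsRootOf
  rw [onPath_iff_of_eq_some h]
  constructor
  · rintro ⟨rfl | h1, h2⟩
    · simp [h] at h2
    · exact ⟨h1, h2⟩
  · rintro ⟨h1, h2⟩
    exact ⟨Or.inr h1, h2⟩

theorem IsRootOf.unique {u v v' : Fin n} (h : π.IsRootOf u v) (h' : π.IsRootOf u v') : v = v' := by
  obtain ⟨h1, h2⟩ := h
  induction h1 using Relation.ReflTransGen.head_induction_on with
  | refl => exact (onPath_iff_of_eq_none h2).1 h'.1
  | head hab _ ih => exact ih ((isRootOf_iff_of_eq_some hab).1 h')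

theorem isRootOf_self {u : Fin n} (h : π u = none) : π.IsRootOf u u :=
  ⟨Relation.ReflTransGen.refl, h⟩

theorem IsPath.mem_iff {l : List (Fin n)} {u : Fin n} (h : π.IsPath l u) (w : Fin n) :
    w ∈ l ↔ π.OnPath u w := by
  induction l using List.reverseRecOn generalizing u with
  | nil => simp [IsPath] at h
  | append_singleton l a ih =>
    obtain ⟨h1, h2, h3⟩ := h
    have hau : a = u := by simpa using h2
    subst hau
    rcases List.eq_nil_or_concat' l with rfl | ⟨l', b, rfl⟩
    · have : π a = none := h3 a (by simp)
      rw [onPath_iff_of_eq_none this]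
      simp [eq_comm]
    · have hb : π a = some b := by
        have := List.isChain_append.1 h1
        exact this.2.2 b (by simp) a (by simp)
      have hp : π.IsPath (l' ++ [b]) b := by
        refine ⟨h1.left_of_append, by simp, fun x hx => h3 x ?_⟩
        cases l' <;> simpa using hx
      rw [onPath_iff_of_eq_some hb, ← ih hp]
      simp only [List.mem_append, List.mem_singleton]
      tauto

theorem IsPath.isRootOf {v u : Fin n} {l : List (Fin n)} (h : π.IsPath (v :: l) u) :
    π.IsRootOf u v :=
  ⟨(h.mem_iff v).1 (by simp), h.2.2 v (by simp)⟩

theorem IsPath.ne_none {v u w : Fin n} {l : List (Fin n)} (h : π.IsPath (v :: l) u) (hw : w ∈ l) :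
    π w ≠ none := by
  have hc := h.1
  clear h
  induction l generalizing v with
  | nil => simp at hw
  | cons a l ih =>
    have hc' := List.isChain_cons_cons.1 hc
    rcases List.mem_cons.1 hw with rfl | hw
    · simp [hc'.1]
    · exact ih hw hc'.2

/-- Each vertex of the path but the root has exactly one outgoing tree arc. Quantities on arcs can
therefore be stored as values of nodes, the value of the root being meaningless. -/
theorem IsPath.arcOnPath_iff {v u w : Fin n} {l : List (Fin n)} (h : π.IsPath (v :: l) u) :
    (∃ b, π.ArcOnPath u w b) ↔ w ∈ l := by
  unfold ArcOnPath
  rw [exists_and_left, ← h.mem_iff, ← Option.ne_none_iff_exists']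
  constructor
  · rintro ⟨h1, h2⟩
    rcases List.mem_cons.1 h1 with rfl | h1
    · exact absurd h.isRootOf.2 h2
    · exact h1
  · intro h1
    exact ⟨List.mem_cons_of_mem _ h1, h.ne_none h1⟩

end Forest

/-! ## Operations on link-cut forests -/

namespace Conf

variable {V : Type*} [Fintype V] [DecidableEq V]
variable {π : V → Option V} {val : V → ℤ} {C C' : Conf V} {A : Set V}

theorem InvX.mem_lst_trans (h : InvX π val C A) {r y w : V} (hy : y ∈ C.lst r) (hw : w ∈ C.lst y) :
    w ∈ C.lst r := by
  induction hk : (C.lst y).length using Nat.strong_induction_on generalizing y with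
  | _ k ih =>
    have hw' := hw
    rw [h.lst_eq y] at hw'
    have key : ∀ d c, C.ch d y = some c → w ∈ C.lst c → w ∈ C.lst r := fun d c hc hwc =>
      ih _ (hk ▸ h.length_lst_of_ch hc) (h.ch_mem_lst hy hc) hwc rfl
    rcases List.mem_append.1 hw' with h1 | h1
    · cases hc : C.ch false y with
      | none => simp [hc, lstO] at h1
      | some c => exact key _ c hc (by simpa [hc, lstO] using h1)
    · rcases List.mem_cons.1 h1 with rfl | h1
      · exact hy
      · cases hc : C.ch true y with
        | none => simp [hc, lstO] at h1
        | some c => exact key _ c hc (by simpa [hc, lstO] using h1)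

/-- Take a common node of largest size. If it were no root, its unique binary parent would be a
larger common node. -/
theorem InvX.root_unique (h : InvX π val C A) {r r' w : V} (hr : C.Root r) (hr' : C.Root r')
    (hw : w ∈ C.lst r) (hw' : w ∈ C.lst r') : r = r' := by
  obtain ⟨x, hx, hmax⟩ := Finset.exists_max_image
    (Finset.univ.filter (fun x => x ∈ C.lst r ∧ x ∈ C.lst r')) C.s
    ⟨w, by simp [hw, hw']⟩
  simp only [Finset.mem_filter, Finset.mem_univ, true_and] at hx hmax
  by_cases hroot : C.Root x
  · rw [← h.eq_of_root_of_mem hx.1 hroot, ← h.eq_of_root_of_mem hx.2 hroot]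
  · exfalso
    obtain ⟨d, y, hy, hyr⟩ := h.exists_parent hx.1 (by rintro rfl; exact hroot hr)
    obtain ⟨d', y', hy', hyr'⟩ := h.exists_parent hx.2 (by rintro rfl; exact hroot hr')
    obtain ⟨-, rfl⟩ := h.ch_unique hy hy'
    have h1 := hmax y' ⟨hyr, hyr'⟩
    have h2 := h.s_lt_of_par (h.par_ch _ _ _ hy)
    linarith

/-- The binary tree of `v` consists of `v` and the subtree of `c`, so any further node belongs to a
different binary tree. -/
theorem InvX.disjoint_lst (h : InvX π val C A) {v c y w : V} (hv : C.Root v)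
    (hl : C.ch false v = none) (hc : C.ch true v = some c) (hy : y ∉ C.lst c) (hyv : y ≠ v)
    (hw : w ∈ C.lst y) : w ∉ C.lst c := by
  intro hwc
  obtain ⟨r, hr, hyr⟩ := h.exists_root y
  have h1 := h.root_unique hr hv (h.mem_lst_trans hyr hw) (h.mem_lst_of_ch hc hwc)
  subst h1
  rw [h.lst_eq r, hl, hc] at hyr
  simp [lstO, hyv] at hyr
  exact hy hyr

/-- Add `x` to the values in the binary subtree of `c`. -/
def addTag (C : Conf V) (c : V) (x : ℤ) : Conf V :=
  { C with
    tag := Function.update C.tag c (C.tag c + x)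
    off := fun w => if w ∈ C.lst c then C.off w + x else C.off w }

/-- As `v` has no left child, the subtree of `c` is the whole path without its top. A tag at `c`
shifts all values there and leaves the relative data correct; only the aggregated data of `v` have
to be recomputed. -/
theorem InvX.addTag (h : Inv π val C) {v c : V} (hv : C.Root v) (hl : C.ch false v = none)
    (hc : C.ch true v = some c) (x : ℤ) :
    Inv π (fun w => if w ∈ C.lst c then val w + x else val w) ((C.addTag c x).pull v) := by
  have hvc : v ∉ C.lst c := fun h' => h.ne_of_ch hc (h.eq_of_root_of_mem h' hv).symm
  have key : InvX π (fun w => if w ∈ C.lst c then val w + x else val w) (C.addTag c x) {v} := by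
    refine ⟨h.par_ch, h.ch_ne, h.s_pos, h.size, h.lst_eq, h.chain, h.head, ?_, ?_, ?_, ?_⟩
    · intro d y w hw
      change (if w ∈ C.lst c then C.off w + x else C.off w)
        = Function.update C.tag c (C.tag c + x) w + if y ∈ C.lst c then C.off y + x else C.off y
      have h1 := h.off_ch d y w hw
      by_cases hwc : w = c
      · subst hwc
        have hyw : y = v := (h.ch_unique hc hw).2
        rw [if_pos (h.mem_lst_self w), Function.update_self, hyw, if_neg hvc, ← hyw, h1]; ring
      · rw [Function.update_of_ne hwc]
        by_cases hyc : y ∈ C.lst c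
        · rw [if_pos hyc, if_pos (h.ch_mem_lst hyc hw), h1]; ring
        · rw [if_neg hyc, if_neg, h1]
          intro hwc'
          obtain ⟨d', y', h2, h3⟩ := h.exists_parent hwc' hwc
          obtain ⟨-, rfl⟩ := h.ch_unique hw h2
          exact hyc h3
    · intro r hr
      change (if r ∈ C.lst c then C.off r + x else C.off r) = Function.update C.tag c (C.tag c + x) r
      have hrc : r ≠ c := by rintro rfl; exact hr _ _ hc
      rw [Function.update_of_ne hrc, if_neg, h.off_root r hr]
      intro h'
      exact hrc (h.eq_of_root_of_mem h' hr)
    · intro w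
      change (if w ∈ C.lst c then val w + x else val w)
        = C.sv w + if w ∈ C.lst c then C.off w + x else C.off w
      rw [h.val_eq w]
      split_ifs <;> ring
    · intro y hy
      obtain ⟨a1, a2, a3, a4⟩ := h.agg y (by simp)
      refine ⟨a1, a2, ?_, ?_⟩
      · change (if C.am y ∈ C.lst c then val (C.am y) + x else val (C.am y))
          = C.sm y + if y ∈ C.lst c then C.off y + x else C.off y
        by_cases hyc : y ∈ C.lst c
        · rw [if_pos hyc, if_pos (h.mem_lst_trans hyc a2), a3]; ring
        · rw [if_neg hyc, if_neg (h.disjoint_lst hv hl hc hyc hy a2), a3]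
      · intro w hw
        change C.sm y + (if y ∈ C.lst c then C.off y + x else C.off y)
          ≤ if w ∈ C.lst c then val w + x else val w
        have hw' : w ∈ C.lst y := hw
        have := a4 w hw'
        by_cases hyc : y ∈ C.lst c
        · rw [if_pos hyc, if_pos (h.mem_lst_trans hyc hw')]; linarith
        · rw [if_neg hyc, if_neg (h.disjoint_lst hv hl hc hyc hy hw')]; exact this
  exact (key.pull v (fun d c hc => by simpa using h.ne_of_ch hc)).mono (by simp)

/-- Give the value `x` to the root `v` of a binary tree. -/
def setVal (C : Conf V) (v : V) (x : ℤ) : Conf V :=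
  { C with sv := Function.update C.sv v (x - C.tag v) }

/-- A binary root occurs in no aggregate but its own, so one recomputation suffices. -/
theorem InvX.setVal (h : Inv π val C) {v : V} (hv : C.Root v) (x : ℤ) :
    Inv π (Function.update val v x) ((C.setVal v x).pull v) := by
  have key : InvX π (Function.update val v x) (C.setVal v x) {v} := by
    refine ⟨h.par_ch, h.ch_ne, h.s_pos, h.size, h.lst_eq, h.chain, h.head, h.off_ch, h.off_root,
      ?_, ?_⟩
    · intro w
      change Function.update val v x w = Function.update C.sv v (x - C.tag v) w + C.off w
      by_cases hw : w = v
      · subst hw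
        rw [Function.update_self, Function.update_self, h.off_root w hv]; ring
      · rw [Function.update_of_ne hw, Function.update_of_ne hw, h.val_eq w]
    · intro y hy
      obtain ⟨a1, a2, a3, a4⟩ := h.agg y (by simp)
      have hvy : ∀ w ∈ C.lst y, w ≠ v := by
        rintro w hw rfl
        exact hy (h.eq_of_root_of_mem hw hv).symm
      refine ⟨a1, a2, ?_, fun w hw => ?_⟩
      · rw [show (C.setVal v x).am y = C.am y from rfl, Function.update_of_ne (hvy _ a2)]
        exact a3
      · rw [Function.update_of_ne (hvy w hw)]
        exact a4 w hw
  exact (key.pull v (fun d c hc => by simpa using h.ne_of_ch hc)).mono (by simp)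

/-- Make the root `v` of a tree a child of `w`. -/
def linkTo (C : Conf V) (v w : V) : Conf V :=
  { C with
    par := Function.update C.par v (some w)
    s := Function.update C.s w (C.s w + C.s v) }

/-- Without a left child `v` is the top of its path, so a dashed edge from its binary root is the
right place for the new forest edge. Since `w` has no `par`, no size but that of `w` changes. -/
theorem InvX.linkTo (h : Inv π val C) {v w : V} (hv : C.Root v) (hpv : C.par v = none)
    (hw : C.Root w) (hpw : C.par w = none) (hvw : v ≠ w) (hl : C.ch false v = none) (hπ : π v = none) :
    Inv (Function.update π v (some w)) val (C.linkTo v w) := by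
  refine ⟨?_, h.ch_ne, ?_, ?_, h.lst_eq, ?_, ?_, h.off_ch, h.off_root, h.val_eq, ?_⟩
  · intro d y c hc
    change Function.update C.par v (some w) c = some y
    rw [Function.update_of_ne (by rintro rfl; exact hv _ _ hc), h.par_ch _ _ _ hc]
  · intro y
    change 1 ≤ Function.update C.s w (C.s w + C.s v) y
    have h1 := h.s_pos v
    have h2 := h.s_pos y
    by_cases hy : y = w
    · subst hy; rw [Function.update_self]; linarith
    · rw [Function.update_of_ne hy]; exact h2
  · intro y
    change Function.update C.s w (C.s w + C.s v) y = 1 + ∑ c,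
      if Function.update C.par v (some w) c = some y then Function.update C.s w (C.s w + C.s v) c else 0
    rw [Finset.sum_eq_add_of_eq_off_pair (F := fun c => if C.par c = some y then C.s c else 0) hvw]
    · have h1 := h.size y
      rw [Function.update_self, Function.update_of_ne hvw.symm, Function.update_of_ne hvw, hpv, hpw]
      by_cases hy : y = w
      · subst hy
        simp
        linarith
      · rw [Function.update_of_ne hy]
        have : w ≠ y := Ne.symm hy
        simp [this]
        linarith
    · intro c h1 h2
      rw [Function.update_of_ne h1, Function.update_of_ne h2]
  · intro r hr
    refine (h.chain r hr).imp ?_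
    intro a b hab
    rw [Function.update_of_ne, hab]
    rintro rfl
    simp [hπ] at hab
  · intro r a hr ha
    change (C.lst r).head? = some a at ha
    change Function.update π v (some w) a = Function.update C.par v (some w) r
    by_cases hrv : r = v
    · subst hrv
      have : a = r := by
        rw [h.lst_eq r, hl] at ha
        simpa [lstO, eq_comm] using ha
      subst this
      rw [Function.update_self, Function.update_self]
    · have hav : a ≠ v := by
        rintro rfl
        exact hrv (h.eq_of_root_of_mem (List.mem_of_mem_head? ha) hv).symm
      rw [Function.update_of_ne hrv, Function.update_of_ne hav, h.head r a hr ha]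
  · intro y _
    exact h.agg y (by simp)

theorem pot_linkTo_le {v w : V} {π' : V → Option V} (h : Inv π val C)
    (h' : Inv π' val (C.linkTo v w)) :
    (C.linkTo v w).pot ≤ C.pot + Real.logb 2 (Fintype.card V) := by
  have h1 := h'.lg_le w
  have h2 := h.lg_nonneg w
  have : (C.linkTo v w).pot = C.pot + ((C.linkTo v w).lg w - C.lg w) := by
    unfold pot
    rw [← Finset.add_sum_erase _ _ (Finset.mem_univ w),
      ← Finset.add_sum_erase _ (fun v => Real.logb 2 (C.s v)) (Finset.mem_univ w)]
    have : ∑ x ∈ Finset.univ.erase w, Real.logb 2 ((C.linkTo v w).s x)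
        = ∑ x ∈ Finset.univ.erase w, Real.logb 2 (C.s x) := by
      apply Finset.sum_congr rfl
      intro x hx
      have hx' : x ≠ w := Finset.ne_of_mem_erase hx
      simp [linkTo, hx']
    rw [this]
    simp only [lg]
    ring
  linarith

/-- Separate the root `w` of a binary tree from the part `l` of its path above it. -/
def cutOff (C : Conf V) (w l : V) : Conf V :=
  { C with
    ch := fun d v => if v = w ∧ d = false then none else C.ch d v
    par := Function.update C.par l none
    tag := Function.update C.tag l (C.tag l + C.tag w)
    s := Function.update C.s w (C.s w - C.s l)
    lst := Function.update C.lst w (w :: C.lstO (C.ch true w)) }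

theorem root_cutOff (h : InvX π val C A) {w l v : V} (hl : C.ch false w = some l) :
    (C.cutOff w l).Root v ↔ C.Root v ∨ v = l := by
  constructor
  · intro hr
    by_cases hvl : v = l
    · exact Or.inr hvl
    · refine Or.inl fun d y hy => hr d y ?_
      change (if y = w ∧ d = false then none else C.ch d y) = some v
      rw [if_neg, hy]
      rintro ⟨rfl, rfl⟩
      rw [hl] at hy
      exact hvl (by simpa using hy.symm)
  · rintro hr d y hy
    change (if y = w ∧ d = false then none else C.ch d y) = some v at hy
    split_ifs at hy with hc
    rcases hr with hr | rfl
    · exact hr _ _ hy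
    · have := h.ch_unique hl hy
      exact hc ⟨this.2, this.1⟩

/-- The path ends at `w`, so its left subtree is the part above `w` and contains the forest parent.
Dropping the pointer removes exactly this forest edge; the new binary root `l` absorbs the tag of
`w`. -/
theorem InvX.cutOff (h : Inv π val C) {w l : V} (hw : C.Root w) (hpw : C.par w = none)
    (hl : C.ch false w = some l) (hr : C.ch true w = none) :
    Inv (Function.update π w none) val ((C.cutOff w l).pull w) := by
  have hlw := h.ne_of_ch hl
  have hpl := h.par_ch _ _ _ hl
  have hsl := h.s_lt_of_par hpl
  have hmem : ∀ r, w ∈ C.lst r → r = w := fun r h' => (h.eq_of_root_of_mem h' hw).symm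
  have hlstw : (C.cutOff w l).lst w = [w] := by simp [Conf.cutOff, hr, lstO]
  have hlst : ∀ r, r ≠ w → (C.cutOff w l).lst r = C.lst r := by
    intro r hrw; simp [Conf.cutOff, hrw]
  have hcl := h.chain w hw
  rw [h.lst_eq w, hl, hr] at hcl
  have hlC : (C.lst l).IsChain (fun a b => π b = some a) := by
    simpa [lstO] using hcl.left_of_append
  have key : InvX (Function.update π w none) val (C.cutOff w l) {w} := by
    refine ⟨?_, ?_, ?_, ?_, ?_, ?_, ?_, ?_, ?_, h.val_eq, ?_⟩
    · intro d y c hc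
      change (if y = w ∧ d = false then none else C.ch d y) = some c at hc
      change Function.update C.par l none c = some y
      split_ifs at hc with h1
      rw [Function.update_of_ne, h.par_ch _ _ _ hc]
      rintro rfl
      have := h.ch_unique hl hc
      exact h1 ⟨this.2, this.1⟩
    · intro y c h1 h2
      change (if y = w ∧ false = false then none else C.ch false y) = some c at h1
      change (if y = w ∧ true = false then none else C.ch true y) = some c at h2
      rw [if_neg (by simp)] at h2
      split_ifs at h1
      exact h.ch_ne _ _ h1 h2
    · intro y
      change 1 ≤ Function.update C.s w (C.s w - C.s l) y
      by_cases hy : y = w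
      · subst hy; rw [Function.update_self]; linarith
      · rw [Function.update_of_ne hy]; exact h.s_pos y
    · intro y
      change Function.update C.s w (C.s w - C.s l) y = 1 + ∑ c,
        if Function.update C.par l none c = some y then Function.update C.s w (C.s w - C.s l) c else 0
      rw [Finset.sum_eq_add_of_eq_off_pair (F := fun c => if C.par c = some y then C.s c else 0) hlw]
      · have h1 := h.size y
        rw [Function.update_self, Function.update_of_ne hlw.symm, Function.update_of_ne hlw, hpl, hpw]
        by_cases hy : y = w
        · subst hy
          simp
          linarith
        · rw [Function.update_of_ne hy]
          have : w ≠ y := Ne.symm hy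
          simp [this]
          linarith
      · intro c h1 h2
        rw [Function.update_of_ne h1, Function.update_of_ne h2]
    · intro y
      by_cases hy : y = w
      · subst hy
        rw [hlstw]
        simp [Conf.cutOff, lstO, hr]
      · rw [hlst y hy, h.lst_eq y]
        have e : ∀ d, (C.cutOff w l).lstO ((C.cutOff w l).ch d y) = C.lstO (C.ch d y) := by
          intro d
          have : (C.cutOff w l).ch d y = C.ch d y := by simp [Conf.cutOff, hy]
          rw [this]
          cases hc : C.ch d y with
          | none => rfl
          | some c => exact hlst c (by rintro rfl; exact hw _ _ hc)
        rw [e, e]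
    · intro r hr'
      by_cases hrw : r = w
      · subst hrw; rw [hlstw]; simp
      · rw [hlst r hrw]
        have hc : (C.lst r).IsChain (fun a b => π b = some a) := by
          rcases (root_cutOff h hl).1 hr' with h1 | h1
          · exact h.chain r h1
          · rw [h1]; exact hlC
        refine List.IsChain.imp_of_mem_imp ?_ hc
        intro a b ha hb hab
        rw [Function.update_of_ne, hab]
        rintro rfl
        exact hrw (hmem r hb)
    · intro r a hr' ha
      change Function.update π w none a = Function.update C.par l none r
      by_cases hrw : r = w
      · subst hrw
        rw [hlstw] at ha
        obtain rfl : r = a := by simpa using ha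
        rw [Function.update_self, Function.update_of_ne hlw.symm, hpw]
      · rw [hlst r hrw] at ha
        have haw : a ≠ w := by
          rintro rfl
          exact hrw (hmem r (List.mem_of_mem_head? ha))
        rw [Function.update_of_ne haw]
        by_cases hrl : r = l
        · subst hrl
          rw [Function.update_self]
          have : (C.lst w).head? = some a := by
            rw [h.lst_eq w, hl]
            cases hll : C.lst r with
            | nil => simp [hll] at ha
            | cons b t => simpa [lstO, hll] using ha
          rw [h.head w a hw this, hpw]
        · rw [Function.update_of_ne hrl]
          exact h.head r a (((root_cutOff h hl).1 hr').resolve_right hrl) ha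
    · intro d y c hc
      change (if y = w ∧ d = false then none else C.ch d y) = some c at hc
      change C.off c = Function.update C.tag l (C.tag l + C.tag w) c + C.off y
      split_ifs at hc with h1
      rw [Function.update_of_ne, h.off_ch _ _ _ hc]
      rintro rfl
      have := h.ch_unique hl hc
      exact h1 ⟨this.2, this.1⟩
    · intro r hr'
      change C.off r = Function.update C.tag l (C.tag l + C.tag w) r
      by_cases hrl : r = l
      · subst hrl
        rw [Function.update_self, h.off_ch _ _ _ hl, h.off_root w hw]
      · rw [Function.update_of_ne hrl]
        exact h.off_root r (((root_cutOff h hl).1 hr').resolve_right hrl)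
    · intro y hy
      have := h.agg y (by simp)
      have hy' : y ≠ w := by simpa using hy
      simpa [AggOK, Conf.cutOff, hy'] using this
  exact (key.pull w (fun d c hc => by simpa using key.ne_of_ch hc)).mono (by simp)

theorem pot_cutOff_le (h : Inv π val C) {w l : V} (hl : C.ch false w = some l) :
    ((C.cutOff w l).pull w).pot ≤ C.pot := by
  have hsl := h.s_lt_of_par (h.par_ch _ _ _ hl)
  have h1 := h.s_pos l
  apply Finset.sum_le_sum
  intro v _
  change Real.logb 2 (Function.update C.s w (C.s w - C.s l) v) ≤ _
  by_cases hv : v = w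
  · subst hv
    rw [Function.update_self]
    exact Real.logb_le_logb_of_le (by norm_num) (by linarith) (by linarith)
  · rw [Function.update_of_ne hv]

end Conf

/-! ### Programs for the forest operations -/

section
variable {n : ℕ} {π : Forest n} {val : Fin n → ℤ} {C : Conf (Fin n)} {S : RState}

/-- The memory holds a link-cut forest for `π` and `val`, of potential `φ`. -/
def LctAt (S : RState) (π : Forest n) (val : Fin n → ℤ) (φ : ℝ) : Prop :=
  ∃ C : Conf (Fin n), MemRep S C ∧ Conf.Inv π val C ∧ φ = 1000 * C.pot

theorem LctAt.nonneg {φ : ℝ} (h : LctAt S π val φ) : 0 ≤ φ := by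
  obtain ⟨C, -, h2, rfl⟩ := h
  have := h2.pot_nonneg
  linarith

theorem LctAt.ext_fld {S' : RState} {φ : ℝ} (h : LctAt S π val φ)
    (hf : ∀ j i, 0 ≤ j → j < 8 → 0 ≤ i → S'.fld j i = S.fld j i) : LctAt S' π val φ := by
  obtain ⟨C, h1, h2, h3⟩ := h
  exact ⟨C, h1.ext_fld hf, h2, h3⟩

theorem LctAt.setR {φ : ℝ} (h : LctAt S π val φ) (x : ℕ) (v : ℤ) : LctAt (S.setR x v) π val φ :=
  h.ext_fld (fun _ _ _ _ _ => rfl)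

theorem LctAt.setF {φ : ℝ} (h : LctAt S π val φ) {j : ℤ} (i v : ℤ) (hj : 8 ≤ j) (hj' : j < 16) :
    LctAt (S.setF j i v) π val φ :=
  h.ext_fld (fun j' i' h1 h2 _ => by
    rw [RState.fld_setF _ (by omega) hj' h1 (by omega), if_neg (by omega)])

/-- A bound on the amortized time of an operation on a link-cut forest. -/
noncomputable def opTime (n : ℕ) : ℝ := 1000 * (30 * Real.logb 2 n + 30)

theorem logb_card_nonneg (n : ℕ) : 0 ≤ Real.logb 2 (n : ℝ) := by
  rcases Nat.eq_zero_or_pos n with rfl | h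
  · simp
  · exact Real.logb_nonneg (by norm_num) (by exact_mod_cast h)

namespace Conf

/-- Inorder is the order by depth: the node just before `v` would be its forest parent. -/
theorem Inv.ch_false_eq_none (h : Inv π val C) {v : Fin n} (hv : C.Root v) (hπ : π v = none) :
    C.ch false v = none := by
  by_contra hne
  obtain ⟨c, hc⟩ := Option.ne_none_iff_exists'.1 hne
  have hch := h.chain v hv
  rw [h.lst_eq v, hc] at hch
  have hcmem := h.mem_lst_self c
  rcases List.eq_nil_or_concat' (C.lst c) with h0 | ⟨l, a, h0⟩
  · simp [h0] at hcmem
  · have := (List.isChain_append.1 hch).2.2 a (by simp [lstO, h0]) v (by simp)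
    simp [hπ] at this

theorem Inv.isPath (h : Inv π val C) {v : Fin n} (hv : C.Root v) (hp : C.par v = none)
    (hc : C.ch true v = none) : Forest.IsPath π (C.lst v) v := by
  refine ⟨h.chain v hv, ?_, fun a ha => by rw [h.head v a hv ha, hp]⟩
  rw [h.lst_eq v, hc]
  simp [lstO]

end Conf

def setvalTail : Cmd := .seqs [.assign 23 (.add (.fl (.lit 4) (.reg 20)) (.fl (.lit 3) (.reg 20))),
  .setf (.lit 4) (.reg 20) (.sub (.reg 22) (.fl (.lit 3) (.reg 20))),
  .assign 60 (.reg 20), pullCmd]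

/-- Give the node in register `20` the value in register `22`; the old value goes to register
`23`. -/
def setvalCmd : Cmd := .seqs [.assign 30 (.reg 20), accessCmd, setvalTail]

theorem setvalTail_cost : setvalTail.loopFree = true ∧ setvalTail.cost ≤ 100 := by decide

theorem setvalTail_spec {v : Fin n} (h : MemRep S C) (h20 : S.reg 20 = vid v) :
    MemRep (setvalTail.run S) ((C.setVal v (S.reg 22)).pull v) ∧ Frame 23 S (setvalTail.run S) ∧
      (setvalTail.run S).reg 23 = C.sv v + C.tag v := by
  let S₁ := ((S.setR 23 (C.sv v + C.tag v)).setF 4 (vid v) (S.reg 22 - C.tag v)).setR 60 (vid v)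
  have hrep : MemRep S₁ (C.setVal v (S.reg 22)) := by
    constructor <;> intros <;>
      simp [S₁, Conf.setVal, h.ch0, h.ch1, h.par, h.tag, h.sv, h.sm, h.am, h.hd, h.null0, h.null1,
        Function.update_apply]
  have k := pullCmd_spec (v := v) hrep (by simp [S₁])
  have e : setvalTail.run S = pullCmd.run S₁ := by
    simp [setvalTail, S₁, h20, h.sv, h.tag]
  rw [e]
  refine ⟨k.1, ?_, by rw [k.2.reg 23 (by norm_num)]; simp [S₁]⟩
  exact (((Frame.setR _ _ (by norm_num)).trans (Frame.setF _ _ (by norm_num) (by norm_num)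
    (vid_pos v).le)).trans (Frame.setR _ _ (by norm_num))).trans (k.2.mono (by norm_num))

/-- Besides the bound it records that `v` ends up as a binary root without path parent, which the
link program relies on. -/
theorem setvalCmd_conf {β : Type*} {cl : Fin n → β} (hcl : ∀ a b, π a = some b → cl a = cl b)
    {v : Fin n} (h : MemRep S C) (hI : Conf.Inv π val C) (h20 : S.reg 20 = vid v) :
    Wp setvalCmd S (fun T S' => ∃ C', MemRep S' C' ∧
      Conf.Inv π (Function.update val v (S.reg 22)) C' ∧ Frame 23 S S' ∧ S'.reg 23 = val v ∧
      C'.Root v ∧ C'.par v = none ∧ T ≤ accessTime n + 101 - 1000 * (C'.pot - C.pot)) := by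
  refine Wp.seqs_cons (Wp.assign (Wp.seqs_cons ?_))
  change Wp accessCmd (S.setR 30 (S.reg 20)) _
  refine Wp.mono (accessCmd_spec hcl (h.setR 30 (S.reg 20)) hI (v := v) (by simp [h20])) ?_
  rintro T₁ S₁ ⟨C₁, k1, k2, k3, k4, k5, k6, k7, k8⟩
  have r20 : S₁.reg 20 = vid v := by rw [k3.reg 20 (by norm_num)]; simp [h20]
  have r22 : S₁.reg 22 = S.reg 22 := by rw [k3.reg 22 (by norm_num)]; simp
  obtain ⟨a1, a2, a3⟩ := setvalTail_spec k1 r20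
  refine Wp.of_run setvalTail_cost.1 (fun T hT => ?_)
  replace hT : T ≤ setvalTail.cost := hT
  have hcost : (setvalTail.cost : ℝ) ≤ 100 := by exact_mod_cast setvalTail_cost.2
  rw [r22] at a1
  refine ⟨_, a1, Conf.InvX.setVal k2 k4 _, ((Frame.setR _ _ (by norm_num)).trans
    (k3.mono (by norm_num))).trans a2, ?_, k4, k6, ?_⟩
  · refine a3.trans ?_
    rw [k2.val_eq v, k2.off_root v k4]
  · change 1 + (T₁ + T) ≤ accessTime n + 101 - 1000 * (C₁.pot - C.pot)
    linarith

theorem setvalCmd_spec {v : Fin n} {φ : ℝ} (h : LctAt S π val φ) (h20 : S.reg 20 = vid v) :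
    Wp setvalCmd S (fun T S' => ∃ φ', LctAt S' π (Function.update val v (S.reg 22)) φ' ∧
      Frame 23 S S' ∧ S'.reg 23 = val v ∧ T ≤ opTime n - (φ' - φ)) := by
  obtain ⟨C, h1, h2, rfl⟩ := h
  refine Wp.mono (setvalCmd_conf (cl := fun _ => ()) (by simp) h1 h2 h20) ?_
  rintro T S' ⟨C', a1, a2, a3, a4, -, -, a5⟩
  refine ⟨_, ⟨C', a1, a2, rfl⟩, a3, a4, ?_⟩
  have := logb_card_nonneg n
  unfold accessTime at a5
  unfold opTime
  linarith

/-- Link the root in register `20` to the node in register `21`, with the value in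
register `22`. -/
def linkCmd : Cmd := .seqs [setvalCmd, .assign 30 (.reg 21), accessCmd,
  .setf (.lit 2) (.reg 20) (.reg 21)]

theorem linkCmd_spec {v w : Fin n} {φ : ℝ} (h : LctAt S π val φ) (h20 : S.reg 20 = vid v)
    (h21 : S.reg 21 = vid w) (hv : π v = none) (hw : ¬ π.IsRootOf w v) :
    Wp linkCmd S (fun T S' => ∃ φ', LctAt S' (Function.update π v (some w))
      (Function.update val v (S.reg 22)) φ' ∧ Frame 23 S S' ∧ T ≤ opTime n - (φ' - φ)) := by
  obtain ⟨C, h1, h2, rfl⟩ := h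
  -- The class of a node tells whether it lies in the tree of `v`. As `w` does not, the access to
  -- `w` keeps `v` a binary root without path parent.
  have hcl : ∀ a b, π a = some b → π.IsRootOf a v = π.IsRootOf b v :=
    fun a b hab => propext (Forest.isRootOf_iff_of_eq_some hab)
  have hclv : π.IsRootOf v v = True := eq_true (Forest.isRootOf_self hv)
  have hclw : π.IsRootOf w v = False := eq_false hw
  have hvw : v ≠ w := by
    rintro rfl
    exact hw (Forest.isRootOf_self hv)
  refine Wp.seqs_cons (Wp.mono (setvalCmd_conf hcl h1 h2 h20) ?_)
  rintro T₁ S₁ ⟨C₁, a1, a2, a3, -, a5, a6, a7⟩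
  refine Wp.seqs_cons (Wp.assign (Wp.seqs_cons ?_))
  change Wp accessCmd (S₁.setR 30 (S₁.reg 21)) _
  have r21 : S₁.reg 21 = vid w := by rw [a3.reg 21 (by norm_num), h21]
  refine Wp.mono (accessCmd_spec hcl (a1.setR 30 (S₁.reg 21)) a2 (v := w) (by simp [r21])) ?_
  rintro T₂ S₂ ⟨C₂, k1, k2, k3, k4, k5, k6, k7, k8⟩
  obtain ⟨b1, b2⟩ := k7 v a5 (by simp [hclv, hclw])
  have r20' : S₂.reg 20 = vid v := by
    rw [k3.reg 20 (by norm_num)]; simp [a3.reg 20 (by norm_num), h20]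
  have r21' : S₂.reg 21 = vid w := by rw [k3.reg 21 (by norm_num)]; simp [r21]
  refine Wp.of_run (by decide) (fun T hT => ?_)
  replace hT : T ≤ 1 := by simpa [Cmd.seqs, Cmd.setf, Cmd.cost] using hT
  have e : (Cmd.seqs [.setf (.lit 2) (.reg 20) (.reg 21)]).run S₂ = S₂.setF 2 (vid v) (vid w) := by
    simp [r20', r21']
  rw [e]
  have hI3 := Conf.InvX.linkTo k2 b1 (b2.trans a6) k4 k6 hvw (Conf.Inv.ch_false_eq_none k2 b1 hv) hv
  refine ⟨_, ⟨C₂.linkTo v w, ?_, hI3, rfl⟩, ((a3.trans (Frame.setR _ _ (by norm_num))).trans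
    (k3.mono (by norm_num))).trans (Frame.setF _ _ (by norm_num) (by norm_num) (vid_pos v).le), ?_⟩
  · constructor <;> intros <;>
      simp [Conf.linkTo, k1.ch0, k1.ch1, k1.par, k1.tag, k1.sv, k1.sm, k1.am, k1.hd, k1.null0, k1.null1,
        Function.update_apply]
    split_ifs <;> rfl
  · have hp := Conf.pot_linkTo_le k2 hI3
    rw [Fintype.card_fin] at hp
    have := logb_card_nonneg n
    unfold accessTime at a7 k8
    unfold opTime
    linarith

def cutTail : Cmd := .seqs [.assign 23 (.fl (.lit 0) (.reg 20)),
  .setf (.lit 3) (.reg 23) (.add (.fl (.lit 3) (.reg 23)) (.fl (.lit 3) (.reg 20))),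
  .setf (.lit 2) (.reg 23) (.lit 0), .setf (.lit 0) (.reg 20) (.lit 0), .assign 60 (.reg 20), pullCmd]

/-- Cut the node in register `20` off its parent. -/
def cutCmd : Cmd := .seqs [.assign 30 (.reg 20), accessCmd, cutTail]

theorem cutTail_cost : cutTail.loopFree = true ∧ cutTail.cost ≤ 100 := by decide

theorem cutTail_spec {w l : Fin n} (h : MemRep S C) (hl : C.ch false w = some l)
    (h20 : S.reg 20 = vid w) :
    MemRep (cutTail.run S) ((C.cutOff w l).pull w) ∧ Frame 23 S (cutTail.run S) := by
  let S₁ := ((((S.setR 23 (vid l)).setF 3 (vid l) (C.tag l + C.tag w)).setF 2 (vid l) 0).setF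
    0 (vid w) 0).setR 60 (vid w)
  have hrep : MemRep S₁ (C.cutOff w l) := by
    constructor <;> intros <;>
      simp [S₁, Conf.cutOff, h.ch0, h.ch1, h.par, h.tag, h.sv, h.sm, h.am, h.hd, h.null0, h.null1,
        Function.update_apply]
    all_goals split_ifs <;> rfl
  have k := pullCmd_spec (v := w) hrep (by simp [S₁])
  have e : cutTail.run S = pullCmd.run S₁ := by
    simp [cutTail, S₁, h20, h.ch0, hl, h.tag]
  rw [e]
  refine ⟨k.1, ?_⟩
  have f1 : Frame 23 S (((S.setR 23 (vid l)).setF 3 (vid l) (C.tag l + C.tag w)).setF 2 (vid l) 0) :=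
    ((Frame.setR _ _ (by norm_num)).trans (Frame.setF _ _ (by norm_num) (by norm_num)
    (vid_pos l).le)).trans (Frame.setF _ _ (by norm_num) (by norm_num) (vid_pos l).le)
  exact ((f1.trans (Frame.setF _ _ (by norm_num) (by norm_num) (vid_pos w).le)).trans
    (Frame.setR _ _ (by norm_num))).trans (k.2.mono (by norm_num))

theorem cutCmd_spec {w : Fin n} {φ : ℝ} (h : LctAt S π val φ) (h20 : S.reg 20 = vid w)
    (hw : π w ≠ none) :
    Wp cutCmd S (fun T S' => ∃ φ', LctAt S' (Function.update π w none) val φ' ∧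
      Frame 23 S S' ∧ T ≤ opTime n - (φ' - φ)) := by
  obtain ⟨C, h1, h2, rfl⟩ := h
  refine Wp.seqs_cons (Wp.assign (Wp.seqs_cons ?_))
  change Wp accessCmd (S.setR 30 (S.reg 20)) _
  refine Wp.mono (accessCmd_spec (cl := fun _ => ()) (by simp) (h1.setR 30 (S.reg 20)) h2 (v := w)
    (by simp [h20])) ?_
  rintro T₁ S₁ ⟨C₁, k1, k2, k3, k4, k5, k6, k7, k8⟩
  have r20 : S₁.reg 20 = vid w := by rw [k3.reg 20 (by norm_num)]; simp [h20]
  have hl : C₁.ch false w ≠ none := by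
    intro h0
    apply hw
    have := k2.head w w k4 (by rw [k2.lst_eq w, h0]; simp [Conf.lstO])
    rw [this, k6]
  obtain ⟨l, hl⟩ := Option.ne_none_iff_exists'.1 hl
  obtain ⟨a1, a2⟩ := cutTail_spec k1 hl r20
  refine Wp.of_run cutTail_cost.1 (fun T hT => ?_)
  replace hT : T ≤ cutTail.cost := hT
  have hcost : (cutTail.cost : ℝ) ≤ 100 := by exact_mod_cast cutTail_cost.2
  refine ⟨_, ⟨_, a1, Conf.InvX.cutOff k2 k4 k6 hl k5, rfl⟩, ((Frame.setR _ _ (by norm_num)).trans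
    (k3.mono (by norm_num))).trans a2, ?_⟩
  have := Conf.pot_cutOff_le k2 hl
  have := logb_card_nonneg n
  unfold accessTime at k8
  unfold opTime
  linarith

def exposeTail : Cmd := .seq (.assign 25 (.fl (.lit 1) (.reg 23)))
  (.ite (.eq (.reg 25) (.lit 0)) (.assign 24 (.lit 0))
    (.seq (.assign 24 (.fl (.lit 6) (.reg 25)))
      (.assign 26 (.add (.add (.fl (.lit 5) (.reg 25)) (.fl (.lit 3) (.reg 25)))
        (.fl (.lit 3) (.reg 23))))))

/-- Find the root of the node in register `20` (register `23`), a node of least value on its path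
without the root (register `24`, `0` if there is none) and this value (register `26`). -/
def exposeCmd : Cmd := .seqs [.assign 30 (.reg 20), accessCmd, .assign 23 (.fl (.lit 7) (.reg 20)),
  .assign 40 (.reg 23), splayCmd, exposeTail]

/-- The access puts the path from `u` to its root into one binary tree, whose first entry `hd u` is
the root. Splaying this entry leaves it without a left child, so the right subtree is the path
without its root and its aggregated data answer the query. The time adds one splay, with factor `3`,
to the `9` of the access. -/
theorem exposeCmd_conf {u : Fin n} (h : MemRep S C) (hI : Conf.Inv π val C)
    (h20 : S.reg 20 = vid u) :
    Wp exposeCmd S (fun T S' => ∃ C' v, MemRep S' C' ∧ Conf.Inv π val C' ∧ Frame 23 S S' ∧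
      C'.Root v ∧ C'.ch false v = none ∧ π.IsPath (v :: C'.lstO (C'.ch true v)) u ∧
      S'.reg 23 = vid v ∧ S'.reg 25 = enc (C'.ch true v) ∧
      S'.reg 24 = enc ((C'.ch true v).map C'.am) ∧
      (∀ c, C'.ch true v = some c → S'.reg 26 = val (C'.am c)) ∧
      T ≤ 1000 * (12 * Real.logb 2 n + 5) - 1000 * (C'.pot - C.pot)) := by
  refine Wp.seqs_cons (Wp.assign (Wp.seqs_cons ?_))
  change Wp accessCmd (S.setR 30 (S.reg 20)) _
  have hcl : ∀ a b, π a = some b → (fun _ : Fin n => ()) a = (fun _ => ()) b := by simp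
  refine Wp.mono (accessCmd_spec hcl (h.setR 30 (S.reg 20)) hI (v := u)
    (by simp [h20])) ?_
  rintro T₁ S₁ ⟨C₁, k1, k2, k3, k4, k5, k6, k7, k8⟩
  have r20 : S₁.reg 20 = vid u := by rw [k3.reg 20 (by norm_num)]; simp [h20]
  have hpath := Conf.Inv.isPath k2 k4 k6 k5
  obtain ⟨hhd, -⟩ := k2.agg u (by simp)
  set v := C₁.hd u with hv
  let S₂ := (S₁.setR 23 (vid v)).setR 40 (vid v)
  refine Wp.seqs_cons (Wp.assign (Wp.seqs_cons (Wp.assign (Wp.seqs_cons ?_))))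
  change Wp splayCmd ((Cmd.assign 40 (.reg 23)).run ((Cmd.assign 23 (.fl (.lit 7) (.reg 20))).run S₁)) _
  rw [show (Cmd.assign 40 (.reg 23)).run ((Cmd.assign 23 (.fl (.lit 7) (.reg 20))).run S₁) = S₂ by
    simp [S₂, r20, k1.hd, hv]]
  refine Wp.mono (splayCmd_spec hcl (S := S₂) ((k1.setR 23 (vid v)).setR 40 (vid v)) k2 (x := v)
    (by simp [S₂])) ?_
  rintro T₂ S₃ ⟨C₂, m1, m2, m3, m4, m5, m6, m7⟩
  have hvπ : π v = none := hpath.2.2 v hhd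
  have hlv : C₂.ch false v = none := Conf.Inv.ch_false_eq_none m2 m5 hvπ
  have hlst : C₂.lst v = C₁.lst u := by
    obtain ⟨r', h1, h2⟩ := m4.path u k4
    have : v ∈ C₂.lst r' := by rw [h2]; exact List.mem_of_mem_head? hhd
    rw [m2.eq_of_root_of_mem this m5, h2]
  have hlst2 : C₂.lst v = v :: C₂.lstO (C₂.ch true v) := by
    rw [m2.lst_eq v, hlv]; simp [Conf.lstO]
  rw [← hlst, hlst2] at hpath
  have r23 : S₃.reg 23 = vid v := by rw [m3.reg 23 (by norm_num)]; simp [S₂]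
  have hF : Frame 23 S S₃ := (((Frame.setR _ _ (by norm_num)).trans (k3.mono (by norm_num))).trans
    ((Frame.setR _ _ (by norm_num)).trans (Frame.setR _ _ (by norm_num)))).trans
    (m3.mono (by norm_num))
  have htime : ∀ T : ℝ, T ≤ 10 → 1 + (T₁ + (1 + (1 + (T₂ + T)))) ≤
      1000 * (12 * Real.logb 2 n + 5) - 1000 * (C₂.pot - C.pot) := by
    intro T hT
    have q1 := k2.lg_nonneg v
    have q2 := m2.lg_le v
    rw [Fintype.card_fin] at q2
    unfold accessTime at k8
    linarith
  refine Wp.of_run (by decide) (fun T hT => ?_)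
  replace hT : T ≤ 10 := by
    have : (Cmd.seqs [exposeTail]).cost ≤ 10 := by decide
    exact hT.trans (by exact_mod_cast this)
  rw [show (Cmd.seqs [exposeTail]).run S₃ = exposeTail.run S₃ from rfl]
  cases hc : C₂.ch true v with
  | none =>
    have e : exposeTail.run S₃ = (S₃.setR 25 0).setR 24 0 := by
      simp [exposeTail, r23, m1.ch1, hc]
    rw [e]
    refine ⟨C₂, v, (m1.setR _ _).setR _ _, m2, hF.trans ((Frame.setR _ _ (by norm_num)).trans
      (Frame.setR _ _ (by norm_num))), m5, hlv, hpath, by simp [r23], by simp [hc], by simp [hc],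
      by simp [hc], htime T hT⟩
  | some c =>
    have hval : val (C₂.am c) = C₂.sm c + C₂.tag c + C₂.tag v := by
      obtain ⟨-, -, h3, -⟩ := m2.agg c (by simp)
      rw [h3, m2.off_ch _ _ _ hc, m2.off_root v m5]; ring
    have e : exposeTail.run S₃ = ((S₃.setR 25 (vid c)).setR 24 (vid (C₂.am c))).setR 26
        (val (C₂.am c)) := by
      simp [exposeTail, r23, m1.ch1, hc, m1.am, m1.sm, m1.tag, hval]
    rw [e]
    refine ⟨C₂, v, ((m1.setR _ _).setR _ _).setR _ _, m2, hF.trans (((Frame.setR _ _ (by norm_num)).trans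
      (Frame.setR _ _ (by norm_num))).trans (Frame.setR _ _ (by norm_num))), m5, hlv, hpath,
      by simp [r23], by simp [hc], by simp [hc], ?_, htime T hT⟩
    intro c' hc'
    rw [hc] at hc'
    cases hc'
    simp

theorem exposeCmd_spec {u : Fin n} {φ : ℝ} (h : LctAt S π val φ) (h20 : S.reg 20 = vid u) :
    Wp exposeCmd S (fun T S' => ∃ φ' v, LctAt S' π val φ' ∧ Frame 23 S S' ∧ π.IsRootOf u v ∧
      S'.reg 23 = vid v ∧ (u = v → S'.reg 24 = 0) ∧
      (u ≠ v → ∃ w b, S'.reg 24 = vid w ∧ π.ArcOnPath u w b ∧ S'.reg 26 = val w ∧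
        ∀ a b, π.ArcOnPath u a b → val w ≤ val a) ∧ T ≤ opTime n - (φ' - φ)) := by
  obtain ⟨C, h1, h2, rfl⟩ := h
  refine Wp.mono (exposeCmd_conf h1 h2 h20) ?_
  rintro T S' ⟨C', v, a1, a2, a3, a4, a5, a6, a7, a8, a9, a10, a11⟩
  refine ⟨_, v, ⟨C', a1, a2, rfl⟩, a3, a6.isRootOf, a7, ?_, ?_, ?_⟩
  · intro huv
    cases hc : C'.ch true v with
    | none => rw [a9, hc]; simp
    | some c =>
      exfalso
      rw [hc] at a6
      have hcm := a2.mem_lst_self c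
      have hlast := a6.2.1
      have : u ∈ C'.lst c := by
        simp only [Conf.lstO, Option.elim] at hlast
        have hne : C'.lst c ≠ [] := List.ne_nil_of_mem hcm
        rw [List.getLast?_cons, List.getLast?_eq_some_getLast hne] at hlast
        simp only [Option.getD_some, Option.some.injEq] at hlast
        rw [← hlast]
        exact List.getLast_mem hne
      exact a6.ne_none this (huv ▸ a6.isRootOf.2)
  · intro huv
    cases hc : C'.ch true v with
    | none =>
      exfalso
      rw [hc] at a6
      have hlast := a6.2.1
      simp [Conf.lstO] at hlast
      exact huv hlast.symm
    | some c =>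
      rw [hc] at a6
      obtain ⟨-, b1, b2, b3⟩ := a2.agg c (by simp)
      obtain ⟨b, hb⟩ := a6.arcOnPath_iff.2 (show C'.am c ∈ _ from b1)
      refine ⟨C'.am c, b, by rw [a9, hc]; simp, hb, a10 c hc, ?_⟩
      intro a b' hab
      rw [b2]
      exact b3 a (a6.arcOnPath_iff.1 ⟨b', hab⟩)
  · have := logb_card_nonneg n
    unfold opTime
    linarith

def addTail : Cmd := .ite (.eq (.reg 25) (.lit 0)) .skip
  (.seqs [.setf (.lit 3) (.reg 25) (.add (.fl (.lit 3) (.reg 25)) (.reg 22)), .assign 60 (.reg 23),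
    pullCmd])

/-- Add the number in register `22` to the values on the path of the node in register `20`, but for
the root. -/
def addCmd : Cmd := .seq exposeCmd addTail

theorem addTail_cost : addTail.loopFree = true ∧ addTail.cost ≤ 100 := by decide

open Classical in
theorem addCmd_spec {u : Fin n} {φ : ℝ} (h : LctAt S π val φ) (h20 : S.reg 20 = vid u) :
    Wp addCmd S (fun T S' => ∃ φ',
      LctAt S' π (fun a => if ∃ b, π.ArcOnPath u a b then val a + S.reg 22 else val a) φ' ∧
      Frame 23 S S' ∧ T ≤ opTime n - (φ' - φ)) := by
  obtain ⟨C, h1, h2, rfl⟩ := h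
  refine Wp.seq (Wp.mono (exposeCmd_conf h1 h2 h20) ?_)
  rintro T₁ S₁ ⟨C₁, v, a1, a2, a3, a4, a5, a6, a7, a8, -, -, a11⟩
  have r22 : S₁.reg 22 = S.reg 22 := a3.reg 22 (by norm_num)
  have hcost : (addTail.cost : ℝ) ≤ 100 := by exact_mod_cast addTail_cost.2
  have := logb_card_nonneg n
  refine Wp.of_run addTail_cost.1 (fun T hT => ?_)
  cases hc : C₁.ch true v with
  | none =>
    rw [hc] at a6
    have e : addTail.run S₁ = S₁ := by simp [addTail, a8, hc]
    rw [e]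
    have hval : (fun a => if ∃ b, π.ArcOnPath u a b then val a + S.reg 22 else val a) = val := by
      funext a
      rw [if_neg]
      rw [a6.arcOnPath_iff]
      simp [Conf.lstO]
    rw [hval]
    refine ⟨_, ⟨C₁, a1, a2, rfl⟩, a3, ?_⟩
    unfold opTime
    linarith
  | some c =>
    rw [hc] at a6
    have hcv := a2.ne_of_ch hc
    let S₂ := (S₁.setF 3 (vid c) (C₁.tag c + S.reg 22)).setR 60 (vid v)
    have hrep : MemRep S₂ (C₁.addTag c (S.reg 22)) := by
      constructor <;> intros <;>
        simp [S₂, Conf.addTag, a1.ch0, a1.ch1, a1.par, a1.tag, a1.sv, a1.sm, a1.am, a1.hd, a1.null0,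
          a1.null1, Function.update_apply]
    have k := pullCmd_spec (v := v) hrep (by simp [S₂])
    have e : addTail.run S₁ = pullCmd.run S₂ := by
      simp [addTail, a8, hc, a1.tag, r22, a7, S₂]
    have hval : (fun a => if ∃ b, π.ArcOnPath u a b then val a + S.reg 22 else val a)
        = fun w => if w ∈ C₁.lst c then val w + S.reg 22 else val w := by
      funext a
      have : (∃ b, π.ArcOnPath u a b) ↔ a ∈ C₁.lst c := a6.arcOnPath_iff
      simp only [this]
    rw [e, hval]
    refine ⟨_, ⟨_, k.1, ?_, rfl⟩, ?_, ?_⟩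
    · convert Conf.InvX.addTag a2 a4 a5 hc (S.reg 22)
    · exact ((a3.trans (Frame.setF _ _ (by norm_num) (by norm_num) (vid_pos c).le)).trans
        (Frame.setR _ _ (by norm_num))).trans (k.2.mono (by norm_num))
    · change T₁ + T ≤ opTime n - (1000 * C₁.pot - 1000 * C.pot)
      unfold opTime
      linarith
end

/-! ## Executions of create-all-pseudoarcs -/

namespace Forest

variable {n : ℕ} {π : Forest n}

/-- Every vertex has a root. -/
def Rooted (π : Forest n) : Prop := ∀ u, ∃ v, π.IsRootOf u v

theorem IsRootOf.of_onPath {u w v : Fin n} (h : π.OnPath u w) (hw : π.IsRootOf w v) :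
    π.IsRootOf u v := ⟨Relation.ReflTransGen.trans h hw.1, hw.2⟩

theorem IsRootOf.update_some {u x v w : Fin n} (h : π.IsRootOf u x) (hv : π v = none) (hx : x ≠ v) :
    IsRootOf (Function.update π v (some w)) u x := by
  obtain ⟨h1, h2⟩ := h
  refine ⟨?_, by rw [Function.update_of_ne hx, h2]⟩
  induction h1 using Relation.ReflTransGen.head_induction_on with
  | refl => exact Relation.ReflTransGen.refl
  | head hab _ ih =>
    refine Relation.ReflTransGen.head ?_ ih
    rw [Function.update_of_ne, hab]
    rintro rfl
    simp [hv] at hab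

theorem IsRootOf.update_some_self {u x v w : Fin n} (h : π.IsRootOf u v) (hw : π.IsRootOf w x)
    (hx : x ≠ v) : IsRootOf (Function.update π v (some w)) u x := by
  have hv := h.2
  have hwx := hw.update_some (w := w) hv hx
  obtain ⟨h1, h2⟩ := h
  refine IsRootOf.of_onPath ?_ hwx
  induction h1 using Relation.ReflTransGen.head_induction_on with
  | refl => exact Relation.ReflTransGen.single (by rw [Function.update_self])
  | head hab _ ih =>
    refine Relation.ReflTransGen.head ?_ ih
    rw [Function.update_of_ne, hab]
    rintro rfl
    simp [hv] at hab

theorem Rooted.update_some (h : Rooted π) {v w : Fin n} (hv : π v = none) (hw : ¬ π.IsRootOf w v) :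
    Rooted (Function.update π v (some w)) := by
  intro u
  obtain ⟨x, hx⟩ := h u
  by_cases hxv : x = v
  · obtain ⟨y, hy⟩ := h w
    have hyv : y ≠ v := by rintro rfl; exact hw hy
    exact ⟨y, (hxv ▸ hx).update_some_self hy hyv⟩
  · exact ⟨x, hx.update_some hv hxv⟩

theorem Rooted.update_none (h : Rooted π) (w : Fin n) : Rooted (Function.update π w none) := by
  intro u
  obtain ⟨x, h1, h2⟩ := h u
  induction h1 using Relation.ReflTransGen.head_induction_on with
  | refl =>
    refine ⟨x, isRootOf_self ?_⟩
    by_cases hx : x = w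
    · rw [hx, Function.update_self]
    · rw [Function.update_of_ne hx, h2]
  | @head a c hab _ ih =>
    by_cases ha : a = w
    · exact ⟨a, isRootOf_self (by rw [ha, Function.update_self])⟩
    · obtain ⟨y, hy⟩ := ih
      refine ⟨y, IsRootOf.of_onPath (Relation.ReflTransGen.single ?_) hy⟩
      rw [Function.update_of_ne ha, hab]

theorem IsRootOf.update_none {u v w : Fin n} (h : π.IsRootOf u v) (hw : ¬ π.OnPath u w) :
    IsRootOf (Function.update π w none) u v := by
  obtain ⟨h1, h2⟩ := h
  refine ⟨?_, ?_⟩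
  swap
  · rw [Function.update_of_ne, h2]
    rintro rfl
    exact hw h1
  induction h1 using Relation.ReflTransGen.head_induction_on with
  | refl => exact Relation.ReflTransGen.refl
  | head hab _ ih =>
    refine Relation.ReflTransGen.head ?_ (ih fun h' => hw (Relation.ReflTransGen.head hab h'))
    rw [Function.update_of_ne, hab]
    rintro rfl
    exact hw Relation.ReflTransGen.refl

theorem OnPath.isRootOf_update_none {u w : Fin n} (h : π.OnPath u w) :
    IsRootOf (Function.update π w none) u w := by
  refine ⟨?_, Function.update_self _ _ _⟩
  induction h using Relation.ReflTransGen.head_induction_on with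
  | refl => exact Relation.ReflTransGen.refl
  | @head a c hab _ ih =>
    by_cases ha : a = w
    · rw [ha]; exact Relation.ReflTransGen.refl
    · refine Relation.ReflTransGen.head ?_ ih
      rw [Function.update_of_ne ha, hab]

/-- A parent function may have cycles; that `u` has a root excludes them, by induction along the
path to it. -/
theorem IsRootOf.not_onPath_parent {u v b : Fin n} (h : π.IsRootOf u v) (hb : π u = some b) :
    ¬ π.OnPath b u := by
  obtain ⟨h1, h2⟩ := h
  induction h1 using Relation.ReflTransGen.head_induction_on generalizing b with
  | refl => simp [h2] at hb
  | @head a c hac _ ih =>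
    rw [hac] at hb
    cases hb
    intro hca
    rcases hca.cases_head with rfl | ⟨z, hz, hza⟩
    · exact ih hac Relation.ReflTransGen.refl
    · exact ih hz (Relation.ReflTransGen.tail hza hac)

theorem arcOnPath_iff_of_eq_some {u c a b : Fin n} (h : π u = some c) :
    π.ArcOnPath u a b ↔ (a = u ∧ b = c) ∨ π.ArcOnPath c a b := by
  unfold ArcOnPath
  rw [onPath_iff_of_eq_some h]
  constructor
  · rintro ⟨rfl | h1, h2⟩
    · rw [h] at h2
      exact Or.inl ⟨rfl, by simpa using h2.symm⟩
    · exact Or.inr ⟨h1, h2⟩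
  · rintro (⟨rfl, rfl⟩ | ⟨h1, h2⟩)
    · exact ⟨Or.inl rfl, h⟩
    · exact ⟨Or.inr h1, h2⟩

open Classical in
/-- The net amount that one unit on the path from `u` to its root `v` brings to `a`. -/
theorem sum_arcOnPath {u v : Fin n} (h : π.IsRootOf u v) (x : ℤ) (a : Fin n) :
    ∑ b, (if π.ArcOnPath u b a then x else 0) - ∑ b, (if π.ArcOnPath u a b then x else 0)
      = (if v = a then x else 0) - (if u = a then x else 0) := by
  obtain ⟨h1, h2⟩ := h
  induction h1 using Relation.ReflTransGen.head_induction_on with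
  | refl =>
    have : ∀ b c, ¬ π.ArcOnPath v b c := by
      rintro b c ⟨h3, h4⟩
      rw [onPath_iff_of_eq_none h2] at h3
      subst h3
      simp [h2] at h4
    simp [this]
  | @head u c hac hcv ih =>
    have hno : ¬ π.OnPath c u := IsRootOf.not_onPath_parent
      (IsRootOf.of_onPath (Relation.ReflTransGen.single hac) ⟨hcv, h2⟩) hac
    have hnoarc : ∀ b, ¬ π.ArcOnPath c u b := fun b hb => hno hb.1
    have key : ∀ p q, (if π.ArcOnPath u p q then x else 0)
        = (if p = u ∧ q = c then x else 0) + (if π.ArcOnPath c p q then x else 0) := by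
      intro p q
      rw [if_congr (arcOnPath_iff_of_eq_some hac) rfl rfl]
      by_cases hp : p = u ∧ q = c
      · obtain ⟨rfl, rfl⟩ := hp
        simp [hnoarc]
      · simp [hp]
    simp only [key, Finset.sum_add_distrib]
    have e1 : ∑ b, (if b = u ∧ a = c then x else 0) = if c = a then x else 0 := by
      by_cases hca : a = c
      · subst hca; simp
      · have : ¬ c = a := fun h' => hca h'.symm
        simp [hca, this]
    have e2 : ∑ b, (if a = u ∧ b = c then x else 0) = if u = a then x else 0 := by
      by_cases hua : a = u
      · subst hua; simp
      · have : ¬ u = a := fun h' => hua h'.symm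
        simp [hua, this]
    rw [e1, e2]
    linarith

end Forest

/-! ### Replaying the queue -/

section Queue

variable {n : ℕ}

/-- The forest after the operations of the queue. -/
def endForest : Forest n → List (Op n) → Forest n
  | π, [] => π
  | π, .link v w :: Q => endForest (Function.update π v (some w)) Q
  | π, .cut w :: Q => endForest (Function.update π w none) Q
  | π, .transfer _ _ _ :: Q => endForest π Q

/-- The operations of the queue are applicable; links are made along arcs in `G`. -/
def QOk (G : Set (Fin n × Fin n)) : Forest n → List (Op n) → Prop
  | _, [] => True
  | π, .link v w :: Q => π v = none ∧ ¬ π.IsRootOf w v ∧ (v, w) ∈ G ∧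
      QOk G (Function.update π v (some w)) Q
  | π, .cut w :: Q => π w ≠ none ∧ QOk G (Function.update π w none) Q
  | π, .transfer u v δ :: Q => π.IsRootOf u v ∧ u ≠ v ∧ 0 ≤ δ ∧ QOk G π Q

/-- The capacities of the pseudoarcs in the queue. -/
def capOf (Q : List (Op n)) (k : ℕ) : ℤ :=
  match Q[k]? with
  | some (.transfer _ _ δ) => δ
  | _ => 0

theorem endForest_append (π : Forest n) (Q Q' : List (Op n)) :
    endForest π (Q ++ Q') = endForest (endForest π Q) Q' := by
  induction Q generalizing π with
  | nil => rfl
  | cons φ Q ih => cases φ <;> exact ih _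

theorem QOk.append {G : Set (Fin n × Fin n)} {π : Forest n} {Q Q' : List (Op n)} (h : QOk G π Q)
    (h' : QOk G (endForest π Q) Q') : QOk G π (Q ++ Q') := by
  induction Q generalizing π with
  | nil => exact h'
  | cons φ Q ih =>
    cases φ
    · exact ⟨h.1, h.2.1, h.2.2.1, ih h.2.2.2 h'⟩
    · exact ⟨h.1, ih h.2 h'⟩
    · exact ⟨h.1, h.2.1, h.2.2.1, ih h.2.2.2 h'⟩

theorem pathFlow_append (π : Forest n) (Q Q' : List (Op n)) (x : ℕ → ℤ) (a b : Fin n) :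
    pathFlow π (Q ++ Q') x a b
      = pathFlow π Q x a b + pathFlow (endForest π Q) Q' (fun k => x (k + Q.length)) a b := by
  induction Q generalizing π x with
  | nil => simp [pathFlow, endForest]
  | cons φ Q ih =>
    have e : ∀ k, k + (Q.length + 1) = k + Q.length + 1 := fun k => by omega
    cases φ <;> simp only [List.cons_append, pathFlow, endForest, ih, List.length_cons, e]
    rw [add_assoc]

theorem pathFlow_congr (π : Forest n) (Q : List (Op n)) {x y : ℕ → ℤ}
    (h : ∀ k, k < Q.length → x k = y k) (a b : Fin n) : pathFlow π Q x a b = pathFlow π Q y a b := by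
  induction Q generalizing π x y with
  | nil => rfl
  | cons φ Q ih =>
    have h0 := h 0 (by simp)
    have h1 : ∀ k, k < Q.length → x (k + 1) = y (k + 1) := fun k hk => h _ (by simpa using hk)
    cases φ <;> simp only [pathFlow, ih _ h1, h0]

theorem pathFlow_mono (π : Forest n) (Q : List (Op n)) {x : ℕ → ℤ}
    (h : ∀ k u v δ, Q[k]? = some (.transfer u v δ) → 0 ≤ x k ∧ x k ≤ δ) (a b : Fin n) :
    0 ≤ pathFlow π Q x a b ∧ pathFlow π Q x a b ≤ pathFlow π Q (capOf Q) a b := by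
  induction Q generalizing π x with
  | nil => simp [pathFlow]
  | cons φ Q ih =>
    have h1 : ∀ k u v δ, Q[k]? = some (.transfer u v δ) → 0 ≤ x (k + 1) ∧ x (k + 1) ≤ δ :=
      fun k u v δ hk => h (k + 1) u v δ (by simpa using hk)
    have e : (fun k => capOf (φ :: Q) (k + 1)) = capOf Q := by
      funext k; simp [capOf]
    cases φ with
    | link v w => simpa only [pathFlow, e] using ih (Function.update π v (some w)) h1
    | cut w => simpa only [pathFlow, e] using ih (Function.update π w none) h1
    | transfer u v δ =>
      have h2 := ih π h1
      have h3 := h 0 u v δ (by simp)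
      have h4 : capOf (Op.transfer u v δ :: Q) 0 = δ := by simp [capOf]
      simp only [pathFlow, e, h4]
      split_ifs <;> constructor <;> linarith

/-- At inner vertices of a path the inflow and the outflow cancel, so each pseudoarc contributes
only at its two ends (`Forest.sum_arcOnPath`). The queue condition guarantees that the second end is
the root. -/
theorem excess_pathFlow {G : Set (Fin n × Fin n)} {π : Forest n} {Q : List (Op n)} (h : QOk G π Q)
    (x : ℕ → ℤ) (a : Fin n) :
    FlowNetwork.excess (pathFlow π Q x) a = pseudoNet Q x a := by
  classical
  induction Q generalizing π x with
  | nil => simp [FlowNetwork.excess, pathFlow, pseudoNet]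
  | cons φ Q ih =>
    cases φ with
    | link v w => simpa only [pseudoNet, FlowNetwork.excess, pathFlow] using ih h.2.2.2 (fun k => x (k + 1))
    | cut w => simpa only [pseudoNet, FlowNetwork.excess, pathFlow] using ih h.2 (fun k => x (k + 1))
    | transfer u v δ =>
      have h1 := ih h.2.2.2 (fun k => x (k + 1))
      have h2 := Forest.sum_arcOnPath h.1 (x 0) a
      simp only [FlowNetwork.excess, pathFlow, pseudoNet, Finset.sum_add_distrib] at h1 ⊢
      convert congrArg₂ (· + ·) h2 h1 using 1
      ring

end Queue

/-! ### Invariants of executions and the length of the queue -/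

namespace PState

variable {n : ℕ} {N : FlowNetwork n} {f : Fin n → Fin n → ℤ}

/-- Properties of the states of an execution. -/
structure Ok (N : FlowNetwork n) (f : Fin n → Fin n → ℤ) (σ : PState n) : Prop where
  rooted : Forest.Rooted σ.π
  r_nonneg : ∀ a b, 0 ≤ σ.r a b
  r_le : ∀ a b, σ.r a b ≤ N.res f a b
  qok : QOk (N.resArcs f) (fun _ => none) σ.Q
  endForest_eq : endForest (fun _ => none) σ.Q = σ.π
  r_eq : ∀ a b, σ.r a b = N.res f a b - pathFlow (fun _ => none) σ.Q (capOf σ.Q) a b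

theorem pathFlow_capOf_append (π : Forest n) (Q : List (Op n)) (φ : Op n) (a b : Fin n) :
    pathFlow π (Q ++ [φ]) (capOf (Q ++ [φ])) a b = pathFlow π Q (capOf Q) a b
      + pathFlow (endForest π Q) [φ] (capOf [φ]) a b := by
  rw [pathFlow_append]
  congr 1
  · apply pathFlow_congr
    intro k hk
    simp [capOf, List.getElem?_append_left hk]
  · apply pathFlow_congr
    intro k hk
    simp [capOf, List.getElem?_append_right]

theorem Ok.with_live {σ : PState n} (h : Ok N f σ) (G : Set (Fin n × Fin n)) :
    Ok N f { σ with live := G } :=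
  ⟨h.rooted, h.r_nonneg, h.r_le, h.qok, h.endForest_eq, h.r_eq⟩

theorem Ok.link {σ : PState n} (h : Ok N f σ) {v w : Fin n} (hv : σ.π v = none)
    (hw : ¬ σ.π.IsRootOf w v) (hr : 0 < σ.r v w) : Ok N f (σ.link v w) where
  rooted := h.rooted.update_some hv hw
  r_nonneg := h.r_nonneg
  r_le := h.r_le
  qok := h.qok.append (by
    rw [h.endForest_eq]
    exact ⟨hv, hw, hr.trans_le (h.r_le v w), trivial⟩)
  endForest_eq := by
    simp only [PState.link, endForest_append, h.endForest_eq]; rfl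
  r_eq := fun a b => by
    simp only [PState.link, pathFlow_capOf_append, pathFlow, add_zero]
    exact h.r_eq a b

theorem Ok.cut {σ : PState n} (h : Ok N f σ) {w : Fin n} (hw : σ.π w ≠ none) :
    Ok N f (σ.cut w) where
  rooted := h.rooted.update_none w
  r_nonneg := h.r_nonneg
  r_le := h.r_le
  qok := h.qok.append (by
    rw [h.endForest_eq]
    exact ⟨hw, trivial⟩)
  endForest_eq := by
    simp only [PState.cut, endForest_append, h.endForest_eq]; rfl
  r_eq := fun a b => by
    simp only [PState.cut, pathFlow_capOf_append, pathFlow, add_zero]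
    exact h.r_eq a b

theorem FindMin.nonneg {σ : PState n} (h : Ok N f σ) {u w : Fin n} {δ : ℤ} (hm : σ.FindMin u w δ) :
    0 ≤ δ := by
  obtain ⟨⟨b, -, rfl⟩, -⟩ := hm
  exact h.r_nonneg w b

theorem FindMin.ne_none {σ : PState n} {u w : Fin n} {δ : ℤ} (hm : σ.FindMin u w δ) :
    σ.π w ≠ none := by
  obtain ⟨⟨b, h1, -⟩, -⟩ := hm
  simp [h1.2]

theorem Ok.transfer {σ : PState n} (h : Ok N f σ) {u v w : Fin n} {δ : ℤ} (hu : σ.π.IsRootOf u v)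
    (huv : u ≠ v) (hm : σ.FindMin u w δ) : Ok N f (σ.transfer u v δ) where
  rooted := h.rooted
  r_nonneg := fun a b => by
    have h1 := h.r_nonneg a b
    simp only [PState.transfer]
    split_ifs with hc
    · have := hm.2 a b hc; linarith
    · exact h1
  r_le := fun a b => by
    have h1 := h.r_le a b
    have h2 := hm.nonneg h
    simp only [PState.transfer]
    split_ifs <;> linarith
  qok := h.qok.append (by
    rw [h.endForest_eq]
    exact ⟨hu, huv, hm.nonneg h, trivial⟩)
  endForest_eq := by
    simp only [PState.transfer, endForest_append, h.endForest_eq]; rfl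
  r_eq := fun a b => by
    have h1 := h.r_eq a b
    have h2 : capOf [Op.transfer u v δ] 0 = δ := by simp [capOf]
    simp only [PState.transfer]
    rw [pathFlow_capOf_append, h.endForest_eq]
    simp only [pathFlow, add_zero, h2]
    split_ifs <;> linarith

theorem Ok.searchStep {VC : Set (Fin n)} {ρ : ℤ} (hρ : 0 ≤ ρ) {u : Fin n} {σ σ' : PState n}
    (h : Ok N f σ) (hs : SearchStep VC ρ u σ σ') : Ok N f σ' := by
  cases hs with
  | link h1 h2 h3 h4 h5 => exact h.link h1.2 h5 (hρ.trans_lt h4)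
  | discard h1 h2 h3 h4 h5 => exact h.with_live _

theorem Ok.search {VC : Set (Fin n)} {ρ : ℤ} (hρ : 0 ≤ ρ) {u : Fin n} {σ σ' : PState n}
    (h : Ok N f σ) (hs : Relation.ReflTransGen (SearchStep VC ρ u) σ σ') : Ok N f σ' := by
  induction hs with
  | refl => exact h
  | tail _ h2 ih => exact ih.searchStep hρ h2

theorem Ok.cutAll {u : Fin n} {σ σ' : PState n} (h : Ok N f σ) (hs : CutAll u σ σ') : Ok N f σ' := by
  induction hs with
  | done _ => exact h
  | step hm _ ih => exact ih (h.cut hm.ne_none)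

theorem Ok.createLoop {VC : Set (Fin n)} {d : Fin n → ℕ} {ρ : ℤ} (hρ : 0 ≤ ρ) {σ σ' : PState n}
    (h : Ok N f σ) (hs : CreateLoop VC d ρ σ σ') : Ok N f σ' := by
  induction hs with
  | done _ => exact h
  | build _ _ hp hm hc _ ih =>
    exact ih (((h.search hρ hp.1).transfer hp.2.1 (Ne.symm hp.2.2.2) hm).cutAll hc)
  | fail _ _ hp _ ih => exact ih (h.search hρ hp.1)

theorem ok_startState (hf : N.IsPreflow f) : Ok N f (N.startState f) where
  rooted := fun u => ⟨u, Forest.isRootOf_self rfl⟩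
  r_nonneg := fun a b => by
    have h1 := hf.1 a b
    have h2 := hf.1 b a
    simp only [FlowNetwork.startState, FlowNetwork.res]
    linarith [h1.2, h2.1]
  r_le := fun _ _ => le_rfl
  qok := trivial
  endForest_eq := rfl
  r_eq := fun a b => by simp [FlowNetwork.startState, pathFlow]

theorem Ok.phase {Δ : ℕ} {d : Fin n → ℕ} (hf : N.IsPreflow f) {σ₁ σ₂ : PState n}
    (h : N.PhaseExecution f Δ d σ₁ σ₂) : Ok N f σ₂ := by
  have h1 : Ok N f σ₁ := ((ok_startState hf).with_live _).createLoop (by positivity) h.1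
  exact (h1.with_live _).createLoop le_rfl h.2

/-! ### The length of the queue -/

open Classical in
/-- A number that bounds the length of the queue at the end of an execution. -/
noncomputable def measure (σ : PState n) : ℕ :=
  σ.Q.length + 3 * (Finset.univ.filter (fun p : Fin n × Fin n =>
    0 < σ.r p.1 p.2 ∧ σ.π p.1 ≠ some p.2)).card
    + 2 * (Finset.univ.filter (fun a => σ.π a ≠ none)).card

/-- One queue entry and one vertex with parent are gained, `1 + 2`, and one positive arc outside the
forest is lost, `3`. -/
theorem measure_link {σ : PState n} {v w : Fin n} (hv : σ.π v = none) (hr : 0 < σ.r v w) :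
    (σ.link v w).measure ≤ σ.measure := by
  classical
  unfold measure
  have h1 : (Finset.univ.filter (fun p : Fin n × Fin n =>
      0 < (σ.link v w).r p.1 p.2 ∧ (σ.link v w).π p.1 ≠ some p.2)).card + 1
      ≤ (Finset.univ.filter (fun p : Fin n × Fin n => 0 < σ.r p.1 p.2 ∧ σ.π p.1 ≠ some p.2)).card := by
    rw [← Finset.card_insert_of_notMem (a := (v, w))]
    · apply Finset.card_le_card
      intro p hp
      rcases Finset.mem_insert.1 hp with rfl | hp
      · simp [hr, hv]
      · have hp' := (Finset.mem_filter.1 hp).2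
        refine Finset.mem_filter.2 ⟨Finset.mem_univ _, hp'.1, ?_⟩
        by_cases hpv : p.1 = v
        · rw [hpv, hv]; simp
        · have := hp'.2
          simp only [PState.link] at this
          rwa [Function.update_of_ne hpv] at this
    · intro h'
      exact (Finset.mem_filter.1 h').2.2 (Function.update_self _ _ _)
  have h2 : (Finset.univ.filter (fun a => (σ.link v w).π a ≠ none)).card
      ≤ (Finset.univ.filter (fun a => σ.π a ≠ none)).card + 1 := by
    refine le_trans (Finset.card_le_card ?_) (Finset.card_insert_le v _)
    intro a ha
    by_cases hav : a = v
    · simp [hav]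
    · have ha' := (Finset.mem_filter.1 ha).2
      simp only [PState.link, Function.update_of_ne hav] at ha'
      exact Finset.mem_insert_of_mem (Finset.mem_filter.2 ⟨Finset.mem_univ _, ha'⟩)
  have h3 : (σ.link v w).Q.length = σ.Q.length + 1 := by simp [PState.link]
  omega

/-- The arc that leaves the forest has capacity zero, so the first count does not grow; the balance
is `1 - 2`. -/
theorem measure_cut {σ : PState n} {w b : Fin n} (hw : σ.π w = some b) (hr : σ.r w b = 0) :
    (σ.cut w).measure + 1 ≤ σ.measure := by
  classical
  unfold measure
  have h1 : (Finset.univ.filter (fun p : Fin n × Fin n =>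
      0 < (σ.cut w).r p.1 p.2 ∧ (σ.cut w).π p.1 ≠ some p.2)).card
      ≤ (Finset.univ.filter (fun p : Fin n × Fin n => 0 < σ.r p.1 p.2 ∧ σ.π p.1 ≠ some p.2)).card := by
    apply Finset.card_le_card
    intro p hp
    have hp' := (Finset.mem_filter.1 hp).2
    simp only [PState.cut] at hp'
    refine Finset.mem_filter.2 ⟨Finset.mem_univ _, hp'.1, ?_⟩
    by_cases hpv : p.1 = w
    · rw [hpv, hw]
      intro h'
      have h'' : b = p.2 := by simpa using h'
      have := hp'.1
      rw [hpv, ← h'', hr] at this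
      exact lt_irrefl _ this
    · have := hp'.2
      rwa [Function.update_of_ne hpv] at this
  have h2 : (Finset.univ.filter (fun a => (σ.cut w).π a ≠ none)).card + 1
      ≤ (Finset.univ.filter (fun a => σ.π a ≠ none)).card := by
    rw [← Finset.card_insert_of_notMem (a := w)]
    · apply Finset.card_le_card
      intro a ha
      rcases Finset.mem_insert.1 ha with rfl | ha
      · simp [hw]
      · have ha' := (Finset.mem_filter.1 ha).2
        refine Finset.mem_filter.2 ⟨Finset.mem_univ _, ?_⟩
        by_cases haw : a = w
        · rw [haw, hw]; simp
        · simp only [PState.cut] at ha'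
          rwa [Function.update_of_ne haw] at ha'
    · intro h'
      exact (Finset.mem_filter.1 h').2 (Function.update_self _ _ _)
  have h3 : (σ.cut w).Q.length = σ.Q.length + 1 := by simp [PState.cut]
  omega

theorem measure_transfer {σ : PState n} {u v : Fin n} {δ : ℤ} (hδ : 0 ≤ δ) :
    (σ.transfer u v δ).measure ≤ σ.measure + 1 := by
  classical
  unfold measure
  have h1 : (Finset.univ.filter (fun p : Fin n × Fin n =>
      0 < (σ.transfer u v δ).r p.1 p.2 ∧ (σ.transfer u v δ).π p.1 ≠ some p.2)).card
      ≤ (Finset.univ.filter (fun p : Fin n × Fin n => 0 < σ.r p.1 p.2 ∧ σ.π p.1 ≠ some p.2)).card := by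
    apply Finset.card_le_card
    intro p hp
    have hp' := (Finset.mem_filter.1 hp).2
    refine Finset.mem_filter.2 ⟨Finset.mem_univ _, ?_, hp'.2⟩
    have := hp'.1
    simp only [PState.transfer] at this
    split_ifs at this <;> linarith
  have h3 : (σ.transfer u v δ).Q.length = σ.Q.length + 1 := by simp [PState.transfer]
  have h2 : (Finset.univ.filter (fun a => (σ.transfer u v δ).π a ≠ none)).card
      = (Finset.univ.filter (fun a => σ.π a ≠ none)).card := rfl
  omega

theorem measure_cutAll {u : Fin n} {σ σ' : PState n} (hs : CutAll u σ σ') :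
    σ'.measure ≤ σ.measure ∧ ((∃ w, σ.FindMin u w 0) → σ'.measure + 1 ≤ σ.measure) := by
  induction hs with
  | done h => exact ⟨le_rfl, fun h' => absurd h' h⟩
  | step hm _ ih =>
    obtain ⟨⟨b, hb, hr⟩, -⟩ := hm
    have := measure_cut hb.2 hr
    exact ⟨by omega, fun _ => by omega⟩

theorem measure_search {VC : Set (Fin n)} {ρ : ℤ} (hρ : 0 ≤ ρ) {u : Fin n} {σ σ' : PState n}
    (hs : Relation.ReflTransGen (SearchStep VC ρ u) σ σ') : σ'.measure ≤ σ.measure := by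
  induction hs with
  | refl => exact le_rfl
  | tail _ h2 ih =>
    refine le_trans ?_ ih
    cases h2 with
    | link h1 h2 h3 h4 h5 => exact measure_link h1.2 (hρ.trans_lt h4)
    | discard h1 h2 h3 h4 h5 => exact le_rfl

theorem FindMin.transfer {σ : PState n} {u v w : Fin n} {δ : ℤ} (hm : σ.FindMin u w δ) :
    (σ.transfer u v δ).FindMin u w 0 := by
  obtain ⟨⟨b, hb, hr⟩, hmin⟩ := hm
  refine ⟨⟨b, hb, ?_⟩, ?_⟩
  · simp only [PState.transfer]
    rw [if_pos hb, hr, sub_self]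
  · intro a c hac
    have hac' : σ.π.ArcOnPath u a c := hac
    simp only [PState.transfer]
    rw [if_pos hac']
    have := hmin a c hac'
    linarith

/-- A new pseudoarc adds one to the measure, but it saturates the smallest arc of its path, so at
least one cut follows and takes the unit back. -/
theorem measure_createLoop {VC : Set (Fin n)} {d : Fin n → ℕ} {ρ : ℤ} (hρ : 0 ≤ ρ) {σ σ' : PState n}
    (h : Ok N f σ) (hs : CreateLoop VC d ρ σ σ') : σ'.measure ≤ σ.measure := by
  induction hs with
  | done _ => exact le_rfl
  | @build _ σ₁ _ _ u v _ _ _ _ hp hm hc _ ih =>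
    have h1 := h.search hρ hp.1
    have k1 := ih ((h1.transfer hp.2.1 (Ne.symm hp.2.2.2) hm).cutAll hc)
    have k2 := measure_search hρ hp.1
    have k3 := (measure_cutAll hc).2 ⟨_, hm.transfer⟩
    have k4 := measure_transfer (σ := σ₁) (u := u) (v := v) (hm.nonneg h1)
    exact k1.trans ((Nat.le_of_succ_le_succ (k3.trans k4)).trans k2)
  | fail _ _ hp _ ih => exact (ih (h.search hρ hp.1)).trans (measure_search hρ hp.1)

theorem mem_arcs_of_res_ne_zero (hf : N.IsPreflow f) {a b : Fin n} (h : N.res f a b ≠ 0) :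
    (a, b) ∈ N.A ∨ (b, a) ∈ N.A := by
  by_contra hcon
  push Not at hcon
  have h1 := N.c_eq_zero _ _ hcon.1
  have h2 := N.c_eq_zero _ _ hcon.2
  have h3 := hf.1 a b
  have h4 := hf.1 b a
  apply h
  simp only [FlowNetwork.res]
  omega

/-- A positive residual capacity needs an arc of `A` in one of the two directions: at most `2m`
pairs, each counted three times. -/
theorem measure_startState_le (hf : N.IsPreflow f) : (N.startState f).measure ≤ 6 * N.A.card := by
  classical
  unfold measure
  have e : (Finset.univ.filter (fun p : Fin n × Fin n =>
      0 < (N.startState f).r p.1 p.2 ∧ (N.startState f).π p.1 ≠ some p.2)).card ≤ 2 * N.A.card := by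
    refine le_trans (Finset.card_le_card (t := N.A ∪ N.A.image Prod.swap) ?_) ?_
    · intro p hp
      have hp' := (Finset.mem_filter.1 hp).2
      simp only [Finset.mem_union, Finset.mem_image]
      rcases mem_arcs_of_res_ne_zero hf (a := p.1) (b := p.2) hp'.1.ne' with h' | h'
      · exact Or.inl h'
      · exact Or.inr ⟨(p.2, p.1), h', rfl⟩
    · refine le_trans (Finset.card_union_le _ _) ?_
      have := Finset.card_image_le (s := N.A) (f := Prod.swap)
      omega
  simp only [FlowNetwork.startState, ne_eq, not_true_eq_false, Finset.filter_false,
    Finset.card_empty, List.length_nil] at e ⊢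
  omega

theorem length_queue_le {Δ : ℕ} {d : Fin n → ℕ} (hf : N.IsPreflow f) {σ₁ σ₂ : PState n}
    (h : N.PhaseExecution f Δ d σ₁ σ₂) : σ₂.Q.length ≤ 6 * N.A.card := by
  classical
  have h1 : Ok N f σ₁ := ((ok_startState hf).with_live _).createLoop (by positivity) h.1
  have k1 : σ₂.measure ≤ (PState.mk σ₁.r σ₁.π (N.inArcs f Δ) σ₁.Q).measure :=
    measure_createLoop (N := N) (f := f) le_rfl (h1.with_live (N.inArcs f Δ)) h.2
  have k2 : σ₁.measure ≤ (PState.mk (N.startState f).r (N.startState f).π (N.abArcs f Δ)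
      (N.startState f).Q).measure :=
    measure_createLoop (N := N) (f := f) (by positivity)
      ((ok_startState hf).with_live (N.abArcs f Δ)) h.1
  have k3 := measure_startState_le hf
  have k4 : σ₂.Q.length ≤ σ₂.measure := by unfold measure; omega
  change σ₂.measure ≤ σ₁.measure at k1
  change σ₁.measure ≤ (N.startState f).measure at k2
  omega

end PState

/-! ## The restored preflow -/

section
variable {n : ℕ} {N : FlowNetwork n} {f : Fin n → Fin n → ℤ}

/-- The flow on `(u, v)` after restoring the flow `h` on top of `f`. -/
def restoredFlow (f h : Fin n → Fin n → ℤ) (u v : Fin n) : ℤ :=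
  max (f u v - f v u + h u v - h v u) 0

/-- Taking the positive part of the net flow keeps net flows and excesses and makes the flow
nonnegative. For the capacity, `y` is at most what the pseudoarcs have left of the residual capacity
and the path flow at most what they have taken, so the net flow is at most `c`. -/
theorem PState.Ok.isRestored {Δ : ℕ} {σ : PState n} (hok : PState.Ok N f σ)
    {y : Fin n → Fin n → ℤ} {x : ℕ → ℤ} (hc : IsCompactPreflow N f Δ σ y x) :
    IsRestored N f σ y x
      (restoredFlow f (fun u v => y u v + pathFlow (fun _ => none) σ.Q x u v)) := by
  set p := pathFlow (fun _ => none) σ.Q x with hp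
  have hbd := fun u v => pathFlow_mono (fun _ => none) σ.Q hc.pseudo_bounds u v
  have hnet : ∀ u v, restoredFlow f (fun u v => y u v + p u v) u v
      - restoredFlow f (fun u v => y u v + p u v) v u
      = f u v - f v u + (y u v + p u v) - (y v u + p v u) := by
    intro u v
    simp only [restoredFlow]
    rcases le_total 0 (f u v - f v u + (y u v + p u v) - (y v u + p v u)) with h | h
    · rw [max_eq_left h, max_eq_right (by linarith)]; ring
    · rw [max_eq_right h, max_eq_left (by linarith)]; ring
  refine ⟨⟨fun u v => ⟨le_max_right _ _, max_le ?_ (N.c_nonneg u v)⟩, fun u hs ht => ?_⟩, hnet⟩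
  · have h1 := hbd u v
    have h2 := hbd v u
    have h3 := hok.r_eq u v
    have h4 := (hc.orig_bounds u v).2
    have h5 := (hc.orig_bounds v u).1
    simp only [FlowNetwork.res] at h3
    rw [← hp] at h1 h2
    linarith [h1.2, h2.1]
  · have h1 := hc.excess_nonneg u hs ht
    rw [← excess_pathFlow hok.qok x u, ← hp] at h1
    have e : FlowNetwork.excess (restoredFlow f (fun u v => y u v + p u v)) u
        = FlowNetwork.excess f u + FlowNetwork.excess y u + FlowNetwork.excess p u := by
      simp only [FlowNetwork.excess, ← Finset.sum_sub_distrib, ← Finset.sum_add_distrib]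
      refine Finset.sum_congr rfl fun v _ => ?_
      rw [hnet v u]; ring
    rw [e]
    exact h1

theorem FlowNetwork.Enumerates.length_le {E : List (Fin n × Fin n)} (h : N.Enumerates E) :
    E.length ≤ 2 * N.A.card := by
  classical
  rw [← List.toFinset_card_of_nodup h.1]
  refine le_trans (Finset.card_le_card (t := N.A ∪ N.A.image Prod.swap) ?_) ?_
  · intro p hp
    simp only [Finset.mem_union, Finset.mem_image]
    rcases (h.2 p).1 (List.mem_toFinset.1 hp) with h' | h'
    · exact Or.inl h'
    · exact Or.inr ⟨p.swap, h', Prod.swap_swap p⟩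
  · refine le_trans (Finset.card_union_le _ _) ?_
    have := Finset.card_image_le (s := N.A) (f := Prod.swap)
    omega

theorem FlowNetwork.Enumerates.swap_mem {E : List (Fin n × Fin n)} (h : N.Enumerates E)
    {a : Fin n × Fin n} (ha : a ∈ E) : a.swap ∈ E := by
  rw [h.2] at ha ⊢
  rw [Prod.swap_swap]
  exact ha.symm

theorem FlowNetwork.Enumerates.mem_of_res {E : List (Fin n × Fin n)} (h : N.Enumerates E)
    (hf : N.IsPreflow f) {a b : Fin n} (hr : N.res f a b ≠ 0) : (a, b) ∈ E :=
  (h.2 _).2 (PState.mem_arcs_of_res_ne_zero hf hr)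
end

/-! ## Infeasible vertices -/

theorem Forest.IsRootOf.of_onPath_left {n : ℕ} {π : Forest n} {u v w : Fin n} (h : π.IsRootOf u v)
    (hw : π.OnPath u w) : π.IsRootOf w v := by
  refine ⟨?_, h.2⟩
  induction hw with
  | refl => exact h.1
  | tail _ hpq ih =>
    rcases Forest.OnPath.cases_head ih with rfl | ⟨z, hz, hzv⟩
    · simp [h.2] at hpq
    · rw [hpq] at hz
      cases hz
      exact hzv

namespace PState

variable {n : ℕ} {VC : Set (Fin n)} {d : Fin n → ℕ} {ρ : ℤ} {σ σ' : PState n} {u u' v' w : Fin n}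

/-- The search from `u`, which has arrived at `v`, can not be continued. -/
def Dead (VC : Set (Fin n)) (ρ : ℤ) (σ : PState n) (u v : Fin n) : Prop :=
  σ.π.IsRootOf u v ∧ (v ∈ VC → v = u) ∧ ∀ w, (v, w) ∈ σ.live → σ.r v w ≤ ρ

theorem Dead.not_feasible (h : Dead VC ρ σ u v') : ¬ Feasible VC ρ σ u := by
  rintro ⟨-, v, hv, hc⟩
  obtain rfl := hv.unique h.1
  rcases hc with ⟨h1, h2⟩ | ⟨w, h1, h2⟩
  · exact h2 (h.2.1 h1)
  · exact absurd (h.2.2 w h1) (not_le.2 h2)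

/-- A link starts at a root with a usable arc, hence never at the dead end `v'`; discarding only
removes arcs. -/
theorem Dead.searchStep (h : Dead VC ρ σ u' v') (hs : SearchStep VC ρ u σ σ') :
    Dead VC ρ σ' u' v' := by
  cases hs with
  | @link v w h1 h2 h3 h4 h5 =>
    have hne : v' ≠ v := by
      rintro rfl
      exact absurd (h.2.2 w h3) (not_le.2 h4)
    exact ⟨h.1.update_some h1.2 hne, h.2.1, h.2.2⟩
  | discard h1 h2 h3 h4 h5 => exact ⟨h.1, h.2.1, fun w hw => h.2.2 w hw.1⟩

theorem Dead.transfer (h : Dead VC ρ σ u' v') {δ : ℤ} (hδ : 0 ≤ δ) (v : Fin n) :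
    Dead VC ρ (σ.transfer u v δ) u' v' := by
  refine ⟨h.1, h.2.1, fun w hw => ?_⟩
  have := h.2.2 w hw
  simp only [PState.transfer]
  split_ifs <;> linarith

/-- All cuts lie on the path of `u`. If the path of `u'` met one of them, both would end at `v'`;
then by `hu` the vertex `u'` is itself a root, and a root is never cut. -/
theorem Dead.cutAll (h : Dead VC ρ σ u' v') (hu : σ.π.IsRootOf u v' → u' = v')
    (hs : CutAll u σ σ') : Dead VC ρ σ' u' v' := by
  induction hs with
  | done _ => exact h
  | @step σ σ' w hm _ ih =>
    obtain ⟨⟨b, hb, -⟩, -⟩ := hm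
    have hw : ¬ σ.π.OnPath u' w := by
      intro hw
      have hwv : σ.π.IsRootOf w v' := h.1.of_onPath_left hw
      have := hu (Forest.IsRootOf.of_onPath hb.1 hwv)
      subst this
      rw [Forest.onPath_iff_of_eq_none h.1.2] at hw
      subst hw
      exact absurd hb.2 (by simp [h.1.2])
    refine ih ⟨h.1.update_none hw, h.2.1, h.2.2⟩ ?_
    intro hr
    have := hr.unique (Forest.OnPath.isRootOf_update_none hb.1)
    subst this
    exact absurd h.1.1 hw

theorem Feasible.of_searchStep (hu : u ∈ VC) (hs : SearchStep VC ρ u σ σ') : Feasible VC ρ σ u := by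
  cases hs with
  | link h1 h2 h3 h4 h5 => exact ⟨hu, _, h1, Or.inr ⟨_, h3, h4⟩⟩
  | discard h1 h2 h3 h4 h5 => exact ⟨hu, _, h1, Or.inr ⟨_, h3, h4⟩⟩

theorem Feasible.of_search (h : Feasible VC ρ σ' u)
    (hs : Relation.ReflTransGen (SearchStep VC ρ u) σ σ') : Feasible VC ρ σ u := by
  rcases hs.cases_head with rfl | ⟨σ₁, h1, -⟩
  · exact h
  · exact Feasible.of_searchStep h.1 h1

/-- The rounds of the loop that lead from one state to another. -/
def CreateRounds (VC : Set (Fin n)) (d : Fin n → ℕ) (ρ : ℤ) (σ σ' : PState n) : Prop :=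
  ∀ τ, CreateLoop VC d ρ σ' τ → CreateLoop VC d ρ σ τ

theorem CreateRounds.refl (σ : PState n) : CreateRounds VC d ρ σ σ := fun _ h => h

/-- The cuts that lead from one state to another. -/
def CutRounds (u : Fin n) (σ σ' : PState n) : Prop :=
  ∀ τ, CutAll u σ' τ → CutAll u σ τ

/-! ### Weights -/

open Classical in
/-- A number that decreases when links or cuts are made. -/
noncomputable def weight (σ : PState n) : ℕ :=
  3 * (Finset.univ.filter (fun p : Fin n × Fin n =>
    0 < σ.r p.1 p.2 ∧ σ.π p.1 ≠ some p.2)).card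
    + 2 * (Finset.univ.filter (fun a => σ.π a ≠ none)).card

theorem measure_eq (σ : PState n) : σ.measure = σ.Q.length + σ.weight := by
  unfold measure weight; omega

theorem weight_link {v : Fin n} (hv : σ.π v = none) (hr : 0 < σ.r v w) :
    (σ.link v w).weight + 1 ≤ σ.weight := by
  have h1 := measure_link hv hr
  have h3 : (σ.link v w).Q.length = σ.Q.length + 1 := by simp [PState.link]
  rw [measure_eq, measure_eq] at h1
  omega

theorem weight_cut {b : Fin n} (hw : σ.π w = some b) (hr : σ.r w b = 0) :
    (σ.cut w).weight + 2 ≤ σ.weight := by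
  have h1 := measure_cut hw hr
  have h3 : (σ.cut w).Q.length = σ.Q.length + 1 := by simp [PState.cut]
  rw [measure_eq, measure_eq] at h1
  omega

theorem weight_transfer {v : Fin n} {δ : ℤ} (hδ : 0 ≤ δ) :
    (σ.transfer u v δ).weight ≤ σ.weight := by
  have h1 := measure_transfer (σ := σ) (u := u) (v := v) hδ
  have h3 : (σ.transfer u v δ).Q.length = σ.Q.length + 1 := by simp [PState.transfer]
  rw [measure_eq, measure_eq] at h1
  omega

theorem weight_startState_le {N : FlowNetwork n} {f : Fin n → Fin n → ℤ} (hf : N.IsPreflow f) :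
    (N.startState f).weight ≤ 6 * N.A.card := by
  have := measure_startState_le hf
  rw [measure_eq] at this
  omega

end PState

/-! ## Counting loops -/

/-- A loop with `N` rounds, each of which takes amortized time `c`. -/
theorem Wp.loop_count {b : Test} {p : Cmd} (J : ℕ → ℝ → RState → Prop) (N : ℕ) (c : ℝ) (hc : 0 ≤ c)
    (hJ : ∀ i φ S, J i φ S → 0 ≤ φ ∧ i ≤ N ∧ (b.Holds S ↔ i < N))
    (body : ∀ i φ S, i < N → J i φ S →
      Wp p S (fun T S' => ∃ φ', J (i + 1) φ' S' ∧ T ≤ c - (φ' - φ)))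
    {φ : ℝ} {S : RState} (h : J 0 φ S) :
    Wp (.loop b p) S (fun T S' => ∃ φ', J N φ' S' ∧ T ≤ N * (c + 1) + 1 - (φ' - φ)) := by
  refine Wp.mono (Wp.loop (α := ℕ × ℝ) (fun a S => J a.1 a.2 S)
    (fun a => ((N : ℝ) - a.1) * (c + 1) + a.2) ?_ ?_ (a := (0, φ)) h) ?_
  · rintro ⟨i, φ⟩ S h
    obtain ⟨h1, h2, -⟩ := hJ i φ S h
    have : (i : ℝ) ≤ N := by exact_mod_cast h2
    have : 0 ≤ ((N : ℝ) - i) * (c + 1) := mul_nonneg (by linarith) (by linarith)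
    simp only
    linarith
  · rintro ⟨i, φ⟩ S h hb
    have hi := (hJ i φ S h).2.2.1 hb
    refine Wp.mono (body i φ S hi h) ?_
    rintro T S' ⟨φ', h1, h2⟩
    refine ⟨(i + 1, φ'), h1, ?_⟩
    push_cast
    linarith
  · rintro T S' ⟨⟨i, φ'⟩, h1, h2, h3⟩
    obtain ⟨-, h4, h5⟩ := hJ i φ' S' h1
    have : i = N := le_antisymm h4 (not_lt.1 fun h' => h2 (h5.2 h'))
    subst this
    refine ⟨φ', h1, ?_⟩
    simp only [Nat.cast_zero] at h3
    linarith

/-! ## Memory cells with nonnegative addresses -/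

/-- The state after setting a memory cell. -/
def RState.setM (S : RState) (a v : ℤ) : RState := { S with mem := Function.update S.mem a v }

@[simp] theorem RState.reg_setM (S : RState) (a v : ℤ) : (S.setM a v).reg = S.reg := rfl

@[simp] theorem RState.mem_setM (S : RState) (a v b : ℤ) :
    (S.setM a v).mem b = if b = a then v else S.mem b := by
  simp only [RState.setM, Function.update_apply]

theorem RState.fld_setM (S : RState) {a v j i : ℤ} (ha : 0 ≤ a) (hj : 0 ≤ j) (hi : 0 ≤ i) :
    (S.setM a v).fld j i = S.fld j i := by
  have := fadr_neg hj hi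
  simp only [RState.fld, RState.mem_setM]
  rw [if_neg (by omega)]

@[simp] theorem Cmd.run_store (a e : Expr) (S : RState) :
    (Cmd.store a e).run S = S.setM (a.eval S) (e.eval S) := rfl

/-! ## Initialization of a link-cut forest -/

section
variable {n : ℕ}

/-- The link-cut forest of isolated nodes with value zero. -/
noncomputable def Conf.initial (n : ℕ) : Conf (Fin n) where
  ch := fun _ _ => none
  par := fun _ => none
  tag := fun _ => 0
  sv := fun _ => 0
  sm := fun _ => 0
  am := fun v => v
  hd := fun v => v
  s := fun _ => 1
  lst := fun v => [v]
  off := fun _ => 0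

theorem Conf.inv_initial : Conf.Inv (fun _ => none) (fun _ => 0) (Conf.initial n) where
  par_ch := by simp [Conf.initial]
  ch_ne := by simp [Conf.initial]
  s_pos := by simp [Conf.initial]
  size := by simp [Conf.initial]
  lst_eq := by simp [Conf.initial, Conf.lstO]
  chain := by simp [Conf.initial]
  head := by simp [Conf.initial]
  off_ch := by simp [Conf.initial]
  off_root := by simp [Conf.initial]
  val_eq := by simp [Conf.initial]
  agg := by simp [Conf.initial, Conf.AggOK]

open Expr in
def initBody : Cmd := .seqs [.setf (lit 0) (reg 21) (lit 0), .setf (lit 1) (reg 21) (lit 0),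
  .setf (lit 2) (reg 21) (lit 0), .setf (lit 3) (reg 21) (lit 0), .setf (lit 4) (reg 21) (lit 0),
  .setf (lit 5) (reg 21) (lit 0), .setf (lit 6) (reg 21) (reg 21), .setf (lit 7) (reg 21) (reg 21),
  .assign 21 (add (reg 21) (lit 1))]

/-- Make the link-cut forest of as many isolated nodes as register `20` says. -/
def initCmd : Cmd := .seq (.assign 21 (.lit 0))
  (.loop (.lt (.reg 21) (.add (.reg 20) (.lit 1))) initBody)

theorem initCmd_spec {S : RState} (h20 : S.reg 20 = n) :
    Wp initCmd S (fun T S' => LctAt S' (fun _ : Fin n => none) (fun _ => 0) 0 ∧ Frame 20 S S' ∧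
      T ≤ 20 * (n : ℝ) + 20) := by
  refine Wp.seq (Wp.assign ?_)
  -- There are `n + 1` rounds: item `0` is the null item, and the vertex `v` is item `v + 1`.
  refine Wp.mono (Wp.loop_count (fun i φ S' => φ = 0 ∧ i ≤ n + 1 ∧ Frame 20 S S' ∧ S'.reg 20 = n ∧
    S'.reg 21 = i ∧ ∀ k : ℕ, k < i → (∀ j : ℤ, 0 ≤ j → j < 6 → S'.fld j k = 0) ∧
      S'.fld 6 k = k ∧ S'.fld 7 k = k) (n + 1) 9 (by norm_num) ?_ ?_ (φ := 0) ?_) ?_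
  · rintro i φ S' ⟨rfl, h1, h2, h3, h4, h5⟩
    refine ⟨le_rfl, h1, ?_⟩
    simp only [Test.Holds, Expr.eval, h3, h4]
    omega
  · rintro i φ S' hi ⟨rfl, h1, h2, h3, h4, h5⟩
    refine Wp.of_run (by decide) (fun T hT => ⟨0, ⟨rfl, hi, ?_, ?_, ?_, ?_⟩, ?_⟩)
    · refine h2.trans ?_
      simp only [initBody, Cmd.seqs, Cmd.run_seq, Cmd.run_setf, Cmd.run_assign]
      have hS : (0 : ℤ) ≤ i := by omega
      simp only [Expr.eval, RState.reg_setF, h4]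
      refine Frame.trans ?_ (Frame.setR _ _ (by norm_num))
      iterate 8 refine Frame.trans ?_ (Frame.setF _ _ (by norm_num) (by norm_num) hS)
      exact Frame.refl _ _
    · simp [initBody, h3]
    · simp [initBody, h4]
    · intro k hk
      rcases Nat.lt_succ_iff_lt_or_eq.1 hk with hk | rfl
      · obtain ⟨g1, g2, g3⟩ := h5 k hk
        have hne : ¬ ((k : ℤ) = i) := by omega
        refine ⟨fun j hj hj' => ?_, ?_, ?_⟩
        · interval_cases j <;> simp [initBody, h4, hne, g1]
        · simp [initBody, h4, hne, g2]
        · simp [initBody, h4, hne, g3]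
      · refine ⟨fun j hj hj' => ?_, ?_, ?_⟩
        · interval_cases j <;> simp [initBody, h4]
        · simp [initBody, h4]
        · simp [initBody, h4]
    · have : initBody.cost ≤ 9 := by decide
      have : (initBody.cost : ℝ) ≤ 9 := by exact_mod_cast this
      linarith
  · refine ⟨rfl, by omega, Frame.setR _ _ (by norm_num), ?_, ?_, by simp⟩
    · simp [h20]
    · simp
  · rintro T S' ⟨φ, ⟨rfl, h1, h2, h3, h4, h5⟩, hT⟩
    refine ⟨⟨Conf.initial n, ?_, Conf.inv_initial, by simp [Conf.pot, Conf.initial]⟩, h2, ?_⟩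
    · have hv : ∀ v : Fin n, vid v = (((v : ℕ) + 1 : ℕ) : ℤ) := fun v => by simp [vid]
      have hl : ∀ v : Fin n, (v : ℕ) + 1 < n + 1 := fun v => by omega
      constructor <;> intros
      any_goals (rw [hv, (h5 _ (hl _)).1 _ (by norm_num) (by norm_num)]; rfl)
      · rw [hv, (h5 _ (hl _)).2.1, ← hv]; rfl
      · rw [hv, (h5 _ (hl _)).2.2, ← hv]; rfl
      · exact (h5 0 (by omega)).1 0 (by norm_num) (by norm_num)
      · exact (h5 0 (by omega)).1 1 (by norm_num) (by norm_num)
    · push_cast at hT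
      linarith
end

/-! ## Lists of blocks -/

theorem List.getElem?_flatMap_block {α β : Type*} {g : α → List β} {k : ℕ} (hg : ∀ a, (g a).length = k)
    (l : List α) (i t : ℕ) (ht : t < k) (hi : i < l.length) :
    (l.flatMap g)[k * i + t]? = (g l[i])[t]? := by
  induction l generalizing i with
  | nil => simp at hi
  | cons a l ih =>
    rw [List.flatMap_cons]
    cases i with
    | zero => simp [List.getElem?_append_left, hg, ht]
    | succ i =>
      rw [List.getElem?_append_right (by rw [hg]; nlinarith), hg]
      have : k * (i + 1) + t - k = k * i + t := by rw [Nat.mul_add]; omega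
      rw [this, ih i (by simpa using hi)]
      simp

theorem List.length_flatMap_block {α β : Type*} {g : α → List β} {k : ℕ} (hg : ∀ a, (g a).length = k)
    (l : List α) : (l.flatMap g).length = k * l.length := by
  induction l with
  | nil => simp
  | cons a l ih => rw [List.flatMap_cons, List.length_append, hg, ih, List.length_cons]; ring

/-! ## The input of restore-all-flows in memory -/

theorem RState.start_mem (input : List ℤ) (a : ℕ) :
    (RState.start input).mem (a : ℤ) = input.getD a 0 := by
  simp [RState.start]

theorem List.getD_append_block {l₁ l₂ l₃ : List ℤ} {a b : ℕ} (h : a = l₁.length + b)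
    (hb : b < l₂.length) : (l₁ ++ l₂ ++ l₃).getD a 0 = l₂.getD b 0 := by
  subst h
  rw [List.append_assoc, List.getD_append_right _ _ _ _ (by omega), List.getD_append _ _ _ _ (by omega)]
  congr 1
  omega

section
variable {n : ℕ}

/-- The row of a queue entry with its flow. -/
def opRow (E : List (Fin n × Fin n)) : Op n → ℤ → List ℤ
  | .transfer u v δ, x => encOp E (.transfer u v δ) ++ [x]
  | φ, _ => encOp E φ ++ [0]

theorem length_opRow (E : List (Fin n × Fin n)) (φ : Op n) (x : ℤ) : (opRow E φ x).length = 5 := by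
  cases φ <;> rfl

theorem encFlows_cons (E : List (Fin n × Fin n)) (φ : Op n) (Q : List (Op n)) (x : ℕ → ℤ) :
    encFlows E (φ :: Q) x = opRow E φ (x 0) ++ encFlows E Q (fun k => x (k + 1)) := by
  cases φ <;> rfl

theorem getD_encFlows (E : List (Fin n × Fin n)) (Q : List (Op n)) (x : ℕ → ℤ) (k t : ℕ) (ht : t < 5)
    (hk : k < Q.length) : (encFlows E Q x).getD (5 * k + t) 0 = (opRow E Q[k] (x k)).getD t 0 := by
  induction Q generalizing x k with
  | nil => simp at hk
  | cons φ Q ih =>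
    rw [encFlows_cons]
    cases k with
    | zero => rw [List.getD_append _ _ _ _ (by rw [length_opRow]; omega)]; simp
    | succ k =>
      rw [List.getD_append_right _ _ _ _ (by rw [length_opRow]; omega), length_opRow,
        show 5 * (k + 1) + t - 5 = 5 * k + t by omega, ih _ _ (by simpa using hk)]
      simp

/-- The memory holds the input of restore-all-flows. -/
structure RestoreMem (f : Fin n → Fin n → ℤ) (E : List (Fin n × Fin n)) (Q : List (Op n))
    (y : Fin n → Fin n → ℤ) (x : ℕ → ℤ) (S : RState) : Prop where
  mem0 : S.mem 0 = n
  mem1 : S.mem 1 = E.length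
  mem2 : S.mem 2 = Q.length
  tail : ∀ (j : ℕ) (hj : j < E.length), S.mem (3 + 5 * j) = vtx E[j].1
  head : ∀ (j : ℕ) (hj : j < E.length), S.mem (3 + 5 * j + 1) = vtx E[j].2
  rev : ∀ (j : ℕ) (hj : j < E.length), S.mem (3 + 5 * j + 2) = E.idxOf E[j].swap
  flow : ∀ (j : ℕ) (hj : j < E.length), S.mem (3 + 5 * j + 3) = f E[j].1 E[j].2
  orig : ∀ (j : ℕ) (hj : j < E.length), S.mem (3 + 5 * j + 4) = y E[j].1 E[j].2
  row : ∀ (k t : ℕ) (hk : k < Q.length), t < 5 →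
    S.mem (3 + 5 * E.length + 5 * k + t) = (opRow E Q[k] (x k)).getD t 0

variable {f : Fin n → Fin n → ℤ} {E : List (Fin n × Fin n)} {Q : List (Op n)}
  {y : Fin n → Fin n → ℤ} {x : ℕ → ℤ} {S S' : RState}

theorem restoreMem_start : RestoreMem f E Q y x (RState.start (restoreInput f E Q y x)) := by
  set g : Fin n × Fin n → List ℤ := fun a =>
    [vtx a.1, vtx a.2, (E.idxOf a.swap : ℤ), f a.1 a.2, y a.1 a.2] with hg
  have hlen : ∀ a, (g a).length = 5 := fun a => rfl
  have hE := List.length_flatMap_block hlen E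
  have key : ∀ (j t : ℕ) (hj : j < E.length), t < 5 →
      (RState.start (restoreInput f E Q y x)).mem ((3 + 5 * j + t : ℕ) : ℤ) = (g E[j]).getD t 0 := by
    intro j t hj ht
    rw [RState.start_mem]
    refine (List.getD_append_block (l₂ := E.flatMap g) (b := 5 * j + t) ?_ ?_).trans ?_
    · simp; omega
    · rw [hE]; omega
    · rw [List.getD_eq_getElem?_getD, List.getElem?_flatMap_block hlen E j t ht hj,
        ← List.getD_eq_getElem?_getD]
  constructor
  · exact RState.start_mem _ 0
  · exact RState.start_mem _ 1
  · exact RState.start_mem _ 2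
  · intro j hj; simpa [hg] using key j 0 hj (by norm_num)
  · intro j hj; simpa [hg] using key j 1 hj (by norm_num)
  · intro j hj; simpa [hg] using key j 2 hj (by norm_num)
  · intro j hj; simpa [hg] using key j 3 hj (by norm_num)
  · intro j hj; simpa [hg] using key j 4 hj (by norm_num)
  · intro k t hk ht
    have := RState.start_mem (restoreInput f E Q y x) (3 + 5 * E.length + 5 * k + t)
    push_cast at this
    rw [this, ← getD_encFlows E Q x k t ht hk]
    unfold restoreInput
    rw [List.getD_append_right _ _ _ _ (by simp only [List.length_append]; simp; omega)]
    congr 1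
    simp only [List.length_append]
    simp; omega

theorem RestoreMem.congr (h : RestoreMem f E Q y x S)
    (hm : ∀ a : ℤ, 0 ≤ a → a < 3 + 5 * E.length + 5 * Q.length → S'.mem a = S.mem a) :
    RestoreMem f E Q y x S' := by
  constructor
  · rw [hm _ (by norm_num) (by omega)]; exact h.mem0
  · rw [hm _ (by norm_num) (by omega)]; exact h.mem1
  · rw [hm _ (by norm_num) (by omega)]; exact h.mem2
  · intro j hj; rw [hm _ (by omega) (by omega)]; exact h.tail j hj
  · intro j hj; rw [hm _ (by omega) (by omega)]; exact h.head j hj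
  · intro j hj; rw [hm _ (by omega) (by omega)]; exact h.rev j hj
  · intro j hj; rw [hm _ (by omega) (by omega)]; exact h.flow j hj
  · intro j hj; rw [hm _ (by omega) (by omega)]; exact h.orig j hj
  · intro k t hk ht; rw [hm _ (by omega) (by omega)]; exact h.row k t hk ht

/-! ## The flows during restore-all-flows -/

/-- The arc of each node (field `11`) and the accumulated flows (field `12`), together with the values
`val` of the link-cut forest for `π`, stand for the flow `p` on the arcs. -/
structure FlowRep (E : List (Fin n × Fin n)) (π : Forest n) (val : Fin n → ℤ)
    (p : Fin n → Fin n → ℤ) (S : RState) : Prop where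
  arc_nonneg : ∀ a : Fin n, 0 ≤ S.fld 11 (vid a)
  arc_tail : ∀ (a : Fin n) (j : ℕ) (hj : j < E.length), S.fld 11 (vid a) = j + 1 → E[j].1 = a
  arc_eq : ∀ a b, π a = some b → ∃ (j : ℕ) (hj : j < E.length), E[j] = (a, b) ∧
    S.fld 11 (vid a) = j + 1
  val_root : ∀ a, π a = none → val a = 0
  flow : ∀ (j : ℕ) (hj : j < E.length), p E[j].1 E[j].2
    = S.fld 12 (j + 1) + if S.fld 11 (vid E[j].1) = j + 1 then val E[j].1 else 0

variable {π : Forest n} {val : Fin n → ℤ} {p : Fin n → Fin n → ℤ}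

theorem FlowRep.congr (h : FlowRep E π val p S) (h11 : ∀ i, S'.fld 11 i = S.fld 11 i)
    (h12 : ∀ i, S'.fld 12 i = S.fld 12 i) : FlowRep E π val p S' := by
  constructor <;> try simp only [h11, h12]
  exacts [h.arc_nonneg, h.arc_tail, h.arc_eq, h.val_root, h.flow]

/-- As a root `v` has value zero, so nothing is lost when the arc stored for it earlier is
overwritten. -/
theorem FlowRep.link (h : FlowRep E π val p S) {v w : Fin n} (hv : π v = none) {j : ℕ}
    (hj : j < E.length) (hjE : E[j] = (v, w)) :
    FlowRep E (Function.update π v (some w)) (Function.update val v 0) p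
      (S.setF 11 (vid v) (j + 1)) := by
  have hval : Function.update val v 0 = val := by
    rw [Function.update_eq_self_iff, h.val_root v hv]
  rw [hval]
  constructor
  · intro a
    rw [RState.fld_setF _ (by norm_num) (by norm_num) (by norm_num) (by norm_num)]
    split_ifs
    · omega
    · exact h.arc_nonneg a
  · intro a i hi
    rw [RState.fld_setF _ (by norm_num) (by norm_num) (by norm_num) (by norm_num)]
    split_ifs with hc
    · intro hij
      have : i = j := by omega
      subst this
      rw [hjE]
      exact (vid_inj.1 hc.2).symm
    · exact h.arc_tail a i hi
  · intro a b hab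
    rw [RState.fld_setF _ (by norm_num) (by norm_num) (by norm_num) (by norm_num)]
    by_cases hav : a = v
    · subst hav
      simp only [Function.update_self, Option.some.injEq] at hab
      subst hab
      exact ⟨j, hj, hjE, by simp⟩
    · rw [Function.update_of_ne hav] at hab
      simpa [hav] using h.arc_eq a b hab
  · intro a ha
    by_cases hav : a = v
    · subst hav; simp at ha
    · rw [Function.update_of_ne hav] at ha
      exact h.val_root a ha
  · intro i hi
    have h1 := h.flow i hi
    rw [RState.fld_setF _ (by norm_num) (by norm_num) (by norm_num) (by norm_num),
      RState.fld_setF _ (by norm_num) (by norm_num) (by norm_num) (by norm_num)]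
    by_cases hiv : E[i].1 = v
    · have h0 := h.val_root v hv
      rw [hiv, h0] at h1 ⊢
      simpa using h1
    · simpa [hiv] using h1

/-- If the node never had an arc, its field `11` is zero and the sum goes to item `0`, which stands
for no arc because positions are shifted by one. -/
theorem FlowRep.flush (h : FlowRep E π val p S) (w : Fin n) :
    FlowRep E π (Function.update val w 0) p
      (S.setF 12 (S.fld 11 (vid w)) (S.fld 12 (S.fld 11 (vid w)) + val w)) := by
  have e11 : ∀ i, (S.setF 12 (S.fld 11 (vid w)) (S.fld 12 (S.fld 11 (vid w)) + val w)).fld 11 i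
      = S.fld 11 i := fun i => by
    rw [RState.fld_setF _ (by norm_num) (by norm_num) (by norm_num) (by norm_num)]; simp
  constructor <;> try simp only [e11]
  · exact h.arc_nonneg
  · exact h.arc_tail
  · exact h.arc_eq
  · intro a ha
    rw [Function.update_apply]
    split_ifs
    · rfl
    · exact h.val_root a ha
  · intro j hj
    rw [RState.fld_setF _ (by norm_num) (by norm_num) (by norm_num) (by norm_num)]
    have h1 := h.flow j hj
    by_cases hw : S.fld 11 (vid w) = j + 1
    · have h2 := h.arc_tail w j hj hw
      rw [h2, if_pos hw] at h1
      rw [if_pos ⟨rfl, hw.symm⟩, h2, Function.update_self, h1, hw]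
      simp
    · rw [if_neg (by simpa using fun h' => hw h'.symm)]
      by_cases hjw : E[j].1 = w
      · rw [hjw, if_neg hw] at h1 ⊢
        exact h1
      · rw [Function.update_of_ne hjw]
        exact h1

theorem FlowRep.cut (h : FlowRep E π val p S) {w : Fin n} (hw : val w = 0) :
    FlowRep E (Function.update π w none) val p S where
  arc_nonneg := h.arc_nonneg
  arc_tail := h.arc_tail
  arc_eq := by
    intro a b hab
    by_cases haw : a = w
    · subst haw; simp at hab
    · rw [Function.update_of_ne haw] at hab
      exact h.arc_eq a b hab
  val_root := by
    intro a ha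
    by_cases haw : a = w
    · rw [haw, hw]
    · rw [Function.update_of_ne haw] at ha
      exact h.val_root a ha
  flow := h.flow

open Classical in
-- Every arc of the path is the current arc of its tail, and `E` has no repetitions. Adding `z` to
-- the values on the path therefore adds `z` to the flow on exactly these arcs.
theorem FlowRep.transfer (h : FlowRep E π val p S) (hE : E.Nodup) (u : Fin n) (z : ℤ) :
    FlowRep E π (fun a => if ∃ b, π.ArcOnPath u a b then val a + z else val a)
      (fun a b => p a b + if π.ArcOnPath u a b then z else 0) S where
  arc_nonneg := h.arc_nonneg
  arc_tail := h.arc_tail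
  arc_eq := h.arc_eq
  val_root := by
    intro a ha
    rw [if_neg]
    · exact h.val_root a ha
    · rintro ⟨b, hb⟩
      exact absurd hb.2 (by simp [ha])
  flow := by
    intro j hj
    have h1 := h.flow j hj
    by_cases hc : π.ArcOnPath u E[j].1 E[j].2
    · obtain ⟨i, hi, h2, h3⟩ := h.arc_eq _ _ hc.2
      have hij : i = j := (List.Nodup.getElem_inj_iff hE).1 h2
      subst hij
      rw [if_pos hc, if_pos h3, if_pos (show ∃ b, π.ArcOnPath u E[i].1 b from ⟨_, hc⟩), h1, if_pos h3]
      ring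
    · rw [if_neg hc]
      by_cases ha : S.fld 11 (vid E[j].1) = j + 1
      · rw [if_pos ha] at h1 ⊢
        rw [if_neg, h1, add_zero]
        rintro ⟨b, hb⟩
        obtain ⟨i, hi, h2, h3⟩ := h.arc_eq _ _ hb.2
        have hij : i = j := by omega
        subst hij
        have h4 : E[i].2 = b := congrArg Prod.snd h2
        exact hc (h4 ▸ hb)
      · rw [if_neg ha] at h1 ⊢
        rw [h1, add_zero, add_zero]
end

/-! ## The program for restore-all-flows -/

section
open Expr

/-- Five times an expression. -/
def Expr.mul5 (e : Expr) : Expr := .add e (.add (.add e e) (.add e e))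

@[simp] theorem Expr.eval_mul5 (S : RState) (e : Expr) : (Expr.mul5 e).eval S = 5 * e.eval S := by
  simp only [Expr.mul5, Expr.eval]; ring

def restoreLinkPre : Cmd := .seqs [.assign 6 (load (add (reg 4) (lit 1))),
  .assign 7 (add (lit 3) (mul5 (reg 6))), .assign 20 (add (load (reg 7)) (lit 1)),
  .assign 21 (add (load (add (reg 7) (lit 1))) (lit 1)), .assign 22 (lit 0),
  .setf (lit 11) (reg 20) (add (reg 6) (lit 1))]

def flushPost : Cmd := .setf (lit 12) (fl (lit 11) (reg 20)) (add (fl (lit 12) (fl (lit 11) (reg 20))) (reg 23))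

/-- Move the value of the node in register `20` to its arc. -/
def flushCmd : Cmd := .seq (.assign 22 (lit 0)) (.seq setvalCmd flushPost)

def nextOp : Cmd := .seq (.assign 4 (add (reg 4) (lit 5))) (.assign 5 (add (reg 5) (lit 1)))

/-- Carry out the queue entry at the address in register `4`. -/
def restoreOp : Cmd :=
  .ite (.eq (load (reg 4)) (lit 0)) (.seq restoreLinkPre (.seq linkCmd nextOp))
    (.ite (.eq (load (reg 4)) (lit 1))
      (.seq (.assign 20 (add (load (add (reg 4) (lit 1))) (lit 1)))
        (.seq flushCmd (.seq cutCmd nextOp)))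
      (.seq (.seq (.assign 20 (add (load (add (reg 4) (lit 1))) (lit 1)))
        (.assign 22 (load (add (reg 4) (lit 4))))) (.seq addCmd nextOp)))

def restoreOut : Cmd := .seqs [.assign 7 (add (lit 3) (mul5 (reg 5))),
  .assign 8 (load (add (reg 7) (lit 2))),
  .assign 9 (add (lit 3) (mul5 (reg 8))),
  .assign 6 (sub (add (sub (load (add (reg 7) (lit 3))) (load (add (reg 9) (lit 3))))
    (add (load (add (reg 7) (lit 4))) (fl (lit 12) (add (reg 5) (lit 1)))))
    (add (load (add (reg 9) (lit 4))) (fl (lit 12) (add (reg 8) (lit 1))))),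
  .ite (.lt (reg 6) (lit 0)) (.assign 6 (lit 0)) .skip,
  .store (add (reg 0) (reg 5)) (reg 6),
  .assign 5 (add (reg 5) (lit 1))]

def restoreHeader : Cmd := .seqs [.assign 1 (load (lit 0)), .assign 2 (load (lit 1)),
  .assign 3 (load (lit 2)), .assign 4 (add (lit 3) (mul5 (reg 2))),
  .assign 0 (add (reg 4) (mul5 (reg 3))), .assign 20 (reg 1)]

/-- The program for restore-all-flows. -/
def restoreCmd : Cmd := .seqs [restoreHeader, initCmd, .assign 5 (lit 0),
  .loop (.lt (reg 5) (reg 3)) restoreOp, .assign 5 (lit 0),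
  .loop (.lt (reg 5) (reg 1)) (.seqs [.assign 20 (add (reg 5) (lit 1)), flushCmd,
    .assign 5 (add (reg 5) (lit 1))]), .assign 5 (lit 0),
  .loop (.lt (reg 5) (reg 2)) restoreOut]
end

/-! ### Correctness and time of restore-all-flows -/

section
variable {n : ℕ} {f : Fin n → Fin n → ℤ} {E : List (Fin n × Fin n)} {Q : List (Op n)}
  {y : Fin n → Fin n → ℤ} {x : ℕ → ℤ} {S S' : RState} {π : Forest n} {val : Fin n → ℤ}
  {p : Fin n → Fin n → ℤ} {φ : ℝ}

theorem Wp.run_seq {p q : Cmd} {S : RState} {Q : ℝ → RState → Prop} (h : p.loopFree = true)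
    (hQ : ∀ T₁ : ℝ, T₁ ≤ p.cost → Wp q (p.run S) (fun T₂ S₂ => Q (T₁ + T₂) S₂)) : Wp (.seq p q) S Q :=
  Wp.seq (Wp.of_run h hQ)

/-- What the loops of restore-all-flows keep. -/
structure RestoreInv (f : Fin n → Fin n → ℤ) (E : List (Fin n × Fin n)) (Q : List (Op n))
    (y : Fin n → Fin n → ℤ) (x : ℕ → ℤ) (S : RState) : Prop where
  mem : RestoreMem f E Q y x S
  reg0 : S.reg 0 = 3 + 5 * E.length + 5 * Q.length
  reg1 : S.reg 1 = n
  reg2 : S.reg 2 = E.length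
  reg3 : S.reg 3 = Q.length

theorem RestoreInv.frame (h : RestoreInv f E Q y x S) {k : ℕ} (hk : 4 ≤ k) (hF : Frame k S S') :
    RestoreInv f E Q y x S' :=
  ⟨h.mem.congr fun a ha _ => hF.mem a ha, by rw [hF.reg 0 (by omega), h.reg0],
    by rw [hF.reg 1 (by omega), h.reg1], by rw [hF.reg 2 (by omega), h.reg2],
    by rw [hF.reg 3 (by omega), h.reg3]⟩

theorem RestoreInv.setR (h : RestoreInv f E Q y x S) {k : ℕ} (hk : 4 ≤ k) (v : ℤ) :
    RestoreInv f E Q y x (S.setR k v) := h.frame hk (Frame.setR _ _ le_rfl)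

theorem RestoreInv.setF (h : RestoreInv f E Q y x S) {j i : ℤ} (hj : 0 ≤ j) (hi : 0 ≤ i) (v : ℤ) :
    RestoreInv f E Q y x (S.setF j i v) :=
  ⟨h.mem.congr fun _ ha _ => S.mem_setF hj hi ha, h.reg0, h.reg1, h.reg2, h.reg3⟩

theorem FlowRep.setR (h : FlowRep E π val p S) (k : ℕ) (v : ℤ) : FlowRep E π val p (S.setR k v) :=
  h.congr (fun _ => rfl) (fun _ => rfl)

theorem FlowRep.frame (h : FlowRep E π val p S) {k : ℕ} (hF : Frame k S S') : FlowRep E π val p S' :=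
  h.congr (fun i => hF.fld 11 i (by norm_num) (by norm_num))
    (fun i => hF.fld 12 i (by norm_num) (by norm_num))

theorem flushCmd_spec {w : Fin n} (h : LctAt S π val φ) (hI : RestoreInv f E Q y x S)
    (hR : FlowRep E π val p S) (h20 : S.reg 20 = vid w) :
    Wp flushCmd S (fun T S' => ∃ φ', LctAt S' π (Function.update val w 0) φ' ∧
      RestoreInv f E Q y x S' ∧ FlowRep E π (Function.update val w 0) p S' ∧
      (∀ k, k < 22 → S'.reg k = S.reg k) ∧ T ≤ opTime n + 2 - (φ' - φ)) := by
  refine Wp.seq (Wp.assign (Wp.seq ?_))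
  change Wp setvalCmd (S.setR 22 0) _
  refine Wp.mono (setvalCmd_spec (h.setR 22 0) (v := w) (by simp [h20])) ?_
  rintro T S₁ ⟨φ', h1, h2, h3, h4⟩
  have r20 : S₁.reg 20 = vid w := by rw [h2.reg 20 (by norm_num)]; simp [h20]
  have hR1 := (hR.setR 22 0).frame h2
  refine Wp.of_run (by decide) fun T' hT' => ?_
  replace hT' : T' ≤ 1 := by simpa [flushPost, Cmd.setf, Cmd.cost] using hT'
  have e : flushPost.run S₁ = S₁.setF 12 (S₁.fld 11 (vid w))
      (S₁.fld 12 (S₁.fld 11 (vid w)) + val w) := by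
    simp [flushPost, r20, h3]
  rw [e]
  refine ⟨φ', ?_, ?_, hR1.flush w, ?_, by linarith⟩
  · simpa using h1.setF (j := 12) _ _ (by norm_num) (by norm_num)
  · exact ((hI.setR (by norm_num) 0).frame (by norm_num) h2).setF (by norm_num) (hR1.arc_nonneg w) _
  · intro k hk
    rw [RState.reg_setF, h2.reg k (by omega), RState.reg_setR, if_neg (by omega)]

theorem vid_eq_vtx (v : Fin n) : vtx v + 1 = vid v := rfl

/-- The state of the loop over the queue before entry `k`. -/
structure RestoreAt (f : Fin n → Fin n → ℤ) (E : List (Fin n × Fin n)) (Q : List (Op n))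
    (y : Fin n → Fin n → ℤ) (x : ℕ → ℤ) (k : ℕ) (π : Forest n) (val : Fin n → ℤ) (φ : ℝ)
    (S : RState) : Prop where
  inv : RestoreInv f E Q y x S
  le : k ≤ Q.length
  reg4 : S.reg 4 = 3 + 5 * E.length + 5 * k
  reg5 : S.reg 5 = k
  π_eq : π = endForest (fun _ => none) (Q.take k)
  lct : LctAt S π val φ
  rep : FlowRep E π val (pathFlow (fun _ => none) (Q.take k) x) S

theorem nextOp_spec {k : ℕ} (h4 : S.reg 4 = 3 + 5 * E.length + 5 * k) (h5 : S.reg 5 = k)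
    (hk : k < Q.length) (hI : RestoreInv f E Q y x S) (hL : LctAt S π val φ)
    (hπ : π = endForest (fun _ => none) (Q.take (k + 1)))
    (hR : FlowRep E π val (pathFlow (fun _ => none) (Q.take (k + 1)) x) S) :
    RestoreAt f E Q y x (k + 1) π val φ (nextOp.run S) := by
  have e : nextOp.run S = (S.setR 4 (S.reg 4 + 5)).setR 5 (S.reg 5 + 1) := by simp [nextOp]
  rw [e]
  refine ⟨(hI.setR (by norm_num) _).setR (by norm_num) _, hk, ?_, ?_, hπ, (hL.setR _ _).setR _ _,
    (hR.setR _ _).setR _ _⟩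
  · simp [h4]; ring
  · simp [h5]

theorem QOk.drop {G : Set (Fin n × Fin n)} {π : Forest n} {Q : List (Op n)} (h : QOk G π Q) (k : ℕ) :
    QOk G (endForest π (Q.take k)) (Q.drop k) := by
  induction k generalizing π Q with
  | zero => exact h
  | succ k ih =>
    cases Q with
    | nil => trivial
    | cons φ Q =>
      cases φ
      · exact ih h.2.2.2
      · exact ih h.2
      · exact ih h.2.2.2

theorem nextOp_cost : nextOp.loopFree = true ∧ nextOp.cost = 2 := by decide

/-- A link starts with value zero, a pseudoarc adds its flow to the values on its path, and a cut
first moves the value to the arc. Thus the representation passes to the next prefix of the queue. A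
cut uses two forest operations, hence `2 * opTime n`. -/
theorem restoreOp_spec {G : Set (Fin n × Fin n)} (hQ : QOk G (fun _ => none) Q) (hE : E.Nodup)
    (hG : ∀ a, a ∈ G → a ∈ E) {k : ℕ} (hk : k < Q.length) (h : RestoreAt f E Q y x k π val φ S) :
    Wp restoreOp S (fun T S' => ∃ π' val' φ', RestoreAt f E Q y x (k + 1) π' val' φ' S' ∧
      T ≤ 2 * opTime n + 20 - (φ' - φ)) := by
  have hop : 0 ≤ opTime n := by
    have := logb_card_nonneg n
    unfold opTime; linarith
  have hrow := fun t ht => h.inv.mem.row k t hk ht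
  have hdrop : Q.drop k = Q[k] :: Q.drop (k + 1) := List.drop_eq_getElem_cons hk
  have hq := hQ.drop k
  rw [← h.π_eq, hdrop] at hq
  have htake : Q.take (k + 1) = Q.take k ++ [Q[k]] := by
    rw [List.take_succ_eq_append_getElem hk]
  have hπ1 : endForest (fun _ => none) (Q.take (k + 1)) = endForest π [Q[k]] := by
    rw [htake, endForest_append, ← h.π_eq]
  have hp1 : ∀ a b, pathFlow (fun _ => none) (Q.take (k + 1)) x a b
      = pathFlow (fun _ => none) (Q.take k) x a b + pathFlow π [Q[k]] (fun i => x (i + k)) a b := by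
    intro a b
    rw [htake, pathFlow_append, ← h.π_eq]
    simp [hk.le]
  have hcost : (nextOp.cost : ℝ) = 2 := by rw [nextOp_cost.2]; norm_num
  have r0 := hrow 0 (by norm_num)
  have r1 := hrow 1 (by norm_num)
  have r4 := hrow 4 (by norm_num)
  push_cast at r0 r1 r4
  rw [add_zero] at r0
  cases hφ : Q[k] with
  | link v w =>
    rw [hφ] at hq hπ1 hp1 r0 r1
    obtain ⟨q1, q2, q3, -⟩ := hq
    simp [opRow, encOp] at r0 r1
    have hmem := hG _ q3
    set j := E.idxOf (v, w) with hj
    have hjl : j < E.length := List.idxOf_lt_length_iff.2 hmem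
    have hjE : E[j] = (v, w) := List.getElem_idxOf hjl
    have m1 := h.inv.mem.tail j hjl
    have m2 := h.inv.mem.head j hjl
    rw [hjE] at m1 m2
    refine Wp.ite (fun _ => ?_) (fun hb => absurd (by simp [h.reg4, r0]) hb)
    refine Wp.run_seq (by decide) fun T₁ hT₁ => Wp.seq ?_
    have hc1 : (restoreLinkPre.cost : ℝ) = 6 := by
      have : restoreLinkPre.cost = 6 := by decide
      rw [this]; norm_num
    set S₁ := (((((S.setR 6 j).setR 7 (3 + 5 * j)).setR 20 (vid v)).setR 21 (vid w)).setR 22 0).setF 11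
      (vid v) (j + 1) with hS₁
    have e : restoreLinkPre.run S = S₁ := by
      simp [restoreLinkPre, hS₁, h.reg4, r1, m1, m2, vid_eq_vtx]
    rw [e]
    have hL1 : LctAt S₁ π val φ :=
      (((((h.lct.setR _ _).setR _ _).setR _ _).setR _ _).setR _ _).setF _ _ (by norm_num) (by norm_num)
    have hI1 : RestoreInv f E Q y x S₁ :=
      (((((h.inv.setR (by norm_num) _).setR (by norm_num) _).setR (by norm_num) _).setR (by norm_num)
        _).setR (by norm_num) _).setF (by norm_num) (vid_pos v).le _
    have hR1 := (((((h.rep.setR 6 j).setR 7 (3 + 5 * j)).setR 20 (vid v)).setR 21 (vid w)).setR 22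
      0).link q1 hjl hjE
    rw [← hS₁] at hR1
    refine Wp.mono (linkCmd_spec hL1 (v := v) (w := w) (by simp [hS₁]) (by simp [hS₁]) q1 q2) ?_
    rintro T₂ S₂ ⟨φ', a1, a2, a3⟩
    refine Wp.of_run nextOp_cost.1 fun T₃ hT₃ => ?_
    have e22 : S₁.reg 22 = 0 := by simp [hS₁]
    rw [e22] at a1
    refine ⟨_, _, φ', nextOp_spec (k := k) ?_ ?_ hk (hI1.frame (by norm_num) a2) a1 hπ1.symm ?_, ?_⟩
    · rw [a2.reg 4 (by norm_num)]; simp [hS₁, h.reg4]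
    · rw [a2.reg 5 (by norm_num)]; simp [hS₁, h.reg5]
    · have : pathFlow (fun _ => none) (Q.take (k + 1)) x = pathFlow (fun _ => none) (Q.take k) x := by
        funext a b
        rw [hp1]; simp [pathFlow]
      rw [this]
      exact hR1.frame a2
    · linarith
  | cut w =>
    rw [hφ] at hq hπ1 hp1 r0 r1
    obtain ⟨q1, -⟩ := hq
    simp [opRow, encOp] at r0 r1
    refine Wp.ite (fun hb => absurd hb (by simp [h.reg4, r0])) (fun _ => ?_)
    refine Wp.ite (fun _ => ?_) (fun hb => absurd (by simp [h.reg4, r0]) hb)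
    refine Wp.seq (Wp.assign (Wp.seq ?_))
    rw [show ({ S with reg := Function.update S.reg 20 _ } : RState) = S.setR 20 (vid w) by
      simp only [Expr.eval, h.reg4, r1]; rfl]
    refine Wp.mono (flushCmd_spec (h.lct.setR 20 (vid w)) (h.inv.setR (by norm_num) _)
      (h.rep.setR 20 (vid w)) (w := w) (by simp)) ?_
    rintro T₁ S₁ ⟨φ₁, a1, a2, a3, a4, a5⟩
    have r20 : S₁.reg 20 = vid w := by rw [a4 20 (by norm_num)]; simp
    refine Wp.seq (Wp.mono (cutCmd_spec a1 (w := w) r20 q1) ?_)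
    rintro T₂ S₂ ⟨φ₂, b1, b2, b3⟩
    refine Wp.of_run nextOp_cost.1 fun T₃ hT₃ => ?_
    refine ⟨_, _, φ₂, nextOp_spec (k := k) ?_ ?_ hk (a2.frame (by norm_num) b2) b1 hπ1.symm ?_, ?_⟩
    · rw [b2.reg 4 (by norm_num), a4 4 (by norm_num)]; simp [h.reg4]
    · rw [b2.reg 5 (by norm_num), a4 5 (by norm_num)]; simp [h.reg5]
    · have : pathFlow (fun _ => none) (Q.take (k + 1)) x = pathFlow (fun _ => none) (Q.take k) x := by
        funext a b
        rw [hp1]; simp [pathFlow]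
      rw [this]
      exact (a3.cut (by simp)).frame b2
    · linarith
  | transfer u v δ =>
    rw [hφ] at hq hπ1 hp1 r0 r1 r4
    simp [opRow, encOp] at r0 r1 r4
    refine Wp.ite (fun hb => absurd hb (by simp [h.reg4, r0])) (fun _ => ?_)
    refine Wp.ite (fun hb => absurd hb (by simp [h.reg4, r0])) (fun _ => ?_)
    refine Wp.run_seq (by decide) fun T₁ hT₁ => Wp.seq ?_
    replace hT₁ : T₁ ≤ 2 := by
      refine hT₁.trans ?_
      norm_num [Cmd.cost]
    set S₁ := (S.setR 20 (vid u)).setR 22 (x k) with hS₁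
    have e : (Cmd.seq (.assign 20 (.add (.load (.add (.reg 4) (.lit 1))) (.lit 1)))
        (.assign 22 (.load (.add (.reg 4) (.lit 4))))).run S = S₁ := by
      simp [hS₁, h.reg4, r1, r4, vid_eq_vtx]
    rw [e]
    refine Wp.mono (addCmd_spec (S := S₁) ((h.lct.setR _ _).setR _ _) (u := u) (by simp [hS₁])) ?_
    rintro T₂ S₂ ⟨φ', a1, a2, a3⟩
    refine Wp.of_run nextOp_cost.1 fun T₃ hT₃ => ?_
    have e22 : S₁.reg 22 = x k := by simp [hS₁]
    rw [e22] at a1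
    refine ⟨_, _, φ', nextOp_spec (k := k) ?_ ?_ hk
      (((h.inv.setR (by norm_num) _).setR (by norm_num) _).frame (by norm_num) a2) a1 hπ1.symm ?_, ?_⟩
    · rw [a2.reg 4 (by norm_num)]; simp [hS₁, h.reg4]
    · rw [a2.reg 5 (by norm_num)]; simp [hS₁, h.reg5]
    · have hfl : pathFlow (fun _ => none) (Q.take (k + 1)) x = fun a b =>
          pathFlow (fun _ => none) (Q.take k) x a b + (open Classical in
            if π.ArcOnPath u a b then x k else 0) := by
        funext a b
        rw [hp1]; simp [pathFlow]
      rw [hfl]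
      have := (((h.rep.setR 20 (vid u)).setR 22 (x k)).transfer hE u (x k)).frame (S' := S₂) a2
      convert this using 1
    · linarith
end

section
variable {n : ℕ} {f : Fin n → Fin n → ℤ} {E : List (Fin n × Fin n)} {Q : List (Op n)}
  {y : Fin n → Fin n → ℤ} {x : ℕ → ℤ} {S S' : RState}

theorem opTime_nonneg (n : ℕ) : 0 ≤ opTime n := by
  have := logb_card_nonneg n
  unfold opTime; linarith

theorem RState.start_fld (input : List ℤ) {j i : ℤ} (hj : 0 ≤ j) (hi : 0 ≤ i) :
    (RState.start input).fld j i = 0 := by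
  have := fadr_neg hj hi
  simp only [RState.fld, RState.start]
  rw [if_neg (by omega)]

theorem restoreOut_cost : restoreOut.loopFree = true ∧ restoreOut.cost ≤ 10 := by decide

theorem restoreOut_spec {h : Fin n → Fin n → ℤ} (hsw : ∀ a ∈ E, a.swap ∈ E) (hI : RestoreInv f E Q y x S)
    (hacc : ∀ (j : ℕ) (hj : j < E.length), S.fld 12 (j + 1) = h E[j].1 E[j].2) {i : ℕ}
    (hi : i < E.length) (h5 : S.reg 5 = i) :
    restoreOut.run S = (((((S.setR 7 (3 + 5 * i)).setR 8 (E.idxOf E[i].swap)).setR 9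
      (3 + 5 * E.idxOf E[i].swap)).setR 6
      (restoredFlow f (fun u v => y u v + h u v) E[i].1 E[i].2)).setM
      (3 + 5 * E.length + 5 * Q.length + i)
      (restoredFlow f (fun u v => y u v + h u v) E[i].1 E[i].2)).setR 5 (i + 1) := by
  set k := E.idxOf E[i].swap with hk
  have hkl : k < E.length := List.idxOf_lt_length_iff.2 (hsw _ (List.getElem_mem hi))
  have hkE : E[k] = E[i].swap := List.getElem_idxOf hkl
  have m1 := hI.mem.rev i hi
  have m2 := hI.mem.flow i hi
  have m3 := hI.mem.orig i hi
  have m4 := hI.mem.flow k hkl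
  have m5 := hI.mem.orig k hkl
  have m6 := hacc i hi
  have m7 := hacc k hkl
  rw [hkE] at m4 m5 m7
  simp only [Prod.fst_swap, Prod.snd_swap] at m4 m5 m7
  rw [← hk] at m1
  simp only [restoredFlow]
  by_cases hneg : f E[i].1 E[i].2 - f E[i].2 E[i].1 + (y E[i].1 E[i].2 + h E[i].1 E[i].2)
      - (y E[i].2 E[i].1 + h E[i].2 E[i].1) < 0
  · rw [max_eq_right hneg.le]
    have : ∀ a b : ℤ, ((((S.setR 7 (3 + 5 * i)).setR 8 k).setR 9 (3 + 5 * k)).setR 6 a).setR 6 b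
        = (((S.setR 7 (3 + 5 * i)).setR 8 k).setR 9 (3 + 5 * k)).setR 6 b := by
      intro a b
      simp [RState.setR]
    simp [restoreOut, h5, m1, m2, m3, m4, m5, m6, m7, hI.reg0, hneg, this]
  · rw [max_eq_left (not_lt.1 hneg)]
    simp only [not_lt] at hneg
    simp [restoreOut, h5, m1, m2, m3, m4, m5, m6, m7, hI.reg0, not_lt.2 hneg]

theorem restoreCmd_spec {G : Set (Fin n × Fin n)} (hQ : QOk G (fun _ => none) Q) (hE : E.Nodup)
    (hG : ∀ a, a ∈ G → a ∈ E) (hsw : ∀ a ∈ E, a.swap ∈ E) :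
    Wp restoreCmd (RState.start (restoreInput f E Q y x)) (fun T S' =>
      S'.Outputs (restoreOutput E
        (restoredFlow f (fun u v => y u v + pathFlow (fun _ => none) Q x u v))) ∧
      T ≤ (n + E.length + Q.length + 1) * (2 * opTime n + 100)) := by
  set S₀ := RState.start (restoreInput f E Q y x) with hS₀
  have hm := restoreMem_start (f := f) (E := E) (Q := Q) (y := y) (x := x)
  rw [← hS₀] at hm
  have hop := opTime_nonneg n
  refine Wp.run_seq (by decide) fun T₁ hT₁ => Wp.seq ?_
  replace hT₁ : T₁ ≤ 6 := by
    have : restoreHeader.cost = 6 := by decide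
    rw [this] at hT₁
    exact_mod_cast hT₁
  set S₁ := (((((S₀.setR 1 n).setR 2 E.length).setR 3 Q.length).setR 4 (3 + 5 * E.length)).setR 0
    (3 + 5 * E.length + 5 * Q.length)).setR 20 n with hS₁
  have e₁ : restoreHeader.run S₀ = S₁ := by
    simp [restoreHeader, hS₁, hm.mem0, hm.mem1, hm.mem2]
  rw [e₁]
  have hI₁ : RestoreInv f E Q y x S₁ :=
    ⟨hm.congr fun a _ _ => rfl, by simp [hS₁], by simp [hS₁], by simp [hS₁], by simp [hS₁]⟩
  have hf₁ : ∀ j i : ℤ, 0 ≤ j → 0 ≤ i → S₁.fld j i = 0 := fun j i hj hi =>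
    (RState.start_fld (restoreInput f E Q y x) hj hi)
  refine Wp.mono (initCmd_spec (n := n) (S := S₁) (by simp [hS₁])) ?_
  rintro T₂ S₂ ⟨hL₂, hF₂, hT₂⟩
  have hI₂ := hI₁.frame (by norm_num) hF₂
  have hf11 : ∀ a : Fin n, S₂.fld 11 (vid a) = 0 := fun a => by
    rw [hF₂.fld _ _ (by norm_num) (by norm_num), hf₁ _ _ (by norm_num) (vid_pos a).le]
  refine Wp.seq (Wp.assign (Wp.seq ?_))
  change Wp (Cmd.loop _ _) (S₂.setR 5 0) _
  have hA : RestoreAt f E Q y x 0 (fun _ => none) (fun _ => 0) 0 (S₂.setR 5 0) := by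
    refine ⟨hI₂.setR (by norm_num) _, Nat.zero_le _, ?_, by simp, rfl, hL₂.setR _ _, ?_⟩
    · simp [hF₂.reg 4 (by norm_num), hS₁]
    · refine FlowRep.setR ?_ _ _
      constructor
      · intro a; rw [hf11]
      · intro a j hj h'; rw [hf11] at h'; omega
      · intro a b h'; simp at h'
      · intro a _; rfl
      · intro j hj
        rw [hF₂.fld _ _ (by norm_num) (by norm_num), hf₁ _ _ (by norm_num) (by omega)]
        simp [pathFlow]
  refine Wp.mono (Wp.loop_count (fun i φ S => ∃ π val, RestoreAt f E Q y x i π val φ S) Q.length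
    (2 * opTime n + 20) (by linarith) ?_ ?_ ⟨_, _, hA⟩) ?_
  · rintro i φ S ⟨π, val, h⟩
    refine ⟨h.lct.nonneg, h.le, ?_⟩
    simp only [Test.Holds, Expr.eval, h.reg5, h.inv.reg3]
    omega
  · rintro i φ S hi ⟨π, val, h⟩
    refine Wp.mono (restoreOp_spec hQ hE hG hi h) ?_
    rintro T S' ⟨π', val', φ', h1, h2⟩
    exact ⟨φ', ⟨π', val', h1⟩, h2⟩
  rintro T₃ S₃ ⟨φ₃, ⟨π, val, h₃⟩, hT₃⟩
  have hφ₃ := h₃.lct.nonneg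
  have hR₃ := h₃.rep
  rw [List.take_length] at hR₃
  refine Wp.seq (Wp.assign (Wp.seq ?_))
  change Wp (Cmd.loop _ _) (S₃.setR 5 0) _
  -- Arcs still in the forest at the end of the queue hold part of their flow as values. Once every
  -- vertex is flushed all values are zero and field `12` alone holds the path flows.
  refine Wp.mono (Wp.loop_count (fun i φ S => ∃ val, RestoreInv f E Q y x S ∧ LctAt S π val φ ∧
    FlowRep E π val (pathFlow (fun _ => none) Q x) S ∧ S.reg 5 = i ∧ i ≤ n ∧
    ∀ a : Fin n, (a : ℕ) < i → val a = 0) n (opTime n + 10) (by linarith) ?_ ?_ (φ := φ₃) ?_) ?_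
  · rintro i φ S ⟨val, h1, h2, h3, h4, h5, h6⟩
    refine ⟨h2.nonneg, h5, ?_⟩
    simp only [Test.Holds, Expr.eval, h4, h1.reg1]
    omega
  · rintro i φ S hi ⟨val, h1, h2, h3, h4, h5, h6⟩
    refine Wp.seq (Wp.assign (Wp.seq ?_))
    change Wp flushCmd (S.setR 20 ((Expr.add (.reg 5) (.lit 1)).eval S)) _
    refine Wp.mono (flushCmd_spec (h2.setR _ _) (h1.setR (by norm_num) _) (h3.setR _ _) (w := ⟨i, hi⟩)
      (by simp [h4, vid])) ?_
    rintro T S' ⟨φ', a1, a2, a3, a4, a5⟩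
    refine Wp.assign ⟨φ', ⟨_, a2.setR (k := 5) (by norm_num) _, a1.setR 5 _, a3.setR 5 _, ?_, hi, ?_⟩, ?_⟩
    · simp [a4 5 (by norm_num), h4]
    · intro a ha
      rw [Function.update_apply]
      split_ifs with hai
      · rfl
      · refine h6 a ?_
        rcases Nat.lt_succ_iff_lt_or_eq.1 ha with h' | h'
        · exact h'
        · exact absurd (Fin.ext h') hai
    · linarith
  · exact ⟨val, h₃.inv.setR (by norm_num) _, h₃.lct.setR _ _, hR₃.setR _ _, by simp, Nat.zero_le _,
      fun a ha => absurd ha (by omega)⟩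
  rintro T₄ S₄ ⟨φ₄, ⟨val₄, h1, h2, h3, h4, h5, h6⟩, hT₄⟩
  have hφ₄ := h2.nonneg
  have hacc : ∀ (j : ℕ) (hj : j < E.length),
      S₄.fld 12 (j + 1) = pathFlow (fun _ => none) Q x E[j].1 E[j].2 := by
    intro j hj
    rw [h3.flow j hj, h6 _ (Fin.isLt _)]
    simp
  refine Wp.seq (Wp.assign ?_)
  change Wp (Cmd.loop _ _) (S₄.setR 5 0) _
  set g := restoredFlow f (fun u v => y u v + pathFlow (fun _ => none) Q x u v) with hg
  refine Wp.mono (Wp.loop_count (fun i φ S => φ = 0 ∧ RestoreInv f E Q y x S ∧ S.reg 5 = i ∧ i ≤ E.length ∧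
    (∀ (j : ℕ) (hj : j < E.length), S.fld 12 (j + 1) = pathFlow (fun _ => none) Q x E[j].1 E[j].2) ∧
    ∀ (j : ℕ) (hj : j < E.length), j < i →
      S.mem (3 + 5 * E.length + 5 * Q.length + j) = g E[j].1 E[j].2) E.length 10 (by norm_num)
      ?_ ?_ (φ := 0) ?_) ?_
  · rintro i φ S ⟨rfl, h1, h2, h3, -⟩
    refine ⟨le_rfl, h3, ?_⟩
    simp only [Test.Holds, Expr.eval, h2, h1.reg2]
    omega
  · rintro i φ S hi ⟨rfl, h1, h2, h3, h4, h5⟩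
    refine Wp.of_run restoreOut_cost.1 fun T hT => ?_
    have hc : (restoreOut.cost : ℝ) ≤ 10 := by exact_mod_cast restoreOut_cost.2
    rw [restoreOut_spec hsw h1 h4 hi h2]
    refine ⟨0, ⟨rfl, ⟨?_, ?_, ?_, ?_, ?_⟩, by simp, hi, ?_, ?_⟩, by linarith⟩
    · refine h1.mem.congr fun a ha ha' => ?_
      simp only [RState.mem_setR, RState.mem_setM]
      rw [if_neg (by omega)]
    · simp [h1.reg0]
    · simp [h1.reg1]
    · simp [h1.reg2]
    · simp [h1.reg3]
    · intro j hj
      rw [RState.fld_setR, RState.fld_setM _ (by omega) (by norm_num) (by omega)]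
      exact h4 j hj
    · intro j hj hji
      simp only [RState.mem_setR, RState.mem_setM]
      rcases Nat.lt_succ_iff_lt_or_eq.1 hji with h' | rfl
      · rw [if_neg (by omega)]
        exact h5 j hj h'
      · rw [if_pos rfl]
  · exact ⟨rfl, h1.setR (by norm_num) _, by simp, Nat.zero_le _, hacc, fun j _ hj => absurd hj (by omega)⟩
  rintro T₅ S₅ ⟨φ, ⟨rfl, k1, k2, k3, k4, k5⟩, hT₅⟩
  refine ⟨?_, ?_⟩
  · intro i hi
    have hi' : i < E.length := by simpa [restoreOutput] using hi
    rw [k1.reg0, k5 i hi' hi']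
    simp [restoreOutput]
  · have n1 : (0 : ℝ) ≤ n := Nat.cast_nonneg _
    have n2 : (0 : ℝ) ≤ E.length := Nat.cast_nonneg _
    have n3 : (0 : ℝ) ≤ Q.length := Nat.cast_nonneg _
    have p1 := mul_nonneg n1 hop
    have p2 := mul_nonneg n2 hop
    have p3 := mul_nonneg n3 hop
    nlinarith
end

/-! ## The input of create-all-pseudoarcs in memory -/

section
variable {n : ℕ}

/-- The memory holds the input of create-all-pseudoarcs. -/
structure CreateMem (N : FlowNetwork n) (f : Fin n → Fin n → ℤ) (Δ : ℕ) (d : Fin n → ℕ)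
    (E : List (Fin n × Fin n)) (S : RState) : Prop where
  mem0 : S.mem 0 = n
  mem1 : S.mem 1 = E.length
  mem2 : S.mem 2 = Δ
  label : ∀ v : Fin n, S.mem (3 + 3 * vtx v) = d v
  act : ∀ v : Fin n, S.mem (3 + 3 * vtx v + 1) = bit (v ∈ FlowNetwork.active f Δ)
  comp : ∀ v : Fin n, S.mem (3 + 3 * vtx v + 2) = bit (v ∈ N.compVerts f Δ)
  tail : ∀ (j : ℕ) (hj : j < E.length), S.mem (3 + 3 * n + 3 * j) = vtx E[j].1
  head : ∀ (j : ℕ) (hj : j < E.length), S.mem (3 + 3 * n + 3 * j + 1) = vtx E[j].2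
  cap : ∀ (j : ℕ) (hj : j < E.length), S.mem (3 + 3 * n + 3 * j + 2) = N.res f E[j].1 E[j].2

variable {N : FlowNetwork n} {f : Fin n → Fin n → ℤ} {Δ : ℕ} {d : Fin n → ℕ}
  {E : List (Fin n × Fin n)} {S S' : RState}

theorem createMem_start : CreateMem N f Δ d E (RState.start (createInput N f Δ d E)) := by
  set g : Fin n × Fin n → List ℤ := fun a => [vtx a.1, vtx a.2, N.res f a.1 a.2] with hg
  set g' : Fin n → List ℤ := fun v =>
    [(d v : ℤ), bit (v ∈ FlowNetwork.active f Δ), bit (v ∈ N.compVerts f Δ)] with hg'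
  have hlen : ∀ a, (g a).length = 3 := fun a => rfl
  have hlen' : ∀ a, (g' a).length = 3 := fun a => rfl
  have hE := List.length_flatMap_block hlen E
  have hV := List.length_flatMap_block hlen' (List.finRange n)
  rw [List.length_finRange] at hV
  have keyV : ∀ (v : Fin n) (t : ℕ), t < 3 →
      (RState.start (createInput N f Δ d E)).mem ((3 + 3 * (v : ℕ) + t : ℕ) : ℤ) = (g' v).getD t 0 := by
    intro v t ht
    rw [RState.start_mem]
    refine (List.getD_append_block (l₂ := (List.finRange n).flatMap g') (b := 3 * v + t) ?_ ?_).trans ?_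
    · simp; omega
    · rw [hV]; omega
    · rw [List.getD_eq_getElem?_getD, List.getElem?_flatMap_block hlen' _ v t ht (by simp),
        ← List.getD_eq_getElem?_getD]
      simp
  have keyE : ∀ (j t : ℕ) (hj : j < E.length), t < 3 →
      (RState.start (createInput N f Δ d E)).mem ((3 + 3 * n + 3 * j + t : ℕ) : ℤ)
        = (g E[j]).getD t 0 := by
    intro j t hj ht
    rw [RState.start_mem]
    unfold createInput
    rw [List.getD_append_right _ _ _ _ (by rw [List.length_append, hV]; simp; omega),
      List.length_append, hV]
    rw [show 3 + 3 * n + 3 * j + t - ([(n : ℤ), (E.length : ℤ), (Δ : ℤ)].length + 3 * n) = 3 * j + t by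
      simp; omega]
    rw [List.getD_eq_getElem?_getD, List.getElem?_flatMap_block hlen E j t ht hj,
        ← List.getD_eq_getElem?_getD]
  constructor
  · exact RState.start_mem _ 0
  · exact RState.start_mem _ 1
  · exact RState.start_mem _ 2
  · intro v; simpa [hg', vtx] using keyV v 0 (by norm_num)
  · intro v; simpa [hg', vtx] using keyV v 1 (by norm_num)
  · intro v; simpa [hg', vtx] using keyV v 2 (by norm_num)
  · intro j hj; simpa [hg] using keyE j 0 hj (by norm_num)
  · intro j hj; simpa [hg] using keyE j 1 hj (by norm_num)
  · intro j hj; simpa [hg] using keyE j 2 hj (by norm_num)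

theorem vtx_bounds (v : Fin n) : 0 ≤ vtx v ∧ vtx v < n := by
  have := v.isLt
  simp only [vtx]; omega

theorem CreateMem.congr (h : CreateMem N f Δ d E S)
    (hm : ∀ a : ℤ, 0 ≤ a → a < 3 + 3 * n + 3 * E.length → S'.mem a = S.mem a) :
    CreateMem N f Δ d E S' := by
  constructor
  · rw [hm _ (by norm_num) (by omega)]; exact h.mem0
  · rw [hm _ (by norm_num) (by omega)]; exact h.mem1
  · rw [hm _ (by norm_num) (by omega)]; exact h.mem2
  · intro v; have := vtx_bounds v; rw [hm _ (by omega) (by omega)]; exact h.label v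
  · intro v; have := vtx_bounds v; rw [hm _ (by omega) (by omega)]; exact h.act v
  · intro v; have := vtx_bounds v; rw [hm _ (by omega) (by omega)]; exact h.comp v
  · intro j hj; rw [hm _ (by omega) (by omega)]; exact h.tail j hj
  · intro j hj; rw [hm _ (by omega) (by omega)]; exact h.head j hj
  · intro j hj; rw [hm _ (by omega) (by omega)]; exact h.cap j hj

/-- The input and the registers with its parameters. -/
structure CreateInv (N : FlowNetwork n) (f : Fin n → Fin n → ℤ) (Δ : ℕ) (d : Fin n → ℕ)
    (E : List (Fin n × Fin n)) (S : RState) : Prop where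
  mem : CreateMem N f Δ d E S
  reg0 : S.reg 0 = 3 + 3 * n + 3 * E.length
  reg1 : S.reg 1 = n
  reg2 : S.reg 2 = E.length
  reg3 : S.reg 3 = 3 + 3 * n

theorem CreateInv.frame (h : CreateInv N f Δ d E S) {k : ℕ} (hk : 4 ≤ k) (hF : Frame k S S') :
    CreateInv N f Δ d E S' :=
  ⟨h.mem.congr fun a ha _ => hF.mem a ha, by rw [hF.reg 0 (by omega), h.reg0],
    by rw [hF.reg 1 (by omega), h.reg1], by rw [hF.reg 2 (by omega), h.reg2],
    by rw [hF.reg 3 (by omega), h.reg3]⟩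

theorem CreateInv.setR (h : CreateInv N f Δ d E S) {k : ℕ} (hk : 4 ≤ k) (v : ℤ) :
    CreateInv N f Δ d E (S.setR k v) := h.frame hk (Frame.setR _ _ le_rfl)

theorem CreateInv.setF (h : CreateInv N f Δ d E S) {j i : ℤ} (hj : 0 ≤ j) (hi : 0 ≤ i) (v : ℤ) :
    CreateInv N f Δ d E (S.setF j i v) :=
  ⟨h.mem.congr fun _ ha _ => S.mem_setF hj hi ha, h.reg0, h.reg1, h.reg2, h.reg3⟩
end

/-! ## Sorting -/

section
open Expr

/-- Three times an expression. -/
def Expr.mul3 (e : Expr) : Expr := .add e (.add e e)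

@[simp] theorem Expr.eval_mul3 (S : RState) (e : Expr) : (Expr.mul3 e).eval S = 3 * e.eval S := by
  simp only [Expr.mul3, Expr.eval]; ring

def sortLinkPre : Cmd := .seqs [.assign 7 (load (add (lit 3) (mul3 (reg 4)))),
  .ite (.lt (reg 6) (reg 7)) (.assign 6 (reg 7)) (.assign 6 (reg 6)), .assign 20 (add (reg 4) (lit 1)),
  .assign 21 (add (reg 4) (lit 2)), .assign 22 (reg 7)]

def sortExtract : Cmd := .seqs [.setf (lit 12) (reg 4) (reg 24), .assign 20 (reg 24),
  .assign 22 (reg 6)]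

/-- Sort the vertices by their labels; the sorted list goes to field `12`. -/
def sortCmd : Cmd := .seqs [.assign 20 (add (reg 1) (lit 1)), initCmd, .assign 4 (lit 0),
  .assign 6 (lit 0),
  .loop (.lt (reg 4) (reg 1)) (.seqs [sortLinkPre, linkCmd, .assign 4 (add (reg 4) (lit 1))]),
  .assign 6 (add (reg 6) (lit 1)), .assign 4 (lit 0),
  .loop (.lt (reg 4) (reg 1)) (.seqs [.assign 20 (lit 1), exposeCmd, sortExtract, setvalCmd,
    .assign 4 (add (reg 4) (lit 1))])]
end

section
variable {n : ℕ} {N : FlowNetwork n} {f : Fin n → Fin n → ℤ} {Δ : ℕ} {d : Fin n → ℕ}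
  {E : List (Fin n × Fin n)} {S S' : RState}

/-- The path on the first nodes. -/
def chainForest (n i : ℕ) : Forest (n + 1) := fun v =>
  if h : (v : ℕ) < i ∧ (v : ℕ) < n then some ⟨v + 1, by omega⟩ else none

/-- Labels as values of nodes. -/
def chainVal (d : Fin n → ℤ) (i : ℕ) : Fin (n + 1) → ℤ := fun v =>
  if h : (v : ℕ) < n then if (v : ℕ) < i then d ⟨v, h⟩ else 0 else 0

theorem chainForest_succ {i : ℕ} (hi : i < n) :
    Function.update (chainForest n i) ⟨i, by omega⟩ (some ⟨i + 1, by omega⟩) = chainForest n (i + 1) := by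
  funext v
  by_cases hv : v = ⟨i, by omega⟩
  · subst hv
    simp [chainForest, hi]
  · rw [Function.update_of_ne hv]
    have : (v : ℕ) ≠ i := fun h => hv (Fin.ext h)
    simp only [chainForest]
    by_cases h : (v : ℕ) < i ∧ (v : ℕ) < n
    · rw [dif_pos h, dif_pos ⟨by omega, h.2⟩]
    · rw [dif_neg h, dif_neg (by omega)]

theorem chainVal_succ (d : Fin n → ℤ) {i : ℕ} (hi : i < n) :
    Function.update (chainVal d i) ⟨i, by omega⟩ (d ⟨i, hi⟩) = chainVal d (i + 1) := by
  funext v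
  by_cases hv : v = ⟨i, by omega⟩
  · subst hv
    simp [chainVal, hi]
  · rw [Function.update_of_ne hv]
    have : (v : ℕ) ≠ i := fun h => hv (Fin.ext h)
    simp only [chainVal]
    split_ifs <;> first | rfl | omega

theorem chainForest_onPath (a : Fin (n + 1)) : (chainForest n n).OnPath 0 a := by
  obtain ⟨a, ha⟩ := a
  induction a with
  | zero => exact Relation.ReflTransGen.refl
  | succ a ih =>
    refine Relation.ReflTransGen.tail (ih (by omega)) ?_
    have : a < n := by omega
    simp [chainForest, this]

theorem chainForest_arcOnPath (a : Fin n) :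
    ∃ b, (chainForest n n).ArcOnPath 0 a.castSucc b :=
  ⟨a.succ, chainForest_onPath _, by simp [chainForest, Fin.succ]⟩

theorem chainForest_isRootOf : (chainForest n n).IsRootOf 0 (Fin.last n) :=
  ⟨chainForest_onPath _, by simp [chainForest]⟩

theorem vid_castSucc (v : Fin n) : vid v.castSucc = vid v := rfl

theorem sortLinkPre_spec {i : ℕ} (hi : i < n) (hI : CreateInv N f Δ d E S) (h4 : S.reg 4 = i) :
    sortLinkPre.run S = ((((S.setR 7 (d ⟨i, hi⟩)).setR 6 (max (S.reg 6) (d ⟨i, hi⟩))).setR 20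
      (i + 1)).setR 21 (i + 2)).setR 22 (d ⟨i, hi⟩) := by
  have h1 := hI.mem.label ⟨i, hi⟩
  simp only [vtx] at h1
  by_cases h : S.reg 6 < d ⟨i, hi⟩
  · rw [max_eq_right h.le]
    simp [sortLinkPre, h4, h1, h]
  · rw [max_eq_left (not_lt.1 h)]
    simp [sortLinkPre, h4, h1, h]

/-- The forest used for sorting has one node more than there are vertices. -/
theorem opTime_succ_le (n : ℕ) : opTime (n + 1) ≤ 2 * opTime n := by
  have h1 : Real.logb 2 ((n + 1 : ℕ) : ℝ) ≤ Real.logb 2 n + 1 := by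
    rcases Nat.eq_zero_or_pos n with rfl | hn
    · simp
    · have hn' : (0 : ℝ) < n := by exact_mod_cast hn
      have hn1 : (1 : ℝ) ≤ n := by exact_mod_cast hn
      rw [show Real.logb 2 (n : ℝ) + 1 = Real.logb 2 (n * 2) by
        rw [Real.logb_mul hn'.ne' (by norm_num), Real.logb_self_eq_one (by norm_num)]]
      refine Real.logb_le_logb_of_le (by norm_num) (by positivity) ?_
      push_cast
      linarith
  have := logb_card_nonneg n
  unfold opTime
  linarith

/-- What the sorting program keeps. -/
structure SortInv (N : FlowNetwork n) (f : Fin n → Fin n → ℤ) (Δ : ℕ) (d : Fin n → ℕ)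
    (E : List (Fin n × Fin n)) (S₀ S : RState) : Prop where
  inv : CreateInv N f Δ d E S
  fld : ∀ j i : ℤ, 8 ≤ j → j < 12 → S.fld j i = S₀.fld j i

theorem SortInv.frame {S₀ : RState} (h : SortInv N f Δ d E S₀ S) {k : ℕ} (hk : 4 ≤ k) (hF : Frame k S S') :
    SortInv N f Δ d E S₀ S' :=
  ⟨h.inv.frame hk hF, fun j i h1 h2 => by rw [hF.fld j i h1 (by omega), h.fld j i h1 h2]⟩

theorem SortInv.setR {S₀ : RState} (h : SortInv N f Δ d E S₀ S) {k : ℕ} (hk : 4 ≤ k) (v : ℤ) :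
    SortInv N f Δ d E S₀ (S.setR k v) := h.frame hk (Frame.setR _ _ le_rfl)

theorem sortLink_spec {S₀ : RState} {i : ℕ} (hi : i < n) {φ : ℝ} (h1 : SortInv N f Δ d E S₀ S)
    (h2 : LctAt S (chainForest n i) (chainVal (fun v => (d v : ℤ)) i) φ) (h3 : S.reg 4 = i) :
    Wp (.seqs [sortLinkPre, linkCmd, .assign 4 (.add (.reg 4) (.lit 1))]) S (fun T S' =>
      ∃ φ', SortInv N f Δ d E S₀ S' ∧
        LctAt S' (chainForest n (i + 1)) (chainVal (fun v => (d v : ℤ)) (i + 1)) φ' ∧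
        S'.reg 4 = (i + 1 : ℕ) ∧ S'.reg 6 = max (S.reg 6) (d ⟨i, hi⟩) ∧
        T ≤ opTime (n + 1) + 10 - (φ' - φ)) := by
  refine Wp.run_seq (by decide) fun T₁ hT₁ => Wp.seq ?_
  replace hT₁ : T₁ ≤ 6 := by
    have : sortLinkPre.cost = 6 := by decide
    rw [this] at hT₁
    exact_mod_cast hT₁
  rw [sortLinkPre_spec hi h1.inv h3]
  set S₁ := ((((S.setR 7 (d ⟨i, hi⟩)).setR 6 (max (S.reg 6) (d ⟨i, hi⟩))).setR 20
      (i + 1)).setR 21 (i + 2)).setR 22 (d ⟨i, hi⟩) with hS₁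
  have hL1 : LctAt S₁ (chainForest n i) (chainVal (fun v => (d v : ℤ)) i) φ :=
    ((((h2.setR _ _).setR _ _).setR _ _).setR _ _).setR _ _
  have hI1 : SortInv N f Δ d E S₀ S₁ :=
    ((((h1.setR (by norm_num) _).setR (by norm_num) _).setR (by norm_num) _).setR (by norm_num) _).setR
      (by norm_num) _
  have hw : chainForest n i ⟨i + 1, by omega⟩ = none := by simp [chainForest]
  refine Wp.mono (linkCmd_spec hL1 (v := ⟨i, by omega⟩) (w := ⟨i + 1, by omega⟩) (by simp [hS₁, vid])
    (by simp [hS₁, vid]; ring) (by simp [chainForest]) ?_) ?_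
  · intro h
    have := h.unique (Forest.isRootOf_self hw)
    simp [Fin.ext_iff] at this
  rintro T₂ S₂ ⟨φ', a1, a2, a3⟩
  have e22 : S₁.reg 22 = d ⟨i, hi⟩ := by simp [hS₁]
  rw [e22, chainForest_succ hi, chainVal_succ _ hi] at a1
  refine Wp.assign ⟨φ', (hI1.frame (by norm_num) a2).setR (k := 4) (by norm_num) _, a1.setR 4 _, ?_, ?_, ?_⟩
  · simp [a2.reg 4 (by norm_num), hS₁, h3]
  · simp [a2.reg 6 (by norm_num), hS₁]
  · linarith

open Classical in
/-- The values when the vertices in `l` have been extracted. -/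
noncomputable def extractVal (d : Fin n → ℕ) (B : ℤ) (l : List (Fin n)) : Fin (n + 1) → ℤ :=
  chainVal (fun v => if v ∈ l then B else (d v : ℤ)) n

theorem extractVal_castSucc (B : ℤ) (l : List (Fin n)) (v : Fin n) :
    extractVal d B l v.castSucc = open Classical in if v ∈ l then B else (d v : ℤ) := by
  simp [extractVal, chainVal]

theorem extractVal_update (B : ℤ) (l : List (Fin n)) (v : Fin n) :
    Function.update (extractVal d B l) v.castSucc B = extractVal d B (l ++ [v]) := by
  funext a
  by_cases ha : a = v.castSucc
  · subst ha
    rw [Function.update_self, extractVal_castSucc]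
    simp
  · rw [Function.update_of_ne ha]
    simp only [extractVal, chainVal]
    by_cases h : (a : ℕ) < n
    · have : (⟨a, h⟩ : Fin n) ≠ v := fun h' => ha (Fin.ext (by simpa [Fin.ext_iff] using h'))
      simp [this]
    · simp [h]

/-- The first vertices of the sorted list have been found. -/
structure Extracted (d : Fin n → ℕ) (l : List (Fin n)) (S : RState) : Prop where
  nodup : l.Nodup
  sorted : l.Pairwise (fun a b => d a ≤ d b)
  le : ∀ a ∈ l, ∀ b, b ∉ l → d a ≤ d b
  fld : ∀ (k : ℕ) (hk : k < l.length), S.fld 12 k = vid l[k]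

/-- Extracted vertices carry the value `B`, which exceeds all labels, so the minimum on the path is
attained at a vertex not yet extracted. The value of the root does not enter the minimum, which is
why the path has an extra last node. -/
theorem sortExtract_spec {S₀ : RState} {l : List (Fin n)} {B : ℤ} (hl : l.length < n) {φ : ℝ}
    (hB : ∀ v, (d v : ℤ) < B) (h1 : SortInv N f Δ d E S₀ S)
    (h2 : LctAt S (chainForest n n) (extractVal d B l) φ) (h3 : S.reg 4 = l.length) (h6 : S.reg 6 = B)
    (h7 : Extracted d l S) :
    Wp (.seqs [.assign 20 (.lit 1), exposeCmd, sortExtract, setvalCmd,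
        .assign 4 (.add (.reg 4) (.lit 1))]) S (fun T S' => ∃ φ' l', l'.length = l.length + 1 ∧
      SortInv N f Δ d E S₀ S' ∧ LctAt S' (chainForest n n) (extractVal d B l') φ' ∧
      S'.reg 4 = (l.length + 1 : ℕ) ∧ S'.reg 6 = B ∧ Extracted d l' S' ∧
      T ≤ 2 * opTime (n + 1) + 10 - (φ' - φ)) := by
  classical
  have hout : ∃ v, v ∉ l := by
    by_contra hcon
    push Not at hcon
    have : Fintype.card (Fin n) ≤ l.length := by
      rw [← List.toFinset_card_of_nodup h7.nodup, ← Finset.card_univ]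
      exact Finset.card_le_card fun v _ => List.mem_toFinset.2 (hcon v)
    simp at this
    omega
  refine Wp.seq (Wp.assign (Wp.seq ?_))
  change Wp exposeCmd (S.setR 20 1) _
  refine Wp.mono (exposeCmd_spec (h2.setR 20 1) (u := 0) (by simp [vid])) ?_
  rintro T₁ S₁ ⟨φ₁, v, a1, a2, a3, a4, -, a5, a6⟩
  have hv := a3.unique chainForest_isRootOf
  subst hv
  obtain ⟨w, b, b1, b2, -, b4⟩ := a5 (by
    intro h
    have := congrArg Fin.val h
    simp at this
    omega)
  have hwn : (w : ℕ) < n := by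
    by_contra hcon
    have := b2.2
    simp [chainForest, hcon] at this
  set z : Fin n := ⟨w, hwn⟩ with hz
  have hwz : w = z.castSucc := rfl
  rw [hwz] at b1 b2 b4
  have hmin : ∀ a : Fin n, (if z ∈ l then B else (d z : ℤ)) ≤ if a ∈ l then B else (d a : ℤ) := by
    intro a
    obtain ⟨c, hc⟩ := chainForest_arcOnPath a
    have := b4 _ _ hc
    rwa [extractVal_castSucc, extractVal_castSucc] at this
  have hzl : z ∉ l := by
    intro hzl
    obtain ⟨v, hv⟩ := hout
    have h' := hmin v
    rw [if_pos hzl, if_neg hv] at h'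
    exact absurd (hB v) (not_lt.2 h')
  have hzmin : ∀ a, a ∉ l → d z ≤ d a := by
    intro a ha
    have h' := hmin a
    rw [if_neg hzl, if_neg ha] at h'
    exact_mod_cast h'
  refine Wp.run_seq (by decide) fun T₂ hT₂ => Wp.seq ?_
  replace hT₂ : T₂ ≤ 3 := by
    have : sortExtract.cost = 3 := by decide
    rw [this] at hT₂
    exact_mod_cast hT₂
  have hI1 := (h1.setR (k := 20) (by norm_num) 1).frame (by norm_num) a2
  have r4 : S₁.reg 4 = l.length := by rw [a2.reg 4 (by norm_num)]; simp [h3]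
  have r6 : S₁.reg 6 = B := by rw [a2.reg 6 (by norm_num)]; simp [h6]
  set S₂ := ((S₁.setF 12 l.length (vid z)).setR 20 (vid z)).setR 22 B with hS₂
  have e : sortExtract.run S₁ = S₂ := by
    simp [sortExtract, hS₂, r4, r6, b1, vid_castSucc]
  rw [e]
  refine Wp.mono (setvalCmd_spec (S := S₂) (((a1.setF _ _ (by norm_num) (by norm_num)).setR _ _).setR _ _)
    (v := z.castSucc) (by simp [hS₂, vid_castSucc])) ?_
  rintro T₃ S₃ ⟨φ₃, c1, c2, -, c4⟩
  have e22 : S₂.reg 22 = B := by simp [hS₂]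
  rw [e22, extractVal_update] at c1
  have hI2 : SortInv N f Δ d E S₀ S₂ := by
    refine SortInv.setR (SortInv.setR ⟨hI1.inv.setF (by norm_num) (by omega) _, ?_⟩ (by norm_num) _)
      (by norm_num) _
    intro j i hj hj'
    rw [RState.fld_setF _ (by norm_num) (by norm_num) (by omega) (by omega), if_neg (by omega)]
    exact hI1.fld j i hj hj'
  refine Wp.assign ⟨φ₃, l ++ [z], by simp, (hI2.frame (by norm_num) c2).setR (k := 4) (by norm_num) _,
    c1.setR 4 _, ?_, ?_, ?_, by linarith⟩
  · simp [c2.reg 4 (by norm_num), hS₂, r4]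
  · simp [c2.reg 6 (by norm_num), hS₂, r6]
  · constructor
    · exact List.nodup_append.2 ⟨h7.nodup, by simp, fun a ha b hb => by
        rw [List.mem_singleton] at hb
        rintro rfl
        exact hzl (hb ▸ ha)⟩
    · refine List.pairwise_append.2 ⟨h7.sorted, by simp, fun a ha b hb => ?_⟩
      rw [List.mem_singleton] at hb
      exact h7.le a ha b (hb ▸ hzl)
    · intro a ha b hb
      simp only [List.mem_append, List.mem_singleton, not_or] at ha hb
      rcases ha with ha | rfl
      · exact h7.le a ha b hb.1
      · exact hzmin b hb.1
    · intro k hk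
      change S₃.fld 12 k = _
      rw [c2.fld _ _ (by norm_num) (by norm_num)]
      simp only [hS₂, RState.fld_setR]
      rw [RState.fld_setF _ (by norm_num) (by norm_num) (by norm_num) (by norm_num)]
      rcases Nat.lt_or_ge k l.length with h' | h'
      · rw [if_neg (by omega), List.getElem_append_left h', a2.fld _ _ (by norm_num) (by norm_num)]
        exact h7.fld k h'
      · have hk' : k = l.length := by simp at hk; omega
        subst hk'
        simp

/-- Labels are arbitrary natural numbers, so the order has to be found by comparisons. With a path
of the forest as priority queue, each vertex needs one link, one minimum query and one value change.
-/
theorem sortCmd_spec {S₀ : RState} (hI : CreateInv N f Δ d E S₀) :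
    Wp sortCmd S₀ (fun T S' => ∃ l, l.length = n ∧ SortInv N f Δ d E S₀ S' ∧ Extracted d l S' ∧
      T ≤ (n + 1) * (6 * opTime n + 100)) := by
  have hop := opTime_nonneg n
  have hop' := opTime_succ_le n
  have hop1 := opTime_nonneg (n + 1)
  refine Wp.seq (Wp.assign (Wp.seq ?_))
  change Wp initCmd (S₀.setR 20 ((Expr.add (.reg 1) (.lit 1)).eval S₀)) _
  refine Wp.mono (initCmd_spec (n := n + 1) (by simp [hI.reg1])) ?_
  rintro T₁ S₁ ⟨hL₁, hF₁, hT₁⟩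
  have h₁ : SortInv N f Δ d E S₀ S₁ :=
    (SortInv.setR ⟨hI, fun _ _ _ _ => rfl⟩ (by norm_num) _).frame (by norm_num) hF₁
  refine Wp.seq (Wp.assign (Wp.seq (Wp.assign (Wp.seq ?_))))
  change Wp (Cmd.loop _ _) ((S₁.setR 4 0).setR 6 0) _
  refine Wp.mono (Wp.loop_count (fun i φ S => SortInv N f Δ d E S₀ S ∧
    LctAt S (chainForest n i) (chainVal (fun v => (d v : ℤ)) i) φ ∧ S.reg 4 = i ∧ i ≤ n ∧
    ∀ v : Fin n, (v : ℕ) < i → (d v : ℤ) ≤ S.reg 6) n (opTime (n + 1) + 10) (by linarith) ?_ ?_ (φ := 0)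
    ?_) ?_
  · rintro i φ S ⟨h1, h2, h3, h4, -⟩
    refine ⟨h2.nonneg, h4, ?_⟩
    simp only [Test.Holds, Expr.eval, h3, h1.inv.reg1]
    omega
  · rintro i φ S hi ⟨h1, h2, h3, h4, h5⟩
    refine Wp.mono (sortLink_spec hi h1 h2 h3) ?_
    rintro T S' ⟨φ', a1, a2, a3, a4, a5⟩
    refine ⟨φ', ⟨a1, a2, a3, hi, fun v hv => ?_⟩, a5⟩
    rw [a4]
    rcases Nat.lt_succ_iff_lt_or_eq.1 hv with h' | h'
    · exact (h5 v h').trans (le_max_left _ _)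
    · have : v = ⟨i, hi⟩ := Fin.ext h'
      rw [this]
      exact le_max_right _ _
  · refine ⟨(h₁.setR (by norm_num) _).setR (by norm_num) _, ?_, by simp, Nat.zero_le _,
      fun v hv => absurd hv (by omega)⟩
    have e1 : chainForest n 0 = fun _ => none := by funext v; simp [chainForest]
    have e2 : chainVal (fun v => (d v : ℤ)) 0 = fun _ => 0 := by funext v; simp [chainVal]
    rw [e1, e2]
    exact (hL₁.setR _ _).setR _ _
  rintro T₂ S₂ ⟨φ₂, ⟨h1, h2, h3, h4, h5⟩, hT₂⟩
  have hφ₂ := h2.nonneg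
  -- Register `6` has collected the maximum of the labels, so `B` lies above all of them.
  set B := S₂.reg 6 + 1 with hB
  have hdB : ∀ v, (d v : ℤ) < B := fun v => by
    have := h5 v v.isLt
    omega
  refine Wp.seq (Wp.assign (Wp.seq (Wp.assign ?_)))
  change Wp (Cmd.loop _ _) ((S₂.setR 6 B).setR 4 0) _
  refine Wp.mono (Wp.loop_count (fun i φ S => ∃ l, l.length = i ∧ i ≤ n ∧ SortInv N f Δ d E S₀ S ∧
    LctAt S (chainForest n n) (extractVal d B l) φ ∧ S.reg 4 = i ∧ S.reg 6 = B ∧ Extracted d l S) n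
    (2 * opTime (n + 1) + 10) (by linarith) ?_ ?_ (φ := φ₂) ?_) ?_
  · rintro i φ S ⟨l, -, h4, h1, h2, h3, -⟩
    refine ⟨h2.nonneg, h4, ?_⟩
    simp only [Test.Holds, Expr.eval, h3, h1.inv.reg1]
    omega
  · rintro i φ S hi ⟨l, rfl, k2, k3, k4, k5, k6, k7⟩
    refine Wp.mono (sortExtract_spec hi hdB k3 k4 k5 k6 k7) ?_
    rintro T S' ⟨φ', l', a1, a2, a3, a4, a5, a6, a7⟩
    exact ⟨φ', ⟨l', a1, hi, a2, a3, a4, a5, a6⟩, a7⟩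
  · refine ⟨[], rfl, Nat.zero_le _, (h1.setR (by norm_num) _).setR (by norm_num) _, ?_, by simp, by simp,
      ⟨by simp, by simp, by simp, fun k hk => absurd hk (by simp)⟩⟩
    have : extractVal d B [] = chainVal (fun v => (d v : ℤ)) n := by simp [extractVal]
    rw [this]
    exact (h2.setR _ _).setR _ _
  rintro T₃ S₃ ⟨φ₃, ⟨l, k1, k2, k3, k4, k5, k6, k7⟩, hT₃⟩
  have hφ₃ := k4.nonneg
  refine ⟨l, k1, k3, k7, ?_⟩
  have n1 : (0 : ℝ) ≤ n := Nat.cast_nonneg _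
  have p1 := mul_nonneg n1 hop
  have p2 := mul_le_mul_of_nonneg_left hop' n1
  push_cast at hT₁
  nlinarith
end

/-! ## Lists of arcs with the same tail -/

section
open Expr

/-- The positions are treated from last to first, so that putting an arc at the front of the list of
its tail keeps each list in the order of positions. Register `6` is the position plus one, hence the
subtraction of `3`. -/
def arcPrepBody : Cmd := .seqs [.assign 7 (sub (add (reg 3) (mul3 (reg 6))) (lit 3)),
  .assign 13 (load (reg 7)), .assign 14 (load (add (reg 7) (lit 1))),
  .ite (.and (.eq (load (add (add (lit 3) (mul3 (reg 13))) (lit 1))) (lit 0))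
      (.eq (load (add (add (lit 3) (mul3 (reg 14))) (lit 1))) (lit 0)))
    (.assign 15 (load (add (reg 7) (lit 2)))) (.assign 15 (lit 0)),
  .setf (lit 9) (reg 6) (fl (lit 11) (add (reg 13) (lit 1))),
  .setf (lit 11) (add (reg 13) (lit 1)) (reg 6), .setf (lit 10) (reg 6) (reg 15),
  .assign 6 (sub (reg 6) (lit 1))]

/-- List the arcs with the same tail: field `11` points to the first arc at a vertex, field `9` to the
next arc with the same tail; the capacities of arcs without active ends go to field `10`. -/
def arcPrep : Cmd := .seq (.assign 6 (reg 2)) (.loop (.lt (lit 0) (reg 6)) arcPrepBody)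
end

section
variable {n : ℕ} {N : FlowNetwork n} {f : Fin n → Fin n → ℤ} {Δ : ℕ} {d : Fin n → ℕ}
  {E : List (Fin n × Fin n)} {S S' : RState}

/-- `c` points to the first arc from position `lo` on with tail `v`. -/
def NextArc (E : List (Fin n × Fin n)) (v : Fin n) (lo : ℕ) (c : ℤ) : Prop :=
  (c = 0 ∧ ∀ (i : ℕ) (hi : i < E.length), lo ≤ i → E[i].1 ≠ v) ∨
    ∃ (j : ℕ) (hj : j < E.length), c = j + 1 ∧ lo ≤ j ∧ E[j].1 = v ∧
      ∀ (i : ℕ) (hi : i < E.length), lo ≤ i → i < j → E[i].1 ≠ v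

theorem NextArc.of_ne {v : Fin n} {lo : ℕ} {c : ℤ} (h : NextArc E v (lo + 1) c) (hlo : lo < E.length)
    (hv : E[lo].1 ≠ v) : NextArc E v lo c := by
  rcases h with ⟨h1, h2⟩ | ⟨j, hj, h1, h2, h3, h4⟩
  · refine Or.inl ⟨h1, fun i hi hl => ?_⟩
    rcases hl.eq_or_lt with rfl | hl
    · exact hv
    · exact h2 i hi hl
  · refine Or.inr ⟨j, hj, h1, by omega, h3, fun i hi hl hij => ?_⟩
    rcases hl.eq_or_lt with rfl | hl
    · exact hv
    · exact h4 i hi hl hij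

open Classical in
/-- The capacity of an arc in the input graphs, `0` if an end is active. -/
noncomputable def usableCap (f : Fin n → Fin n → ℤ) (Δ : ℕ) (r : Fin n → Fin n → ℤ)
    (a : Fin n × Fin n) : ℤ :=
  if a.1 ∈ FlowNetwork.active f Δ ∨ a.2 ∈ FlowNetwork.active f Δ then 0 else r a.1 a.2

theorem arcPrepBody_cost : arcPrepBody.loopFree = true ∧ arcPrepBody.cost ≤ 10 := by decide

theorem bit_eq_zero {P : Prop} : bit P = 0 ↔ ¬ P := by
  unfold bit; split_ifs <;> simp_all

theorem bit_eq_one {P : Prop} : bit P = 1 ↔ P := by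
  unfold bit; split_ifs <;> simp_all

theorem arcPrepBody_spec (hI : CreateInv N f Δ d E S) {j : ℕ} (hj : j < E.length)
    (h6 : S.reg 6 = j + 1) :
    arcPrepBody.run S = (((((((S.setR 7 (3 + 3 * n + 3 * j)).setR 13 (vtx E[j].1)).setR 14
      (vtx E[j].2)).setR 15 (usableCap f Δ (N.res f) E[j])).setF 9 (j + 1) (S.fld 11 (vid E[j].1))).setF 11 (vid E[j].1) (j + 1)).setF 10 (j + 1)
      (usableCap f Δ (N.res f) E[j])).setR 6 j := by
  have m1 := hI.mem.tail j hj
  have m2 := hI.mem.head j hj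
  have m3 := hI.mem.cap j hj
  have m4 := hI.mem.act E[j].1
  have m5 := hI.mem.act E[j].2
  have e : (3 : ℤ) + 3 * n + 3 * (j + 1) - 3 = 3 + 3 * n + 3 * j := by ring
  by_cases hc : E[j].1 ∈ FlowNetwork.active f Δ ∨ E[j].2 ∈ FlowNetwork.active f Δ
  · have hc' : ¬ (bit (E[j].1 ∈ FlowNetwork.active f Δ) = 0 ∧ bit (E[j].2 ∈ FlowNetwork.active f Δ) = 0) := by
      rw [bit_eq_zero, bit_eq_zero]; tauto
    rw [usableCap, if_pos hc]
    simp [arcPrepBody, h6, hI.reg3, e, m1, m2, m4, m5, hc', vid_eq_vtx]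
  · have hc' : bit (E[j].1 ∈ FlowNetwork.active f Δ) = 0 ∧ bit (E[j].2 ∈ FlowNetwork.active f Δ) = 0 := by
      rw [bit_eq_zero, bit_eq_zero]; tauto
    rw [usableCap, if_neg hc]
    simp [arcPrepBody, h6, hI.reg3, e, m1, m2, m3, m4, m5, hc', vid_eq_vtx]

/-- The arc lists are in memory. -/
structure ArcLists (E : List (Fin n × Fin n)) (S : RState) : Prop where
  nxt : ∀ (j : ℕ) (hj : j < E.length), NextArc E E[j].1 (j + 1) (S.fld 9 (j + 1))
  first : ∀ v : Fin n, NextArc E v 0 (S.fld 11 (vid v))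

theorem arcPrep_spec {l : List (Fin n)} (hI : CreateInv N f Δ d E S) (hX : Extracted d l S)
    (h11 : ∀ v : Fin n, S.fld 11 (vid v) = 0) :
    Wp arcPrep S (fun T S' => CreateInv N f Δ d E S' ∧ Extracted d l S' ∧ ArcLists E S' ∧
      (∀ (j : ℕ) (hj : j < E.length), S'.fld 10 (j + 1) = usableCap f Δ (N.res f) E[j]) ∧
      T ≤ 11 * (E.length : ℝ) + 2) := by
  refine Wp.seq (Wp.assign ?_)
  change Wp (Cmd.loop _ _) (S.setR 6 (S.reg 2)) _
  refine Wp.mono (Wp.loop_count (fun i φ S' => φ = 0 ∧ i ≤ E.length ∧ CreateInv N f Δ d E S' ∧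
    Extracted d l S' ∧ S'.reg 6 = E.length - i ∧
    (∀ (j : ℕ) (hj : j < E.length), E.length - i ≤ j → NextArc E E[j].1 (j + 1) (S'.fld 9 (j + 1)) ∧
      S'.fld 10 (j + 1) = usableCap f Δ (N.res f) E[j]) ∧
    ∀ v : Fin n, NextArc E v (E.length - i) (S'.fld 11 (vid v))) E.length 10 (by norm_num) ?_ ?_
    (φ := 0) ?_) ?_
  · rintro i φ S' ⟨rfl, h1, h2, h3, h4, -⟩
    refine ⟨le_rfl, h1, ?_⟩
    simp only [Test.Holds, Expr.eval, h4]
    omega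
  · rintro i φ S' hi ⟨rfl, h1, h2, h3, h4, h5, h6⟩
    obtain ⟨j, hj⟩ : ∃ j, E.length - i = j + 1 := ⟨E.length - i - 1, by omega⟩
    have hjl : j < E.length := by omega
    have hj' : E.length - (i + 1) = j := by omega
    refine Wp.of_run arcPrepBody_cost.1 fun T hT => ?_
    have hc : (arcPrepBody.cost : ℝ) ≤ 10 := by exact_mod_cast arcPrepBody_cost.2
    rw [arcPrepBody_spec h2 hjl (by omega)]
    rw [hj']
    rw [hj] at h5 h6
    refine ⟨0, ⟨rfl, hi, ?_, ?_, ?_, ?_, ?_⟩, by linarith⟩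
    · exact (((((((h2.setR (by norm_num) _).setR (by norm_num) _).setR (by norm_num) _).setR
        (by norm_num) _).setF (by norm_num)
        (by omega) _).setF (by norm_num) (vid_pos _).le _).setF (by norm_num) (by omega) _).setR
        (by norm_num) _
    · refine ⟨h3.nodup, h3.sorted, h3.le, fun k hk => ?_⟩
      have := h3.fld k hk
      simpa using this
    · simp; omega
    · intro k hk hjk
      rcases hjk.eq_or_lt with rfl | hlt
      · refine ⟨?_, by simp⟩
        simpa using h6 E[j].1
      · have hne : ¬ k = j := by omega
        simpa [hne] using h5 k hk hlt
    · intro v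
      by_cases hv : E[j].1 = v
      · refine Or.inr ⟨j, hjl, ?_, le_rfl, hv, fun i hi h1 h2 => absurd h1 (by omega)⟩
        simp [hv]
      · have hv' : ¬ v = E[j].1 := fun h => hv h.symm
        simpa [hv'] using (h6 v).of_ne hjl hv
  · refine ⟨rfl, Nat.zero_le _, hI.setR (by norm_num) _, ⟨hX.nodup, hX.sorted, hX.le, hX.fld⟩, ?_, ?_, ?_⟩
    · simp [hI.reg2]
    · intro j hj h; omega
    · intro v
      refine Or.inl ⟨?_, fun i hi h => by omega⟩
      simp [h11]
  · rintro T S' ⟨φ, ⟨rfl, h1, h2, h3, h4, h5, h6⟩, hT⟩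
    rw [Nat.sub_self] at h5 h6
    exact ⟨h2, h3, ⟨fun j hj => (h5 j hj (by omega)).1, h6⟩, fun j hj => (h5 j hj (by omega)).2,
      by linarith⟩

/-! ## The queue in memory -/

/-- The queue is in memory; register `8` points to its end. -/
structure QueueAt (E : List (Fin n × Fin n)) (Q : List (Op n)) (S : RState) : Prop where
  reg8 : S.reg 8 = S.reg 0 + 2 + 4 * Q.length
  reg9 : S.reg 9 = Q.length
  cell : ∀ (k t : ℕ) (hk : k < Q.length), t < 4 →
    S.mem (S.reg 0 + 2 + 4 * k + t) = (encOp E Q[k]).getD t 0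

open Expr in
/-- Append a row to the queue. -/
def pushCmd (e₁ e₂ e₃ e₄ : Expr) : Cmd := .seqs [.store (reg 8) e₁, .store (add (reg 8) (lit 1)) e₂,
  .store (add (reg 8) (lit 2)) e₃, .store (add (reg 8) (lit 3)) e₄,
  .assign 8 (add (reg 8) (lit 4)), .assign 9 (add (reg 9) (lit 1))]

/-- The state after appending a row to the queue. -/
def RState.push (S : RState) (x₁ x₂ x₃ x₄ : ℤ) : RState :=
  (((((S.setM (S.reg 8) x₁).setM (S.reg 8 + 1) x₂).setM (S.reg 8 + 2) x₃).setM (S.reg 8 + 3) x₄).setR 8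
    (S.reg 8 + 4)).setR 9 (S.reg 9 + 1)

theorem RState.push_reg (S : RState) (x₁ x₂ x₃ x₄ : ℤ) {k : ℕ} (h8 : k ≠ 8) (h9 : k ≠ 9) :
    (S.push x₁ x₂ x₃ x₄).reg k = S.reg k := by
  simp [RState.push, h8, h9]

theorem RState.push_fld (S : RState) (x₁ x₂ x₃ x₄ : ℤ) {j i : ℤ} (h8 : 0 ≤ S.reg 8) (hj : 0 ≤ j)
    (hi : 0 ≤ i) : (S.push x₁ x₂ x₃ x₄).fld j i = S.fld j i := by
  simp only [RState.push, RState.fld_setR]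
  rw [RState.fld_setM _ (by omega) hj hi, RState.fld_setM _ (by omega) hj hi,
    RState.fld_setM _ (by omega) hj hi, RState.fld_setM _ (by omega) hj hi]

theorem RState.push_mem (S : RState) (x₁ x₂ x₃ x₄ : ℤ) {a : ℤ} (h : a < S.reg 8) :
    (S.push x₁ x₂ x₃ x₄).mem a = S.mem a := by
  simp only [RState.push, RState.mem_setR, RState.mem_setM]
  rw [if_neg (by omega), if_neg (by omega), if_neg (by omega), if_neg (by omega)]

theorem QueueAt.push {Q : List (Op n)} (h : QueueAt E Q S) {φ : Op n} {x₁ x₂ x₃ x₄ : ℤ}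
    (hφ : encOp E φ = [x₁, x₂, x₃, x₄]) : QueueAt E (Q ++ [φ]) (S.push x₁ x₂ x₃ x₄) := by
  have e0 : (S.push x₁ x₂ x₃ x₄).reg 0 = S.reg 0 := S.push_reg _ _ _ _ (by norm_num) (by norm_num)
  constructor
  · rw [e0]; simp [RState.push, h.reg8]; ring
  · simp [RState.push, h.reg9]
  · intro k t hk ht
    rw [e0]
    rcases Nat.lt_or_ge k Q.length with h' | h'
    · rw [RState.push_mem _ _ _ _ _ (by rw [h.reg8]; omega), List.getElem_append_left h']
      exact h.cell k t h' ht
    · have hk' : k = Q.length := by simp at hk; omega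
      subst hk'
      rw [← h.reg8]
      simp only [List.getElem_concat_length, hφ, RState.push, RState.mem_setR, RState.mem_setM]
      interval_cases t <;> simp

theorem QueueAt.congr {Q : List (Op n)} (h : QueueAt E Q S) (h0 : S'.reg 0 = S.reg 0)
    (h8 : S'.reg 8 = S.reg 8) (h9 : S'.reg 9 = S.reg 9) (hm : ∀ a, S.reg 0 + 2 ≤ a → S'.mem a = S.mem a) :
    QueueAt E Q S' := by
  refine ⟨by rw [h8, h0, h.reg8], by rw [h9, h.reg9], fun k t hk ht => ?_⟩
  rw [h0, hm _ (by omega)]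
  exact h.cell k t hk ht
end

/-! ## States of create-all-pseudoarcs in memory -/

/-- The data of a call of create-all-pseudoarcs; `l` lists the vertices by their labels, and `q` is a
number that is kept in register `7`. -/
structure CreateCtx (n : ℕ) where
  N : FlowNetwork n
  f : Fin n → Fin n → ℤ
  Δ : ℕ
  d : Fin n → ℕ
  E : List (Fin n × Fin n)
  l : List (Fin n)
  G : Set (Fin n × Fin n)
  ρ : ℤ
  q : ℤ
  enum : N.Enumerates E
  preflow : N.IsPreflow f
  ρ_nonneg : 0 ≤ ρ
  length_l : l.length = n
  res_pos : ∀ a ∈ G, 0 < N.res f a.1 a.2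
  not_active : ∀ a ∈ G, a.1 ∉ FlowNetwork.active f Δ ∧ a.2 ∉ FlowNetwork.active f Δ
  mem_G : ∀ a : Fin n × Fin n, a.1 ∉ FlowNetwork.active f Δ → a.2 ∉ FlowNetwork.active f Δ →
    ρ < N.res f a.1 a.2 → a ∈ G

section
variable {n : ℕ}

/-- The part of the memory that does not change during a call. -/
structure CreateStatic (c : CreateCtx n) (S : RState) : Prop where
  inv : CreateInv c.N c.f c.Δ c.d c.E S
  lists : ArcLists c.E S
  ord : Extracted c.d c.l S
  reg5 : S.reg 5 = c.ρ
  reg7 : S.reg 7 = c.q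

/-- The memory holds the state `σ`; the search for arcs at `v` has arrived at position `lo v`. -/
structure CreateAt (c : CreateCtx n) (σ : PState n) (val : Fin n → ℤ) (lo : Fin n → ℕ) (φ : ℝ)
    (S : RState) : Prop where
  static : CreateStatic c S
  ok : PState.Ok c.N c.f σ
  lct : LctAt S σ.π val φ
  val_eq : ∀ a b, σ.π a = some b → val a = σ.r a b
  cap : ∀ (j : ℕ) (hj : j < c.E.length), S.fld 10 (j + 1)
    = if σ.π c.E[j].1 = some c.E[j].2 then 0 else usableCap c.f c.Δ σ.r c.E[j]
  live_sub : σ.live ⊆ c.G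
  cur_next : ∀ v, NextArc c.E v (lo v) (S.fld 8 (vid v))
  cur_done : ∀ (j : ℕ) (hj : j < c.E.length), j < lo c.E[j].1 →
    c.E[j] ∉ σ.live ∨ σ.r c.E[j].1 c.E[j].2 ≤ c.ρ
  cur_live : ∀ (j : ℕ) (hj : j < c.E.length), lo c.E[j].1 ≤ j → c.E[j] ∈ c.G → c.E[j] ∈ σ.live
  queue : QueueAt c.E σ.Q S

variable {c : CreateCtx n} {σ : PState n} {val : Fin n → ℤ} {lo : Fin n → ℕ} {φ : ℝ} {S S' : RState}

theorem Extracted.congr {d : Fin n → ℕ} {l : List (Fin n)} (h : Extracted d l S)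
    (hf : ∀ i : ℤ, 0 ≤ i → S'.fld 12 i = S.fld 12 i) : Extracted d l S' :=
  ⟨h.nodup, h.sorted, h.le, fun k hk => by rw [hf _ (by omega), h.fld k hk]⟩

theorem ArcLists.congr {E : List (Fin n × Fin n)} (h : ArcLists E S)
    (h9 : ∀ i : ℤ, 0 ≤ i → S'.fld 9 i = S.fld 9 i) (h11 : ∀ i : ℤ, 0 ≤ i → S'.fld 11 i = S.fld 11 i) :
    ArcLists E S' :=
  ⟨fun j hj => by rw [h9 _ (by omega)]; exact h.nxt j hj,
    fun v => by rw [h11 _ (vid_pos v).le]; exact h.first v⟩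

theorem CreateStatic.congr (h : CreateStatic c S) (hI : CreateInv c.N c.f c.Δ c.d c.E S')
    (h5 : S'.reg 5 = S.reg 5) (h7 : S'.reg 7 = S.reg 7)
    (hf : ∀ j i : ℤ, 9 ≤ j → j ≠ 10 → j < 16 → 0 ≤ i → S'.fld j i = S.fld j i) :
    CreateStatic c S' :=
  ⟨hI, h.lists.congr (fun i => hf 9 i (by norm_num) (by norm_num) (by norm_num))
    (fun i => hf 11 i (by norm_num) (by norm_num) (by norm_num)),
    h.ord.congr (fun i => hf 12 i (by norm_num) (by norm_num) (by norm_num)), h5.trans h.reg5,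
    h7.trans h.reg7⟩

theorem CreateStatic.frame (h : CreateStatic c S) {k : ℕ} (hk : 10 ≤ k) (hF : Frame k S S') :
    CreateStatic c S' :=
  h.congr (h.inv.frame (by omega) hF) (hF.reg 5 (by omega)) (hF.reg 7 (by omega))
    (fun j i h1 _ h2 _ => hF.fld j i (by omega) h2)

theorem QueueAt.frame {E : List (Fin n × Fin n)} {Q : List (Op n)} (h : QueueAt E Q S) {k : ℕ}
    (hk : 10 ≤ k) (h0 : 0 ≤ S.reg 0) (hF : Frame k S S') : QueueAt E Q S' :=
  h.congr (hF.reg 0 (by omega)) (hF.reg 8 (by omega)) (hF.reg 9 (by omega))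
    (fun a ha => hF.mem a (by omega))

theorem CreateStatic.reg0_nonneg (h : CreateStatic c S) : 0 ≤ S.reg 0 := by
  rw [h.inv.reg0]; omega

theorem CreateAt.frame {φ' : ℝ} (h : CreateAt c σ val lo φ S) {k : ℕ} (hk : 10 ≤ k) (hF : Frame k S S')
    (hL : LctAt S' σ.π val φ') : CreateAt c σ val lo φ' S' where
  static := h.static.frame hk hF
  ok := h.ok
  lct := hL
  val_eq := h.val_eq
  cap := fun j hj => by rw [hF.fld _ _ (by norm_num) (by norm_num)]; exact h.cap j hj
  live_sub := h.live_sub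
  cur_next := fun v => by rw [hF.fld _ _ (by norm_num) (by norm_num)]; exact h.cur_next v
  cur_done := h.cur_done
  cur_live := h.cur_live
  queue := h.queue.frame hk h.static.reg0_nonneg hF

theorem CreateAt.setR (h : CreateAt c σ val lo φ S) {k : ℕ} (hk : 10 ≤ k) (x : ℤ) :
    CreateAt c σ val lo φ (S.setR k x) :=
  h.frame hk (Frame.setR _ _ le_rfl) (h.lct.setR _ _)

theorem CreateStatic.push (h : CreateStatic c S) (h8 : S.reg 0 ≤ S.reg 8) (x₁ x₂ x₃ x₄ : ℤ) :
    CreateStatic c (S.push x₁ x₂ x₃ x₄) := by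
  have h0 := h.reg0_nonneg
  refine h.congr ⟨?_, ?_, ?_, ?_, ?_⟩ ?_ ?_ ?_
  · refine h.inv.mem.congr fun a _ ha => RState.push_mem _ _ _ _ _ ?_
    rw [h.inv.reg0] at h8
    omega
  · rw [S.push_reg _ _ _ _ (by norm_num) (by norm_num), h.inv.reg0]
  · rw [S.push_reg _ _ _ _ (by norm_num) (by norm_num), h.inv.reg1]
  · rw [S.push_reg _ _ _ _ (by norm_num) (by norm_num), h.inv.reg2]
  · rw [S.push_reg _ _ _ _ (by norm_num) (by norm_num), h.inv.reg3]
  · exact S.push_reg _ _ _ _ (by norm_num) (by norm_num)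
  · exact S.push_reg _ _ _ _ (by norm_num) (by norm_num)
  · intro j i h1 _ h2 h3
    exact S.push_fld _ _ _ _ (by omega) (by omega) h3

theorem QueueAt.reg8_le {E : List (Fin n × Fin n)} {Q : List (Op n)} (h : QueueAt E Q S) :
    S.reg 0 ≤ S.reg 8 := by
  rw [h.reg8]; omega

/-! ### Advancing the search for arcs -/

/-- The number of arcs that have not been passed. -/
noncomputable def CreateCtx.pending (c : CreateCtx n) (lo : Fin n → ℕ) : ℕ :=
  (Finset.univ.filter (fun j : Fin c.E.length => lo c.E[j].1 ≤ j)).card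

theorem CreateCtx.pending_le (c : CreateCtx n) (lo : Fin n → ℕ) : c.pending lo ≤ c.E.length :=
  (Finset.card_le_univ _).trans (by simp)

theorem CreateCtx.pending_advance {v : Fin n} {j : ℕ} (hj : j < c.E.length) (hv : c.E[j].1 = v)
    (hlo : lo v ≤ j) : c.pending (Function.update lo v (j + 1)) + 1 ≤ c.pending lo := by
  unfold CreateCtx.pending
  rw [← Finset.card_insert_of_notMem (a := (⟨j, hj⟩ : Fin c.E.length))]
  · apply Finset.card_le_card
    intro i hi
    rcases Finset.mem_insert.1 hi with rfl | hi
    · refine Finset.mem_filter.2 ⟨Finset.mem_univ _, ?_⟩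
      simpa [hv] using hlo
    · have hi' := (Finset.mem_filter.1 hi).2
      refine Finset.mem_filter.2 ⟨Finset.mem_univ _, ?_⟩
      rw [Function.update_apply] at hi'
      split_ifs at hi' with h
      · rw [h]; omega
      · exact hi'
  · intro h
    have h' := (Finset.mem_filter.1 h).2
    simp [hv] at h'

theorem CreateAt.cur_eq (h : CreateAt c σ val lo φ S) {v : Fin n} (hne : S.fld 8 (vid v) ≠ 0) :
    ∃ (j : ℕ) (hj : j < c.E.length), S.fld 8 (vid v) = j + 1 ∧ lo v ≤ j ∧ c.E[j].1 = v ∧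
      ∀ (i : ℕ) (hi : i < c.E.length), lo v ≤ i → i < j → c.E[i].1 ≠ v := by
  rcases h.cur_next v with ⟨h1, -⟩ | h1
  · exact absurd h1 hne
  · exact h1

/-- An arc is passed for two reasons: it is discarded, and `L` omits it, or its capacity is at most
`ρ`, and `L` is the old set. Neither can change back within the call, because capacities never grow,
so the pointer need not return. -/
theorem CreateAt.advance (h : CreateAt c σ val lo φ S) {v : Fin n} {j : ℕ} (hj : j < c.E.length)
    (hv : c.E[j].1 = v) (hlo : lo v ≤ j)
    (hgap : ∀ (i : ℕ) (hi : i < c.E.length), lo v ≤ i → i < j → c.E[i].1 ≠ v) {L : Set (Fin n × Fin n)}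
    (hL : L ⊆ σ.live) (hL' : ∀ a ∈ σ.live, a ≠ c.E[j] → a ∈ L)
    (hdone : c.E[j] ∉ L ∨ σ.r c.E[j].1 c.E[j].2 ≤ c.ρ) :
    CreateAt c { σ with live := L } val (Function.update lo v (j + 1)) φ
      (S.setF 8 (vid v) (S.fld 9 (j + 1))) where
  static := h.static.congr (h.static.inv.setF (by norm_num) (vid_pos v).le _) rfl rfl
    (fun j i h1 _ h2 _ => by
      rw [RState.fld_setF _ (by norm_num) (by norm_num) (by omega) h2, if_neg (by omega)])
  ok := h.ok.with_live _
  lct := h.lct.setF _ _ (by norm_num) (by norm_num)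
  val_eq := h.val_eq
  cap := fun i hi => by
    rw [RState.fld_setF _ (by norm_num) (by norm_num) (by norm_num) (by norm_num), if_neg (by norm_num)]
    exact h.cap i hi
  live_sub := hL.trans h.live_sub
  cur_next := fun a => by
    rw [RState.fld_setF _ (by norm_num) (by norm_num) (by norm_num) (by norm_num)]
    by_cases ha : a = v
    · subst ha
      rw [Function.update_self, if_pos ⟨rfl, rfl⟩, ← hv]
      exact h.static.lists.nxt j hj
    · rw [Function.update_of_ne ha, if_neg (by simp [ha])]
      exact h.cur_next a
  cur_done := fun i hi hlt => by
    by_cases hij : i = j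
    · subst hij; exact hdone
    · have hlt' : i < lo c.E[i].1 := by
        rw [Function.update_apply] at hlt
        split_ifs at hlt with hiv
        · by_contra hcon
          exact hgap i hi (by rw [← hiv]; omega) (by omega) hiv
        · exact hlt
      rcases h.cur_done i hi hlt' with h' | h'
      · exact Or.inl fun h'' => h' (hL h'')
      · exact Or.inr h'
  cur_live := fun i hi hle hG => by
    have hij : i ≠ j := by
      rintro rfl
      rw [hv, Function.update_self] at hle
      omega
    have hle' : lo c.E[i].1 ≤ i := by
      rw [Function.update_apply] at hle
      split_ifs at hle with hiv
      · rw [hiv]; omega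
      · exact hle
    exact hL' _ (h.cur_live i hi hle' hG) fun he =>
      hij ((List.Nodup.getElem_inj_iff c.enum.1).1 he)
  queue := h.queue.congr rfl rfl rfl (fun a ha =>
    RState.mem_setF _ (by norm_num) (vid_pos v).le (by
      have := h.static.reg0_nonneg
      omega))

/-! ### Operations -/

/-- The capacity of an arc has one place at a time: with the link it moves from field `10` of the
arc to the value of `v` in the forest. -/
theorem CreateAt.link {φ' : ℝ} (h : CreateAt c σ val lo φ S) {v w : Fin n} {j : ℕ} (hj : j < c.E.length)
    (hjE : c.E[j] = (v, w)) (hv : σ.π v = none) (hw : ¬ σ.π.IsRootOf w v) (hr : 0 < σ.r v w)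
    (hF : Frame 20 ((S.setF 10 (j + 1) 0).push 0 j 0 0) S')
    (hL : LctAt S' (Function.update σ.π v (some w)) (Function.update val v (σ.r v w)) φ') :
    CreateAt c (σ.link v w) (Function.update val v (σ.r v w)) lo φ' S' := by
  set S₁ := S.setF 10 (j + 1) 0 with hS₁
  have hst : CreateStatic c S₁ := h.static.congr (h.static.inv.setF (by norm_num) (by omega) _) rfl rfl
    (fun j i h1 h3 h2 _ => by
      rw [RState.fld_setF _ (by norm_num) (by norm_num) (by omega) h2, if_neg (by tauto)])
  have hq : QueueAt c.E σ.Q S₁ := h.queue.congr rfl rfl rfl (fun a ha =>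
    RState.mem_setF _ (by norm_num) (by omega) (by
      have := h.static.reg0_nonneg
      omega))
  have hq' : QueueAt c.E (σ.Q ++ [.link v w]) (S₁.push 0 j 0 0) := hq.push (by
    simp only [encOp]
    rw [← hjE, List.Nodup.idxOf_getElem c.enum.1])
  have hst' : CreateStatic c (S₁.push 0 j 0 0) := hst.push hq.reg8_le _ _ _ _
  have h8 : 0 ≤ S₁.reg 8 := hst.reg0_nonneg.trans hq.reg8_le
  have hfl : ∀ i k : ℤ, 8 ≤ i → i < 16 → 0 ≤ k → S'.fld i k = S₁.fld i k := fun i k h1 h2 h3 => by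
    rw [hF.fld i k h1 h2, S₁.push_fld _ _ _ _ h8 (by omega) h3]
  refine ⟨hst'.frame (by norm_num) hF, h.ok.link hv hw hr, hL, ?_, ?_, h.live_sub, ?_, h.cur_done,
    h.cur_live, hq'.frame (by norm_num) hst'.reg0_nonneg hF⟩
  · intro a b hab
    simp only [PState.link] at hab ⊢
    by_cases hav : a = v
    · subst hav
      simp only [Function.update_self, Option.some.injEq] at hab ⊢
      rw [hab]
    · rw [Function.update_of_ne hav] at hab ⊢
      exact h.val_eq a b hab
  · intro i hi
    rw [hfl _ _ (by norm_num) (by norm_num) (by omega), hS₁,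
      RState.fld_setF _ (by norm_num) (by norm_num) (by norm_num) (by norm_num)]
    change _ = if Function.update σ.π v (some w) c.E[i].1 = some c.E[i].2 then 0
      else usableCap c.f c.Δ σ.r c.E[i]
    by_cases hij : i = j
    · subst hij
      rw [hjE]
      simp
    · rw [if_neg (by omega), h.cap i hi]
      by_cases hiv : c.E[i].1 = v
      · rw [hiv, hv, Function.update_self, if_neg (by simp), if_neg]
        intro h'
        apply hij
        have he : c.E[i] = c.E[j] := by
          rw [hjE]
          exact Prod.ext hiv (by simpa using h'.symm)
        exact (List.Nodup.getElem_inj_iff c.enum.1).1 he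
      · rw [Function.update_of_ne hiv]
  · intro a
    rw [hfl _ _ (by norm_num) (by norm_num) (vid_pos a).le, hS₁,
      RState.fld_setF _ (by norm_num) (by norm_num) (by norm_num) (by norm_num), if_neg (by norm_num)]
    exact h.cur_next a

/-- Field `10` of a tree arc is zero, and a cut arc is saturated, so this zero is already its
correct capacity and nothing is written back. -/
theorem CreateAt.cut {φ' : ℝ} (h : CreateAt c σ val lo φ S) {w b : Fin n} (hw : σ.π w = some b)
    (hr : σ.r w b = 0) (hF : Frame 20 (S.push 1 (vtx w) 0 0) S')
    (hL : LctAt S' (Function.update σ.π w none) val φ') : CreateAt c (σ.cut w) val lo φ' S' := by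
  have hq' : QueueAt c.E (σ.Q ++ [.cut w]) (S.push 1 (vtx w) 0 0) := h.queue.push rfl
  have hst' : CreateStatic c (S.push 1 (vtx w) 0 0) := h.static.push h.queue.reg8_le _ _ _ _
  have h8 : 0 ≤ S.reg 8 := h.static.reg0_nonneg.trans h.queue.reg8_le
  have hfl : ∀ i k : ℤ, 8 ≤ i → i < 16 → 0 ≤ k → S'.fld i k = S.fld i k := fun i k h1 h2 h3 => by
    rw [hF.fld i k h1 h2, S.push_fld _ _ _ _ h8 (by omega) h3]
  refine ⟨hst'.frame (by norm_num) hF, h.ok.cut (by simp [hw]), hL, ?_, ?_, h.live_sub, ?_, h.cur_done,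
    h.cur_live, hq'.frame (by norm_num) hst'.reg0_nonneg hF⟩
  · intro a b hab
    simp only [PState.cut] at hab ⊢
    by_cases haw : a = w
    · subst haw; simp at hab
    · rw [Function.update_of_ne haw] at hab
      exact h.val_eq a b hab
  · intro i hi
    rw [hfl _ _ (by norm_num) (by norm_num) (by omega), h.cap i hi]
    change _ = if Function.update σ.π w none c.E[i].1 = some c.E[i].2 then 0
      else usableCap c.f c.Δ σ.r c.E[i]
    by_cases hiw : c.E[i].1 = w
    · rw [hiw, hw, Function.update_self]
      rw [if_neg (show ¬ (none = some c.E[i].2) by simp)]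
      split_ifs with hb
      · have hb' : b = c.E[i].2 := by simpa using hb
        unfold usableCap
        rw [hiw, ← hb', hr, ite_self]
      · rfl
    · rw [Function.update_of_ne hiw]
  · intro a
    rw [hfl _ _ (by norm_num) (by norm_num) (vid_pos a).le]
    exact h.cur_next a

open Classical in
-- Only capacities of tree arcs change, and these are held by the forest; field `10` is not touched.
theorem CreateAt.transfer {φ' : ℝ} (h : CreateAt c σ val lo φ S) {u v w : Fin n} {δ : ℤ}
    (hu : σ.π.IsRootOf u v) (huv : u ≠ v) (hm : σ.FindMin u w δ)
    (hF : Frame 20 (S.push 2 (vtx u) (vtx v) δ) S')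
    (hL : LctAt S' σ.π (fun a => if ∃ b, σ.π.ArcOnPath u a b then val a + -δ else val a) φ') :
    CreateAt c (σ.transfer u v δ) (fun a => if ∃ b, σ.π.ArcOnPath u a b then val a + -δ else val a) lo φ'
      S' := by
  have hq' : QueueAt c.E (σ.Q ++ [.transfer u v δ]) (S.push 2 (vtx u) (vtx v) δ) := h.queue.push rfl
  have hst' : CreateStatic c (S.push 2 (vtx u) (vtx v) δ) := h.static.push h.queue.reg8_le _ _ _ _
  have h8 : 0 ≤ S.reg 8 := h.static.reg0_nonneg.trans h.queue.reg8_le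
  have hfl : ∀ i k : ℤ, 8 ≤ i → i < 16 → 0 ≤ k → S'.fld i k = S.fld i k := fun i k h1 h2 h3 => by
    rw [hF.fld i k h1 h2, S.push_fld _ _ _ _ h8 (by omega) h3]
  have hδ := hm.nonneg h.ok
  refine ⟨hst'.frame (by norm_num) hF, h.ok.transfer hu huv hm, hL, ?_, ?_, h.live_sub, ?_, ?_,
    h.cur_live, hq'.frame (by norm_num) hst'.reg0_nonneg hF⟩
  · intro a b hab
    have hab' : σ.π a = some b := hab
    have hiff : (∃ b', σ.π.ArcOnPath u a b') ↔ σ.π.ArcOnPath u a b := by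
      constructor
      · rintro ⟨b', h1, -⟩; exact ⟨h1, hab'⟩
      · exact fun h1 => ⟨b, h1⟩
    simp only [PState.transfer, hiff, h.val_eq a b hab']
    split_ifs <;> ring
  · intro i hi
    rw [hfl _ _ (by norm_num) (by norm_num) (by omega), h.cap i hi]
    change _ = if σ.π c.E[i].1 = some c.E[i].2 then 0
      else usableCap c.f c.Δ (σ.transfer u v δ).r c.E[i]
    by_cases hc : σ.π c.E[i].1 = some c.E[i].2
    · rw [if_pos hc, if_pos hc]
    · rw [if_neg hc, if_neg hc]
      unfold usableCap
      simp only [PState.transfer]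
      rw [if_neg (fun h' : σ.π.ArcOnPath u c.E[i].1 c.E[i].2 => hc h'.2)]
  · intro a
    rw [hfl _ _ (by norm_num) (by norm_num) (vid_pos a).le]
    exact h.cur_next a
  · intro j hj hlt
    rcases h.cur_done j hj hlt with h' | h'
    · exact Or.inl h'
    · refine Or.inr ?_
      simp only [PState.transfer]
      split_ifs <;> linarith
end

/-! ## The program for create-all-pseudoarcs -/

section
open Expr

def createCutPre : Cmd := .seq (.assign 20 (reg 24))
  (pushCmd (lit 1) (sub (reg 20) (lit 1)) (lit 0) (lit 0))

def createCut : Cmd := .seq createCutPre (.seq cutCmd (.seq (.assign 20 (reg 11)) exposeCmd))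

/-- cut-all-saturated for the vertex in register `11`. -/
def cutAllCmd : Cmd := .loop (.and (.neg (.eq (reg 24) (lit 0))) (.eq (reg 26) (lit 0))) createCut

def createTransferPre : Cmd := .seq (.assign 14 (reg 26))
  (.seq (pushCmd (lit 2) (sub (reg 11) (lit 1)) (sub (reg 12) (lit 1)) (reg 14))
    (.seq (.assign 20 (reg 11)) (.assign 22 (sub (lit 0) (reg 14)))))

/-- Create the pseudoarc from the vertex in register `11` to the root in register `12`. -/
def createTransfer : Cmd := .seq createTransferPre
  (.seq addCmd (.seq (.assign 20 (reg 11)) (.seq exposeCmd cutAllCmd)))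

def createAdvance : Cmd := .setf (lit 8) (reg 12) (fl (lit 9) (reg 13))

def createLinkPre : Cmd := .seq (.assign 14 (fl (lit 10) (reg 13)))
  (.seq (.setf (lit 10) (reg 13) (lit 0))
    (.seq (pushCmd (lit 0) (sub (reg 13) (lit 1)) (lit 0) (lit 0))
      (.seq (.assign 21 (reg 20)) (.seq (.assign 20 (reg 12)) (.assign 22 (reg 14))))))

/-- Use the arc in register `13` for a link, if possible. -/
def createTry : Cmd := .seq
  (.assign 20 (add (load (sub (add (reg 3) (mul3 (reg 13))) (lit 2))) (lit 1)))
  (.seq exposeCmd (.ite (.eq (reg 23) (reg 12)) createAdvance (.seq createLinkPre linkCmd)))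

/-- One step of the search at the root in register `12`. -/
def createSearch : Cmd := .seq (.assign 13 (fl (lit 8) (reg 12)))
  (.ite (.eq (reg 13) (lit 0)) (.assign 10 (lit 0))
    (.ite (.lt (reg 5) (fl (lit 10) (reg 13))) createTry createAdvance))

/-- One step for the vertex in register `11`. -/
def createStep : Cmd := .seq (.assign 20 (reg 11)) (.seq exposeCmd (.seq (.assign 12 (reg 23))
  (.ite (.and (.neg (.eq (reg 12) (reg 11))) (.eq (load (add (mul3 (reg 12)) (lit 2))) (lit 1)))
    createTransfer createSearch)))
end

/-! ### Correctness and time of single steps of create-all-pseudoarcs -/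

section
variable {n : ℕ} {c : CreateCtx n} {σ : PState n} {val : Fin n → ℤ} {lo : Fin n → ℕ} {φ : ℝ}
  {S S' : RState}

/-- The vertices of the compact network. -/
abbrev CreateCtx.VC (c : CreateCtx n) : Set (Fin n) := c.N.compVerts c.f c.Δ

/-- The result of `exposeCmd` for `u`. -/
def Exposed (σ : PState n) (u v : Fin n) (S : RState) : Prop :=
  σ.π.IsRootOf u v ∧ S.reg 23 = vid v ∧ (u = v → S.reg 24 = 0) ∧
    (u ≠ v → ∃ w, S.reg 24 = vid w ∧ σ.FindMin u w (S.reg 26))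

theorem CreateAt.expose {u : Fin n} (h : CreateAt c σ val lo φ S) (h20 : S.reg 20 = vid u) :
    Wp exposeCmd S (fun T S' => ∃ φ' v, CreateAt c σ val lo φ' S' ∧ Frame 23 S S' ∧ Exposed σ u v S' ∧
      T ≤ opTime n - (φ' - φ)) := by
  refine Wp.mono (exposeCmd_spec h.lct h20) ?_
  rintro T S' ⟨φ', v, a1, a2, a3, a4, a5, a6, a7⟩
  refine ⟨φ', v, h.frame (by norm_num) a2 a1, a2, ⟨a3, a4, a5, fun huv => ?_⟩, a7⟩
  obtain ⟨w, b, b1, b2, b3, b4⟩ := a6 huv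
  refine ⟨w, b1, ⟨b, b2, ?_⟩, fun a b' hab => ?_⟩
  · rw [b3, h.val_eq w b b2.2]
  · rw [b3, ← h.val_eq a b' hab.2]
    exact b4 a b' hab

theorem PState.weight_cutAll {u : Fin n} {σ σ' : PState n} (hs : PState.CutAll u σ σ') :
    σ'.weight ≤ σ.weight ∧ ((∃ w, σ.FindMin u w 0) → σ'.weight + 2 ≤ σ.weight) := by
  induction hs with
  | done h => exact ⟨le_rfl, fun h' => absurd h' h⟩
  | step hm _ ih =>
    obtain ⟨⟨b, hb, hr⟩, -⟩ := hm
    have := PState.weight_cut hb.2 hr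
    exact ⟨by omega, fun _ => by omega⟩

theorem vid_sub_one (v : Fin n) : vid v - 1 = vtx v := by simp [vid, vtx]

theorem createCut_spec {u w : Fin n} (h : CreateAt c σ val lo φ S)
    (h11 : S.reg 11 = vid u) (h24 : S.reg 24 = vid w) (hm : σ.FindMin u w 0) :
    Wp createCut S (fun T S' => ∃ φ' v', CreateAt c (σ.cut w) val lo φ' S' ∧ Exposed (σ.cut w) u v' S' ∧
      (∀ k, k < 20 → k ≠ 8 → k ≠ 9 → S'.reg k = S.reg k) ∧ T ≤ 2 * opTime n + 10 - (φ' - φ)) := by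
  obtain ⟨⟨b, hb, hr⟩, -⟩ := id hm
  refine Wp.run_seq (by decide) fun T₁ hT₁ => Wp.seq ?_
  replace hT₁ : T₁ ≤ 7 := by
    have : createCutPre.cost = 7 := by decide
    rw [this] at hT₁
    exact_mod_cast hT₁
  have e : createCutPre.run S = (S.setR 20 (vid w)).push 1 (vtx w) 0 0 := by
    simp [createCutPre, pushCmd, RState.push, h24, vid_sub_one]
  rw [e]
  have h1 := h.setR (k := 20) (by norm_num) (vid w)
  have h8 : 0 ≤ (S.setR 20 (vid w)).reg 8 := h1.static.reg0_nonneg.trans h1.queue.reg8_le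
  have hL1 : LctAt ((S.setR 20 (vid w)).push 1 (vtx w) 0 0) σ.π val φ :=
    h1.lct.ext_fld fun j i hj _ hi => RState.push_fld _ _ _ _ _ h8 hj hi
  refine Wp.mono (cutCmd_spec hL1 (w := w)
    (by rw [RState.push_reg _ _ _ _ _ (by norm_num) (by norm_num)]; simp) (by simp [hb.2])) ?_
  rintro T₂ S₂ ⟨φ₂, a1, a2, a3⟩
  have h2 := h1.cut hb.2 hr (a2.mono (by norm_num)) a1
  have hreg : ∀ k, k < 20 → k ≠ 8 → k ≠ 9 → S₂.reg k = S.reg k := fun k hk h8 h9 => by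
    rw [a2.reg k (by omega), RState.push_reg _ _ _ _ _ h8 h9, RState.reg_setR, if_neg (by omega)]
  refine Wp.seq (Wp.assign ?_)
  change Wp exposeCmd (S₂.setR 20 ((Expr.reg 11).eval S₂)) _
  refine Wp.mono ((h2.setR (k := 20) (by norm_num) _).expose (u := u)
    (by simp [hreg 11 (by norm_num) (by norm_num) (by norm_num), h11])) ?_
  rintro T₃ S₃ ⟨φ₃, v', b1, b2, b3, b4⟩
  refine ⟨φ₃, v', b1, b3, fun k hk h8 h9 => ?_, by linarith⟩
  rw [b2.reg k (by omega), RState.reg_setR, if_neg (by omega), hreg k hk h8 h9]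

theorem Exposed.findMin_zero {u v w : Fin n} (hok : PState.Ok c.N c.f σ) (hX : Exposed σ u v S)
    (hm : σ.FindMin u w 0) : ¬ S.reg 24 = 0 ∧ S.reg 26 = 0 := by
  obtain ⟨h1, h2, h3, h4⟩ := hX
  obtain ⟨⟨b, hb, hr⟩, hmin⟩ := hm
  have huv : u ≠ v := by
    rintro rfl
    have h5 := hb.1
    rw [Forest.onPath_iff_of_eq_none h1.2] at h5
    subst h5
    exact absurd hb.2 (by simp [h1.2])
  obtain ⟨w', h5, h6⟩ := h4 huv
  refine ⟨by rw [h5]; simp, le_antisymm ?_ (h6.nonneg hok)⟩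
  have := h6.2 w b hb
  rwa [hr] at this

/-- Each cut lowers the weight by at least two, which pays for the cut and the next minimum query.
The loop ends properly because capacities are nonnegative: a saturated arc exists exactly when the
minimum on the path is zero. -/
theorem cutAllCmd_spec {u v : Fin n} (h : CreateAt c σ val lo φ S) (hX : Exposed σ u v S)
    (h11 : S.reg 11 = vid u) :
    Wp cutAllCmd S (fun T S' => ∃ σ' φ', CreateAt c σ' val lo φ' S' ∧ PState.CutAll u σ σ' ∧
      (∀ k, k < 20 → k ≠ 8 → k ≠ 9 → S'.reg k = S.reg k) ∧
      T ≤ (opTime n + 20) * (σ.weight - σ'.weight) + (φ - φ') + 1) := by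
  have hop := opTime_nonneg n
  refine Wp.mono (Wp.loop (α := PState n × ℝ) (fun a S' => ∃ v, CreateAt c a.1 val lo a.2 S' ∧
    Exposed a.1 u v S' ∧ PState.CutRounds u σ a.1 ∧
    ∀ k, k < 20 → k ≠ 8 → k ≠ 9 → S'.reg k = S.reg k)
    (fun a => (opTime n + 20) * a.1.weight + a.2) ?_ ?_ (a := (σ, φ)) ?_) ?_
  · rintro ⟨τ, ψ⟩ S' ⟨v, h1, -⟩
    have h2 := h1.lct.nonneg
    have h3 : (0 : ℝ) ≤ (opTime n + 20) * τ.weight := mul_nonneg (by linarith) (Nat.cast_nonneg _)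
    simp only
    linarith
  · rintro ⟨τ, ψ⟩ S' ⟨v, h1, h2, h3, h4⟩ hb
    simp only [Test.Holds, Expr.eval] at hb h1 h2 h3
    have huv : u ≠ v := fun huv => hb.1 (h2.2.2.1 huv)
    obtain ⟨w, h5, h6⟩ := h2.2.2.2 huv
    rw [hb.2] at h6
    obtain ⟨⟨b, hbb, hr⟩, -⟩ := id h6
    refine Wp.mono (createCut_spec h1 (by rw [h4 11 (by norm_num) (by norm_num) (by norm_num), h11])
      h5 h6) ?_
    rintro T S'' ⟨ψ', v', a1, a2, a3, a4⟩
    refine ⟨(τ.cut w, ψ'), ⟨v', a1, a2, fun σ'' hσ'' => h3 _ (.step h6 hσ''), fun k hk h8 h9 => ?_⟩, ?_⟩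
    · rw [a3 k hk h8 h9, h4 k hk h8 h9]
    · have hw : (((τ.cut w).weight : ℝ)) + 2 ≤ τ.weight := by
        exact_mod_cast PState.weight_cut hbb.2 hr
      simp only
      nlinarith
  · exact ⟨v, h, hX, fun _ h => h, fun _ _ _ _ => rfl⟩
  · rintro T S' ⟨⟨τ, ψ⟩, ⟨v, h1, h2, h3, h4⟩, hb, hT⟩
    refine ⟨τ, ψ, h1, h3 _ (.done ?_), h4, ?_⟩
    · rintro ⟨w, hw⟩
      exact hb (h2.findMin_zero h1.ok hw)
    · simp only at hT
      linarith

/-- The arc of least capacity becomes saturated, so at least one cut follows; this is the drop of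
the weight by two. -/
theorem createTransfer_spec {u v : Fin n} (h : CreateAt c σ val lo φ S) (hX : Exposed σ u v S)
    (h11 : S.reg 11 = vid u) (h12 : S.reg 12 = vid v) (huv : u ≠ v) :
    Wp createTransfer S (fun T S' => ∃ σ' val' φ' w δ, CreateAt c σ' val' lo φ' S' ∧ σ.FindMin u w δ ∧
      PState.CutAll u (σ.transfer u v δ) σ' ∧
      (∀ k, k < 20 → k ≠ 8 → k ≠ 9 → k ≠ 14 → S'.reg k = S.reg k) ∧ σ'.weight + 2 ≤ σ.weight ∧
      T ≤ 2 * opTime n + 20 + (opTime n + 20) * (σ.weight - σ'.weight) + (φ - φ')) := by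
  have hop := opTime_nonneg n
  obtain ⟨w, h24, hm⟩ := hX.2.2.2 huv
  set δ := S.reg 26 with hδ
  refine Wp.run_seq (by decide) fun T₁ hT₁ => Wp.seq ?_
  replace hT₁ : T₁ ≤ 9 := by
    have : createTransferPre.cost = 9 := by decide
    rw [this] at hT₁
    exact_mod_cast hT₁
  set S₁ := (S.setR 14 δ).push 2 (vtx u) (vtx v) δ with hS₁
  have e : createTransferPre.run S = (S₁.setR 20 (vid u)).setR 22 (-δ) := by
    simp [createTransferPre, pushCmd, hS₁, RState.push, h11, h12, vid_sub_one, ← hδ]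
  rw [e]
  have h1 := h.setR (k := 14) (by norm_num) δ
  have h8 : 0 ≤ (S.setR 14 δ).reg 8 := h1.static.reg0_nonneg.trans h1.queue.reg8_le
  have hL1 : LctAt S₁ σ.π val φ :=
    h1.lct.ext_fld fun j i hj _ hi => RState.push_fld _ _ _ _ _ h8 hj hi
  refine Wp.mono (addCmd_spec ((hL1.setR 20 (vid u)).setR 22 (-δ)) (u := u) (by simp)) ?_
  rintro T₂ S₂ ⟨φ₂, a1, a2, a3⟩
  have e22 : ((S₁.setR 20 (vid u)).setR 22 (-δ)).reg 22 = -δ := by simp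
  rw [e22] at a1
  have hF : Frame 20 S₁ S₂ := ((Frame.setR _ _ (by norm_num)).trans (Frame.setR _ _ (by norm_num))).trans
    (a2.mono (by norm_num))
  have h2 := h1.transfer hX.1 huv hm hF a1
  have hreg : ∀ k, k < 20 → k ≠ 8 → k ≠ 9 → k ≠ 14 → S₂.reg k = S.reg k := fun k hk h8 h9 h14 => by
    rw [hF.reg k hk, RState.push_reg _ _ _ _ _ h8 h9, RState.reg_setR, if_neg h14]
  refine Wp.seq (Wp.assign (Wp.seq ?_))
  change Wp exposeCmd (S₂.setR 20 ((Expr.reg 11).eval S₂)) _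
  refine Wp.mono ((h2.setR (k := 20) (by norm_num) _).expose (u := u)
    (by simp [hreg 11 (by norm_num) (by norm_num) (by norm_num), h11])) ?_
  rintro T₃ S₃ ⟨φ₃, v', b1, b2, b3, b4⟩
  have hreg₃ : ∀ k, k < 20 → k ≠ 8 → k ≠ 9 → k ≠ 14 → S₃.reg k = S.reg k := fun k hk h8 h9 h14 => by
    rw [b2.reg k (by omega), RState.reg_setR, if_neg (by omega), hreg k hk h8 h9 h14]
  refine Wp.mono (cutAllCmd_spec b1 b3 (by
    rw [hreg₃ 11 (by norm_num) (by norm_num) (by norm_num) (by norm_num), h11])) ?_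
  rintro T₄ S₄ ⟨σ', φ', d1, d2, d3, d4⟩
  have hw1 := (PState.weight_cutAll d2).2 ⟨w, hm.transfer⟩
  have hw2 := PState.weight_transfer (σ := σ) (u := u) (v := v) (hm.nonneg h.ok)
  have hw2' : ((σ.transfer u v δ).weight : ℝ) ≤ σ.weight := by exact_mod_cast hw2
  refine ⟨σ', _, φ', w, δ, d1, hm, d2, fun k hk h8 h9 h14 => ?_, by omega, ?_⟩
  · rw [d3 k hk h8 h9, hreg₃ k hk h8 h9 h14]
  · nlinarith
end

section
variable {n : ℕ} {c : CreateCtx n} {σ : PState n} {val : Fin n → ℤ} {lo : Fin n → ℕ} {φ : ℝ}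
  {S S' : RState}

/-- With the pointer at its end every listed arc at `v` has been passed, so it is discarded or has
capacity at most `ρ`. Live arcs have positive residual capacity under `f` and hence are listed in
`E`. -/
theorem CreateAt.dead {u v : Fin n} (h : CreateAt c σ val lo φ S) (hv : σ.π.IsRootOf u v)
    (hVC : ¬ (v ∈ c.VC ∧ v ≠ u)) (hcur : S.fld 8 (vid v) = 0) : PState.Dead c.VC c.ρ σ u v := by
  refine ⟨hv, fun h' => by_contra fun hne => hVC ⟨h', hne⟩, fun w hw => ?_⟩
  have hE : (v, w) ∈ c.E := c.enum.mem_of_res c.preflow (c.res_pos _ (h.live_sub hw)).ne'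
  obtain ⟨j, hj, hjE⟩ := List.getElem_of_mem hE
  rcases h.cur_next v with ⟨-, h2⟩ | ⟨i, hi, h1, -⟩
  · have hlt : j < lo c.E[j].1 := by
      by_contra hcon
      rw [hjE] at hcon
      exact h2 j hj (not_lt.1 hcon) (by rw [hjE])
    have := h.cur_done j hj hlt
    rw [hjE] at this
    rcases this with h' | h'
    · exact absurd hw h'
    · exact h'
  · rw [hcur] at h1
    omega

theorem createAdvance_run {v : Fin n} {j : ℕ} (h12 : S.reg 12 = vid v) (h13 : S.reg 13 = j + 1) :
    createAdvance.run S = S.setF 8 (vid v) (S.fld 9 (j + 1)) := by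
  simp [createAdvance, h12, h13]

/-- The state after one step of the search: nothing but passing an arc, or a step of feasible-path. -/
def SearchOutcome (c : CreateCtx n) (u : Fin n) (σ σ' : PState n) (lo lo' : Fin n → ℕ) : Prop :=
  (σ' = σ ∨ PState.SearchStep c.VC c.ρ u σ σ') ∧
    σ'.weight + c.pending lo' + 1 ≤ σ.weight + c.pending lo

theorem createTry_spec {u v : Fin n} (h : CreateAt c σ val lo φ S) (hv : σ.π.IsRootOf u v)
    (hVC : ¬ (v ∈ c.VC ∧ v ≠ u)) (h12 : S.reg 12 = vid v) {j : ℕ} (hj : j < c.E.length)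
    (h13 : S.reg 13 = j + 1) (hlo : lo v ≤ j) (hjv : c.E[j].1 = v)
    (hgap : ∀ (i : ℕ) (hi : i < c.E.length), lo v ≤ i → i < j → c.E[i].1 ≠ v)
    (hcap : c.ρ < S.fld 10 (j + 1)) :
    Wp createTry S (fun T S' => ∃ σ' val' lo' φ', CreateAt c σ' val' lo' φ' S' ∧
      SearchOutcome c u σ σ' lo lo' ∧
      (∀ k, k < 20 → k ≠ 8 → k ≠ 9 → k ≠ 14 → S'.reg k = S.reg k) ∧
      T ≤ 2 * opTime n + 20 - (φ' - φ)) := by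
  have hop := opTime_nonneg n
  set w := c.E[j].2 with hw
  have hjE : c.E[j] = (v, w) := Prod.ext hjv rfl
  have hcapj := h.cap j hj
  have hπ : ¬ σ.π c.E[j].1 = some c.E[j].2 := by rw [hjv, hv.2]; simp
  rw [if_neg hπ] at hcapj
  -- An active end would make the stored capacity zero, which is not above `ρ`.
  have hnact : ¬ (c.E[j].1 ∈ FlowNetwork.active c.f c.Δ ∨ c.E[j].2 ∈ FlowNetwork.active c.f c.Δ) := by
    intro hact
    rw [usableCap, if_pos hact] at hcapj
    have := c.ρ_nonneg
    omega
  rw [usableCap, if_neg hnact, hjv, ← hw] at hcapj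
  have hr : c.ρ < σ.r v w := by rw [← hcapj]; exact hcap
  -- Current capacities are at most the residual ones of `f`, so the arc belongs to the input graph;
  -- not having been passed, it is live.
  have hG : c.E[j] ∈ c.G := by
    refine c.mem_G _ (fun h' => hnact (Or.inl h')) (fun h' => hnact (Or.inr h')) ?_
    rw [hjv, ← hw]
    exact hr.trans_le (h.ok.r_le v w)
  have hlive : c.E[j] ∈ σ.live := h.cur_live j hj (by rw [hjv]; exact hlo) hG
  have hlive' := hlive
  rw [hjE] at hlive'
  have mh := h.static.inv.mem.head j hj
  refine Wp.seq (Wp.assign (Wp.seq ?_))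
  rw [show ({ S with reg := Function.update S.reg 20 _ } : RState) = S.setR 20 (vid w) by
    simp only [Expr.eval, Expr.eval_mul3, h13, h.static.inv.reg3]
    rw [show (3 : ℤ) + 3 * n + 3 * (j + 1) - 2 = 3 + 3 * n + 3 * j + 1 by ring, mh, vid_eq_vtx]; rfl]
  refine Wp.mono ((h.setR (k := 20) (by norm_num) (vid w)).expose (u := w) (by simp)) ?_
  rintro T₁ S₁ ⟨φ₁, x, a1, a2, a3, a4⟩
  have hreg : ∀ k, k < 20 → S₁.reg k = S.reg k := fun k hk => by
    rw [a2.reg k (by omega), RState.reg_setR, if_neg (by omega)]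
  have r12 : S₁.reg 12 = vid v := by rw [hreg 12 (by norm_num), h12]
  have r13 : S₁.reg 13 = j + 1 := by rw [hreg 13 (by norm_num), h13]
  have r20 : S₁.reg 20 = vid w := by rw [a2.reg 20 (by norm_num)]; simp
  refine Wp.ite (fun hb => ?_) (fun hb => ?_)
  · have hxv : x = v := by
      simp only [Test.Holds, Expr.eval, a3.2.1, r12, vid_inj] at hb
      exact hb
    subst hxv
    refine Wp.of_run (by decide) fun T₂ hT₂ => ?_
    replace hT₂ : T₂ ≤ 1 := by simpa [createAdvance, Cmd.setf, Cmd.cost] using hT₂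
    rw [createAdvance_run r12 r13]
    refine ⟨_, _, _, φ₁, a1.advance hj hjv hlo hgap (L := σ.live \ {c.E[j]}) Set.sdiff_subset
      (fun a ha hne => ⟨ha, hne⟩) (Or.inl fun h' => h'.2 rfl), ⟨Or.inr ?_, ?_⟩, ?_, by linarith⟩
    · rw [hjE]
      exact .discard hv hVC hlive' hr a3.1
    · have := CreateCtx.pending_advance (c := c) hj hjv hlo
      change σ.weight + _ + 1 ≤ _
      omega
    · intro k hk _ _ _
      rw [RState.reg_setF, hreg k hk]
  · have hnr : ¬ σ.π.IsRootOf w v := by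
      intro h'
      apply hb
      simp [a3.2.1, r12, a3.1.unique h']
    refine Wp.run_seq (by decide) fun T₂ hT₂ => ?_
    replace hT₂ : T₂ ≤ 11 := by
      have : createLinkPre.cost = 11 := by decide
      rw [this] at hT₂
      exact_mod_cast hT₂
    have hc10 : S₁.fld 10 (j + 1) = σ.r v w := by
      rw [a2.fld _ _ (by norm_num) (by norm_num), RState.fld_setR, hcapj]
    set S₂ := ((S₁.setR 14 (σ.r v w)).setF 10 (j + 1) 0).push 0 j 0 0 with hS₂
    have e : createLinkPre.run S₁ = ((S₂.setR 21 (vid w)).setR 20 (vid v)).setR 22 (σ.r v w) := by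
      simp [createLinkPre, pushCmd, hS₂, RState.push, r12, r13, r20, hc10]
    rw [e]
    have h1 := a1.setR (k := 14) (by norm_num) (σ.r v w)
    have h8 : 0 ≤ (S₁.setR 14 (σ.r v w)).reg 8 := h1.static.reg0_nonneg.trans h1.queue.reg8_le
    have hL1 : LctAt S₂ σ.π val φ₁ :=
      (h1.lct.setF (j := 10) (j + 1) 0 (by norm_num) (by norm_num)).ext_fld
        fun j i hj _ hi => RState.push_fld _ _ _ _ _ h8 hj hi
    refine Wp.mono (linkCmd_spec (((hL1.setR 21 (vid w)).setR 20 (vid v)).setR 22 (σ.r v w)) (v := v)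
      (w := w) (by simp) (by simp) hv.2 hnr) ?_
    rintro T₃ S₃ ⟨φ₃, b1, b2, b3⟩
    have e22 : (((S₂.setR 21 (vid w)).setR 20 (vid v)).setR 22 (σ.r v w)).reg 22 = σ.r v w := by simp
    rw [e22] at b1
    have hF : Frame 20 S₂ S₃ := (((Frame.setR _ _ (by norm_num)).trans (Frame.setR _ _ (by norm_num))).trans
      (Frame.setR _ _ (by norm_num))).trans (b2.mono (by norm_num))
    have hr0 := c.ρ_nonneg.trans_lt hr
    -- The pointer stays at the linked arc, and the drop of the weight pays for the step. If the arc
    -- is cut within this call, its stored capacity is zero, and the search passes it then.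
    refine ⟨_, _, lo, φ₃, h1.link hj hjE hv.2 hnr hr0 hF b1, ⟨Or.inr (.link hv hVC hlive' hr hnr), ?_⟩,
      ?_, ?_⟩
    · have := PState.weight_link (σ := σ) hv.2 hr0
      omega
    · intro k hk h8 h9 h14
      rw [hF.reg k hk, RState.push_reg _ _ _ _ _ h8 h9, RState.reg_setF, RState.reg_setR, if_neg h14,
        hreg k hk]
    · linarith

theorem createSearch_spec {u v : Fin n} (h : CreateAt c σ val lo φ S) (hv : σ.π.IsRootOf u v)
    (hVC : ¬ (v ∈ c.VC ∧ v ≠ u)) (h12 : S.reg 12 = vid v) :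
    Wp createSearch S (fun T S' => ∃ σ' val' lo' φ', CreateAt c σ' val' lo' φ' S' ∧
      ((SearchOutcome c u σ σ' lo lo' ∧ S'.reg 10 = S.reg 10) ∨
        (σ' = σ ∧ lo' = lo ∧ PState.Dead c.VC c.ρ σ u v ∧ S'.reg 10 = 0)) ∧
      (∀ k, k < 20 → k ≠ 8 → k ≠ 9 → k ≠ 10 → k ≠ 13 → k ≠ 14 → S'.reg k = S.reg k) ∧
      T ≤ 2 * opTime n + 30 - (φ' - φ)) := by
  have hop := opTime_nonneg n
  refine Wp.seq (Wp.assign ?_)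
  rw [show ({ S with reg := Function.update S.reg 13 _ } : RState) = S.setR 13 (S.fld 8 (vid v)) by
    simp only [Expr.eval_fl, Expr.eval, h12]; rfl]
  set S₁ := S.setR 13 (S.fld 8 (vid v)) with hS₁
  have h1 : CreateAt c σ val lo φ S₁ := h.setR (by norm_num) _
  have hreg : ∀ k, k ≠ 13 → S₁.reg k = S.reg k := fun k hk => by
    rw [hS₁, RState.reg_setR, if_neg hk]
  have r13 : S₁.reg 13 = S.fld 8 (vid v) := by simp [hS₁]
  refine Wp.ite (fun hb => ?_) (fun hb => ?_)
  · simp only [Test.Holds, Expr.eval, r13] at hb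
    refine Wp.assign ?_
    refine ⟨σ, val, lo, φ, h1.setR (k := 10) (by norm_num) _, Or.inr ⟨rfl, rfl, h.dead hv hVC hb, ?_⟩, ?_,
      ?_⟩
    · simp
    · intro k hk h8 h9 h10 h13 h14
      change (S₁.setR 10 _).reg k = _
      rw [RState.reg_setR, if_neg h10, hreg k h13]
    · linarith
  · simp only [Test.Holds, Expr.eval, r13] at hb
    obtain ⟨j, hj, hc, hlo, hjv, hgap⟩ := h.cur_eq hb
    have r13' : S₁.reg 13 = j + 1 := by rw [r13, hc]
    have r12 : S₁.reg 12 = vid v := by rw [hreg 12 (by norm_num), h12]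
    have r5 : S₁.reg 5 = c.ρ := h1.static.reg5
    refine Wp.ite (fun hb' => ?_) (fun hb' => ?_)
    · simp only [Test.Holds, Expr.eval, Expr.eval_fl, r13', r5] at hb'
      refine Wp.mono (createTry_spec h1 hv hVC r12 hj r13' hlo hjv hgap hb') ?_
      rintro T S' ⟨σ', val', lo', φ', a1, a2, a3, a4⟩
      refine ⟨σ', val', lo', φ', a1, Or.inl ⟨a2, ?_⟩, fun k hk h8 h9 _ h13 h14 => ?_, by linarith⟩
      · rw [a3 10 (by norm_num) (by norm_num) (by norm_num) (by norm_num), hreg 10 (by norm_num)]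
      · rw [a3 k hk h8 h9 h14, hreg k h13]
    · simp only [Test.Holds, Expr.eval, Expr.eval_fl, r13', r5, not_lt] at hb'
      refine Wp.of_run (by decide) fun T₂ hT₂ => ?_
      replace hT₂ : T₂ ≤ 1 := by simpa [createAdvance, Cmd.setf, Cmd.cost] using hT₂
      rw [createAdvance_run r12 r13']
      have hdone : c.E[j] ∉ σ.live ∨ σ.r c.E[j].1 c.E[j].2 ≤ c.ρ := by
        by_cases hact : c.E[j].1 ∈ FlowNetwork.active c.f c.Δ ∨ c.E[j].2 ∈ FlowNetwork.active c.f c.Δ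
        · refine Or.inl fun hl => ?_
          have := c.not_active _ (h.live_sub hl)
          tauto
        · refine Or.inr ?_
          have hcapj := h1.cap j hj
          rw [if_neg (by rw [hjv, hv.2]; simp), usableCap, if_neg hact] at hcapj
          rwa [← hcapj]
      refine ⟨σ, _, _, φ, h1.advance hj hjv hlo hgap (L := σ.live) subset_rfl (fun a ha _ => ha) hdone,
        Or.inl ⟨⟨Or.inl rfl, ?_⟩, ?_⟩, ?_, by linarith⟩
      · have := CreateCtx.pending_advance (c := c) hj hjv hlo
        omega
      · rw [RState.reg_setF, hreg 10 (by norm_num)]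
      · intro k hk _ _ _ h13 _
        rw [RState.reg_setF, hreg k h13]

/-! ## The loops -/

/-- The vertices listed before position `k` are infeasible. -/
def DeadBelow (c : CreateCtx n) (k : ℕ) (σ : PState n) : Prop :=
  ∀ u ∈ c.l.take k, u ∈ c.VC → ∃ v, PState.Dead c.VC c.ρ σ u v

/-- All vertices before position `k` are infeasible, so every feasible vertex stands at `k` or later
in the sorted list. -/
theorem DeadBelow.min_label {k : ℕ} (h : DeadBelow c k σ) (hX : Extracted c.d c.l S)
    (hk : k < c.l.length) {u : Fin n} (hu : PState.Feasible c.VC c.ρ σ u) : c.d c.l[k] ≤ c.d u := by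
  classical
  have hmem : u ∈ c.l := by
    have h1 : c.l.toFinset = Finset.univ := by
      apply Finset.eq_univ_of_card
      rw [List.toFinset_card_of_nodup hX.nodup, c.length_l, Fintype.card_fin]
    rw [← List.mem_toFinset, h1]
    exact Finset.mem_univ u
  obtain ⟨i, hi, rfl⟩ := List.getElem_of_mem hmem
  rcases lt_trichotomy i k with hik | rfl | hik
  · exfalso
    obtain ⟨v, hv⟩ := h _ (List.mem_take_iff_getElem.2 ⟨i, by omega, rfl⟩) hu.1
    exact hv.not_feasible hu
  · exact le_rfl
  · exact List.pairwise_iff_getElem.1 hX.sorted k i hk hi hik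

/-- The states of the loop for the vertex `u` at position `k`; the flag tells whether it goes on. -/
structure VertexInv (c : CreateCtx n) (σs : PState n) (k : ℕ) (u : Fin n) (σ : PState n) (val : Fin n → ℤ)
    (lo : Fin n → ℕ) (φ : ℝ) (flag : Bool) (S : RState) : Prop where
  at_ : CreateAt c σ val lo φ S
  reg4 : S.reg 4 = k
  reg11 : S.reg 11 = vid u
  reg10 : S.reg 10 = if flag then 1 else 0
  below : DeadBelow c k σ
  going : flag = true → ∃ σ₀, PState.CreateRounds c.VC c.d c.ρ σs σ₀ ∧
    Relation.ReflTransGen (PState.SearchStep c.VC c.ρ u) σ₀ σ ∧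
    ∀ u', PState.Feasible c.VC c.ρ σ₀ u' → c.d u ≤ c.d u'
  done : flag = false → PState.CreateRounds c.VC c.d c.ρ σs σ ∧ ∃ v, PState.Dead c.VC c.ρ σ u v

/-- `CreateLoop` is built from its first round, while the program extends an execution at its end;
therefore `CreateRounds` speaks about all continuations. If the search made no step, no round is
recorded, since a round would require `u` to have been feasible. -/
theorem PState.CreateRounds.fail {VC : Set (Fin n)} {d : Fin n → ℕ} {ρ : ℤ} {σs σ₀ σ : PState n}
    {u v : Fin n} (hu : u ∈ VC) (h : PState.CreateRounds VC d ρ σs σ₀)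
    (hs : Relation.ReflTransGen (PState.SearchStep VC ρ u) σ₀ σ)
    (hmin : ∀ u', PState.Feasible VC ρ σ₀ u' → d u ≤ d u') (hd : PState.Dead VC ρ σ u v) :
    PState.CreateRounds VC d ρ σs σ := by
  rcases hs.cases_head with rfl | ⟨τ, h1, -⟩
  · exact h
  · exact fun _ hτ => h _ (.fail (PState.Feasible.of_searchStep hu h1) hmin
      ⟨hs, hd.not_feasible⟩ hτ)

/-- The time that pays for one operation of the forest or one passed arc. -/
noncomputable def stepTime (n : ℕ) : ℝ := 3 * opTime n + 100

/-- The potential of the loop for a vertex. -/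
noncomputable def vertexPot (c : CreateCtx n) (σ : PState n) (lo : Fin n → ℕ) (φ : ℝ) (flag : Bool) : ℝ :=
  stepTime n * (σ.weight + c.pending lo) + φ + if flag then stepTime n else 0

/-- A step creates a pseudoarc, which lowers the weight by at least two, or links or passes an arc,
which lowers `weight + pending` by at least one, or clears the flag. In each case `vertexPot`
releases at least one `stepTime`, and three forest operations fit into it. -/
theorem createStep_spec {σs : PState n} {k : ℕ} (hk : k < c.l.length) {u : Fin n} (hu : c.l[k] = u)
    (huVC : u ∈ c.VC) (h : VertexInv c σs k u σ val lo φ true S) :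
    Wp createStep S (fun T S' => ∃ σ' val' lo' φ' flag', VertexInv c σs k u σ' val' lo' φ' flag' S' ∧
      T + 1 ≤ vertexPot c σ lo φ true - vertexPot c σ' lo' φ' flag') := by
  have hop := opTime_nonneg n
  obtain ⟨σ₀, g1, g2, g3⟩ := h.going rfl
  refine Wp.seq (Wp.assign (Wp.seq ?_))
  change Wp exposeCmd (S.setR 20 ((Expr.reg 11).eval S)) _
  refine Wp.mono ((h.at_.setR (k := 20) (by norm_num) _).expose (u := u) (by simp [h.reg11])) ?_
  rintro T₁ S₁ ⟨φ₁, v, a1, a2, a3, a4⟩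
  have hreg : ∀ k, k < 20 → S₁.reg k = S.reg k := fun k hk => by
    rw [a2.reg k (by omega), RState.reg_setR, if_neg (by omega)]
  refine Wp.seq (Wp.assign ?_)
  rw [show ({ S₁ with reg := Function.update S₁.reg 12 _ } : RState) = S₁.setR 12 (vid v) by
    simp only [Expr.eval, a3.2.1]; rfl]
  set S₂ := S₁.setR 12 (vid v) with hS₂
  have h2 : CreateAt c σ val lo φ₁ S₂ := a1.setR (by norm_num) _
  have hX : Exposed σ u v S₂ := by
    obtain ⟨x1, x2, x3, x4⟩ := a3
    refine ⟨x1, ?_, ?_, ?_⟩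
    · simp [hS₂, x2]
    · simpa [hS₂] using x3
    · simpa [hS₂] using x4
  have hreg₂ : ∀ k, k < 20 → k ≠ 12 → S₂.reg k = S.reg k := fun k hk h12 => by
    rw [hS₂, RState.reg_setR, if_neg h12, hreg k hk]
  have r11 : S₂.reg 11 = vid u := by rw [hreg₂ 11 (by norm_num) (by norm_num), h.reg11]
  have r12 : S₂.reg 12 = vid v := by simp [hS₂]
  have mVC := h2.static.inv.mem.comp v
  have htest : (Test.and (.neg (.eq (.reg 12) (.reg 11)))
      (.eq (.load (.add (Expr.mul3 (.reg 12)) (.lit 2))) (.lit 1))).Holds S₂ ↔ (v ∈ c.VC ∧ v ≠ u) := by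
    simp only [Test.Holds, Expr.eval, Expr.eval_mul3, r11, r12, vid_inj]
    rw [show 3 * vid v + 2 = 3 + 3 * vtx v + 2 by simp only [vid, vtx]; ring, mVC, bit_eq_one]
    tauto
  refine Wp.ite (fun hb => ?_) (fun hb => ?_)
  · obtain ⟨hvVC, hvu⟩ := htest.1 hb
    refine Wp.mono (createTransfer_spec h2 hX r11 r12 (Ne.symm hvu)) ?_
    rintro T₃ S₃ ⟨σ', val', φ', w, δ, b1, b2, b3, b4, b5, b6⟩
    have hb5 : (σ'.weight : ℝ) + 2 ≤ σ.weight := by exact_mod_cast b5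
    -- If a dead search ends at the same root `v` as the new path, then, as `v` lies in `V_C`, the
    -- dead vertex is `v` itself, and the cuts do not affect it.
    have hbelow : DeadBelow c k σ' := by
      intro u' hu' huVC'
      obtain ⟨v', hv'⟩ := h.below u' hu' huVC'
      refine ⟨v', (hv'.transfer (b2.nonneg h2.ok) v).cutAll ?_ b3⟩
      intro hr
      have : v' = v := Forest.IsRootOf.unique hr hX.1
      subst this
      exact (hv'.2.1 hvVC).symm
    refine ⟨σ', val', lo, φ', true, ⟨b1, ?_, ?_, ?_, hbelow, fun _ => ⟨σ', ?_, .refl, ?_⟩, by simp⟩, ?_⟩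
    · rw [b4 4 (by norm_num) (by norm_num) (by norm_num) (by norm_num),
        hreg₂ 4 (by norm_num) (by norm_num), h.reg4]
    · rw [b4 11 (by norm_num) (by norm_num) (by norm_num) (by norm_num), r11]
    · rw [b4 10 (by norm_num) (by norm_num) (by norm_num) (by norm_num),
        hreg₂ 10 (by norm_num) (by norm_num), h.reg10]
    · intro σ'' hσ''
      have hfeas : PState.Feasible c.VC c.ρ σ u := ⟨huVC, v, hX.1, Or.inl ⟨hvVC, hvu⟩⟩
      -- The pseudoarc completes the round that began at `σ₀`; the next round begins at `σ'`, where
      -- the label of `u` is still the smallest.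
      exact g1 _ (.build (hfeas.of_search g2) g3 ⟨g2, hX.1, hvVC, hvu⟩ b2 b3 hσ'')
    · intro u' hu'
      rw [← hu]
      exact hbelow.min_label b1.static.ord hk hu'
    · unfold vertexPot stepTime
      nlinarith
  · refine Wp.mono (createSearch_spec h2 hX.1 (fun h' => hb (htest.2 h')) r12) ?_
    rintro T₃ S₃ ⟨σ', val', lo', φ', b1, b2, b3, b4⟩
    have q4 : S₃.reg 4 = k := by
      rw [b3 4 (by norm_num) (by norm_num) (by norm_num) (by norm_num) (by norm_num) (by norm_num),
        hreg₂ 4 (by norm_num) (by norm_num), h.reg4]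
    have q11 : S₃.reg 11 = vid u := by
      rw [b3 11 (by norm_num) (by norm_num) (by norm_num) (by norm_num) (by norm_num) (by norm_num), r11]
    rcases b2 with ⟨⟨c1, c2⟩, c3⟩ | ⟨rfl, rfl, c3, c4⟩
    · have hc2 : (σ'.weight : ℝ) + c.pending lo' + 1 ≤ σ.weight + c.pending lo := by exact_mod_cast c2
      refine ⟨σ', val', lo', φ', true, ⟨b1, q4, q11, ?_, ?_, fun _ => ⟨σ₀, g1, ?_, g3⟩, by simp⟩, ?_⟩
      · rw [c3, hreg₂ 10 (by norm_num) (by norm_num), h.reg10]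
      · rcases c1 with rfl | c1
        · exact h.below
        · intro u' hu' huVC'
          obtain ⟨v', hv'⟩ := h.below u' hu' huVC'
          exact ⟨v', hv'.searchStep c1⟩
      · rcases c1 with rfl | c1
        · exact g2
        · exact g2.tail c1
      · unfold vertexPot stepTime
        nlinarith
    · refine ⟨σ', val', lo', φ', false, ⟨b1, q4, q11, by rw [c4]; simp, h.below, by simp,
        fun _ => ⟨g1.fail huVC g2 g3 c3, v, c3⟩⟩, ?_⟩
      unfold vertexPot stepTime
      simp only [if_true, Bool.false_eq_true, if_false]
      linarith
end

section
open Expr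

/-- The loop for the vertex at the position in register `4`. -/
def createVertex : Cmd := .seq (.assign 11 (fl (lit 12) (reg 4)))
  (.seq (.ite (.eq (load (add (mul3 (reg 11)) (lit 2))) (lit 1))
    (.seq (.assign 10 (lit 1)) (.loop (.eq (reg 10) (lit 1)) createStep)) .skip)
    (.assign 4 (add (reg 4) (lit 1))))

def resetStep : Cmd := .seq (.setf (lit 8) (add (reg 4) (lit 1)) (fl (lit 11) (add (reg 4) (lit 1))))
  (.assign 4 (add (reg 4) (lit 1)))

/-- A call of create-all-pseudoarcs. -/
def createCall : Cmd := .seq (.assign 4 (lit 0)) (.seq (.loop (.lt (reg 4) (reg 1)) resetStep)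
  (.seq (.assign 4 (lit 0)) (.loop (.lt (reg 4) (reg 1)) createVertex)))

def createHeader : Cmd := .seq (.assign 1 (load (lit 0))) (.seq (.assign 2 (load (lit 1)))
  (.seq (.assign 3 (add (lit 3) (mul3 (reg 1)))) (.assign 0 (add (reg 3) (mul3 (reg 2))))))

def createFirst : Cmd := .seq (.assign 8 (add (reg 0) (lit 2))) (.seq (.assign 9 (lit 0))
  (.assign 5 (load (lit 2))))

def createSecond : Cmd := .seq (.assign 7 (reg 9)) (.assign 5 (lit 0))

def createFinish : Cmd := .seq (.store (reg 0) (reg 7)) (.store (add (reg 0) (lit 1)) (reg 9))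

/-- The program for the two calls of create-all-pseudoarcs in a phase. -/
def createCmd : Cmd := .seq createHeader (.seq sortCmd (.seq arcPrep (.seq (.assign 20 (reg 1))
  (.seq initCmd (.seq createFirst (.seq createCall (.seq createSecond (.seq createCall createFinish))))))))
end

section
variable {n : ℕ} {c : CreateCtx n} {σ : PState n} {val : Fin n → ℤ} {lo : Fin n → ℕ} {φ : ℝ}
  {S S' : RState}

/-- The memory holds the state `σ` before or after a call. -/
structure CreateReady (c : CreateCtx n) (σ : PState n) (val : Fin n → ℤ) (φ : ℝ) (S : RState) : Prop where
  static : CreateStatic c S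
  ok : PState.Ok c.N c.f σ
  lct : LctAt S σ.π val φ
  val_eq : ∀ a b, σ.π a = some b → val a = σ.r a b
  cap : ∀ (j : ℕ) (hj : j < c.E.length), S.fld 10 (j + 1)
    = if σ.π c.E[j].1 = some c.E[j].2 then 0 else usableCap c.f c.Δ σ.r c.E[j]
  queue : QueueAt c.E σ.Q S

theorem CreateAt.ready (h : CreateAt c σ val lo φ S) : CreateReady c σ val φ S :=
  ⟨h.static, h.ok, h.lct, h.val_eq, h.cap, h.queue⟩

theorem CreateReady.createAt (h : CreateReady c σ val φ S)
    (h8 : ∀ v : Fin n, S.fld 8 (vid v) = S.fld 11 (vid v)) :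
    CreateAt c { σ with live := c.G } val (fun _ => 0) φ S where
  static := h.static
  ok := h.ok.with_live _
  lct := h.lct
  val_eq := h.val_eq
  cap := h.cap
  live_sub := subset_rfl
  cur_next := fun v => by rw [h8]; exact h.static.lists.first v
  cur_done := fun _ _ h => absurd h (by omega)
  cur_live := fun _ _ _ h => h
  queue := h.queue

theorem CreateStatic.setR4 (h : CreateStatic c S) (x : ℤ) : CreateStatic c (S.setR 4 x) :=
  h.congr (h.inv.setR (by norm_num) _) (by simp) (by simp) (fun _ _ _ _ _ _ => rfl)

theorem CreateReady.setR4 (h : CreateReady c σ val φ S) (x : ℤ) : CreateReady c σ val φ (S.setR 4 x) :=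
  ⟨h.static.setR4 x, h.ok, h.lct.setR _ _, h.val_eq, h.cap,
    h.queue.congr (by simp) (by simp) (by simp) (fun _ _ => rfl)⟩

theorem CreateAt.setR4 (h : CreateAt c σ val lo φ S) (x : ℤ) : CreateAt c σ val lo φ (S.setR 4 x) :=
  ⟨h.static.setR4 x, h.ok, h.lct.setR _ _, h.val_eq, h.cap, h.live_sub, h.cur_next, h.cur_done,
    h.cur_live, h.queue.congr (by simp) (by simp) (by simp) (fun _ _ => rfl)⟩

theorem CreateReady.setF8 (h : CreateReady c σ val φ S) {i : ℤ} (hi : 0 ≤ i) (x : ℤ) :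
    CreateReady c σ val φ (S.setF 8 i x) where
  static := h.static.congr (h.static.inv.setF (by norm_num) hi _) rfl rfl
    (fun j i h1 _ h2 _ => by
      rw [RState.fld_setF _ (by norm_num) (by norm_num) (by omega) h2, if_neg (by omega)])
  ok := h.ok
  lct := h.lct.setF _ _ (by norm_num) (by norm_num)
  val_eq := h.val_eq
  cap := fun k hk => by
    rw [RState.fld_setF _ (by norm_num) (by norm_num) (by norm_num) (by norm_num), if_neg (by norm_num)]
    exact h.cap k hk
  queue := h.queue.congr rfl rfl rfl (fun a ha => RState.mem_setF _ (by norm_num) hi (by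
    have := h.static.reg0_nonneg
    omega))

theorem stepTime_nonneg (n : ℕ) : 0 ≤ stepTime n := by
  have := opTime_nonneg n
  unfold stepTime; linarith

theorem createVertex_spec {σs : PState n} {k : ℕ} (hk : k < c.l.length) (h : CreateAt c σ val lo φ S)
    (h4 : S.reg 4 = k) (hD : DeadBelow c k σ) (hR : PState.CreateRounds c.VC c.d c.ρ σs σ) :
    Wp createVertex S (fun T S' => ∃ σ' val' lo' φ', CreateAt c σ' val' lo' φ' S' ∧
      S'.reg 4 = (k + 1 : ℕ) ∧ DeadBelow c (k + 1) σ' ∧ PState.CreateRounds c.VC c.d c.ρ σs σ' ∧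
      T ≤ stepTime n + 10 - (stepTime n * (σ'.weight + c.pending lo') + φ'
        - (stepTime n * (σ.weight + c.pending lo) + φ))) := by
  have hst := stepTime_nonneg n
  obtain ⟨u, hu⟩ : ∃ u, c.l[k] = u := ⟨_, rfl⟩
  have hord := h.static.ord.fld k hk
  rw [hu] at hord
  have htake : ∀ σ', DeadBelow c k σ' → (u ∈ c.VC → ∃ v, PState.Dead c.VC c.ρ σ' u v) →
      DeadBelow c (k + 1) σ' := by
    intro σ' h1 h2 u' hu' hVC
    rw [List.take_succ_eq_append_getElem hk, List.mem_append, List.mem_singleton, hu] at hu'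
    rcases hu' with hu' | rfl
    · exact h1 u' hu' hVC
    · exact h2 hVC
  refine Wp.seq (Wp.assign (Wp.seq ?_))
  rw [show ({ S with reg := Function.update S.reg 11 _ } : RState) = S.setR 11 (vid u) by
    simp only [Expr.eval, Expr.eval_fl, h4, hord]; rfl]
  have h1 := h.setR (k := 11) (by norm_num) (vid u)
  have mVC := h1.static.inv.mem.comp u
  have htest : (Test.eq (.load (.add (Expr.mul3 (.reg 11)) (.lit 2))) (.lit 1)).Holds (S.setR 11 (vid u))
      ↔ u ∈ c.VC := by
    simp only [Test.Holds, Expr.eval, Expr.eval_mul3, RState.reg_setR, if_true]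
    rw [show 3 * vid u + 2 = 3 + 3 * vtx u + 2 by simp only [vid, vtx]; ring, mVC, bit_eq_one]
  refine Wp.ite (fun hb => ?_) (fun hb => ?_)
  · have huVC := htest.1 hb
    refine Wp.seq (Wp.assign ?_)
    change Wp (Cmd.loop _ _) ((S.setR 11 (vid u)).setR 10 1) _
    have hV : VertexInv c σs k u σ val lo φ true ((S.setR 11 (vid u)).setR 10 1) := by
      refine ⟨h1.setR (by norm_num) _, by simp [h4], by simp, by simp, hD, fun _ => ⟨σ, hR, .refl, ?_⟩,
        by simp⟩
      intro u' hu'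
      rw [← hu]
      exact hD.min_label h.static.ord hk hu'
    refine Wp.mono (Wp.loop (α := PState n × (Fin n → ℤ) × (Fin n → ℕ) × ℝ × Bool)
      (fun a S' => VertexInv c σs k u a.1 a.2.1 a.2.2.1 a.2.2.2.1 a.2.2.2.2 S')
      (fun a => vertexPot c a.1 a.2.2.1 a.2.2.2.1 a.2.2.2.2) ?_ ?_ (a := (σ, val, lo, φ, true)) hV) ?_
    · rintro ⟨τ, v, m, ψ, b⟩ S' h'
      have := h'.at_.lct.nonneg
      have : (0 : ℝ) ≤ stepTime n * (τ.weight + c.pending m) := mul_nonneg hst (by positivity)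
      simp only [vertexPot]
      split_ifs <;> linarith
    · rintro ⟨τ, v, m, ψ, b⟩ S' h' hb'
      have hbt : b = true := by
        simp only [Test.Holds, Expr.eval] at hb'
        rw [h'.reg10] at hb'
        by_contra hne
        simp [hne] at hb'
      subst hbt
      refine Wp.mono (createStep_spec hk hu huVC h') ?_
      rintro T S'' ⟨σ', val', lo', φ', flag', b1, b2⟩
      exact ⟨(σ', val', lo', φ', flag'), b1, b2⟩
    · rintro T S' ⟨⟨τ, v, m, ψ, b⟩, h', hb', hT⟩
      have hbf : b = false := by
        simp only [Test.Holds, Expr.eval] at hb'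
        rw [h'.reg10] at hb'
        by_contra hne
        simp [hne] at hb'
      subst hbf
      obtain ⟨d1, d2⟩ := h'.done rfl
      refine Wp.assign ⟨τ, v, m, ψ, h'.at_.setR4 _, ?_, htake τ h'.below fun _ => d2, d1, ?_⟩
      · have := h'.reg4
        simp [this]
      · simp only [vertexPot, if_true, Bool.false_eq_true, if_false] at hT
        linarith
  · refine Wp.of_run (by decide) fun T hT => ?_
    replace hT : T ≤ 1 := by simpa [Cmd.cost] using hT
    refine Wp.assign ⟨σ, val, lo, φ, h1.setR4 _, ?_, htake σ hD fun h' => absurd (htest.2 h') hb, hR, ?_⟩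
    · simp [h4]
    · linarith

/-- The weight is carried over from call to call, so its decrease telescopes over the phase. The arc
pointers are reset, which costs a fresh `E.length` per call, and each vertex pays one step that ends
its loop. -/
theorem createCall_spec (h : CreateReady c σ val φ S) :
    Wp createCall S (fun T S' => ∃ σ' val' φ', CreateReady c σ' val' φ' S' ∧
      PState.CreateAll c.VC c.d c.G c.ρ σ σ' ∧
      T ≤ n * (stepTime n + 20) + stepTime n * (σ.weight - σ'.weight + c.E.length) + (φ - φ') + 10) := by
  have hst := stepTime_nonneg n
  refine Wp.seq (Wp.assign (Wp.seq ?_))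
  change Wp (Cmd.loop _ _) (S.setR 4 0) _
  refine Wp.mono (Wp.loop_count (fun i ψ S' => ψ = φ ∧ i ≤ n ∧ CreateReady c σ val φ S' ∧ S'.reg 4 = i ∧
    ∀ v : Fin n, (v : ℕ) < i → S'.fld 8 (vid v) = S'.fld 11 (vid v)) n 2 (by norm_num) ?_ ?_ (φ := φ) ?_) ?_
  · rintro i ψ S' ⟨rfl, h1, h2, h3, -⟩
    refine ⟨h2.lct.nonneg, h1, ?_⟩
    simp only [Test.Holds, Expr.eval, h3, h2.static.inv.reg1]
    omega
  · rintro i ψ S' hi ⟨rfl, h1, h2, h3, h4⟩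
    refine Wp.of_run (by decide) fun T hT => ?_
    replace hT : T ≤ 2 := by
      have : resetStep.cost = 2 := by decide
      rw [this] at hT
      exact_mod_cast hT
    have e : resetStep.run S' = (S'.setF 8 (i + 1) (S'.fld 11 (i + 1))).setR 4 (i + 1) := by
      simp [resetStep, h3]
    rw [e]
    refine ⟨ψ, ⟨rfl, hi, (h2.setF8 (by omega) _).setR4 _, by simp, fun v hv => ?_⟩, by linarith⟩
    rcases Nat.lt_succ_iff_lt_or_eq.1 hv with h' | h'
    · have hne : ¬ vid v = (i : ℤ) + 1 := by simp only [vid]; omega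
      simpa [hne] using h4 v h'
    · have he : vid v = (i : ℤ) + 1 := by simp only [vid]; omega
      simp [he]
  · exact ⟨rfl, Nat.zero_le _, h.setR4 _, by simp, fun v hv => absurd hv (by omega)⟩
  rintro T₁ S₁ ⟨ψ, ⟨rfl, -, h1, h2, h3⟩, hT₁⟩
  refine Wp.seq (Wp.assign ?_)
  change Wp (Cmd.loop _ _) (S₁.setR 4 0) _
  have hA := (h1.createAt fun v => h3 v v.isLt).setR4 0
  set σs : PState n := { σ with live := c.G } with hσs
  refine Wp.mono (Wp.loop_count (fun k Φ S' => ∃ σ' val' lo' φ', CreateAt c σ' val' lo' φ' S' ∧ k ≤ n ∧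
    S'.reg 4 = k ∧ DeadBelow c k σ' ∧ PState.CreateRounds c.VC c.d c.ρ σs σ' ∧
    Φ = stepTime n * (σ'.weight + c.pending lo') + φ') n (stepTime n + 10) (by linarith) ?_ ?_
    (φ := stepTime n * (σs.weight + c.pending (fun _ => 0)) + ψ) ?_) ?_
  · rintro k Φ S' ⟨σ', val', lo', φ', a1, a2, a3, -, -, rfl⟩
    have := a1.lct.nonneg
    have : (0 : ℝ) ≤ stepTime n * (σ'.weight + c.pending lo') := mul_nonneg hst (by positivity)
    refine ⟨by linarith, a2, ?_⟩
    simp only [Test.Holds, Expr.eval, a3, a1.static.inv.reg1]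
    omega
  · rintro k Φ S' hk ⟨σ', val', lo', φ', a1, a2, a3, a4, a5, rfl⟩
    refine Wp.mono (createVertex_spec (by rw [c.length_l]; exact hk) a1 a3 a4 a5) ?_
    rintro T S'' ⟨τ, v, m, ψ', b1, b2, b3, b4, b5⟩
    exact ⟨_, ⟨τ, v, m, ψ', b1, hk, b2, b3, b4, rfl⟩, b5⟩
  · exact ⟨σs, val, _, ψ, hA, Nat.zero_le _, by simp, by intro u hu; simp at hu,
      PState.CreateRounds.refl _, rfl⟩
  rintro T₂ S₂ ⟨Φ, ⟨σ', val', lo', φ', a1, a2, a3, a4, a5, rfl⟩, hT₂⟩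
  -- When the list is exhausted every vertex of `V_C` is dead, so no vertex is feasible and the loop
  -- of the procedure may end here.
  refine ⟨σ', val', φ', a1.ready, a5 _ (.done fun u hu => ?_), ?_⟩
  · have hmem : u ∈ c.l.take n := by
      classical
      have h1 : c.l.toFinset = Finset.univ := by
        apply Finset.eq_univ_of_card
        rw [List.toFinset_card_of_nodup a1.static.ord.nodup, c.length_l, Fintype.card_fin]
      rw [List.take_of_length_le c.length_l.le, ← List.mem_toFinset, h1]
      exact Finset.mem_univ u
    obtain ⟨v, hv⟩ := a4 u hmem hu.1
    exact hv.not_feasible hu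
  · have hw : σs.weight = σ.weight := rfl
    rw [hw] at hT₂
    have hp : (c.pending (fun _ => 0) : ℝ) ≤ c.E.length := by exact_mod_cast c.pending_le _
    have hp' : (0 : ℝ) ≤ c.pending lo' := Nat.cast_nonneg _
    have hn : (0 : ℝ) ≤ n := Nat.cast_nonneg _
    have q1 := mul_le_mul_of_nonneg_left hp hst
    have q2 := mul_nonneg hst hp'
    nlinarith
end

/-! ### The two calls of a phase and the theorem -/

section
variable {n : ℕ} {N : FlowNetwork n} {f : Fin n → Fin n → ℤ} {Δ : ℕ} {d : Fin n → ℕ}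
  {E : List (Fin n × Fin n)} {S : RState}

/-- The call for the abundant pseudoarcs. -/
def abundantCtx (hE : N.Enumerates E) (hf : N.IsPreflow f) (Δ : ℕ) (d : Fin n → ℕ) {l : List (Fin n)}
    (hl : l.length = n) (q : ℤ) : CreateCtx n where
  N := N
  f := f
  Δ := Δ
  d := d
  E := E
  l := l
  G := N.abArcs f Δ
  ρ := Δ
  q := q
  enum := hE
  preflow := hf
  ρ_nonneg := Int.natCast_nonneg Δ
  length_l := hl
  res_pos := fun _ ha => lt_of_le_of_lt (Int.natCast_nonneg Δ) ha.1
  not_active := fun _ ha => ha.2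
  mem_G := fun _ h1 h2 h3 => ⟨h3, h1, h2⟩

/-- The call for the small pseudoarcs. -/
def smallCtx (hE : N.Enumerates E) (hf : N.IsPreflow f) (Δ : ℕ) (d : Fin n → ℕ) {l : List (Fin n)}
    (hl : l.length = n) (q : ℤ) : CreateCtx n where
  N := N
  f := f
  Δ := Δ
  d := d
  E := E
  l := l
  G := N.inArcs f Δ
  ρ := 0
  q := q
  enum := hE
  preflow := hf
  ρ_nonneg := le_rfl
  length_l := hl
  res_pos := fun _ ha => ha.1
  not_active := fun _ ha => ha.2
  mem_G := fun _ h1 h2 h3 => ⟨h3, h1, h2⟩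

theorem length_encOp (E : List (Fin n × Fin n)) (φ : Op n) : (encOp E φ).length = 4 := by
  cases φ <;> rfl

theorem QueueAt.outputs {σ₁ σ₂ : PState n} (h : QueueAt E σ₂.Q S) (h7 : S.reg 7 = σ₁.Q.length) :
    (createFinish.run S).Outputs (createOutput E σ₁ σ₂) := by
  have e : createFinish.run S
      = (S.setM (S.reg 0) (S.reg 7)).setM (S.reg 0 + 1) (S.reg 9) := by
    simp [createFinish]
  rw [e]
  have hlen : (createOutput E σ₁ σ₂).length = 2 + 4 * σ₂.Q.length := by
    rw [createOutput, List.length_append, List.length_flatMap_block (length_encOp E)]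
    simp
  intro i hi
  rw [hlen] at hi
  rw [← Option.some_inj, ← List.getElem?_eq_getElem]
  simp only [RState.mem_setM, RState.reg_setM]
  rcases Nat.lt_or_ge i 2 with h2 | h2
  · interval_cases i
    · simp [createOutput, h7]
    · simp [createOutput, h.reg9]
  · obtain ⟨k, t, ht, rfl⟩ : ∃ k t, t < 4 ∧ i = 2 + (4 * k + t) :=
      ⟨(i - 2) / 4, (i - 2) % 4, Nat.mod_lt _ (by norm_num), by omega⟩
    have hk : k < σ₂.Q.length := by omega
    rw [if_neg (by push_cast; omega), if_neg (by push_cast; omega), createOutput,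
      List.getElem?_append_right (by simp)]
    have hc := h.cell k t hk ht
    rw [show S.reg 0 + ((2 + (4 * k + t) : ℕ) : ℤ) = S.reg 0 + 2 + 4 * k + t by push_cast; ring, hc]
    rw [show 2 + (4 * k + t) - [(σ₁.Q.length : ℤ), (σ₂.Q.length : ℤ)].length = 4 * k + t by simp,
      List.getElem?_flatMap_block (length_encOp E) _ _ _ ht hk,
      List.getD_eq_getElem _ _ (by rw [length_encOp]; exact ht), List.getElem?_eq_getElem]

theorem createCmd_spec (hE : N.Enumerates E) (hf : N.IsPreflow f) :
    Wp createCmd (RState.start (createInput N f Δ d E)) (fun T S' => ∃ σ₁ σ₂,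
      N.PhaseExecution f Δ d σ₁ σ₂ ∧ S'.Outputs (createOutput E σ₁ σ₂) ∧
      T ≤ (n + E.length + (N.startState f).weight + 1) * (12 * opTime n + 400)) := by
  have hop := opTime_nonneg n
  set S₀ := RState.start (createInput N f Δ d E) with hS₀
  have hM : CreateMem N f Δ d E S₀ := createMem_start
  refine Wp.run_seq (by decide) fun T₀ hT₀ => ?_
  replace hT₀ : T₀ ≤ 4 := by
    have : createHeader.cost = 4 := by decide
    rw [this] at hT₀
    exact_mod_cast hT₀
  obtain ⟨S₁, hS₁⟩ : ∃ S₁, createHeader.run S₀ = S₁ := ⟨_, rfl⟩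
  rw [hS₁]
  have e₁ : S₁ = (((S₀.setR 1 n).setR 2 E.length).setR 3 (3 + 3 * n)).setR 0
      (3 + 3 * n + 3 * E.length) := by
    simp [← hS₁, createHeader, hM.mem0, hM.mem1]
  have hI₁ : CreateInv N f Δ d E S₁ := by
    rw [e₁]
    exact ⟨hM.congr fun _ _ _ => rfl, by simp, by simp, by simp, by simp⟩
  have hz : ∀ v : Fin n, S₁.fld 11 (vid v) = 0 := by
    intro v
    rw [e₁]
    exact RState.start_fld (createInput N f Δ d E) (j := 11) (i := vid v) (by norm_num) (vid_pos v).le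
  refine Wp.seq (Wp.mono (sortCmd_spec hI₁) ?_)
  rintro T₁ S₂ ⟨l, hl, hI₂, hX₂, hT₁⟩
  refine Wp.seq (Wp.mono (arcPrep_spec hI₂.inv hX₂ fun v => ?_) ?_)
  · rw [hI₂.fld _ _ (by norm_num) (by norm_num), hz]
  rintro T₂ S₃ ⟨hI₃, hX₃, hA₃, hc₃, hT₂⟩
  refine Wp.seq (Wp.assign (Wp.seq ?_))
  change Wp initCmd (S₃.setR 20 (S₃.reg 1)) _
  refine Wp.mono (initCmd_spec (n := n) (by simp [hI₃.reg1])) ?_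
  rintro T₃ S₄ ⟨hL₄, hF₄', hT₃⟩
  have hF₄ : Frame 20 S₃ S₄ := (Frame.setR _ _ le_rfl).trans hF₄'
  have hI₄ := hI₃.frame (by norm_num) hF₄
  refine Wp.run_seq (by decide) fun T₄ hT₄ => ?_
  replace hT₄ : T₄ ≤ 3 := by
    have : createFirst.cost = 3 := by decide
    rw [this] at hT₄
    exact_mod_cast hT₄
  have e₅ : createFirst.run S₄ = ((S₄.setR 8 (S₄.reg 0 + 2)).setR 9 0).setR 5 Δ := by
    simp [createFirst, hI₄.mem.mem2]
  rw [e₅]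
  -- Register `7` has no role in the first call, so `q` is whatever it contains. In the second call
  -- it preserves the length that the queue had after the first one, for the output.
  have hR : CreateReady (abundantCtx hE hf Δ d hl (S₄.reg 7)) (N.startState f) (fun _ => 0) 0
      (((S₄.setR 8 (S₄.reg 0 + 2)).setR 9 0).setR 5 Δ) := by
    refine ⟨⟨((hI₄.setR (by norm_num) _).setR (by norm_num) _).setR (by norm_num) _,
      hA₃.congr (fun i _ => hF₄.fld 9 i (by norm_num) (by norm_num))
        (fun i _ => hF₄.fld 11 i (by norm_num) (by norm_num)),
      hX₃.congr (fun i _ => hF₄.fld 12 i (by norm_num) (by norm_num)),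
      by simp [abundantCtx], by simp [abundantCtx]⟩, PState.ok_startState hf,
      ((hL₄.setR _ _).setR _ _).setR _ _, fun a b h => by simp [FlowNetwork.startState] at h,
      fun j hj => (hF₄.fld _ _ (by norm_num) (by norm_num)).trans (hc₃ j hj),
      ⟨by simp [FlowNetwork.startState], by simp [FlowNetwork.startState],
      fun k t hk => absurd hk (by simp [FlowNetwork.startState])⟩⟩
  refine Wp.seq (Wp.mono (createCall_spec hR) ?_)
  rintro T₅ S₅ ⟨σ₁, val₁, φ₁, hR₅, hC₁, hT₅⟩
  refine Wp.run_seq (by decide) fun T₆ hT₆ => ?_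
  replace hT₆ : T₆ ≤ 2 := by
    have : createSecond.cost = 2 := by decide
    rw [this] at hT₆
    exact_mod_cast hT₆
  have e₆ : createSecond.run S₅ = (S₅.setR 7 σ₁.Q.length).setR 5 0 := by
    simp [createSecond, hR₅.queue.reg9]
  rw [e₆]
  have hR' : CreateReady (smallCtx hE hf Δ d hl σ₁.Q.length) σ₁ val₁ φ₁
      ((S₅.setR 7 σ₁.Q.length).setR 5 0) :=
    ⟨⟨(hR₅.static.inv.setR (by norm_num) _).setR (by norm_num) _, hR₅.static.lists.congr (fun _ _ => rfl) (fun _ _ => rfl),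
      hR₅.static.ord.congr (fun _ _ => rfl),
      by simp [smallCtx], by simp [smallCtx]⟩, hR₅.ok, (hR₅.lct.setR _ _).setR _ _, hR₅.val_eq,
      hR₅.cap, hR₅.queue.congr (by simp) (by simp) (by simp) (fun _ _ => rfl)⟩
  refine Wp.seq (Wp.mono (createCall_spec hR') ?_)
  rintro T₇ S₆ ⟨σ₂, val₂, φ₂, hR₆, hC₂, hT₇⟩
  refine Wp.of_run (by decide) fun T₈ hT₈ => ⟨σ₁, σ₂, ⟨hC₁, hC₂⟩, hR₆.queue.outputs hR₆.static.reg7, ?_⟩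
  replace hT₈ : T₈ ≤ 2 := by
    have : createFinish.cost = 2 := by decide
    rw [this] at hT₈
    exact_mod_cast hT₈
  have hφ := hR₆.lct.nonneg
  have q1 : (0 : ℝ) ≤ n * opTime n := by positivity
  have q2 : (0 : ℝ) ≤ E.length * opTime n := by positivity
  have q3 : (0 : ℝ) ≤ (N.startState f).weight * opTime n := by positivity
  have q4 : (0 : ℝ) ≤ σ₂.weight * opTime n := by positivity
  have q5 : (0 : ℝ) ≤ σ₂.weight := by positivity
  have q6 : (0 : ℝ) ≤ (N.startState f).weight := by positivity
  have q7 : (0 : ℝ) ≤ n := by positivity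
  have q8 : (0 : ℝ) ≤ E.length := by positivity
  -- Sorting contributes `6 * opTime n` per vertex and each call `3 * opTime n`, which makes the
  -- factor `12`. Arcs need `6 * opTime n` in the two calls, units of weight `3 * opTime n`.
  simp only [abundantCtx, smallCtx, stepTime] at hT₅ hT₇
  nlinarith

/-- From two vertices on the binary logarithm is at least one and absorbs the additive constants. -/
theorem opTime_le_log (hn : 2 ≤ n) : 30000 ≤ opTime n ∧ opTime n ≤ 60000 / Real.log 2 * Real.log n := by
  have h2 : (0 : ℝ) < Real.log 2 := Real.log_pos (by norm_num)
  have h3 := logb_card_nonneg n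
  have h4 : 1 ≤ Real.logb 2 n := by
    rw [Real.le_logb_iff_rpow_le (by norm_num) (by positivity)]
    simpa using (by exact_mod_cast hn : (2 : ℝ) ≤ n)
  have h5 : 60000 / Real.log 2 * Real.log n = 60000 * Real.logb 2 n := by
    rw [Real.logb]; ring
  rw [h5]
  unfold opTime
  constructor <;> linarith

theorem FlowNetwork.two_le (N : FlowNetwork n) : 2 ≤ n := by
  have h := N.s_ne_t
  have h1 := N.s.isLt
  have h2 := N.t.isLt
  have : (N.s : ℕ) ≠ N.t := fun h' => h (Fin.ext h')
  omega
end

theorem theoremB1 :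
    ∃ (create restore : Cmd) (C : ℝ), 0 < C ∧
      ∀ (n : ℕ) (N : FlowNetwork n) (f : Fin n → Fin n → ℤ) (Δ : ℕ) (d : Fin n → ℕ)
        (E : List (Fin n × Fin n)),
        n ≤ 2 * N.A.card → N.IsPreflow f → 0 < Δ → N.Enumerates E →
        (∃ (σ₁ σ₂ : PState n) (T : ℕ) (S : RState),
          N.PhaseExecution f Δ d σ₁ σ₂ ∧
          Exec create (RState.start (createInput N f Δ d E)) T S ∧
          (T : ℝ) ≤ C * (N.A.card : ℝ) * Real.log n ∧
          S.Outputs (createOutput E σ₁ σ₂)) ∧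
        (∀ σ₁ σ₂ : PState n, N.PhaseExecution f Δ d σ₁ σ₂ →
          (σ₂.Q.length : ℝ) ≤ C * (N.A.card : ℝ) ∧
          ∀ (y : Fin n → Fin n → ℤ) (x : ℕ → ℤ), IsCompactPreflow N f Δ σ₂ y x →
            ∃ (g : Fin n → Fin n → ℤ) (T : ℕ) (S : RState),
              IsRestored N f σ₂ y x g ∧
              Exec restore (RState.start (restoreInput f E σ₂.Q y x)) T S ∧
              (T : ℝ) ≤ C * (N.A.card : ℝ) * Real.log n ∧
              S.Outputs (restoreOutput E g)) := by
  have hlog : (0 : ℝ) < Real.log 2 := Real.log_pos (by norm_num)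
  -- The quotient `60000 / Real.log 2` turns `opTime n` into a multiple of the natural logarithm,
  -- and `200` leaves room for `11 * 13 = 143`.
  refine ⟨createCmd, restoreCmd, 200 * (60000 / Real.log 2), by positivity, ?_⟩
  intro n N f Δ d E hnm hf _ hE
  have hn := N.two_le
  obtain ⟨hop, hop'⟩ := opTime_le_log hn
  have hm : 1 ≤ N.A.card := by omega
  -- The bound `11` collects `n ≤ 2m`, `E.length ≤ 2m`, a weight or queue length of at most `6m`,
  -- and `1 ≤ m`; the last holds because the source differs from the sink, so that `2 ≤ n ≤ 2m`.
  have hbound : ∀ T L : ℝ, T ≤ L * (12 * opTime n + 400) → L ≤ 11 * N.A.card →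
      T ≤ 200 * (60000 / Real.log 2) * (N.A.card : ℝ) * Real.log n := by
    intro T L h1 h2
    have hm' : (0 : ℝ) ≤ N.A.card := by positivity
    calc T ≤ L * (12 * opTime n + 400) := h1
      _ ≤ (11 * N.A.card) * (12 * opTime n + 400) := mul_le_mul_of_nonneg_right h2 (by linarith)
      _ ≤ (11 * N.A.card) * (13 * opTime n) :=
        mul_le_mul_of_nonneg_left (by linarith) (by positivity)
      _ = 143 * N.A.card * opTime n := by ring
      _ ≤ 200 * N.A.card * opTime n := mul_le_mul_of_nonneg_right (by linarith) (by linarith)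
      _ ≤ 200 * N.A.card * (60000 / Real.log 2 * Real.log n) :=
        mul_le_mul_of_nonneg_left hop' (by positivity)
      _ = _ := by ring
  have hEl := hE.length_le
  refine ⟨?_, fun σ₁ σ₂ hP => ⟨?_, fun y x hc => ?_⟩⟩
  · obtain ⟨T, S, h1, σ₁, σ₂, h2, h3, h4⟩ := createCmd_spec (Δ := Δ) (d := d) hE hf
    refine ⟨σ₁, σ₂, T, S, h2, h1, hbound _ _ h4 ?_, h3⟩
    have hw := PState.weight_startState_le hf
    have : n + E.length + (N.startState f).weight + 1 ≤ 11 * N.A.card := by omega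
    exact_mod_cast this
  · have hQ : (σ₂.Q.length : ℝ) ≤ 6 * N.A.card := by exact_mod_cast PState.length_queue_le hf hP
    refine hQ.trans (mul_le_mul_of_nonneg_right ?_ (by positivity))
    have h1 : Real.log 2 ≤ 1 := by linarith [Real.log_le_sub_one_of_pos (x := 2) (by norm_num)]
    have : 60000 ≤ 60000 / Real.log 2 := by
      rw [le_div_iff₀ hlog]; linarith
    linarith
  · have hok := PState.Ok.phase hf hP
    obtain ⟨T, S, h1, h2, h3⟩ := restoreCmd_spec (f := f) (y := y) (x := x) hok.qok hE.1
      (fun a ha => hE.mem_of_res hf (ne_of_gt ha)) (fun a ha => hE.swap_mem ha)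
    refine ⟨_, T, S, hok.isRestored hc, h1, hbound _ (n + E.length + σ₂.Q.length + 1) ?_ ?_, h2⟩
    · refine h3.trans (mul_le_mul_of_nonneg_left (by linarith) (by positivity))
    · have hQ := PState.length_queue_le hf hP
      have : n + E.length + σ₂.Q.length + 1 ≤ 11 * N.A.card := by omega
      exact_mod_cast this
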